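/- Let $V\in C^1(\mathbb R^3;\mathbb R)$ satisfy $|\nabla V(x)|\le C\langle x\rangle^{-1-\rho}$ for all $x\in\mathbb R^3$, with some constants $C$ and $\rho>1$, where $\langle x\rangle=(1+|x|^2)^{1/2}$. For $(x,v)\in\mathbb R^3\times\mathbb R^3$ put $$P=P_0+W,\qquad P_0=v\cdot\nabla_x-\Delta_v+\tfrac14|v|^2-\tfrac32,\qquad W=-\nabla V(x)\cdot\nabla_v ,$$ and $\mathcal L^{2,r}=L^2(\mathbb R^6;\langle x\rangle^{2r}\,dx\,dv)$ for $r\in\mathbb R$. Let $R_0(z)=(P_0-z)^{-1}$ be the resolvent of $P_0$ on $L^2(\mathbb R^6)$ with maximal domain $\{u\in L^2: P_0u\in L^2\}$. (i) Let $1<s<(1+\rho)/2$. For $z\notin[0,\infty)$ near $0$ the resolvent $R_0(z)$ exists, and the limit $G_0=\lim_{z\to0,\,z\notin[0,\infty)}R_0(z)$ exists in the norm of bounded operators from $\mathcal L^{2,1+\rho-s}$ to $\mathcal L^{2,-s}$. The operator $G_0W$, defined on $C_c^\infty(\mathbb R^6)$, extends to a bounded operator on $\mathcal L^{2,-s}$;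 this extension (again denoted $G_0W$) is compact, and $$\ker_{\mathcal L^{2,-s}}(1+G_0W)=\{0\}.$$ (ii) Zero is neither an eigenvalue nor a resonance of $P$: the equation $Pu=0$ (in the sense of distributions) has no solution $0\ne u\in L^2(\mathbb R^6)$, and no solution $u\notin L^2(\mathbb R^6)$ that belongs to $\mathcal L^{2,-s}$ for every $s>\frac12$. -/

import Mathlib

open MeasureTheory Filter Topology

namespace KFP

/-- The position space and the velocity space, `ℝ³` with its Euclidean norm. -/
abbrev E3 : Type := EuclideanSpace ℝ (Fin 3)

/-- The phase space of points `(x, v)`. It carries the product Lebesgue measure `dx dv`. -/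
abbrev Phase : Type := E3 × E3

/-- The bracket `⟨x⟩ = (1 + |x|²)^{1/2}`. -/
noncomputable def bracket (x : E3) : ℝ := Real.sqrt (1 + ‖x‖ ^ 2)

/-- The measure `⟨x⟩^{2s} dx dv` on the phase space. -/
noncomputable def weightedVolume (s : ℝ) : Measure Phase :=
  (volume : Measure Phase).withDensity (fun p => ENNReal.ofReal (bracket p.1 ^ (2 * s)))

/-- The weighted space `L^{2,s} = L²(ℝ⁶; ⟨x⟩^{2s} dx dv)`, complex valued. -/
abbrev L2w (s : ℝ) : Type := Lp ℂ 2 (weightedVolume s)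

/-- The space `L²(ℝ⁶; dx dv)`. -/
abbrev L2 : Type := Lp ℂ 2 (volume : Measure Phase)

/-- Test functions on the phase space: smooth with compact support. -/
def IsTest (φ : Phase → ℂ) : Prop :=
  ContDiff ℝ (⊤ : ℕ∞) φ ∧ HasCompactSupport φ

/-- The operator `W = -∇V(x)·∇_v` on differentiable functions. -/
noncomputable def W (V : E3 → ℝ) (φ : Phase → ℂ) (p : Phase) : ℂ :=
  - fderiv ℝ φ p (0, gradient V p.1)

/-- The formal transpose
`Pᵗ = -v·∇_x + ∇V(x)·∇_v - Δ_v + |v|²/4 - 3/2` of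
`P = v·∇_x - ∇V(x)·∇_v - Δ_v + |v|²/4 - 3/2`. -/
noncomputable def transposeP (V : E3 → ℝ) (φ : Phase → ℂ) (p : Phase) : ℂ :=
  - fderiv ℝ φ p (p.2, 0) + fderiv ℝ φ p (0, gradient V p.1)
    - Laplacian.laplacian (fun v : E3 => φ (p.1, v)) p.2
    + ((‖p.2‖ ^ 2 / 4 - 3 / 2 : ℝ) : ℂ) * φ p

/-- `P u = g` in the sense of distributions on the phase space, for locally square integrable
`u` and `g`. For `V = 0` the operator is the free one, `P₀`. -/
def WeakEq (V : E3 → ℝ) (u g : Phase → ℂ) : Prop :=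
  ∀ φ : Phase → ℂ, IsTest φ → ∫ p, u p * transposeP V φ p = ∫ p, g p * φ p

/-- The bounded operator `R` on `L²` is the resolvent `R₀(z) = (P₀ - z)⁻¹` of the free operator
`P₀` with maximal domain `{u ∈ L² : P₀ u ∈ L²}`: it is a right and a left inverse of `P₀ - z`. -/
def IsFreeResolvent (z : ℂ) (R : L2 →L[ℂ] L2) : Prop :=
  (∀ f : L2, WeakEq 0 (R f) (f + z • R f : L2)) ∧
  (∀ u g : L2, WeakEq 0 u g → R (g - z • u) = u)

/-- The half line `[0, ∞)` in the complex plane. -/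
def halfLine : Set ℂ := Complex.ofReal '' Set.Ici 0

/-- `G : L^{2,σ} → L^{2,τ}` is the zero energy limit `G₀` of the free resolvent: `R₀(z)` exists for
`z ∉ [0, ∞)` close to `0`, and `R₀(z) → G` in the norm of bounded operators from `L^{2,σ}` to
`L^{2,τ}` as `z → 0`, `z ∉ [0, ∞)`. (For `σ ≥ 0`, each `f ∈ L^{2,σ}` is represented by
some `g ∈ L²`.) -/
def IsG0 (σ τ : ℝ) (G : L2w σ →L[ℂ] L2w τ) : Prop :=
  ∀ ε : ℝ, 0 < ε → ∀ᶠ z in 𝓝[halfLineᶜ] (0 : ℂ),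
    ∃ R : L2 →L[ℂ] L2, IsFreeResolvent z R ∧
      ∀ (f : L2w σ) (g : L2), (g : Phase → ℂ) =ᵐ[volume] (f : Phase → ℂ) →
        eLpNorm (fun p => (R g : Phase → ℂ) p - (G f : Phase → ℂ) p) 2 (weightedVolume τ)
          ≤ ENNReal.ofReal ε * ‖f‖ₑ

/-- `K` is the operator `G W` on `L^{2,τ}`: the bounded operator which agrees with `φ ↦ G (W φ)`
on the dense subspace of test functions. -/
def IsG0W (V : E3 → ℝ) (σ τ : ℝ) (G : L2w σ →L[ℂ] L2w τ) (K : L2w τ →L[ℂ] L2w τ) : Prop :=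
  ∀ φ : Phase → ℂ, IsTest φ → ∀ (u : L2w τ) (f : L2w σ),
    (u : Phase → ℂ) =ᵐ[volume] φ → (f : Phase → ℂ) =ᵐ[volume] W V φ → K u = G f

/-- Zero is an eigenvalue of `P` with maximal domain in `L²`. -/
def ZeroIsEigenvalue (V : E3 → ℝ) : Prop :=
  ∃ u : Phase → ℂ, MemLp u 2 (volume : Measure Phase) ∧ ¬ u =ᵐ[volume] 0 ∧ WeakEq V u 0

/-- Zero is a resonance of `P`: `P u = 0` has a solution that lies in `L^{2,-s}` for all `s > 1/2`
but does not lie in `L²`. -/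
def ZeroIsResonance (V : E3 → ℝ) : Prop :=
  ∃ u : Phase → ℂ, (∀ s : ℝ, 1 / 2 < s → MemLp u 2 (weightedVolume (-s))) ∧
    ¬ MemLp u 2 (volume : Measure Phase) ∧ WeakEq V u 0

end KFP

/-!
The free operator `P₀` becomes explicit after a Fourier transform in `x`: on the fibre over `k` it
is a harmonic oscillator plus `i k·v`, that is, the oscillator translated by `-2ik`, with ground
state energy `|k|²` and ground state `cs (-k)`, a Gaussian times `e^{-i k·v}`. The algebraic tensor
product `Dom`, mapped to `L²(ℝ⁶)` by `lv`, is a core on which the equation `(P₀ - z) U = F` is solved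
fibrewise (`exists_sol`), with bounds for the resolvent `RR z` and for its compositions `RA z j`,
`RC z j` with the annihilation and creation operators `A_j = ∂_{v_j} + v_j / 2` and `A_j^*`.

*Limits at zero.* For small `z` only small `k` are singular, and there the resolvent is the sum of a
bounded family and of `(|k|² - z)⁻¹` times the projection to the ground state. Each of the families
`RR`, `RA`, `RC` is a channel in this sense, and the decay of the Newtonian kernel `1 / |x - y|`
makes a channel converge from `L^{2,σ}` to `L^{2,-s}` whenever `s, σ > 1/2` and `s + σ > 2`
(`IsChannel.eventually_cauchy`, `IsChannel.exists_limit`). Since `-∇V·∇_v = ½ ∑ (A_j^* - A_j) ∂_jV`,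
the product `R₀(z) W` is a combination `Kz` of `RC` and `RA` with multiplications which map
`L^{2,-s}` to `L^{2,1+ρ-s}`; so it converges as well (`exists_limit_Kz`), and its limit extends
`G₀W` (`isG0W_of_tendsto`).

*Compactness.* A norm limit of compact operators is compact. For fixed `z ∉ [0, ∞)` the functions in
the range of `Kz` are weak solutions of an equation with controlled data (`WData`). The energy
identity bounds their velocity derivatives and a velocity moment, and a hypoelliptic argument
gives Hölder continuity of order `1/3` under translations in `x` (`WData.norm_tau_sub_le`).
Averaging over cells then approximates by finite rank operators (`isCompactOperator_incl_comp`).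

*Uniqueness.* Let `P u = 0` with `u ∈ L^{2,-s}`, `s < 1`. Multiplying `u` by the cutoff
`(1 + t²|x|²)^{-1/2}` and letting `t → 0` in the energy identity gives `(∂_v + v/2) u = 0`
(`integral_mul_qC_eq_zero`): the potential drops out because `W` is antisymmetric, and the commutator
with the cutoff tends to zero as `s < 1`. The equation and its commutators with `∂_v` then yield
`∂_x u = -½ ∇V u` (`integral_mul_qX_eq`), so that `u` is a multiple of the Maxwellian
`exp (-|v|²/4 - V/2)` (`ae_eq_of_integral_fderiv_sub`). As `V` is bounded above, no nonzero
multiple lies in `L^{2,-s}` for `s ≤ 1` (`eq_zero_of_memLp_exp`). This settles eigenfunctions and resonances.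
For the kernel of `1 + G₀W` with `1 < s < (1 + ρ)/2`, the limit of `R₀(z) W` exists even with values
in `L^{2,-t}` for some `t < 1`, so every solution of `u + G₀W u = 0` lies in that smaller space
and satisfies `P u = 0` (`exists_limit_operators`).
-/

namespace KFP

noncomputable section

open Complex (I exp ofRealCLM norm_real conj_ofReal exp_add norm_exp)
open ENNReal (ofReal ofReal_mul mul_ne_top mul_lt_top ofReal_ne_top ofReal_le_ofReal ofReal_pow)
open Metric (ball closedBall)
open MvPolynomial (pderiv monomial)
open MeasureTheory.Measure (volume_eq_prod)
open Finset (sum_congr sum_nonneg sum_add_distrib mul_sum sum_le_sum)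

open scoped ComplexConjugate Real SchwartzMap LineDeriv ContDiff FourierTransform ENNReal TensorProduct
  Convolution BoundedContinuousFunction

/-- The Schwartz space on `ℝ³`. -/
abbrev S3 : Type := 𝓢(E3, ℂ)

/-- The Schwartz space on the phase space `ℝ⁶`. -/
abbrev S6 : Type := 𝓢(Phase, ℂ)

/-- The coordinate functionals on `ℝ³`. -/
abbrev pj (j : Fin 3) : E3 →L[ℝ] ℝ := EuclideanSpace.proj j

/-! ### Exponentials -/

section Exponential

open scoped Nat

variable {E : Type*} [NormedAddCommGroup E] [NormedSpace ℝ E]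

lemma norm_iteratedFDeriv_cexp_le (n : ℕ) (w : ℂ) : ‖iteratedFDeriv ℝ n exp w‖ ≤ Real.exp w.re := by
  have key : ∀ n : ℕ, iteratedFDeriv ℝ n exp = fun w => exp w • iteratedFDeriv ℝ n exp 0 := by
    intro n; ext w m
    have h : (fun y : ℂ => exp (w + y)) = fun y => exp w • exp y := by
      ext y; rw [exp_add, smul_eq_mul]
    have h1 := iteratedFDeriv_comp_add_left (𝕜 := ℝ) (f := exp) n w 0
    rw [h, iteratedFDeriv_const_smul_apply' (Complex.contDiff_exp.contDiffAt), add_zero] at h1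
    rw [← h1]
  have key2 : ∀ n : ℕ, ‖iteratedFDeriv ℝ n exp 0‖ ≤ 1 := by
    intro n
    induction n with
    | zero => simp
    | succ n ih =>
      rw [← norm_fderiv_iteratedFDeriv, key n]
      have h1 : HasFDerivAt exp ((1 : ℂ →L[ℂ] ℂ).restrictScalars ℝ) 0 := by
        have := (Complex.hasStrictFDerivAt_exp_real 0).hasFDerivAt
        simpa using! this
      have : HasFDerivAt (fun w : ℂ => exp w • iteratedFDeriv ℝ n exp 0)
          (((1 : ℂ →L[ℂ] ℂ).restrictScalars ℝ).smulRight (iteratedFDeriv ℝ n exp 0)) 0 := by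
        have h2 := h1.smul_const (iteratedFDeriv ℝ n exp 0)
        exact h2
      rw [this.fderiv]
      refine ContinuousLinearMap.opNorm_le_bound _ (by norm_num) fun w => ?_
      simp only [ContinuousLinearMap.smulRight_apply, norm_smul]
      simp only [ContinuousLinearMap.coe_restrictScalars', one_apply_eq_self]
      nlinarith [norm_nonneg w]
  rw [key n]; simp only [norm_smul, norm_exp]
  nlinarith [key2 n, Real.exp_pos w.re]

lemma exists_norm_iteratedFDeriv_cexp_comp_le {F : E → ℂ} (hF : F.HasTemperateGrowth) (n : ℕ) :
    ∃ (k : ℕ) (C : ℝ), 0 ≤ C ∧ ∀ x, ‖iteratedFDeriv ℝ n (fun x => exp (F x)) x‖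
      ≤ C * (1 + ‖x‖) ^ k * Real.exp (F x).re := by
  obtain ⟨k, C, hC, h⟩ := hF.norm_iteratedFDeriv_le_uniform n
  refine ⟨k * n, n ! * (1 + C) ^ n, by positivity, fun x => ?_⟩
  have h1 := norm_iteratedFDeriv_comp_le (𝕜 := ℝ) (g := exp) (f := F) (n := n) (N := ∞)
    (Complex.contDiff_exp) hF.1 (by exact_mod_cast le_top) x
    (C := Real.exp (F x).re) (D := (1 + C) * (1 + ‖x‖) ^ k)
    (fun i _ => norm_iteratedFDeriv_cexp_le i _) ?_
  · refine h1.trans (le_of_eq ?_)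
    rw [mul_pow, ← pow_mul]; ring
  · intro i hi hi'
    calc _ ≤ C * (1 + ‖x‖) ^ k := h i hi' x
      _ ≤ (1 + C) * (1 + ‖x‖) ^ k := by gcongr; simp
      _ ≤ _ := by
        apply le_self_pow₀ (one_le_mul_of_one_le_of_one_le (by simp [hC]) (by simp [one_le_pow₀]))
        grind

lemma hasTemperateGrowth_cexp {F : E → ℂ} (hF : F.HasTemperateGrowth) {M : ℝ}
    (hM : ∀ x, (F x).re ≤ M) : (fun x => exp (F x)).HasTemperateGrowth := by
  refine ⟨Complex.contDiff_exp.comp hF.1, fun n => ?_⟩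
  obtain ⟨k, C, hC, h⟩ := exists_norm_iteratedFDeriv_cexp_comp_le hF n
  refine ⟨k, C * Real.exp M, fun x => (h x).trans ?_⟩
  have := Real.exp_le_exp.2 (hM x)
  calc _ ≤ C * (1 + ‖x‖) ^ k * Real.exp M := by gcongr
    _ = _ := by ring

/-- The exponential of a function of temperate growth whose real part tends to `-∞` at least
quadratically is a Schwartz function. -/
def expSchwartz (F : E → ℂ) (hF : F.HasTemperateGrowth) {c : ℝ} (hc : 0 < c)
    (hM : ∀ x, (F x).re ≤ -c * ‖x‖ ^ 2) : 𝓢(E, ℂ) where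
  toFun := fun x => exp (F x)
  smooth' := Complex.contDiff_exp.comp hF.1
  decay' := by
    intro m n
    obtain ⟨k, C, hC, h⟩ := exists_norm_iteratedFDeriv_cexp_comp_le hF n
    have hb : ∃ B : ℝ, ∀ r : ℝ, 0 ≤ r → (1 + r) ^ (m + k) * Real.exp (-c * r ^ 2) ≤ B := by
      refine ⟨(m + k)! * Real.exp 1 * Real.exp (1 / (4 * c)), fun r hr => ?_⟩
      have h1 : (1 + r) ^ (m + k) / (m + k)! ≤ Real.exp (1 + r) :=
        Real.pow_div_factorial_le_exp (1 + r) (by positivity) (m + k)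
      rw [div_le_iff₀ (by positivity)] at h1
      have h2 : r - c * r ^ 2 ≤ 1 / (4 * c) := by
        rw [le_div_iff₀ (by positivity)]; nlinarith [sq_nonneg (2 * c * r - 1)]
      calc _ ≤ Real.exp (1 + r) * (m + k)! * Real.exp (-c * r ^ 2) := by gcongr
        _ = (m + k)! * Real.exp 1 * Real.exp (r - c * r ^ 2) := by
          rw [Real.exp_add, show r - c * r ^ 2 = r + (-c * r ^ 2) by ring, Real.exp_add]; ring
        _ ≤ _ := by gcongr
    obtain ⟨B, hB⟩ := hb
    refine ⟨C * B, fun x => ?_⟩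
    calc ‖x‖ ^ m * _ ≤ (1 + ‖x‖) ^ m * (C * (1 + ‖x‖) ^ k * Real.exp (F x).re) := by
          gcongr
          · linarith
          · exact h x
      _ ≤ (1 + ‖x‖) ^ m * (C * (1 + ‖x‖) ^ k * Real.exp (-c * ‖x‖ ^ 2)) := by gcongr; exact hM x
      _ = C * ((1 + ‖x‖) ^ (m + k) * Real.exp (-c * ‖x‖ ^ 2)) := by ring
      _ ≤ C * B := by gcongr; exact hB _ (norm_nonneg x)

end Exponential

/-! ### Schwartz functions of the velocity -/

/-- The standard basis vector `e_j` of `ℝ³`. -/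
abbrev eb (j : Fin 3) : E3 := EuclideanSpace.single j 1

lemma hasTemperateGrowth_coord (j : Fin 3) :
    (fun v : E3 => ((v j : ℝ) : ℂ)).HasTemperateGrowth := by
  have h1 : (fun v : E3 => v j).HasTemperateGrowth := (pj j).hasTemperateGrowth
  exact Function.HasTemperateGrowth.comp Function.Complex.hasTemperateGrowth_ofReal h1

/-- Multiplication by the coordinate `v_j`. -/
def mulv (j : Fin 3) : S3 →ₗ[ℂ] S3 :=
  (SchwartzMap.smulLeftCLM ℂ (fun v : E3 => ((v j : ℝ) : ℂ))).toLinearMap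

@[simp] lemma mulv_apply (j : Fin 3) (w : S3) (v : E3) : mulv j w v = (v j : ℂ) * w v := by
  simp [mulv, SchwartzMap.smulLeftCLM_apply_apply (hasTemperateGrowth_coord j)]

/-- The partial derivative `∂_j` on Schwartz functions. -/
def pd (j : Fin 3) : S3 →ₗ[ℂ] S3 := (LineDeriv.lineDerivOpCLM ℂ S3 (eb j)).toLinearMap

lemma pd_apply (j : Fin 3) (w : S3) (v : E3) : pd j w v = fderiv ℝ w v (eb j) := by
  simp [pd, SchwartzMap.lineDerivOp_apply_eq_fderiv]

lemma pd_eq (j : Fin 3) (w : S3) : pd j w = ∂_{eb j} w := by simp [pd]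

/-- The annihilation operator `∂_j + v_j/2`. -/
def An (j : Fin 3) : S3 →ₗ[ℂ] S3 := pd j + (1 / 2 : ℂ) • mulv j

/-- The creation operator `-∂_j + v_j/2`. -/
def Cr (j : Fin 3) : S3 →ₗ[ℂ] S3 := -pd j + (1 / 2 : ℂ) • mulv j

lemma An_apply (j : Fin 3) (w : S3) (v : E3) :
    An j w v = fderiv ℝ w v (eb j) + (v j : ℂ) / 2 * w v := by
  simp [An, pd_apply]; ring

lemma An_add_Cr (j : Fin 3) (w : S3) : An j w + Cr j w = mulv j w := by
  simp only [An, Cr, LinearMap.add_apply, LinearMap.neg_apply, LinearMap.smul_apply]; module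

lemma An_sub_Cr (j : Fin 3) (w : S3) : An j w - Cr j w = (2 : ℂ) • pd j w := by
  simp only [An, Cr, LinearMap.add_apply, LinearMap.neg_apply, LinearMap.smul_apply]; module

/-- A Schwartz function as an element of `L²(ℝ³)`. -/
def toH : S3 →ₗ[ℂ] Lp ℂ 2 (volume : Measure E3) := (SchwartzMap.toLpCLM ℂ ℂ 2 volume).toLinearMap

lemma toH_apply (w : S3) : toH w = w.toLp 2 := rfl

/-- The `L²` inner product of Schwartz functions. -/
def ip (f g : S3) : ℂ := inner ℂ (toH f) (toH g)

lemma ip_eq (f g : S3) : ip f g = ∫ v, conj (f v) * g v := by simp [ip, toH_apply, mul_comm]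

/-- Complex conjugation of Schwartz functions. -/
def conjS (f : S3) : S3 := SchwartzMap.postcompCLM (𝕜 := ℝ) (Complex.conjCLE : ℂ →L[ℝ] ℂ) f

@[simp] lemma conjS_apply (f : S3) (v : E3) : conjS f v = conj (f v) := by simp [conjS]

lemma pd_conjS (j : Fin 3) (f : S3) : pd j (conjS f) = conjS (pd j f) := by
  ext v; rw [pd_apply, conjS_apply, pd_apply]
  have : (conjS f : E3 → ℂ) = fun v => Complex.conjCLE (f v) := by ext; simp
  rw [this]
  have h := (Complex.conjCLE : ℂ →L[ℝ] ℂ).hasFDerivAt.comp v (f.hasFDerivAt v)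
  rw [show (fun v => Complex.conjCLE (f v)) = (Complex.conjCLE : ℂ →L[ℝ] ℂ) ∘ f from rfl, h.fderiv]
  simp

lemma ip_mulv (j : Fin 3) (f g : S3) : ip f (mulv j g) = ip (mulv j f) g := by
  simp only [ip_eq, mulv_apply, map_mul, conj_ofReal]
  congr 1; ext v; ring

lemma ip_pd (j : Fin 3) (f g : S3) : ip f (pd j g) = - ip (pd j f) g := by
  simp only [ip_eq]
  have h := SchwartzMap.integral_mul_lineDerivOp_right_eq_neg_left (conjS f) g (eb j) (μ := volume)
  rw [← pd_eq, ← pd_eq, pd_conjS] at h; simpa using h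

lemma ip_add_left (f g h : S3) : ip (f + g) h = ip f h + ip g h := by simp [ip, inner_add_left]
lemma ip_add_right (f g h : S3) : ip f (g + h) = ip f g + ip f h := by simp [ip, inner_add_right]
lemma ip_sub_left (f g h : S3) : ip (f - g) h = ip f h - ip g h := by simp [ip, inner_sub_left]
lemma ip_sub_right (f g h : S3) : ip f (g - h) = ip f g - ip f h := by simp [ip, inner_sub_right]
lemma ip_neg_left (f h : S3) : ip (-f) h = - ip f h := by simp [ip]
lemma ip_smul_left (c : ℂ) (f h : S3) :
    ip (c • f) h = conj c * ip f h := by simp [ip, inner_smul_left]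
lemma ip_smul_right (c : ℂ) (f h : S3) : ip f (c • h) = c * ip f h := by simp [ip, inner_smul_right]
lemma ip_sum_left {ι : Type*} (s : Finset ι) (f : ι → S3) (h : S3) :
    ip (∑ i ∈ s, f i) h = ∑ i ∈ s, ip (f i) h := by simp [ip, sum_inner]
lemma ip_sum_right {ι : Type*} (s : Finset ι) (f : ι → S3) (h : S3) :
    ip h (∑ i ∈ s, f i) = ∑ i ∈ s, ip h (f i) := by simp [ip, inner_sum]
lemma ip_conj (f g : S3) : conj (ip f g) = ip g f := by simp [ip]

/-- The `L²` norm of a Schwartz function. -/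
def nn (f : S3) : ℝ := ‖toH f‖

lemma nn_nonneg (f : S3) : 0 ≤ nn f := norm_nonneg _
lemma norm_ip_le (f g : S3) : ‖ip f g‖ ≤ nn f * nn g := norm_inner_le_norm _ _
lemma ip_self (f : S3) : ip f f = ((nn f ^ 2 : ℝ) : ℂ) := by
  simp [ip, nn, inner_self_eq_norm_sq_to_K]
lemma nn_add_le (f g : S3) : nn (f + g) ≤ nn f + nn g := by
  simpa [nn] using norm_add_le (toH f) (toH g)
lemma nn_sub_le (f g : S3) : nn (f - g) ≤ nn f + nn g := by
  simpa [nn] using norm_sub_le (toH f) (toH g)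
lemma nn_smul (c : ℂ) (f : S3) : nn (c • f) = ‖c‖ * nn f := by simp [nn, norm_smul]
lemma nn_sq (f : S3) : nn f ^ 2 = ∫ v, ‖f v‖ ^ 2 := by
  have h := ip_eq f f
  rw [ip_self] at h
  have : ∀ v, conj (f v) * f v = ((‖f v‖ ^ 2 : ℝ) : ℂ) := by
    intro v; rw [mul_comm, Complex.mul_conj, Complex.normSq_eq_norm_sq]
  simp_rw [this] at h
  exact Complex.ofReal_injective (h.trans integral_ofReal)

lemma ip_An (j : Fin 3) (f g : S3) : ip f (An j g) = ip (Cr j f) g := by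
  simp only [An, Cr, LinearMap.add_apply, LinearMap.neg_apply, LinearMap.smul_apply, ip_add_right,
    ip_add_left, ip_neg_left, ip_smul_left, ip_smul_right, ip_pd, ip_mulv]
  simp [Complex.conj_ofNat]

lemma ip_Cr (j : Fin 3) (f g : S3) : ip f (Cr j g) = ip (An j f) g := by
  rw [← ip_conj, ← ip_An, ip_conj]

lemma pd_mulv (i j : Fin 3) (w : S3) :
    pd i (mulv j w) = mulv j (pd i w) + (if i = j then (1 : ℂ) else 0) • w := by
  ext v
  have h1 : HasFDerivAt (fun v : E3 => ((v j : ℝ) : ℂ)) (ofRealCLM ∘L pj j) v := (ofRealCLM ∘L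
      pj j).hasFDerivAt
  have h2 := h1.mul (w.hasFDerivAt v)
  have h3 : (mulv j w : E3 → ℂ) = fun v => ((v j : ℝ) : ℂ) * w v := by ext; simp
  rw [pd_apply, h3]
  erw [h2.fderiv]
  simp [pd_apply, eq_comm]
  split_ifs <;> simp

lemma pd_comm (i j : Fin 3) (w : S3) : pd i (pd j w) = pd j (pd i w) := by
  ext v
  have h : ∀ (a b : Fin 3), pd a (pd b w) v = fderiv ℝ (fderiv ℝ w) v (eb a) (eb b) := by
    intro a b
    have h3 : (pd b w : E3 → ℂ) = fun v => fderiv ℝ w v (eb b) := by ext; rw [pd_apply]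
    rw [pd_apply, h3]
    have hd : DifferentiableAt ℝ (fderiv ℝ w) v :=
      ((w.smooth 2).fderiv_right (m := 1) (by norm_num)).differentiable (by norm_num) v
    rw [fderiv_clm_apply hd (by fun_prop)]
    simp
  rw [h, h]; exact ((w.smooth 2).contDiffAt.isSymmSndFDerivAt (by simp)).eq _ _

lemma mulv_comm (i j : Fin 3) (w : S3) : mulv i (mulv j w) = mulv j (mulv i w) := by
  ext v; simp; ring

lemma An_comm (i j : Fin 3) (w : S3) : An i (An j w) = An j (An i w) := by
  simp only [An, LinearMap.add_apply, LinearMap.smul_apply, map_add, map_smul, pd_mulv,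
    mulv_comm i j, pd_comm i j, eq_comm (a := i) (b := j)]
  module

/-- The canonical commutation relation. -/
lemma An_Cr (i j : Fin 3) (w : S3) :
    An i (Cr j w) = Cr j (An i w) + (if i = j then (1 : ℂ) else 0) • w := by
  simp only [An, Cr, LinearMap.add_apply, LinearMap.smul_apply, LinearMap.neg_apply, map_add,
    map_neg, map_smul, pd_mulv, mulv_comm i j, pd_comm i j, eq_comm (a := i) (b := j)]
  module

/-! ### Coherent states -/

/-- The phase `-|v|²/4 + i k·v` of a coherent state. -/
def csPhase (k v : E3) : ℂ := ((-(1 / 4) * ‖v‖ ^ 2 : ℝ) : ℂ) + ((inner ℝ k v : ℝ) : ℂ) * I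

lemma csPhase_hasTemperateGrowth (k : E3) : (csPhase k).HasTemperateGrowth := by
  unfold csPhase
  have h1 : (fun v : E3 => ((-(1 / 4) * ‖v‖ ^ 2 : ℝ) : ℂ)).HasTemperateGrowth :=
    Function.HasTemperateGrowth.comp Function.Complex.hasTemperateGrowth_ofReal
      ((Function.HasTemperateGrowth.const (-(1 / 4) : ℝ)).mul
        (Function.hasTemperateGrowth_norm_sq (H := E3)))
  have h2 : (fun v : E3 => ((inner ℝ k v : ℝ) : ℂ)).HasTemperateGrowth :=
    Function.HasTemperateGrowth.comp Function.Complex.hasTemperateGrowth_ofReal (Function.hasTemperateGrowth_inner_right k)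
  exact h1.add (h2.mul (Function.HasTemperateGrowth.const I))

/-- The constant `(2π)^{-3/4}` which normalizes the Gaussian `e^{-|v|²/4}` in `L²(ℝ³)`. -/
def cN : ℝ := (2 * π) ^ (-(3 / 4) : ℝ)

lemma cN_pos : 0 < cN := by unfold cN; positivity

/-- The coherent state `(2π)^{-3/4} e^{-|v|²/4 + i k·v}`. -/
def cs (k : E3) : S3 :=
  (cN : ℂ) • expSchwartz (csPhase k) (csPhase_hasTemperateGrowth k) (c := 1 / 4) (by norm_num)
    (fun v => by simp [csPhase, -Complex.ofReal_pow])

lemma cs_apply (k v : E3) : cs k v = cN * exp (csPhase k v) := rfl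

/-- The normalized Gaussian `ψ(v) = (2π)^{-3/4} e^{-|v|²/4}`. -/
def ps : S3 := cs 0

lemma ps_apply (v : E3) : ps v = ((cN * Real.exp (-(1 / 4) * ‖v‖ ^ 2) : ℝ) : ℂ) := by
  simp [ps, cs_apply, csPhase]

lemma fderiv_cs (k v h : E3) : fderiv ℝ (cs k) v h =
    cs k v * (-(1 / 2) * (inner ℝ v h : ℝ) + (inner ℝ k h : ℝ) * I) := by
  have h1 : HasFDerivAt (fun v : E3 => -(1 / 4 : ℝ) * ‖v‖ ^ 2)
      (-(1 / 4 : ℝ) • ((2 : ℕ) • innerSL ℝ v)) v :=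
    (hasStrictFDerivAt_norm_sq v).hasFDerivAt.const_mul _
  have h2 : HasFDerivAt (fun v : E3 => (inner ℝ k v : ℝ)) (innerSL ℝ k) v :=
    (innerSL ℝ k).hasFDerivAt
  have h3 : HasFDerivAt (csPhase k) _ v := (Complex.ofRealCLM.hasFDerivAt.comp v h1).add
      ((Complex.ofRealCLM.hasFDerivAt.comp v h2).mul_const I)
  have h4 := (h3.cexp).const_mul (cN : ℂ)
  have h5 : (cs k : E3 → ℂ) = fun v => cN * exp (csPhase k v) := rfl
  rw [h5, h4.fderiv]; simp; ring

lemma An_cs (j : Fin 3) (k : E3) : An j (cs k) = (I * k j) • cs k := by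
  ext v; rw [An_apply, fderiv_cs]
  simp [EuclideanSpace.inner_single_right]; ring

lemma An_ps (j : Fin 3) : An j ps = 0 := by rw [ps, An_cs]; simp

attribute [irreducible] ip nn

/-! ### Poincaré inequality for the Gaussian measure -/

/-- The Cauchy–Schwarz inequality for lower Lebesgue integrals. -/
lemma sq_lintegral_mul_le {α : Type*} [MeasurableSpace α] {μ : Measure α} {f g : α → ℝ≥0∞}
    (hf : AEMeasurable f μ) (hg : AEMeasurable g μ) :
    (∫⁻ x, f x * g x ∂μ) ^ 2 ≤ (∫⁻ x, f x ^ 2 ∂μ) * ∫⁻ x, g x ^ 2 ∂μ := by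
  have h := ENNReal.lintegral_mul_le_Lp_mul_Lq μ Real.HolderConjugate.two_two hf hg
  simp only [Pi.mul_apply, ENNReal.rpow_ofNat] at h
  calc _ ≤ ((∫⁻ x, f x ^ 2 ∂μ) ^ (1 / 2 : ℝ) * (∫⁻ x, g x ^ 2 ∂μ) ^ (1 / 2 : ℝ)) ^ 2 := by gcongr
    _ = _ := by
      rw [mul_pow, ← ENNReal.rpow_natCast, ← ENNReal.rpow_natCast, ← ENNReal.rpow_mul,
        ← ENNReal.rpow_mul]
      norm_num

lemma enorm_integral_mul_sq_le {α : Type*} [MeasurableSpace α] {μ : Measure α} {f g : α → ℂ}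
    (hf : AEMeasurable f μ) (hg : AEMeasurable g μ) :
    ‖∫ x, f x * g x ∂μ‖ₑ ^ 2 ≤ (∫⁻ x, ‖f x‖ₑ ^ 2 ∂μ) * ∫⁻ x, ‖g x‖ₑ ^ 2 ∂μ := by
  refine le_trans ?_ (sq_lintegral_mul_le hf.enorm hg.enorm); gcongr
  refine (enorm_integral_le_lintegral_enorm _).trans (le_of_eq ?_)
  exact lintegral_congr fun x => enorm_mul _ _

lemma lintegral_enorm_sq (f : S3) : ∫⁻ v, ‖f v‖ₑ ^ 2 = ofReal (nn f ^ 2) := by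
  rw [nn_sq, ofReal_integral_eq_lintegral_ofReal]
  · simp only [ofReal_pow (norm_nonneg _), ofReal_norm]
  · exact (f.memLp 2 volume).integrable_norm_pow (by norm_num)
  · exact ae_of_all _ fun _ => by positivity

lemma nn_ps : nn ps = 1 := by
  have h : nn ps ^ 2 = 1 := by
    rw [nn_sq]
    have : ∀ v : E3, ‖ps v‖ ^ 2 = cN ^ 2 * Real.exp (-(1 / 2) * ‖v‖ ^ 2) := by
      intro v
      rw [ps_apply, norm_real, Real.norm_of_nonneg (by have := cN_pos; positivity), mul_pow,
        ← Real.exp_nat_mul]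
      congr 2; push_cast; ring
    simp_rw [this]
    rw [integral_const_mul, GaussianFourier.integral_rexp_neg_mul_sq_norm (by norm_num), cN,
      ← Real.rpow_natCast, ← Real.rpow_mul (by positivity)]
    simp only [finrank_euclideanSpace, Fintype.card_fin]
    rw [show π / (1 / 2) = 2 * π by ring, ← Real.rpow_add (by positivity)]
    norm_num
  nlinarith [nn_nonneg ps]

lemma ps_neg (v : E3) : ps (-v) = ps v := by simp [ps_apply]

/-- The rotation `(x, y) ↦ (x cos θ + y sin θ, -x sin θ + y cos θ)` of the plane `ℝ²`, acting on
pairs of vectors, as an isometry. -/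
def rotIso (θ : ℝ) : WithLp 2 (E3 × E3) →ₗᵢ[ℝ] WithLp 2 (E3 × E3) where
  toFun p := WithLp.toLp 2 (Real.cos θ • p.fst + Real.sin θ • p.snd,
    -(Real.sin θ • p.fst) + Real.cos θ • p.snd)
  map_add' p q := by refine WithLp.ofLp_injective 2 (Prod.ext ?_ ?_) <;> simp <;> module
  map_smul' c p := by refine WithLp.ofLp_injective 2 (Prod.ext ?_ ?_) <;> simp <;> module
  norm_map' p := by
    rw [← sq_eq_sq₀ (norm_nonneg _) (norm_nonneg _), WithLp.prod_norm_sq_eq_of_L2,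
      WithLp.prod_norm_sq_eq_of_L2]
    simp only [LinearMap.coe_mk, AddHom.coe_mk, WithLp.toLp_fst, WithLp.toLp_snd]
    have h := Real.sin_sq_add_cos_sq θ
    rw [neg_add_eq_sub, norm_add_sq_real, norm_sub_sq_real]
    simp only [norm_smul, mul_pow, Real.norm_eq_abs, sq_abs, inner_smul_left, inner_smul_right,
      real_inner_comm p.fst p.snd]
    simp only [conj_trivial]
    linear_combination (‖p.fst‖ ^ 2 + ‖p.snd‖ ^ 2) * h

/-- The rotation by the angle `θ` on `ℝ³ × ℝ³`. -/
def rot (θ : ℝ) (p : E3 × E3) : E3 × E3 :=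
  (Real.cos θ • p.1 + Real.sin θ • p.2, -(Real.sin θ • p.1) + Real.cos θ • p.2)

lemma measurePreserving_rot (θ : ℝ) : MeasurePreserving (rot θ) := by
  have h1 := ((rotIso θ).toLinearIsometryEquiv rfl).measurePreserving
  exact (WithLp.volume_preserving_ofLp E3 E3).comp (h1.comp (WithLp.volume_preserving_toLp E3 E3))

/-- The derivative of `w(x) ψ(y)` along rotations. -/
def rotDeriv (w : S3) (p : E3 × E3) : ℂ := ps p.2 * ∑ j, (p.2 j : ℂ) * An j w p.1

lemma continuous_rotDeriv (w : S3) : Continuous (rotDeriv w) := by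
  unfold rotDeriv
  have h1 : Continuous ps := ps.continuous
  have h2 : ∀ j, Continuous (An j w) := fun j => (An j w).continuous
  fun_prop

lemma hasDerivAt_rot (w : S3) (p : E3 × E3) (θ : ℝ) :
    HasDerivAt (fun θ => w (rot θ p).1 * ps (rot θ p).2) (rotDeriv w (rot θ p)) θ := by
  have h1 : HasDerivAt (fun θ => (rot θ p).1) (rot θ p).2 θ := by
    have := ((Real.hasDerivAt_cos θ).smul_const p.1).add ((Real.hasDerivAt_sin θ).smul_const p.2)
    simpa [rot] using! this
  have h2 : HasDerivAt (fun θ => (rot θ p).2) (-(rot θ p).1) θ := by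
    have := ((Real.hasDerivAt_sin θ).smul_const p.1).neg.add
      ((Real.hasDerivAt_cos θ).smul_const p.2)
    convert! this using 1
    simp [rot]; abel
  have h3 := (w.hasFDerivAt (rot θ p).1).comp_hasDerivAt θ h1
  have h4 := (ps.hasFDerivAt (rot θ p).2).comp_hasDerivAt θ h2
  have h5 := h3.mul h4
  convert! h5 using 1
  set q := rot θ p
  have e1 : fderiv ℝ w q.1 q.2 = ∑ j, (q.2 j : ℂ) * fderiv ℝ w q.1 (eb j) := by
    conv_lhs => rw [← (EuclideanSpace.basisFun (Fin 3) ℝ).sum_repr q.2, map_sum]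
    simp
  have e2 : (inner ℝ q.1 q.2 : ℝ) = ∑ j, q.2 j * q.1 j := by simp [PiLp.inner_apply]
  have e3 : fderiv ℝ ps q.2 (-q.1) = ps q.2 * (1 / 2 * (inner ℝ q.1 q.2 : ℝ)) := by
    rw [ps, fderiv_cs]; simp [real_inner_comm]
  simp only [Function.comp_apply]
  rw [e1, e3, e2, rotDeriv]
  simp only [An_apply, mul_add, sum_add_distrib, Complex.ofReal_sum, mul_sum, Finset.sum_mul]
  congr 1
  · exact sum_congr rfl fun _ _ => by ring
  · refine sum_congr rfl fun _ _ => ?_; push_cast; ring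

/-- A constant in the Gaussian Poincaré inequality. -/
def cPoin : ℝ := (π / 2) ^ 2 * (3 * ∑ j, nn (mulv j ps) ^ 2)

lemma cPoin_nonneg : 0 ≤ cPoin := by unfold cPoin; positivity

lemma lintegral_rotDeriv_le (w : S3) : ∫⁻ p : E3 × E3, ‖rotDeriv w p‖ₑ ^ 2 ≤
      ofReal ((3 * ∑ j, nn (mulv j ps) ^ 2) * ∑ j, nn (An j w) ^ 2) := by
  have h1 : ∀ p : E3 × E3, ‖rotDeriv w p‖ₑ ^ 2 ≤
      3 * ∑ j, ‖An j w p.1‖ₑ ^ 2 * ‖mulv j ps p.2‖ₑ ^ 2 := by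
    intro p
    have h : ‖rotDeriv w p‖ ^ 2 ≤ 3 * ∑ j, ‖An j w p.1‖ ^ 2 * ‖mulv j ps p.2‖ ^ 2 := by
      have e : rotDeriv w p = ∑ j, An j w p.1 * mulv j ps p.2 := by
        rw [rotDeriv, mul_sum]
        exact sum_congr rfl fun _ _ => by rw [mulv_apply]; ring
      rw [e]
      calc _ ≤ (∑ j, ‖An j w p.1‖ * ‖mulv j ps p.2‖) ^ 2 := by
            gcongr; exact (norm_sum_le _ _).trans (by simp)
        _ ≤ _ := by
            have := sq_sum_le_card_mul_sum_sq (s := (Finset.univ : Finset (Fin 3)))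
              (f := fun j => ‖An j w p.1‖ * ‖mulv j ps p.2‖)
            simpa [mul_pow] using this
    have h' := ofReal_le_ofReal h
    rw [ofReal_pow (norm_nonneg _), ofReal_mul (by norm_num),
      ENNReal.ofReal_sum_of_nonneg (fun _ _ => by positivity)] at h'
    simpa only [ofReal_mul (sq_nonneg _), ofReal_pow (norm_nonneg _), ofReal_norm,
      ENNReal.ofReal_ofNat] using h'
  calc _ ≤ ∫⁻ p : E3 × E3, 3 * ∑ j, ‖An j w p.1‖ₑ ^ 2 * ‖mulv j ps p.2‖ₑ ^ 2 :=
        lintegral_mono h1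
    _ = 3 * ∑ j, ofReal (nn (An j w) ^ 2) * ofReal (nn (mulv j ps) ^ 2) := by
        have hm : ∀ f : S3, Measurable fun v => ‖f v‖ₑ ^ 2 := fun f =>
          (f.continuous.measurable.enorm).pow_const 2
        rw [lintegral_const_mul, lintegral_finsetSum]
        · congr 1; refine sum_congr rfl fun j _ => ?_
          rw [volume_eq_prod, lintegral_prod_mul (hm _).aemeasurable (hm _).aemeasurable,
            lintegral_enorm_sq, lintegral_enorm_sq]
        · exact fun j _ => ((hm _).comp measurable_fst).mul ((hm _).comp measurable_snd)
        · exact Finset.measurable_sum _ fun j _ =>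
            ((hm _).comp measurable_fst).mul ((hm _).comp measurable_snd)
    _ = ofReal (3 * ∑ j, nn (An j w) ^ 2 * nn (mulv j ps) ^ 2) := by
        rw [ofReal_mul (by norm_num), ENNReal.ofReal_sum_of_nonneg (fun _ _ => by positivity)]
        simp only [ofReal_mul (sq_nonneg _), ENNReal.ofReal_ofNat]
    _ ≤ _ := by
        apply ofReal_le_ofReal
        rw [mul_assoc, Finset.sum_mul_sum]; gcongr with j; rw [mul_comm]
        exact Finset.single_le_sum (f := fun i => nn (mulv j ps) ^ 2 * nn (An i w) ^ 2)
          (fun i _ => by positivity) (Finset.mem_univ j)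

lemma continuous_rotDeriv_rot (w : S3) :
    Continuous fun q : ℝ × (E3 × E3) => rotDeriv w (rot q.1 q.2) := by
  refine (continuous_rotDeriv w).comp ?_; unfold rot; fun_prop

lemma enorm_swap_sub_sq_le (w : S3) (p : E3 × E3) :
    ‖w p.2 * ps p.1 - w p.1 * ps p.2‖ₑ ^ 2 ≤ ofReal (π / 2) *
      ∫⁻ θ in Set.Ioc 0 (π / 2), ‖rotDeriv w (rot θ p)‖ₑ ^ 2 := by
  have hpi := Real.pi_pos
  have hc : Continuous fun θ => rotDeriv w (rot θ p) :=
    Continuous.comp (g := fun q : ℝ × (E3 × E3) => rotDeriv w (rot q.1 q.2))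
      (continuous_rotDeriv_rot w) (f := fun θ : ℝ => (θ, p)) (by fun_prop)
  have e : w p.2 * ps p.1 - w p.1 * ps p.2 = ∫ θ in Set.Ioc 0 (π / 2), rotDeriv w (rot θ p) := by
    rw [← intervalIntegral.integral_of_le (by positivity),
      intervalIntegral.integral_eq_sub_of_hasDerivAt (fun θ _ => hasDerivAt_rot w p θ)
        (hc.intervalIntegrable _ _)]
    simp [rot, ps_neg]
  rw [e]
  have h := enorm_integral_mul_sq_le (μ := volume.restrict (Set.Ioc 0 (π / 2)))
    (f := fun _ => (1 : ℂ)) (g := fun θ => rotDeriv w (rot θ p)) aemeasurable_const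
    hc.measurable.aemeasurable
  simpa only [one_mul, enorm_one, one_pow, lintegral_const, Measure.restrict_apply_univ,
    Real.volume_Ioc, sub_zero] using h

lemma lintegral_swap_sub_sq_le (w : S3) : ∫⁻ p : E3 × E3, ‖w p.2 * ps p.1 - w p.1 * ps p.2‖ₑ ^ 2 ≤
      ofReal (cPoin * ∑ j, nn (An j w) ^ 2) := by
  have hpi := Real.pi_pos
  have hm : Measurable fun q : (E3 × E3) × ℝ => ‖rotDeriv w (rot q.2 q.1)‖ₑ ^ 2 :=
    (Continuous.comp (g := fun q : ℝ × (E3 × E3) => rotDeriv w (rot q.1 q.2))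
      (continuous_rotDeriv_rot w) continuous_swap).measurable.enorm.pow_const 2
  calc _ ≤ ∫⁻ p, ofReal (π / 2) *
        ∫⁻ θ in Set.Ioc 0 (π / 2), ‖rotDeriv w (rot θ p)‖ₑ ^ 2 :=
        lintegral_mono (enorm_swap_sub_sq_le w)
    _ = ofReal (π / 2) * ∫⁻ θ in Set.Ioc 0 (π / 2), ∫⁻ p, ‖rotDeriv w (rot θ p)‖ₑ ^ 2 := by
      rw [lintegral_const_mul _ (Measurable.lintegral_prod_right' hm), lintegral_lintegral_swap]
      exact hm.aemeasurable
    _ = ofReal (π / 2) * ∫⁻ θ in Set.Ioc 0 (π / 2), ∫⁻ p, ‖rotDeriv w p‖ₑ ^ 2 := by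
      congr 1; refine lintegral_congr fun θ => ?_
      exact (measurePreserving_rot θ).lintegral_comp
        ((continuous_rotDeriv w).measurable.enorm.pow_const 2)
    _ ≤ ofReal (π / 2) * ∫⁻ θ in Set.Ioc 0 (π / 2),
        ofReal ((3 * ∑ j, nn (mulv j ps) ^ 2) * ∑ j, nn (An j w) ^ 2) := by
      gcongr; exact lintegral_rotDeriv_le w
    _ = _ := by
      rw [lintegral_const, Measure.restrict_apply_univ, Real.volume_Ioc, sub_zero,
        ← ofReal_mul (by positivity), ← ofReal_mul (by positivity), cPoin]
      congr 1; ring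

/-- Integrating `w(y) ψ(x) - w(x) ψ(y)` against `ψ(x)` gives the projection of `w` off `ψ`. -/
lemma sub_proj_apply (w : S3) (y : E3) :
    (w - ip ps w • ps) y = ∫ x, ps x * (w y * ps x - w x * ps y) := by
  have i1 : Integrable fun x => conj (ps x) * ps x := by
    have := (ps.memLp 2 volume).integrable_mul ((conjS ps).memLp 2 volume)
    refine this.congr (ae_of_all _ fun x => ?_)
    simp [mul_comm]
  have i2 : Integrable fun x => conj (ps x) * w x := by
    have := (w.memLp 2 volume).integrable_mul ((conjS ps).memLp 2 volume)
    refine this.congr (ae_of_all _ fun x => ?_)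
    simp [mul_comm]
  have hr : ∀ x, conj (ps x) = ps x := by intro x; rw [ps_apply, conj_ofReal]
  have h1 := ip_self ps
  rw [ip_eq, nn_ps] at h1
  have e2 : ∀ x, ps x * (w y * ps x - w x * ps y) = w y * (conj (ps x) * ps x)
      - ps y * (conj (ps x) * w x) := by
    intro x; rw [hr]; ring
  simp_rw [e2]
  rw [integral_sub (i1.const_mul _) (i2.const_mul _), integral_const_mul, integral_const_mul,
    h1, ip_eq]
  simp [mul_comm]

/-- The Poincaré inequality for the Gaussian measure, with a constant that is not sharp. The proof
interpolates between `w(x) ψ(y)` and `w(y) ψ(x)` by rotations in the `(x, y)` variables. -/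
lemma poincare (w : S3) : nn (w - ip ps w • ps) ^ 2 ≤ cPoin * ∑ j, nn (An j w) ^ 2 := by
  have hFc : Continuous fun p : E3 × E3 => w p.2 * ps p.1 - w p.1 * ps p.2 := by
    have h1 : Continuous ps := ps.continuous
    have h2 : Continuous w := w.continuous
    fun_prop
  have h3 : ∀ y, ‖(w - ip ps w • ps) y‖ₑ ^ 2 ≤ ∫⁻ x, ‖w y * ps x - w x * ps y‖ₑ ^ 2 := by
    intro y; rw [sub_proj_apply]
    have hFy : Continuous fun x => w y * ps x - w x * ps y := by
      have h1 : Continuous ps := ps.continuous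
      have h2 : Continuous w := w.continuous
      fun_prop
    have h := enorm_integral_mul_sq_le (μ := volume) (f := ps)
      (g := fun x => w y * ps x - w x * ps y)
      ps.continuous.measurable.aemeasurable hFy.measurable.aemeasurable
    rwa [lintegral_enorm_sq, nn_ps, one_pow, ENNReal.ofReal_one, one_mul] at h
  have h4 : ofReal (nn (w - ip ps w • ps) ^ 2) ≤ ofReal (cPoin * ∑ j, nn (An j w) ^ 2) := by
    rw [← lintegral_enorm_sq]
    refine (lintegral_mono h3).trans (le_trans (le_of_eq ?_) (lintegral_swap_sub_sq_le w))
    rw [volume_eq_prod, lintegral_prod_symm' _ (hFc.measurable.enorm.pow_const 2)]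
  have hC := cPoin_nonneg
  exact (ENNReal.ofReal_le_ofReal_iff (by positivity)).1 h4

/-! ### The free operator at a fixed frequency -/

lemma ip_zero_left (f : S3) : ip 0 f = 0 := by simpa using ip_smul_left 0 f f

lemma ip_zero_right (f : S3) : ip f 0 = 0 := by simpa using ip_smul_right 0 f f

lemma integral_cexp_gaussian (b : E3) :
    ∫ v : E3, exp (-(1 / 2 : ℂ) * ‖v‖ ^ 2 + I * (inner ℝ b v : ℝ)) =
      (2 * π : ℂ) ^ (3 / 2 : ℂ) * exp (-‖b‖ ^ 2 / 2) := by
  have h := GaussianFourier.integral_cexp_neg_mul_sq_norm_add (V := E3) (b := 1 / 2)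
    (by norm_num) I b
  simp only [finrank_euclideanSpace, Fintype.card_fin] at h; rw [h]; congr 2
  · ring
  · norm_num

lemma ip_cs_cs (k l : E3) : ip (cs k) (cs l) = Real.exp (-‖k - l‖ ^ 2 / 2) := by
  rw [ip_eq]
  have h : ∀ v, conj (cs k v) * cs l v = (cN : ℂ) ^ 2 *
      exp (-(1 / 2 : ℂ) * ‖v‖ ^ 2 + I * (inner ℝ (l - k) v : ℝ)) := by
    intro v; rw [cs_apply, cs_apply, map_mul, ← Complex.exp_conj, conj_ofReal]
    rw [show ∀ a b c : ℂ, c * a * (c * b) = c ^ 2 * (a * b) by intros; ring, ← exp_add]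
    congr 2; simp only [csPhase, map_add, map_mul, conj_ofReal, Complex.conj_I, inner_sub_left]
    push_cast; ring
  simp_rw [h]
  rw [integral_const_mul, integral_cexp_gaussian, ← mul_assoc, norm_sub_rev]
  have h2 : (cN : ℂ) ^ 2 * (2 * π : ℂ) ^ (3 / 2 : ℂ) = 1 := by
    have : ((cN ^ 2 * (2 * π) ^ (3 / 2 : ℝ) : ℝ) : ℂ) = 1 := by
      rw [cN, ← Real.rpow_natCast, ← Real.rpow_mul (by positivity), ← Real.rpow_add (by positivity)]
      norm_num
    rw [← this]; push_cast
    rw [Complex.ofReal_cpow (by positivity)]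
    push_cast; rfl
  rw [h2, one_mul]; push_cast; ring_nf

lemma nn_cs (k : E3) : nn (cs k) = 1 := by
  have h := ip_cs_cs k k
  rw [ip_self] at h
  have h' : nn (cs k) ^ 2 = 1 := by
    have := Complex.ofReal_injective h
    simpa using this
  nlinarith [nn_nonneg (cs k)]

/-- The harmonic oscillator `Σ_j (-∂_j + v_j/2)(∂_j + v_j/2)`. -/
def osc : S3 →ₗ[ℂ] S3 := ∑ j, Cr j ∘ₗ An j

lemma osc_apply (w : S3) : osc w = ∑ j, Cr j (An j w) := by simp [osc]

/-- Multiplication by `k·v`. -/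
def mulk (k : E3) : S3 →ₗ[ℂ] S3 := ∑ j, (k j : ℂ) • mulv j

lemma mulk_eq (k : E3) (w : S3) : mulk k w = ∑ j, (k j : ℂ) • mulv j w := by simp [mulk]

/-- The free operator `Σ_j (-∂_j + v_j/2)(∂_j + v_j/2) + i k·v` at the frequency `k`. -/
def Pk (k : E3) : S3 →ₗ[ℂ] S3 := osc + I • mulk k

lemma Pk_apply (k : E3) (w : S3) : Pk k w = osc w + I • mulk k w := rfl

lemma ip_osc (f g : S3) : ip f (osc g) = ∑ j, ip (An j f) (An j g) := by
  simp [osc_apply, ip_sum_right, ip_Cr]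

lemma ip_mulk (k : E3) (f g : S3) : ip f (mulk k g) = ip (mulk k f) g := by
  simp only [mulk_eq, ip_sum_right, ip_sum_left, ip_smul_left, ip_smul_right, ip_mulv, conj_ofReal]

lemma ip_mulk_eq (k : E3) (f g : S3) :
    ip f (mulk k g) = ∑ j, (k j : ℂ) * (ip f (An j g) + ip f (Cr j g)) := by
  simp only [mulk_eq, ip_sum_right, ip_smul_right, ← An_add_Cr, ip_add_right]

lemma sum_sq_coord (k : E3) : ∑ j, (k j : ℂ) * (k j : ℂ) = ((‖k‖ ^ 2 : ℝ) : ℂ) := by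
  rw [EuclideanSpace.norm_sq_eq]; push_cast
  refine sum_congr rfl fun j _ => ?_
  rw [Real.norm_eq_abs, ← Complex.ofReal_pow, sq_abs]
  push_cast; ring

/-- Coherent states are eigenfunctions of the adjoint of `Pk`. -/
lemma ip_cs_Pk (k : E3) (w : S3) : ip (cs k) (Pk k w) = ((‖k‖ ^ 2 : ℝ) : ℂ) * ip (cs k) w := by
  rw [Pk_apply, ip_add_right, ip_osc, ip_smul_right, ip_mulk_eq, ← sum_sq_coord, Finset.sum_mul,
    mul_sum, ← sum_add_distrib]
  refine sum_congr rfl fun j _ => ?_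
  rw [ip_Cr, An_cs, ip_smul_left, ip_smul_left]
  simp only [map_mul, Complex.conj_I, conj_ofReal]
  linear_combination (-(k j : ℂ) ^ 2 * ip (cs k) w) * Complex.I_sq

lemma re_ip_Pk (k : E3) (w : S3) : (ip w (Pk k w)).re = ∑ j, nn (An j w) ^ 2 := by
  have him : (ip w (mulk k w)).im = 0 := by
    have h := ip_conj w (mulk k w)
    rw [← ip_mulk] at h
    exact Complex.conj_eq_iff_im.1 h
  rw [Pk_apply, ip_add_right, ip_osc, ip_smul_right]
  simp only [ip_self, Complex.add_re, Complex.re_sum, Complex.ofReal_re, Complex.mul_re,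
    Complex.I_re, Complex.I_im, him]
  simp

lemma nn_Cr_sq (j : Fin 3) (w : S3) : nn (Cr j w) ^ 2 = nn (An j w) ^ 2 + nn w ^ 2 := by
  have h : ip (Cr j w) (Cr j w) = ip (An j w) (An j w) + ip w w := by
    rw [← ip_An, An_Cr, ip_add_right, ip_Cr]; simp
  simp only [ip_self] at h
  exact_mod_cast h

lemma nn_Cr_le (j : Fin 3) (w : S3) : nn (Cr j w) ≤ nn (An j w) + nn w := by
  have h := nn_Cr_sq j w
  have h1 := nn_nonneg (An j w)
  have h2 := nn_nonneg w
  nlinarith [nn_nonneg (Cr j w)]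

/-- The sum of the norms of the annihilated functions. -/
def dn (w : S3) : ℝ := ∑ j, nn (An j w)

lemma dn_nonneg (w : S3) : 0 ≤ dn w := sum_nonneg fun _ _ => nn_nonneg _

lemma dn_sq_le (w : S3) : dn w ^ 2 ≤ 3 * ∑ j, nn (An j w) ^ 2 := by
  simpa [dn] using sq_sum_le_card_mul_sum_sq (s := (Finset.univ : Finset (Fin 3)))
    (f := fun j => nn (An j w))

/-- The norm of `H¹` type which is dual to right hand sides `f₀ + Σ A_j f_j + Σ A_j^* f'_j`. -/
def mn (w : S3) : ℝ := nn w + ∑ j, nn (An j w) + ∑ j, nn (Cr j w)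

lemma mn_nonneg (w : S3) : 0 ≤ mn w :=
  add_nonneg (add_nonneg (nn_nonneg _) (sum_nonneg fun _ _ => nn_nonneg _))
    (sum_nonneg fun _ _ => nn_nonneg _)

lemma mn_le (w : S3) : mn w ≤ 4 * nn w + 2 * dn w := by
  have : ∑ j, nn (Cr j w) ≤ ∑ j, (nn (An j w) + nn w) := sum_le_sum fun j _ => nn_Cr_le j w
  rw [sum_add_distrib] at this; simp at this; unfold mn dn; linarith

/-- The right hand side `f₀ + Σ A_j f_j + Σ A_j^* f'_j`. -/
def rhs (f0 : S3) (f1 f2 : Fin 3 → S3) : S3 := f0 + ∑ j, An j (f1 j) + ∑ j, Cr j (f2 j)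

/-- The size of a right hand side `f₀ + Σ A_j f_j + Σ A_j^* f'_j`. -/
def rn (f0 : S3) (f1 f2 : Fin 3 → S3) : ℝ := nn f0 + ∑ j, nn (f1 j) + ∑ j, nn (f2 j)

lemma rn_nonneg (f0 : S3) (f1 f2 : Fin 3 → S3) : 0 ≤ rn f0 f1 f2 := by
  have h1 := nn_nonneg f0
  have h2 : 0 ≤ ∑ j, nn (f1 j) := sum_nonneg fun _ _ => nn_nonneg _
  have h3 : 0 ≤ ∑ j, nn (f2 j) := sum_nonneg fun _ _ => nn_nonneg _
  exact add_nonneg (add_nonneg h1 h2) h3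

lemma norm_ip_rhs_le (g f0 : S3) (f1 f2 : Fin 3 → S3) :
    ‖ip g (rhs f0 f1 f2)‖ ≤ rn f0 f1 f2 * mn g := by
  have e : ip g (rhs f0 f1 f2) = ip g f0 + ∑ j, ip (Cr j g) (f1 j) + ∑ j, ip (An j g) (f2 j) := by
    simp [rhs, ip_add_right, ip_sum_right, ip_An, ip_Cr]
  have hsum : ∀ a b : Fin 3 → S3, ‖∑ j, ip (a j) (b j)‖ ≤ (∑ j, nn (a j)) * ∑ j, nn (b j) := by
    intro a b
    calc _ ≤ ∑ j, nn (a j) * nn (b j) :=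
          (norm_sum_le _ _).trans (sum_le_sum fun j _ => norm_ip_le _ _)
      _ ≤ _ := by
        rw [Finset.sum_mul]; gcongr with j
        · exact nn_nonneg _
        · exact Finset.single_le_sum (f := fun i => nn (b i)) (fun i _ => nn_nonneg _)
            (Finset.mem_univ j)
  have hs : ∀ a : Fin 3 → S3, 0 ≤ ∑ j, nn (a j) := fun a => sum_nonneg fun _ _ => nn_nonneg _
  have h0 := nn_nonneg f0
  have h0' := nn_nonneg g
  have h1 := hs f1
  have h2 := hs f2
  have h3 := hs (fun j => An j g)
  have h4 := hs (fun j => Cr j g)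
  rw [e]
  calc _ ≤ nn g * nn f0 + (∑ j, nn (Cr j g)) * (∑ j, nn (f1 j)) +
        (∑ j, nn (An j g)) * ∑ j, nn (f2 j) :=
      (norm_add_le _ _).trans (add_le_add ((norm_add_le _ _).trans
        (add_le_add (norm_ip_le _ _) (hsum _ _))) (hsum _ _))
    _ ≤ _ := by
      unfold rn mn
      nlinarith [mul_nonneg h0 h3, mul_nonneg h0 h4, mul_nonneg h1 h0', mul_nonneg h1 h3,
        mul_nonneg h2 h0', mul_nonneg h2 h4]

lemma abs_coord_le (k : E3) (j : Fin 3) : |k j| ≤ ‖k‖ := by simpa using PiLp.norm_apply_le k j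

lemma norm_coord_le (k : E3) (j : Fin 3) : ‖(k j : ℂ)‖ ≤ ‖k‖ := by simpa using abs_coord_le k j

lemma nn_sum_le {ι : Type*} (s : Finset ι) (f : ι → S3) :
    nn (∑ i ∈ s, f i) ≤ ∑ i ∈ s, nn (f i) := by
  simpa [nn] using norm_sum_le s (fun i => toH (f i))

lemma nn_sum_smul_le (k : E3) (f : Fin 3 → S3) :
    nn (∑ j, (k j : ℂ) • f j) ≤ ‖k‖ * ∑ j, nn (f j) := by
  refine (nn_sum_le _ _).trans ?_; rw [mul_sum]; gcongr with j; rw [nn_smul]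
  exact mul_le_mul_of_nonneg_right (norm_coord_le k j) (nn_nonneg _)

lemma An_Cr_ps (i j : Fin 3) : An i (Cr j ps) = (if i = j then (1 : ℂ) else 0) • ps := by
  rw [An_Cr, An_ps, map_zero, zero_add]

/-- The norms of the first two levels of Hermite functions. -/
def cHerm : ℝ := ∑ j, nn (Cr j ps) + ∑ i, ∑ j, nn (Cr i (Cr j ps))

lemma cHerm_nonneg : 0 ≤ cHerm := by
  have h1 : 0 ≤ ∑ j, nn (Cr j ps) := sum_nonneg fun _ _ => nn_nonneg _
  have h2 : 0 ≤ ∑ i, ∑ j, nn (Cr i (Cr j ps)) :=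
    sum_nonneg fun _ _ => sum_nonneg fun _ _ => nn_nonneg _
  exact add_nonneg h1 h2

/-- At frequencies away from zero the component along `ψ` is controlled by the first moments of
the equation. -/
lemma norm_ip_ps_le_of_one_le {k : E3} (hk : 1 ≤ ‖k‖) {z : ℂ} (hz : ‖z‖ ≤ 1)
    {w f0 : S3} {f1 f2 : Fin 3 → S3} (hw : Pk k w - z • w = rhs f0 f1 f2) :
    ‖ip ps w‖ ≤ (3 * cHerm + 3) * (rn f0 f1 f2 + nn (w - ip ps w • ps)) := by
  set p := w - ip ps w • ps with hp
  set b : S3 := ∑ j, (k j : ℂ) • Cr j ps with hb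
  set e : S3 := ∑ j, (k j : ℂ) • Cr j b with he
  have hAb : ∀ i, An i b = (k i : ℂ) • ps := by
    intro i; simp [hb, map_sum, An_Cr_ps]
  have hbp : ip b ps = 0 := by
    simp only [hb, ip_sum_left, ip_smul_left, ← ip_An, An_ps, ip_zero_right, mul_zero,
      Finset.sum_const_zero]
  have hep : ip e ps = 0 := by
    simp only [he, ip_sum_left, ip_smul_left, ← ip_An, An_ps, ip_zero_right, mul_zero,
      Finset.sum_const_zero]
  have hwp : w = p + ip ps w • ps := by simp [hp]
  have hbw : ip b w = ip b p := by
    conv_lhs => rw [hwp, ip_add_right, ip_smul_right, hbp]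
    simp
  have hew : ip e w = ip e p := by
    conv_lhs => rw [hwp, ip_add_right, ip_smul_right, hep]
    simp
  have key : ip b (rhs f0 f1 f2) = (1 - z) * ip b p +
      I * (((‖k‖ ^ 2 : ℝ) : ℂ) * ip ps w + ip e p) := by
    rw [← hw, ip_sub_right, ip_smul_right, Pk_apply, ip_add_right, ip_smul_right, ip_osc,
      ip_mulk, ← hbw, ← hew]
    have e1 : ∑ j, ip (An j b) (An j w) = ip b w := by
      rw [hb, ip_sum_left]
      refine sum_congr rfl fun j _ => ?_
      rw [← hb, hAb, ip_smul_left, ip_smul_left, ip_An]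
    have e2 : mulk k b = ((‖k‖ ^ 2 : ℝ) : ℂ) • ps + e := by
      rw [mulk_eq, he, ← sum_sq_coord, Finset.sum_smul, ← sum_add_distrib]
      refine sum_congr rfl fun j _ => ?_
      rw [← An_add_Cr, hAb, smul_add, smul_smul]
    rw [e1, e2, ip_add_left, ip_smul_left, conj_ofReal]; ring
  have nb : nn b ≤ ‖k‖ * cHerm := by
    refine (nn_sum_smul_le k _).trans (mul_le_mul_of_nonneg_left ?_ (norm_nonneg _))
    have h2 : 0 ≤ ∑ i, ∑ j, nn (Cr i (Cr j ps)) :=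
      sum_nonneg fun _ _ => sum_nonneg fun _ _ => nn_nonneg _
    unfold cHerm; linarith
  have nCb : ∑ i, nn (Cr i b) ≤ ‖k‖ * cHerm := by
    have h1 : ∀ i, nn (Cr i b) ≤ ‖k‖ * ∑ j, nn (Cr i (Cr j ps)) := by
      intro i
      have : Cr i b = ∑ j, (k j : ℂ) • Cr i (Cr j ps) := by simp [hb, map_sum]
      rw [this]; exact nn_sum_smul_le k _
    refine (sum_le_sum fun i _ => h1 i).trans ?_; rw [← mul_sum]
    refine mul_le_mul_of_nonneg_left ?_ (norm_nonneg _)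
    have h1 : 0 ≤ ∑ j, nn (Cr j ps) := sum_nonneg fun _ _ => nn_nonneg _
    unfold cHerm; linarith
  have nAb : ∑ i, nn (An i b) ≤ ‖k‖ * 3 := by
    have : ∀ i ∈ Finset.univ, nn (An i b) ≤ ‖k‖ := by
      intro i _; rw [hAb, nn_smul, nn_ps, mul_one]
      exact norm_coord_le k i
    simpa [mul_comm] using sum_le_sum this
  have ne : nn e ≤ ‖k‖ ^ 2 * cHerm := by
    refine (nn_sum_smul_le k _).trans ?_
    rw [pow_two, mul_assoc]
    exact mul_le_mul_of_nonneg_left nCb (norm_nonneg _)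
  have hA := rn_nonneg f0 f1 f2
  have hc := cHerm_nonneg
  have hpn := nn_nonneg p
  set A := rn f0 f1 f2
  have hmb : mn b ≤ ‖k‖ * (2 * cHerm + 3) := by unfold mn; linarith
  have h1 : ‖k‖ ^ 2 * ‖ip ps w‖ ≤ A * mn b + 2 * (nn b * nn p) + nn e * nn p := by
    have h2 : ((‖k‖ ^ 2 : ℝ) : ℂ) * ip ps w =
        -I * (ip b (rhs f0 f1 f2) - (1 - z) * ip b p) - ip e p := by
      rw [key]; linear_combination (((‖k‖ ^ 2 : ℝ) : ℂ) * ip ps w + ip e p) * Complex.I_sq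
    have h3 : ‖((‖k‖ ^ 2 : ℝ) : ℂ) * ip ps w‖ = ‖k‖ ^ 2 * ‖ip ps w‖ := by
      rw [norm_mul, norm_real, Real.norm_of_nonneg (by positivity)]
    rw [← h3, h2]
    have h4 : ‖(1 : ℂ) - z‖ ≤ 2 := (norm_sub_le _ _).trans (by norm_num; linarith)
    calc _ ≤ (‖ip b (rhs f0 f1 f2)‖ + ‖(1 : ℂ) - z‖ * ‖ip b p‖) + ‖ip e p‖ := by
          refine (norm_sub_le _ _).trans (add_le_add_left ?_ _)
          rw [norm_mul, norm_neg, Complex.norm_I, one_mul]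
          refine (norm_sub_le _ _).trans (add_le_add_right ?_ _); rw [norm_mul]
      _ ≤ _ := by
          have := norm_ip_rhs_le b f0 f1 f2
          have := norm_ip_le b p
          have := norm_ip_le e p
          have : ‖(1 : ℂ) - z‖ * ‖ip b p‖ ≤ 2 * (nn b * nn p) := by gcongr
          linarith
  have hk2 : ‖k‖ ≤ ‖k‖ ^ 2 := by nlinarith
  have hk0 : 0 < ‖k‖ ^ 2 := by positivity
  refine le_of_mul_le_mul_left (h1.trans ?_) hk0
  have t1 : A * mn b ≤ A * (‖k‖ ^ 2 * (2 * cHerm + 3)) := by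
    refine mul_le_mul_of_nonneg_left (hmb.trans ?_) hA
    exact mul_le_mul_of_nonneg_right hk2 (by positivity)
  have t2 : nn b * nn p ≤ (‖k‖ ^ 2 * cHerm) * nn p :=
    mul_le_mul_of_nonneg_right (nb.trans (mul_le_mul_of_nonneg_right hk2 hc)) hpn
  have t3 : nn e * nn p ≤ (‖k‖ ^ 2 * cHerm) * nn p := mul_le_mul_of_nonneg_right ne hpn
  have t4 : 0 ≤ ‖k‖ ^ 2 * cHerm * A := by positivity
  have t5 : 0 ≤ ‖k‖ ^ 2 * nn p := by positivity
  nlinarith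

/-- At low frequencies the component along `ψ` is controlled by the component along the coherent
state. -/
lemma norm_ip_ps_le_of_le_one {k : E3} (hk : ‖k‖ ≤ 1) (w : S3) :
    ‖ip ps w‖ ≤ 2 * (‖ip (cs k) w‖ + nn (w - ip ps w • ps)) := by
  set p := w - ip ps w • ps with hp
  have h1 : ip (cs k) w = ip ps w * (Real.exp (-‖k‖ ^ 2 / 2) : ℝ) + ip (cs k) p := by
    rw [hp, ip_sub_right, ip_smul_right, ps, ip_cs_cs, sub_zero]; ring
  have h2 : ‖ip ps w‖ * Real.exp (-‖k‖ ^ 2 / 2) ≤ ‖ip (cs k) w‖ + nn p := by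
    have h3 : ip ps w * (Real.exp (-‖k‖ ^ 2 / 2) : ℝ) = ip (cs k) w - ip (cs k) p := by
      rw [h1]; ring
    have h4 : ‖ip ps w‖ * Real.exp (-‖k‖ ^ 2 / 2) = ‖ip ps w * (Real.exp (-‖k‖ ^ 2 / 2) : ℝ)‖ := by
      rw [norm_mul, norm_real, Real.norm_of_nonneg (Real.exp_pos _).le]
    rw [h4, h3]; refine (norm_sub_le _ _).trans (add_le_add_right ?_ _)
    simpa [nn_cs] using norm_ip_le (cs k) p
  have h3 : (1 / 2 : ℝ) ≤ Real.exp (-‖k‖ ^ 2 / 2) := by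
    have := Real.add_one_le_exp (-‖k‖ ^ 2 / 2)
    nlinarith [norm_nonneg k]
  nlinarith [norm_nonneg (ip ps w)]

/-- The absorption argument which concludes the a priori estimate. -/
lemma absorb {N d S C₁ C₂ δ : ℝ} (hN : 0 ≤ N) (hd : 0 ≤ d) (hS : 0 ≤ S) (hC₁ : 0 ≤ C₁)
    (hC₂ : 0 ≤ C₂) (hδ : 0 ≤ δ) (hδ' : 4 * δ * C₂ ^ 2 ≤ 1) (h1 : N ≤ C₁ * S + C₂ * d)
    (h2 : d ^ 2 ≤ S * (4 * N + 4 * d) + δ * N ^ 2) :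
    d ≤ (8 * C₁ + 4 * δ * C₁ ^ 2 + 8 * C₂ + 8 + 1) * S := by
  have h3 : N ^ 2 ≤ 2 * C₁ ^ 2 * S ^ 2 + 2 * C₂ ^ 2 * d ^ 2 := by
    have : N ^ 2 ≤ (C₁ * S + C₂ * d) ^ 2 := by gcongr
    nlinarith [sq_nonneg (C₁ * S - C₂ * d)]
  have h4 : δ * N ^ 2 ≤ 2 * δ * C₁ ^ 2 * S ^ 2 + d ^ 2 / 2 := by
    have h5 := mul_le_mul_of_nonneg_left h3 hδ
    have h6 : 4 * δ * C₂ ^ 2 * d ^ 2 ≤ 1 * d ^ 2 := by gcongr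
    nlinarith
  have h5 : S * N ≤ S * (C₁ * S + C₂ * d) := mul_le_mul_of_nonneg_left h1 hS
  have h6 : d ^ 2 ≤ (8 * C₁ + 4 * δ * C₁ ^ 2) * S ^ 2 + (8 * C₂ + 8) * S * d := by nlinarith
  by_contra hcon
  push Not at hcon
  obtain ⟨α, hα⟩ : ∃ α, α = 8 * C₁ + 4 * δ * C₁ ^ 2 := ⟨_, rfl⟩
  obtain ⟨β, hβ⟩ : ∃ β, β = 8 * C₂ + 8 := ⟨_, rfl⟩
  have hα0 : 0 ≤ α := by rw [hα]; positivity
  have hβ0 : 0 ≤ β := by rw [hβ]; positivity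
  rw [← hα, ← hβ] at h6
  have hcon' : (α + β + 1) * S < d := by rw [hα, hβ]; linarith
  have hSd : S ≤ d := by nlinarith [mul_nonneg hα0 hS, mul_nonneg hβ0 hS]
  have h7 : α * S ^ 2 ≤ α * (S * d) := by rw [pow_two]; gcongr
  have hd1 : 0 < d := lt_of_le_of_lt (by positivity) hcon'
  have h8 := mul_lt_mul_of_pos_left hcon' hd1
  nlinarith [mul_nonneg hS hd]

/-- **A priori estimate at a fixed frequency**, uniform in the frequency `k` and in small `z`. It
says that the only obstruction to solving `(Pk - z) w = f` is the component of `w` along the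
coherent state, which solves a scalar equation. -/
lemma exists_apriori : ∃ δ C : ℝ, 0 < δ ∧ δ ≤ 1 ∧ 0 < C ∧ ∀ (k : E3) (z : ℂ), ‖z‖ ≤ δ →
    ∀ (w f0 : S3) (f1 f2 : Fin 3 → S3), Pk k w - z • w = rhs f0 f1 f2 →
      nn w + dn w ≤ C * (rn f0 f1 f2 + ‖ip (cs k) w‖) := by
  set C₁ : ℝ := 3 * cHerm + 3 with hC₁
  set C₂ : ℝ := (C₁ + 1) * Real.sqrt cPoin with hC₂
  have hH := cHerm_nonneg
  have hC₁0 : 3 ≤ C₁ := by rw [hC₁]; linarith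
  have hC₂0 : 0 ≤ C₂ := by positivity
  set δ : ℝ := 1 / (4 * C₂ ^ 2 + 1) with hδ
  have hδ0 : 0 < δ := by positivity
  have hδ1 : δ ≤ 1 := by rw [hδ, div_le_one (by positivity)]; nlinarith [sq_nonneg C₂]
  have hδ2 : 4 * δ * C₂ ^ 2 ≤ 1 := by rw [hδ]; field_simp; linarith
  set C₃ := 8 * C₁ + 4 * δ * C₁ ^ 2 + 8 * C₂ + 8 + 1 with hC₃
  have hC₃0 : 0 < C₃ := by positivity
  refine ⟨δ, C₁ + C₂ * C₃ + 2 * C₃, hδ0, hδ1, by positivity, fun k z hz w f0 f1 f2 hw => ?_⟩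
  set p := w - ip ps w • ps with hp
  set S := rn f0 f1 f2 + ‖ip (cs k) w‖ with hS
  have hA := rn_nonneg f0 f1 f2
  have hS0 : 0 ≤ S := add_nonneg hA (norm_nonneg _)
  have hAS : rn f0 f1 f2 ≤ S := by rw [hS]; linarith [norm_nonneg (ip (cs k) w)]
  set d := Real.sqrt (∑ j, nn (An j w) ^ 2) with hd
  have hd0 : 0 ≤ d := Real.sqrt_nonneg _
  have hd2 : d ^ 2 = ∑ j, nn (An j w) ^ 2 := Real.sq_sqrt (sum_nonneg fun _ _ => sq_nonneg _)
  have hdn : dn w ≤ 2 * d := by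
    have := dn_sq_le w
    rw [← hd2] at this
    nlinarith [dn_nonneg w]
  have hpd : nn p ≤ Real.sqrt cPoin * d := by
    have h := poincare w
    rw [← hp, ← hd2] at h
    have h' : nn p ^ 2 ≤ (Real.sqrt cPoin * d) ^ 2 := by
      rw [mul_pow, Real.sq_sqrt cPoin_nonneg]; exact h
    exact (sq_le_sq₀ (nn_nonneg _) (by positivity)).1 h'
  have ha : ‖ip ps w‖ ≤ C₁ * (S + nn p) := by
    have hpn := nn_nonneg p
    rcases le_total 1 ‖k‖ with hk | hk
    · have := norm_ip_ps_le_of_one_le hk (hz.trans hδ1) hw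
      exact this.trans (by gcongr)
    · have h := norm_ip_ps_le_of_le_one hk w
      have : ‖ip (cs k) w‖ ≤ S := by rw [hS]; linarith
      refine h.trans ?_
      have h0 : 0 ≤ S + nn p := by positivity
      nlinarith
  have hN : nn w ≤ C₁ * S + C₂ * d := by
    have h1 : nn w ≤ nn p + ‖ip ps w‖ := by
      calc nn w = nn (p + ip ps w • ps) := by rw [hp]; simp
        _ ≤ nn p + nn (ip ps w • ps) := nn_add_le _ _
        _ = _ := by rw [nn_smul, nn_ps, mul_one]
    have h2 : (C₁ + 1) * nn p ≤ (C₁ + 1) * (Real.sqrt cPoin * d) := by gcongr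
    rw [hC₂]; nlinarith
  have hE : d ^ 2 ≤ S * (4 * nn w + 4 * d) + δ * nn w ^ 2 := by
    have e1 : (ip w (rhs f0 f1 f2)).re = d ^ 2 - z.re * nn w ^ 2 := by
      rw [← hw, ip_sub_right, ip_smul_right, Complex.sub_re, re_ip_Pk, ip_self, hd2,
        Complex.mul_re, Complex.ofReal_re, Complex.ofReal_im, mul_zero, sub_zero]
    have e2 : (ip w (rhs f0 f1 f2)).re ≤ S * (4 * nn w + 4 * d) := by
      refine (Complex.re_le_norm _).trans ((norm_ip_rhs_le w f0 f1 f2).trans ?_)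
      have hm : mn w ≤ 4 * nn w + 4 * d := (mn_le w).trans (by linarith)
      have hw0 := nn_nonneg w
      exact mul_le_mul hAS hm (mn_nonneg w) hS0
    have e3 : z.re * nn w ^ 2 ≤ δ * nn w ^ 2 := by
      gcongr; exact (Complex.re_le_norm z).trans hz
    linarith
  have hdS := absorb (nn_nonneg w) hd0 hS0 (by linarith) hC₂0 hδ0.le hδ2 hN hE
  rw [← hC₃] at hdS
  have h3 : C₂ * d ≤ C₂ * (C₃ * S) := by gcongr
  nlinarith

lemma isClosed_halfLine : IsClosed halfLine :=
  Complex.isUniformEmbedding_ofReal.isClosedEmbedding.isClosedMap _ isClosed_Ici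

/-- Off the half line, the symbol `|k|² - z` dominates the growth in `k` of the coherent state. -/
lemma exists_bound_symbol {z : ℂ} (hz : z ∉ halfLine) :
    ∃ C : ℝ, 0 < C ∧ ∀ t : ℝ, 0 ≤ t → 4 + 6 * t ≤ C * ‖((t ^ 2 : ℝ) : ℂ) - z‖ := by
  obtain ⟨ε, hε, hb⟩ := Metric.isOpen_iff.1 isClosed_halfLine.isOpen_compl z hz
  have h1 : ∀ t : ℝ, ε ≤ ‖((t ^ 2 : ℝ) : ℂ) - z‖ := by
    intro t; by_contra! h
    exact hb (by rwa [Metric.mem_ball, dist_eq_norm]) ⟨t ^ 2, sq_nonneg t, rfl⟩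
  set M := 2 + ‖z‖ with hM
  have hM0 : 2 ≤ M := by rw [hM]; linarith [norm_nonneg z]
  refine ⟨(4 + 6 * M) / ε + 6, by positivity, fun t ht => ?_⟩
  have h2 : t ^ 2 - ‖z‖ ≤ ‖((t ^ 2 : ℝ) : ℂ) - z‖ := by
    have h := norm_sub_norm_le ((t ^ 2 : ℝ) : ℂ) z
    rwa [norm_real, Real.norm_of_nonneg (sq_nonneg t)] at h
  rcases le_total t M with h | h
  · have h3 : (4 + 6 * M) / ε * ε ≤ (4 + 6 * M) / ε * ‖((t ^ 2 : ℝ) : ℂ) - z‖ := by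
      gcongr; exact h1 t
    rw [div_mul_cancel₀ _ hε.ne'] at h3
    nlinarith [h1 t]
  · have h3 : 0 ≤ (4 + 6 * M) / ε * ‖((t ^ 2 : ℝ) : ℂ) - z‖ := by positivity
    have h4 : 4 + 6 * t ≤ 6 * (t ^ 2 - ‖z‖) := by nlinarith [norm_nonneg z]
    nlinarith

/-- The radius of the neighbourhood of zero in which the resolvent is studied. -/
def dl : ℝ := exists_apriori.choose

/-- The constant of the a priori estimate. -/
def cA : ℝ := exists_apriori.choose_spec.choose

lemma dl_pos : 0 < dl := exists_apriori.choose_spec.choose_spec.1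

lemma dl_le_one : dl ≤ 1 := exists_apriori.choose_spec.choose_spec.2.1

lemma cA_pos : 0 < cA := exists_apriori.choose_spec.choose_spec.2.2.1

lemma apriori (k : E3) {z : ℂ} (hz : ‖z‖ ≤ dl) {w f0 : S3} {f1 f2 : Fin 3 → S3}
    (hw : Pk k w - z • w = rhs f0 f1 f2) :
    nn w + dn w ≤ cA * (rn f0 f1 f2 + ‖ip (cs k) w‖) :=
  exists_apriori.choose_spec.choose_spec.2.2.2 k z hz w f0 f1 f2 hw

lemma mn_cs_le (k : E3) : mn (cs k) ≤ 4 + 6 * ‖k‖ := by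
  have h := mn_le (cs k)
  have h2 : dn (cs k) ≤ 3 * ‖k‖ := by
    have : ∀ j ∈ Finset.univ, nn (An j (cs k)) ≤ ‖k‖ := by
      intro j _; rw [An_cs, nn_smul, nn_cs, mul_one, norm_mul, Complex.norm_I, one_mul]
      exact norm_coord_le k j
    simpa [dn] using sum_le_sum this
  rw [nn_cs] at h; linarith

/-- Off the half line the component along the coherent state is bounded by the data as well. -/
lemma exists_apriori_resolvent {z : ℂ} (hz : ‖z‖ ≤ dl) (hz' : z ∉ halfLine) :
    ∃ C : ℝ, 0 < C ∧ ∀ (k : E3) (w f0 : S3) (f1 f2 : Fin 3 → S3),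
      Pk k w - z • w = rhs f0 f1 f2 → nn w + dn w ≤ C * rn f0 f1 f2 := by
  obtain ⟨C, hC, h⟩ := exists_bound_symbol hz'
  have hcA := cA_pos
  refine ⟨cA * (1 + C), by positivity, fun k w f0 f1 f2 hw => ?_⟩
  have h1 := apriori k hz hw
  have h2 : ip (cs k) (rhs f0 f1 f2) = (((‖k‖ ^ 2 : ℝ) : ℂ) - z) * ip (cs k) w := by
    rw [← hw, ip_sub_right, ip_smul_right, ip_cs_Pk]; ring
  have h3 := norm_ip_rhs_le (cs k) f0 f1 f2
  rw [h2, norm_mul] at h3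
  have h4 := h ‖k‖ (norm_nonneg k)
  have hA := rn_nonneg f0 f1 f2
  have h5 : ‖((‖k‖ ^ 2 : ℝ) : ℂ) - z‖ * ‖ip (cs k) w‖ ≤
      ‖((‖k‖ ^ 2 : ℝ) : ℂ) - z‖ * (C * rn f0 f1 f2) := by
    calc _ ≤ rn f0 f1 f2 * (C * ‖((‖k‖ ^ 2 : ℝ) : ℂ) - z‖) :=
          h3.trans (mul_le_mul_of_nonneg_left ((mn_cs_le k).trans h4) hA)
      _ = _ := by ring
  have h6 : 0 < ‖((‖k‖ ^ 2 : ℝ) : ℂ) - z‖ := by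
    by_contra! h7
    nlinarith [norm_nonneg k]
  have h7 := le_of_mul_le_mul_left h5 h6
  calc _ ≤ cA * (rn f0 f1 f2 + ‖ip (cs k) w‖) := h1
    _ ≤ cA * (rn f0 f1 f2 + C * rn f0 f1 f2) := by gcongr
    _ = _ := by ring

/-! ### Decay in the frequency -/

/-- Translation of Schwartz functions: `(tr a w)(v) = w(v - a)`. -/
def tr (a : E3) : S3 →ₗ[ℂ] S3 := (SchwartzMap.compSubConstCLM ℂ a).toLinearMap

@[simp] lemma tr_apply (a : E3) (w : S3) (v : E3) : tr a w v = w (v - a) := rfl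

lemma ip_tr (a : E3) (f g : S3) : ip (tr a f) (tr a g) = ip f g := by
  simp only [ip_eq, tr_apply]
  exact integral_sub_right_eq_self (fun v => conj (f v) * g v) a

lemma nn_tr (a : E3) (f : S3) : nn (tr a f) = nn f := by
  have h := ip_tr a f f
  rw [ip_self, ip_self] at h
  have h' := Complex.ofReal_injective h
  exact (sq_eq_sq₀ (nn_nonneg _) (nn_nonneg _)).1 h'

lemma An_tr (a : E3) (j : Fin 3) (w : S3) :
    An j (tr a w) = tr a (An j w) + ((a j / 2 : ℝ) : ℂ) • tr a w := by
  ext v; simp only [An_apply, add_apply, smul_apply, tr_apply, smul_eq_mul]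
  have : fderiv ℝ (tr a w) v = fderiv ℝ w (v - a) := by
    rw [show (tr a w : E3 → ℂ) = fun v => w (v - a) from rfl, fderiv_comp_sub]
  rw [this]; simp only [PiLp.sub_apply]; push_cast; ring

lemma mulk_apply (k : E3) (w : S3) (v : E3) : mulk k w v = ((inner ℝ k v : ℝ) : ℂ) * w v := by
  rw [mulk_eq]
  simp only [sum_apply, smul_apply, mulv_apply, smul_eq_mul,
    PiLp.inner_apply, RCLike.inner_apply, conj_trivial, Complex.ofReal_sum, Complex.ofReal_mul,
    Finset.sum_mul]
  refine sum_congr rfl fun j _ => by ring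

lemma mulk_tr (k a : E3) (w : S3) :
    mulk k (tr a w) = tr a (mulk k w) + ((inner ℝ k a : ℝ) : ℂ) • tr a w := by
  ext v; simp only [mulk_apply, add_apply, smul_apply, tr_apply, smul_eq_mul, inner_sub_right]
  push_cast; ring

lemma tr_tr_neg (a : E3) (w : S3) : tr a (tr (-a) w) = w := by ext v; simp

lemma nn_sq_eq_fourier (f : S3) : nn f ^ 2 = ∫ ξ, ‖𝓕 f ξ‖ ^ 2 := by
  rw [← nn_sq]
  have h := SchwartzMap.norm_fourier_toL2_eq f
  unfold nn; rw [toH_apply, toH_apply, h]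

lemma nn_le_of_norm_fourier_le {f g : S3} (h : ∀ ξ, ‖𝓕 f ξ‖ ≤ ‖𝓕 g ξ‖) : nn f ≤ nn g := by
  have hi : ∀ f : S3, Integrable (fun ξ => ‖f ξ‖ ^ 2) := fun f =>
    (f.memLp 2).integrable_norm_pow (by norm_num)
  have : nn f ^ 2 ≤ nn g ^ 2 := by
    rw [nn_sq_eq_fourier, nn_sq_eq_fourier]
    exact integral_mono (hi _) (hi _) fun ξ => by
      have := h ξ
      dsimp only
      gcongr
  exact (sq_le_sq₀ (nn_nonneg _) (nn_nonneg _)).1 this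

lemma fourier_tr (a : E3) (w : S3) (ξ : E3) :
    𝓕 (tr a w) ξ = exp (I * ((-(2 * π * inner ℝ a ξ) : ℝ) : ℂ)) * 𝓕 w ξ := by
  rw [SchwartzMap.fourier_coe, SchwartzMap.fourier_coe, Real.fourier_eq', Real.fourier_eq',
    ← integral_const_mul,
    ← integral_sub_right_eq_self (fun v => exp (I * ((-(2 * π * inner ℝ a ξ) : ℝ) : ℂ)) *
      (exp (((-2 * π * inner ℝ v ξ : ℝ) : ℂ) * I) • w v)) a]
  congr 1; ext v
  simp only [tr_apply, smul_eq_mul, ← mul_assoc, ← exp_add, inner_sub_left]; congr 2; push_cast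
  ring

lemma nn_tr_sub_le (a : E3) (w : S3) : nn (tr a w - w) ≤ ‖a‖ * ∑ j, nn (pd j w) := by
  have h1 : nn (tr a w - w) ≤ nn (∑ j, (a j : ℂ) • pd j w) := by
    refine nn_le_of_norm_fourier_le fun ξ => ?_
    have e1 : ∑ j, (a j : ℂ) • pd j w = ∂_{a} w := by
      ext v; simp only [sum_apply, smul_apply, pd_apply, SchwartzMap.lineDerivOp_apply_eq_fderiv]
      conv_rhs => rw [← (EuclideanSpace.basisFun (Fin 3) ℝ).sum_repr a]
      simp [map_sum]
    have hi : (fun ξ : E3 => (inner ℝ ξ a : ℝ)).HasTemperateGrowth :=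
      ((innerSL ℝ).flip a).hasTemperateGrowth
    rw [e1, SchwartzMap.fourier_lineDerivOp_eq]
    have e2 : 𝓕 (tr a w - w) ξ = (exp (I * ((-(2 * π * inner ℝ a ξ) : ℝ) : ℂ)) - 1) * 𝓕 w ξ := by
      rw [sub_eq_add_neg, FourierTransform.fourier_add, FourierTransform.fourier_neg, ← sub_eq_add_neg, sub_apply, fourier_tr]; ring
    rw [e2, smul_apply, SchwartzMap.smulLeftCLM_apply_apply hi, norm_mul]
    refine (mul_le_mul_of_nonneg_right Real.norm_exp_I_mul_ofReal_sub_one_le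
      (norm_nonneg _)).trans (le_of_eq ?_)
    rw [norm_smul, norm_smul, real_inner_comm a ξ]
    simp [abs_of_pos Real.pi_pos]; ring
  exact h1.trans (nn_sum_smul_le a _)

lemma nn_pd_le (j : Fin 3) (w : S3) : nn (pd j w) ≤ nn (An j w) + nn w := by
  have h : nn ((2 : ℂ) • pd j w) ≤ nn (An j w) + nn (Cr j w) := by
    rw [← An_sub_Cr]; exact nn_sub_le _ _
  rw [nn_smul] at h
  have h2 := nn_Cr_le j w
  have h3 := nn_nonneg w
  norm_num at h; linarith

lemma sum_nn_pd_le (w : S3) : ∑ j, nn (pd j w) ≤ dn w + 3 * nn w := by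
  refine (sum_le_sum fun j _ => nn_pd_le j w).trans ?_
  simp [sum_add_distrib, dn]

lemma nn_sub_sq (f g : S3) : nn (f - g) ^ 2 = nn f ^ 2 + nn g ^ 2 - 2 * (ip g f).re := by
  have h : ip (f - g) (f - g) = ip f f + ip g g - (ip g f + conj (ip g f)) := by
    rw [ip_conj, ip_sub_left, ip_sub_right, ip_sub_right]; ring
  rw [ip_self, ip_self, ip_self, Complex.add_conj] at h
  exact_mod_cast h

/-- The commutator of the transport term with translations of the velocity. -/
lemma re_ip_tr_mulk (k a : E3) (w : S3) :
    (ip (tr a w - tr (-a) w) (mulk k w)).re = inner ℝ k a * (ip w (tr a w)).re := by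
  have h1 : ip (tr (-a) w) (mulk k w) =
      ip w (mulk k (tr a w)) - ((inner ℝ k a : ℝ) : ℂ) * ip w (tr a w) := by
    rw [← ip_tr a, tr_tr_neg, mulk_tr, ip_add_right, ip_smul_right]; ring
  have h2 : ip w (mulk k (tr a w)) = conj (ip (tr a w) (mulk k w)) := by rw [ip_conj, ip_mulk]
  rw [ip_sub_left, h1, h2]; simp

/-- **Velocity averaging**: the transport term `i k·v` gains a third of a derivative. -/
lemma rpow_mul_nn_sq_le {k : E3} (hk : 1 ≤ ‖k‖) {z : ℂ} (hz : ‖z‖ ≤ 1)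
    {w f0 : S3} {f1 f2 : Fin 3 → S3} (hw : Pk k w - z • w = rhs f0 f1 f2) :
    nn w ^ 2 ≤ 50 * ‖k‖ ^ (-(2 / 3) : ℝ) * (rn f0 f1 f2 + nn w + dn w) ^ 2 := by
  set t : ℝ := ‖k‖ ^ (-(1 / 3) : ℝ) with ht
  have hk0 : 0 < ‖k‖ := by linarith
  have ht0 : 0 < t := Real.rpow_pos_of_pos hk0 _
  have ht1 : t ≤ 1 := Real.rpow_le_one_of_one_le_of_nonpos hk (by norm_num)
  set a : E3 := (t / ‖k‖) • k with ha
  have hna : ‖a‖ = t := by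
    rw [ha, norm_smul, norm_div, norm_norm, Real.norm_of_nonneg ht0.le]; field_simp
  have hka : (inner ℝ k a : ℝ) = t * ‖k‖ := by
    rw [ha, inner_smul_right, real_inner_self_eq_norm_sq]; field_simp
  have hA := rn_nonneg f0 f1 f2
  have hw0 := nn_nonneg w
  have hd0 := dn_nonneg w
  set X := rn f0 f1 f2 + nn w + dn w with hX
  have hX0 : 0 ≤ X := by rw [hX]; linarith
  set S := tr a w - tr (-a) w with hS
  have nS : nn S ≤ 2 * nn w := by
    have := nn_sub_le (tr a w) (tr (-a) w)
    rw [nn_tr, nn_tr] at this; linarith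
  have nAS : ∀ j, nn (An j S) ≤ 2 * nn (An j w) + nn w := by
    intro j
    have e : An j S = (tr a (An j w) - tr (-a) (An j w)) +
        ((a j / 2 : ℝ) : ℂ) • (tr a w + tr (-a) w) := by
      rw [hS, map_sub, An_tr, An_tr]
      simp only [PiLp.neg_apply, neg_div, Complex.ofReal_neg]; module
    rw [e]
    have h1 := nn_sub_le (tr a (An j w)) (tr (-a) (An j w))
    have h2 := nn_add_le (tr a w) (tr (-a) w)
    rw [nn_tr, nn_tr] at h1 h2
    refine (nn_add_le _ _).trans ?_
    rw [nn_smul, norm_real, norm_div, Real.norm_eq_abs]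
    have h3 : |a j| / ‖(2 : ℝ)‖ ≤ 1 / 2 := by
      have := abs_coord_le a j
      rw [Real.norm_of_nonneg (by norm_num)]
      linarith
    have h4 := mul_le_mul h3 h2 (nn_nonneg _) (by norm_num)
    linarith
  have dS : dn S ≤ 2 * dn w + 3 * nn w := by
    refine (sum_le_sum fun j _ => nAS j).trans ?_
    rw [sum_add_distrib, ← mul_sum]; simp [dn]
  have mS : mn S ≤ 14 * X := by
    have := mn_le S
    linarith
  have key : I * ip S (mulk k w) =
      ip S (rhs f0 f1 f2) - ∑ j, ip (An j S) (An j w) + z * ip S w := by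
    rw [← hw, ip_sub_right, ip_smul_right, Pk_apply, ip_add_right, ip_smul_right, ip_osc]; ring
  have hb : (ip S (mulk k w)).re ≤ 20 * X ^ 2 := by
    have h1 : ‖ip S (mulk k w)‖ ≤ 20 * X ^ 2 := by
      have h2 : ‖ip S (mulk k w)‖ = ‖I * ip S (mulk k w)‖ := by simp
      rw [h2, key]
      have a1 : ‖ip S (rhs f0 f1 f2)‖ ≤ X * (14 * X) := (norm_ip_rhs_le S f0 f1 f2).trans
          (mul_le_mul (by linarith) mS (mn_nonneg S) hX0)
      have a2 : ‖∑ j, ip (An j S) (An j w)‖ ≤ 3 * X * dn w := by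
        rw [dn, mul_sum]
        refine (norm_sum_le _ _).trans (sum_le_sum fun j _ => ?_)
        refine (norm_ip_le _ _).trans (mul_le_mul_of_nonneg_right ?_ (nn_nonneg _))
        have h3 : nn (An j w) ≤ dn w :=
          Finset.single_le_sum (f := fun i => nn (An i w)) (fun i _ => nn_nonneg _)
            (Finset.mem_univ j)
        linarith [nAS j]
      have a3 : ‖z * ip S w‖ ≤ 2 * X * nn w := by
        rw [norm_mul]
        calc _ ≤ 1 * (nn S * nn w) := by
              gcongr; exact norm_ip_le _ _
          _ ≤ _ := by
            rw [one_mul]; exact mul_le_mul_of_nonneg_right (by linarith) hw0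
      have a4 := norm_add_le (ip S (rhs f0 f1 f2) - ∑ j, ip (An j S) (An j w)) (z * ip S w)
      have a5 := norm_sub_le (ip S (rhs f0 f1 f2)) (∑ j, ip (An j S) (An j w))
      have a6 : X * dn w ≤ X * X := mul_le_mul_of_nonneg_left (by linarith) hX0
      have a7 : X * nn w ≤ X * X := mul_le_mul_of_nonneg_left (by linarith) hX0
      nlinarith
    exact (Complex.re_le_norm _).trans h1
  rw [hS, re_ip_tr_mulk, hka] at hb
  have hs := nn_sub_sq (tr a w) w
  rw [nn_tr] at hs
  have ht2 : nn (tr a w - w) ≤ t * (3 * X) := by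
    have h := nn_tr_sub_le a w
    rw [hna] at h; refine h.trans (mul_le_mul_of_nonneg_left ?_ ht0.le)
    linarith [sum_nn_pd_le w]
  have ht3 : nn (tr a w - w) ^ 2 ≤ (t * (3 * X)) ^ 2 := by
    have := nn_nonneg (tr a w - w)
    gcongr
  have htk : 0 < t * ‖k‖ := by positivity
  have e1 : t ^ 2 = ‖k‖ ^ (-(2 / 3) : ℝ) := by
    rw [ht, ← Real.rpow_natCast, ← Real.rpow_mul hk0.le]; norm_num
  have e2 : t ^ 2 * (t * ‖k‖) = 1 := by
    rw [e1, ht, ← Real.rpow_add_one hk0.ne', ← Real.rpow_add hk0]; norm_num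
  rw [← e1]
  have h3 : (ip w (tr a w)).re ≤ 20 * t ^ 2 * X ^ 2 := by
    refine le_of_mul_le_mul_left (hb.trans (le_of_eq ?_)) htk
    linear_combination (-20 * X ^ 2) * e2
  nlinarith [mul_nonneg (sq_nonneg t) (sq_nonneg X)]

/-! ### A core for the free operator: Gaussians times polynomials -/

lemma hasTemperateGrowth_eval (p : MvPolynomial (Fin 3) ℂ) :
    (fun v : E3 => MvPolynomial.eval (fun j => (v j : ℂ)) p).HasTemperateGrowth := by
  induction p using MvPolynomial.induction_on with
  | C a => simp
  | add p q hp hq =>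
    simp only [map_add]
    exact hp.add hq
  | mul_X p j hp =>
    simp only [map_mul, MvPolynomial.eval_X]
    exact hp.mul (hasTemperateGrowth_coord j)

/-- The function `p(v) ψ(v)`. -/
def polyS : MvPolynomial (Fin 3) ℂ →ₗ[ℂ] S3 where
  toFun p := SchwartzMap.smulLeftCLM ℂ (fun v : E3 => MvPolynomial.eval (fun j => (v j : ℂ)) p) ps
  map_add' p q := by
    ext v; simp only [SchwartzMap.smulLeftCLM_apply_apply (hasTemperateGrowth_eval _), add_apply]
    simp [add_mul]
  map_smul' c p := by
    ext v; simp only [SchwartzMap.smulLeftCLM_apply_apply (hasTemperateGrowth_eval _), smul_apply]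
    simp [mul_assoc]

lemma polyS_apply (p : MvPolynomial (Fin 3) ℂ) (v : E3) :
    polyS p v = MvPolynomial.eval (fun j => (v j : ℂ)) p * ps v :=
  SchwartzMap.smulLeftCLM_apply_apply (hasTemperateGrowth_eval p) ps v

lemma polyS_one : polyS 1 = ps := by ext v; simp [polyS_apply]

lemma mulv_polyS (j : Fin 3) (p : MvPolynomial (Fin 3) ℂ) :
    mulv j (polyS p) = polyS (MvPolynomial.X j * p) := by
  ext v; simp [polyS_apply, mul_assoc]

lemma An_mulv (i j : Fin 3) (w : S3) :
    An i (mulv j w) = mulv j (An i w) + (if i = j then (1 : ℂ) else 0) • w := by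
  rw [← An_add_Cr, map_add, An_Cr, An_comm, ← add_assoc, ← An_add_Cr]

lemma An_polyS (j : Fin 3) (p : MvPolynomial (Fin 3) ℂ) : An j (polyS p) = polyS (pderiv j p) := by
  induction p using MvPolynomial.induction_on with
  | C a =>
    have : polyS (MvPolynomial.C a) = a • ps := by ext v; simp [polyS_apply]
    rw [this, map_smul, An_ps, MvPolynomial.pderiv_C, map_zero, smul_zero]
  | add p q hp hq => simp only [map_add, hp, hq]
  | mul_X p i hp =>
    rw [mul_comm p, ← mulv_polyS, An_mulv, hp, mulv_polyS, Derivation.leibniz,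
      MvPolynomial.pderiv_X, smul_eq_mul, smul_eq_mul, map_add]
    congr 1; rcases eq_or_ne j i with rfl | h
    · simp
    · simp [h]

/-- Smooth functions of the frequency with compact support. -/
def Sc : Submodule ℂ S3 where
  carrier := {a | HasCompactSupport a}
  add_mem' := fun ha hb => HasCompactSupport.add ha hb
  zero_mem' := by
    change HasCompactSupport (fun _ : E3 => (0 : ℂ))
    exact HasCompactSupport.zero
  smul_mem' := fun c a ha => by
    change HasCompactSupport (fun ξ => c • a ξ)
    exact HasCompactSupport.smul_left (f := fun _ => c) ha

/-- The element of `Sc` given by a smooth function of compact support. -/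
def Sc.mk (f : E3 → ℂ) (hf : ContDiff ℝ ∞ f) (hc : HasCompactSupport f) : Sc :=
  ⟨hc.toSchwartzMap hf, hc⟩

@[simp] lemma Sc.mk_apply (f : E3 → ℂ) (hf : ContDiff ℝ ∞ f) (hc : HasCompactSupport f)
    (ξ : E3) : (Sc.mk f hf hc).1 ξ = f ξ := rfl

/-- Multiplication by a smooth function of the frequency. -/
def mulc (m : E3 → ℂ) (hm : ContDiff ℝ ∞ m) : Sc →ₗ[ℂ] Sc where
  toFun a := Sc.mk (fun ξ => m ξ * a.1 ξ) (hm.mul a.1.smooth') a.2.mul_left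
  map_add' a b := by ext ξ; simp [mul_add]
  map_smul' c a := by ext ξ; simp; ring

@[simp] lemma mulc_apply (m : E3 → ℂ) (hm : ContDiff ℝ ∞ m) (a : Sc) (ξ : E3) :
    (mulc m hm a).1 ξ = m ξ * a.1 ξ := rfl

/-- The frequency `k = 2πξ`. -/
def kk (ξ : E3) : E3 := (2 * π) • ξ

lemma contDiff_kk : ContDiff ℝ ∞ kk := contDiff_const_smul _

lemma contDiff_kk_coord (j : Fin 3) : ContDiff ℝ ∞ (fun ξ => (kk ξ j : ℂ)) :=
  Complex.ofRealCLM.contDiff.comp ((pj j).contDiff.comp contDiff_kk)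

/-- Multiplication by `i k_j`. -/
def ikap (j : Fin 3) : Sc →ₗ[ℂ] Sc :=
  mulc (fun ξ => I * (kk ξ j : ℂ)) (contDiff_const.mul (contDiff_kk_coord j))

lemma hasTemperateGrowth_char (k : E3) :
    (fun v : E3 => exp (-(I * (inner ℝ k v : ℝ)))).HasTemperateGrowth := by
  refine hasTemperateGrowth_cexp (M := 0) ?_ (fun v => by simp)
  have h1 : (fun v : E3 => (inner ℝ k v : ℝ)).HasTemperateGrowth := (innerSL ℝ k).hasTemperateGrowth
  have h2 := Function.HasTemperateGrowth.comp Function.Complex.hasTemperateGrowth_ofReal h1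
  exact ((Function.HasTemperateGrowth.const I).mul h2).neg

/-- Multiplication by `e^{-i k·v}`. -/
def md (k : E3) : S3 →ₗ[ℂ] S3 := (SchwartzMap.smulLeftCLM ℂ
    (fun v : E3 => exp (-(I * (inner ℝ k v : ℝ))))).toLinearMap

lemma md_apply (k : E3) (w : S3) (v : E3) : md k w v = exp (-(I * (inner ℝ k v : ℝ))) * w v :=
  SchwartzMap.smulLeftCLM_apply_apply (hasTemperateGrowth_char k) w v

lemma mulv_md (j : Fin 3) (k : E3) (w : S3) : mulv j (md k w) = md k (mulv j w) := by
  ext v; simp only [mulv_apply, md_apply]; ring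

lemma pd_md (j : Fin 3) (k : E3) (w : S3) :
    pd j (md k w) = md k (pd j w) - (I * (k j : ℂ)) • md k w := by
  ext v
  have h0 : HasFDerivAt (fun v : E3 => (inner ℝ k v : ℝ)) (innerSL ℝ k) v :=
    (innerSL ℝ k).hasFDerivAt
  have h1 : HasFDerivAt (fun v : E3 => exp (-(I * (inner ℝ k v : ℝ)))) _ v :=
    (((Complex.ofRealCLM.hasFDerivAt.comp v h0).const_mul I).neg).cexp
  have h2 := h1.mul (w.hasFDerivAt v)
  have h3 : (md k w : E3 → ℂ) = (fun v : E3 => exp (-(I * (inner ℝ k v : ℝ)))) * ⇑w :=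
    funext fun v => md_apply k w v
  rw [pd_apply, h3, h2.fderiv]
  simp [md_apply, pd_apply, EuclideanSpace.inner_single_right]; ring

lemma An_md (j : Fin 3) (k : E3) (w : S3) :
    An j (md k w) = md k (An j w) - (I * (k j : ℂ)) • md k w := by
  simp only [An, LinearMap.add_apply, LinearMap.smul_apply, pd_md, mulv_md, map_add, map_smul]; abel

lemma ip_md (k : E3) (f g : S3) : ip (md k f) (md k g) = ip f g := by
  simp only [ip_eq, md_apply, map_mul, ← Complex.exp_conj]; congr 1; ext v
  rw [show ∀ a b c d : ℂ, a * b * (c * d) = (a * c) * (b * d) by intros; ring, ← exp_add]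
  simp

/-- The core of the free operator. The element `p ⊗ a` stands for the function of `(x, v)` whose
Fourier transform in `x` is `a(ξ) p(v) ψ(v) e^{-i k·v}`, with `k = 2πξ`. -/
abbrev Dom : Type := MvPolynomial (Fin 3) ℂ ⊗[ℂ] Sc

/-- The Fourier transform in `x` of an element of the core at the frequency `ξ`. -/
def fib (ξ : E3) : Dom →ₗ[ℂ] S3 :=
  TensorProduct.lift (LinearMap.mk₂ ℂ (fun p (a : Sc) => a.1 ξ • md (kk ξ) (polyS p))
    (fun p q a => by simp only [map_add, smul_add])
    (fun c p a => by simp only [map_smul]; rw [smul_comm])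
    (fun p a b => by simp [add_smul])
    (fun c p a => by simp [mul_smul]))

lemma fib_tmul (ξ : E3) (p : MvPolynomial (Fin 3) ℂ) (a : Sc) :
    fib ξ (p ⊗ₜ a) = a.1 ξ • md (kk ξ) (polyS p) := by simp [fib]

/-- The annihilation operator on the core. -/
def dA (j : Fin 3) : Dom →ₗ[ℂ] Dom := TensorProduct.map (pderiv j).toLinearMap LinearMap.id -
    TensorProduct.map LinearMap.id (ikap j)

/-- Multiplication by `v_j` on the core. -/
def dM (j : Fin 3) : Dom →ₗ[ℂ] Dom :=
  TensorProduct.map (LinearMap.mulLeft ℂ (MvPolynomial.X j)) LinearMap.id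

/-- The derivative `∂_{x_j}` on the core. -/
def dX (j : Fin 3) : Dom →ₗ[ℂ] Dom := TensorProduct.map LinearMap.id (ikap j)

/-- The creation operator on the core. -/
def dC (j : Fin 3) : Dom →ₗ[ℂ] Dom := dM j - dA j

/-- The free operator on the core. -/
def dP : Dom →ₗ[ℂ] Dom := ∑ j, (dC j ∘ₗ dA j + dM j ∘ₗ dX j)

lemma dA_tmul (j : Fin 3) (p : MvPolynomial (Fin 3) ℂ) (a : Sc) :
    dA j (p ⊗ₜ a) = pderiv j p ⊗ₜ a - p ⊗ₜ ikap j a := by simp [dA]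

lemma dM_tmul (j : Fin 3) (p : MvPolynomial (Fin 3) ℂ) (a : Sc) :
    dM j (p ⊗ₜ a) = (MvPolynomial.X j * p) ⊗ₜ a := by simp [dM]

lemma dX_tmul (j : Fin 3) (p : MvPolynomial (Fin 3) ℂ) (a : Sc) :
    dX j (p ⊗ₜ a) = p ⊗ₜ ikap j a := by simp [dX]

lemma fib_dA (ξ : E3) (j : Fin 3) (U : Dom) : fib ξ (dA j U) = An j (fib ξ U) := by
  induction U using TensorProduct.induction_on with
  | zero => simp
  | add U V hU hV => simp only [map_add, hU, hV]
  | tmul p a =>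
    rw [dA_tmul, map_sub, fib_tmul, fib_tmul, fib_tmul, map_smul, An_md, An_polyS, smul_sub,
      smul_smul, ikap, mulc_apply, mul_comm]

lemma fib_dM (ξ : E3) (j : Fin 3) (U : Dom) : fib ξ (dM j U) = mulv j (fib ξ U) := by
  induction U using TensorProduct.induction_on with
  | zero => simp
  | add U V hU hV => simp only [map_add, hU, hV]
  | tmul p a => rw [dM_tmul, fib_tmul, fib_tmul, map_smul, mulv_md, mulv_polyS]

lemma fib_dX (ξ : E3) (j : Fin 3) (U : Dom) : fib ξ (dX j U) = (I * (kk ξ j : ℂ)) • fib ξ U := by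
  induction U using TensorProduct.induction_on with
  | zero => simp
  | add U V hU hV => simp only [map_add, hU, hV, smul_add]
  | tmul p a => rw [dX_tmul, fib_tmul, fib_tmul, ikap, mulc_apply, mul_smul]

lemma fib_dC (ξ : E3) (j : Fin 3) (U : Dom) : fib ξ (dC j U) = Cr j (fib ξ U) := by
  rw [dC, LinearMap.sub_apply, map_sub, fib_dA, fib_dM, ← An_add_Cr, add_sub_cancel_left]

lemma fib_dP (ξ : E3) (U : Dom) : fib ξ (dP U) = Pk (kk ξ) (fib ξ U) := by
  rw [Pk_apply, osc_apply, mulk_eq, Finset.smul_sum, ← sum_add_distrib]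
  simp only [dP, LinearMap.sum_apply, map_sum, LinearMap.add_apply, LinearMap.comp_apply, map_add,
    fib_dC, fib_dA, fib_dM, fib_dX, map_smul, smul_smul]

/-- The symbol `|k|²`. -/
def ksq (ξ : E3) : ℂ := ((‖kk ξ‖ ^ 2 : ℝ) : ℂ)

lemma contDiff_ksq : ContDiff ℝ ∞ ksq := Complex.ofRealCLM.contDiff.comp (contDiff_kk.norm_sq ℝ)

lemma sum_ikap_ikap (a : Sc) : ∑ j, ikap j (ikap j a) = - mulc ksq contDiff_ksq a := by
  ext ξ
  have h := sum_sq_coord (kk ξ)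
  simp only [Submodule.coe_sum, sum_apply, ikap, mulc_apply, Submodule.coe_neg, neg_apply, ksq]
  rw [← h, ← neg_mul, ← Finset.sum_neg_distrib, Finset.sum_mul]
  refine sum_congr rfl fun j _ => ?_
  linear_combination ((kk ξ j : ℂ) * kk ξ j * a.1 ξ) * Complex.I_sq

/-- The free operator is triangular with respect to the degree in `v`. -/
lemma dP_tmul (p : MvPolynomial (Fin 3) ℂ) (a : Sc) : dP (p ⊗ₜ a) = p ⊗ₜ mulc ksq contDiff_ksq a +
      (∑ j, MvPolynomial.X j * pderiv j p) ⊗ₜ a +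
      ∑ j, ((2 : ℂ) • (pderiv j p ⊗ₜ ikap j a) - pderiv j (pderiv j p) ⊗ₜ[ℂ] a) := by
  have h : p ⊗ₜ mulc ksq contDiff_ksq a = - ∑ j, p ⊗ₜ[ℂ] ikap j (ikap j a) := by
    rw [← TensorProduct.tmul_sum, sum_ikap_ikap, TensorProduct.tmul_neg, neg_neg]
  rw [h, TensorProduct.sum_tmul, ← Finset.sum_neg_distrib, ← sum_add_distrib,
    ← sum_add_distrib, dP, LinearMap.sum_apply]
  refine sum_congr rfl fun j _ => ?_
  simp only [dC, LinearMap.add_apply, LinearMap.comp_apply, LinearMap.sub_apply, dA_tmul, dX_tmul,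
    dM_tmul, map_sub]
  module

lemma symbol_ne {z : ℂ} (hz : z ∉ halfLine) (n : ℕ) (ξ : E3) : ksq ξ + n - z ≠ 0 := by
  intro h; refine hz ⟨‖kk ξ‖ ^ 2 + n, by simp only [Set.mem_Ici]; positivity, ?_⟩
  rw [← sub_eq_zero, ← h, ksq]; push_cast; ring

lemma contDiff_symbol_inv {z : ℂ} (hz : z ∉ halfLine) (n : ℕ) :
    ContDiff ℝ ∞ (fun ξ => (ksq ξ + n - z)⁻¹) :=
  ((contDiff_ksq.add contDiff_const).sub contDiff_const).inv (symbol_ne hz n)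

/-- Off the half line the core is mapped onto itself. -/
lemma surjective_dP_sub {z : ℂ} (hz : z ∉ halfLine) :
    Function.Surjective (dP - z • LinearMap.id : Dom →ₗ[ℂ] Dom) := by
  set L : Dom →ₗ[ℂ] Dom := dP - z • LinearMap.id with hL
  have hmono : ∀ n : ℕ, ∀ s : Fin 3 →₀ ℕ, s.degree = n → ∀ (c : ℂ) (a : Sc),
      monomial s c ⊗ₜ a ∈ LinearMap.range L := by
    intro n
    induction n using Nat.strong_induction_on with
    | _ n ih =>
      intro s hs c a
      have hlow : ∀ s' : Fin 3 →₀ ℕ, s'.degree ≤ n → ∀ (c : ℂ) (j : Fin 3) (b : Sc),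
          pderiv j (monomial s' c) ⊗ₜ b ∈ LinearMap.range L ∧
            (s' - Finsupp.single j 1).degree ≤ n := by
        intro s' hs' c j b
        rw [MvPolynomial.pderiv_monomial]
        rcases Nat.eq_zero_or_pos (s' j) with h0 | h0
        · have h1 : s' - Finsupp.single j 1 = s' := by
            ext i; rcases eq_or_ne j i with rfl | h
            · simp [h0]
            · simp [h]
          rw [h1]; simpa [h0] using hs'
        · have : (s' - Finsupp.single j 1) + Finsupp.single j 1 = s' :=
            tsub_add_cancel_of_le (Finsupp.single_le_iff.2 h0)
          have h2 := congrArg Finsupp.degree this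
          rw [map_add, Finsupp.degree_single] at h2
          exact ⟨ih _ (by omega) _ rfl _ _, by omega⟩
      have hlow2 : ∀ (c : ℂ) (j : Fin 3) (b : Sc), pderiv j (pderiv j (monomial s c)) ⊗ₜ b ∈
            LinearMap.range L := by
        intro c j b; rw [MvPolynomial.pderiv_monomial]
        exact (hlow _ (hlow s hs.le c j b).2 _ j b).1
      set b := mulc _ (contDiff_symbol_inv hz n) a with hb
      set q := monomial s c with hq
      have hE : ∑ j, MvPolynomial.X j * pderiv j q = (n : ℂ) • q := by
        rw [hq]; simp only [MvPolynomial.X_mul_pderiv_monomial]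
        rw [← Finset.sum_smul, ← hs, Finsupp.degree_eq_sum, Nat.cast_smul_eq_nsmul]
      have hLb : L (q ⊗ₜ b) = q ⊗ₜ a + ∑ j, ((2 : ℂ) • (pderiv j q ⊗ₜ ikap j b) -
            pderiv j (pderiv j q) ⊗ₜ[ℂ] b) := by
        have h1 : mulc ksq contDiff_ksq b + (n : ℂ) • b - z • b = a := by
          ext ξ
          simp only [hb, Submodule.coe_sub, Submodule.coe_add, sub_apply, add_apply, mulc_apply,
            Submodule.coe_smul, smul_apply, smul_eq_mul]
          have := symbol_ne hz n ξ
          field_simp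
        rw [hL, LinearMap.sub_apply, LinearMap.smul_apply, LinearMap.id_apply, dP_tmul, hE]
        conv_rhs => rw [← h1]
        rw [TensorProduct.tmul_sub, TensorProduct.tmul_add, TensorProduct.tmul_smul,
          TensorProduct.tmul_smul, ← TensorProduct.smul_tmul']
        abel
      have h2 : q ⊗ₜ a = L (q ⊗ₜ b) - ∑ j, ((2 : ℂ) • (pderiv j q ⊗ₜ ikap j b) -
            pderiv j (pderiv j q) ⊗ₜ[ℂ] b) := by
        rw [hLb, add_sub_cancel_right]
      rw [h2]
      exact Submodule.sub_mem _ (LinearMap.mem_range_self _ _) (Submodule.sum_mem _ fun j _ =>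
        Submodule.sub_mem _ (Submodule.smul_mem _ _ (hlow s hs.le c j _).1) (hlow2 c j _))
  rw [← LinearMap.range_eq_top, eq_top_iff]; intro U _
  induction U using TensorProduct.induction_on with
  | zero => exact Submodule.zero_mem _
  | add U V hU hV => exact Submodule.add_mem _ (hU trivial) (hV trivial)
  | tmul p a =>
    rw [p.as_sum, TensorProduct.sum_tmul]
    exact Submodule.sum_mem _ fun s _ => hmono _ s rfl _ a

/-! ### The core in phase space -/

lemma norm_iteratedFDeriv_comp_clm_le {E F : Type*} [NormedAddCommGroup E] [NormedSpace ℝ E]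
    [NormedAddCommGroup F] [NormedSpace ℝ F] (L : E →L[ℝ] F) (hL : ‖L‖ ≤ 1) (f : 𝓢(F, ℂ)) (n : ℕ)
    (x : E) : ‖iteratedFDeriv ℝ n (fun y => f (L y)) x‖ ≤ ‖iteratedFDeriv ℝ n f (L x)‖ := by
  have h := L.iteratedFDeriv_comp_right (f := f) (f.smooth n) x (i := n) le_rfl
  change ‖iteratedFDeriv ℝ n (f ∘ L) x‖ ≤ _
  rw [h]; refine (ContinuousMultilinearMap.norm_compContinuousLinearMap_le _ _).trans ?_
  refine mul_le_of_le_one_right (norm_nonneg _) ?_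
  simp only [Finset.prod_const]
  exact pow_le_one₀ (norm_nonneg _) hL

/-- The product `f(v) g(x)` of Schwartz functions. -/
def outer (f g : S3) : S6 where
  toFun p := f p.2 * g p.1
  smooth' := (f.smooth'.comp contDiff_snd).mul (g.smooth'.comp contDiff_fst)
  decay' := by
    intro m n
    have hb : ∀ (f : S3) (a : ℕ), ∃ C, 0 ≤ C ∧ ∀ i ≤ n, ∀ v,
        ‖v‖ ^ a * ‖iteratedFDeriv ℝ i f v‖ ≤ C := by
      intro f a
      refine ⟨∑ i ∈ Finset.range (n + 1), SchwartzMap.seminorm ℝ a i f,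
        sum_nonneg fun _ _ => apply_nonneg _ _, fun i hi v => ?_⟩
      refine (SchwartzMap.le_seminorm ℝ a i f v).trans ?_
      exact Finset.single_le_sum (f := fun i => SchwartzMap.seminorm ℝ a i f)
        (fun _ _ => apply_nonneg _ _) (Finset.mem_range.2 (by omega))
    obtain ⟨F0, hF0, hf0⟩ := hb f 0
    obtain ⟨Fm, hFm, hfm⟩ := hb f m
    obtain ⟨G0, hG0, hg0⟩ := hb g 0
    obtain ⟨Gm, hGm, hgm⟩ := hb g m
    simp only [pow_zero, one_mul] at hf0 hg0
    refine ⟨∑ i ∈ Finset.range (n + 1), (n.choose i : ℝ) * (Fm * G0 + F0 * Gm), fun p => ?_⟩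
    have h1 := norm_iteratedFDeriv_mul_le (𝕜 := ℝ) (N := ∞) (f := fun p : Phase => f p.2)
      (g := fun p : Phase => g p.1) ((f.smooth'.comp contDiff_snd))
      ((g.smooth'.comp contDiff_fst)) p (n := n) (by exact_mod_cast le_top)
    refine (mul_le_mul_of_nonneg_left h1 (by positivity)).trans ?_
    rw [mul_sum]; refine sum_le_sum fun i hi => ?_
    have hi' : i ≤ n := by have := Finset.mem_range.1 hi; omega
    have h2 := norm_iteratedFDeriv_comp_clm_le (ContinuousLinearMap.snd ℝ E3 E3)
      (ContinuousLinearMap.norm_snd_le ..) f i p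
    have h3 := norm_iteratedFDeriv_comp_clm_le (ContinuousLinearMap.fst ℝ E3 E3)
      (ContinuousLinearMap.norm_fst_le ..) g (n - i) p
    simp only [ContinuousLinearMap.coe_snd', ContinuousLinearMap.coe_fst'] at h2 h3
    have h4 := hf0 i hi' p.2
    have h5 := hfm i hi' p.2
    have h6 := hg0 (n - i) (by omega) p.1
    have h7 := hgm (n - i) (by omega) p.1
    have h8 : ‖p‖ ^ m ≤ ‖p.1‖ ^ m + ‖p.2‖ ^ m := by
      rcases max_cases ‖p.1‖ ‖p.2‖ with h | h
      · rw [Prod.norm_def, h.1]; exact le_add_of_nonneg_right (by positivity)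
      · rw [Prod.norm_def, h.1]; exact le_add_of_nonneg_left (by positivity)
    set a := ‖iteratedFDeriv ℝ i f p.2‖
    set b := ‖iteratedFDeriv ℝ (n - i) g p.1‖
    calc _ ≤ (‖p.1‖ ^ m + ‖p.2‖ ^ m) * ((n.choose i : ℝ) * a * b) := by gcongr
      _ = (n.choose i : ℝ) * ((‖p.2‖ ^ m * a) * b + a * (‖p.1‖ ^ m * b)) := by ring
      _ ≤ _ := by gcongr

@[simp] lemma outer_apply (f g : S3) (p : Phase) : outer f g p = f p.2 * g p.1 := rfl

/-- The shear `(x, v) ↦ (x - v, v)`. -/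
def shear : Phase ≃L[ℝ] Phase where
  toFun p := (p.1 - p.2, p.2)
  invFun p := (p.1 + p.2, p.2)
  map_add' p q := by ext1 <;> simp; abel
  map_smul' c p := by ext1 <;> simp [smul_sub]
  left_inv p := by simp
  right_inv p := by simp
  continuous_toFun := by fun_prop
  continuous_invFun := by fun_prop

@[simp] lemma shear_apply (p : Phase) : shear p = (p.1 - p.2, p.2) := rfl

lemma measurePreserving_shear : MeasurePreserving shear (volume : Measure Phase) volume := by
  exact measurePreserving_sub_prod (volume : Measure E3) (volume : Measure E3)

/-- The inverse Fourier transform of an element of `Sc`. -/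
def ifr : Sc →ₗ[ℂ] S3 := (FourierTransform.fourierInvₗ ℂ S3) ∘ₗ Sc.subtype

lemma ifr_eq (a : Sc) : ifr a = 𝓕⁻ a.1 := rfl

instance : (volume : Measure Phase).IsAddHaarMeasure :=
  inferInstanceAs ((volume : Measure E3).prod volume).IsAddHaarMeasure

/-- The function of `(x, v)` represented by an element of the core. -/
def phys : Dom →ₗ[ℂ] S6 := TensorProduct.lift (LinearMap.mk₂ ℂ
    (fun p (a : Sc) => SchwartzMap.compCLMOfContinuousLinearEquiv ℂ shear (outer (polyS p) (ifr a)))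
    (fun p q a => by ext; simp [add_mul])
    (fun c p a => by ext; simp [mul_assoc])
    (fun p a b => by ext; simp [mul_add])
    (fun c p a => by ext; simp; ring))

lemma phys_tmul (p : MvPolynomial (Fin 3) ℂ) (a : Sc) (q : Phase) :
    phys (p ⊗ₜ a) q = polyS p q.2 * ifr a (q.1 - q.2) := by simp [phys]

/-- The derivative `∂_{v_j}` in phase space. -/
def qD (j : Fin 3) : S6 →L[ℂ] S6 := LineDeriv.lineDerivOpCLM ℂ S6 ((0, eb j) : Phase)

/-- The derivative `∂_{x_j}` in phase space. -/
def qX (j : Fin 3) : S6 →L[ℂ] S6 := LineDeriv.lineDerivOpCLM ℂ S6 ((eb j, 0) : Phase)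

lemma hasTemperateGrowth_coord_snd (j : Fin 3) :
    (fun p : Phase => ((p.2 j : ℝ) : ℂ)).HasTemperateGrowth := by
  have h1 : (fun p : Phase => p.2).HasTemperateGrowth :=
    (ContinuousLinearMap.snd ℝ E3 E3).hasTemperateGrowth
  exact Function.HasTemperateGrowth.comp (hasTemperateGrowth_coord j) h1

/-- Multiplication by `v_j` in phase space. -/
def qM (j : Fin 3) : S6 →L[ℂ] S6 := SchwartzMap.smulLeftCLM ℂ (fun p : Phase => ((p.2 j : ℝ) : ℂ))

/-- The annihilation operator in phase space. -/
def qA (j : Fin 3) : S6 →L[ℂ] S6 := qD j + (1 / 2 : ℂ) • qM j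

/-- The creation operator in phase space. -/
def qC (j : Fin 3) : S6 →L[ℂ] S6 := -qD j + (1 / 2 : ℂ) • qM j

lemma qD_apply (j : Fin 3) (f : S6) (p : Phase) : qD j f p = fderiv ℝ f p (0, eb j) := by
  simp [qD, SchwartzMap.lineDerivOp_apply_eq_fderiv]

lemma qX_apply (j : Fin 3) (f : S6) (p : Phase) : qX j f p = fderiv ℝ f p (eb j, 0) := by
  simp [qX, SchwartzMap.lineDerivOp_apply_eq_fderiv]

@[simp] lemma qM_apply (j : Fin 3) (f : S6) (p : Phase) : qM j f p = (p.2 j : ℂ) * f p :=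
  SchwartzMap.smulLeftCLM_apply_apply (hasTemperateGrowth_coord_snd j) f p

lemma qA_apply (j : Fin 3) (f : S6) (p : Phase) :
    qA j f p = fderiv ℝ f p (0, eb j) + (p.2 j : ℂ) / 2 * f p := by
  simp [qA, qD_apply]; ring

lemma qC_apply (j : Fin 3) (f : S6) (p : Phase) :
    qC j f p = - fderiv ℝ f p (0, eb j) + (p.2 j : ℂ) / 2 * f p := by
  simp [qC, qD_apply]; ring

lemma qA_add_qC (j : Fin 3) (f : S6) : qA j f + qC j f = qM j f := by
  ext p; simp only [add_apply, qA_apply, qC_apply, qM_apply]; ring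

/-- The free operator in phase space. -/
def qP : S6 →L[ℂ] S6 := ∑ j, (qC j ∘L qA j + qM j ∘L qX j)

/-- The formal transpose of the free operator in phase space. -/
def qPt : S6 →L[ℂ] S6 := ∑ j, (qC j ∘L qA j - qM j ∘L qX j)

lemma hasFDerivAt_phys (p : MvPolynomial (Fin 3) ℂ) (a : Sc) (q : Phase) :
    HasFDerivAt (phys (p ⊗ₜ a)) (polyS p q.2 • (fderiv ℝ (ifr a) (q.1 - q.2)).comp
        (ContinuousLinearMap.fst ℝ E3 E3 - ContinuousLinearMap.snd ℝ E3 E3) +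
      ifr a (q.1 - q.2) • (fderiv ℝ (polyS p) q.2).comp (ContinuousLinearMap.snd ℝ E3 E3)) q := by
  have h1 : HasFDerivAt (fun q : Phase => polyS p q.2) _ q :=
    ((polyS p).hasFDerivAt q.2).comp q (ContinuousLinearMap.snd ℝ E3 E3).hasFDerivAt
  have h2 : HasFDerivAt (fun q : Phase => ifr a (q.1 - q.2)) _ q :=
    (SchwartzMap.hasFDerivAt (ifr a) (q.1 - q.2)).comp q
      (ContinuousLinearMap.fst ℝ E3 E3 - ContinuousLinearMap.snd ℝ E3 E3).hasFDerivAt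
  have h3 : (phys (p ⊗ₜ a) : Phase → ℂ) =
      (fun q : Phase => polyS p q.2) * (fun q : Phase => ifr a (q.1 - q.2)) :=
    funext fun q => phys_tmul p a q
  rw [h3]; exact h1.mul h2

lemma ifr_ikap (j : Fin 3) (a : Sc) : ifr (ikap j a) = pd j (ifr a) := by
  have hi : (fun ξ : E3 => (inner ℝ ξ (eb j) : ℝ)).HasTemperateGrowth :=
    ((innerSL ℝ).flip (eb j)).hasTemperateGrowth
  rw [ifr_eq, ifr_eq, pd_eq, SchwartzMap.lineDerivOp_fourierInv_eq]; congr 1; ext ξ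
  rw [ikap, mulc_apply, smul_apply, SchwartzMap.smulLeftCLM_apply_apply hi]
  simp [kk, EuclideanSpace.inner_single_right]; ring

lemma phys_dX (j : Fin 3) (U : Dom) : phys (dX j U) = qX j (phys U) := by
  induction U using TensorProduct.induction_on with
  | zero => simp
  | add U V hU hV => simp only [map_add, hU, hV]
  | tmul p a =>
    ext q; rw [qX_apply, (hasFDerivAt_phys p a q).fderiv, dX_tmul, phys_tmul, ifr_ikap, pd_apply]
    simp

lemma phys_dM (j : Fin 3) (U : Dom) : phys (dM j U) = qM j (phys U) := by
  induction U using TensorProduct.induction_on with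
  | zero => simp
  | add U V hU hV => simp only [map_add, hU, hV]
  | tmul p a =>
    ext q; rw [qM_apply, dM_tmul, phys_tmul, phys_tmul, ← mulv_polyS, mulv_apply, mul_assoc]

lemma phys_dA (j : Fin 3) (U : Dom) : phys (dA j U) = qA j (phys U) := by
  induction U using TensorProduct.induction_on with
  | zero => simp
  | add U V hU hV => simp only [map_add, hU, hV]
  | tmul p a =>
    ext q
    rw [qA_apply, (hasFDerivAt_phys p a q).fderiv, dA_tmul, map_sub, sub_apply, phys_tmul,
      phys_tmul, phys_tmul, ifr_ikap, pd_apply, ← An_polyS, An_apply]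
    simp; ring

lemma phys_dC (j : Fin 3) (U : Dom) : phys (dC j U) = qC j (phys U) := by
  rw [dC, LinearMap.sub_apply, map_sub, phys_dA, phys_dM, ← qA_add_qC, add_sub_cancel_left]

lemma phys_dP (U : Dom) : phys (dP U) = qP (phys U) := by
  simp [dP, qP, phys_dC, phys_dA, phys_dM, phys_dX]

/-- A Schwartz function on the phase space as an element of `L²`. -/
def toL : S6 →L[ℂ] L2 := SchwartzMap.toLpCLM ℂ ℂ 2 volume

lemma coeFn_toL (f : S6) : (toL f : Phase → ℂ) =ᵐ[volume] f := f.coeFn_toLp 2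

/-- The element of `L²` represented by an element of the core. -/
def lv : Dom →ₗ[ℂ] L2 := toL.toLinearMap ∘ₗ phys

lemma lv_apply (U : Dom) : lv U = toL (phys U) := rfl

lemma inner_toL (f g : S6) : inner ℂ (toL f) (toL g) = ∫ p, conj (f p) * g p := by
  rw [L2.inner_def]
  refine integral_congr_ae ?_
  filter_upwards [coeFn_toL f, coeFn_toL g] with p h1 h2
  rw [h1, h2, RCLike.inner_apply, mul_comm]

/-- Plancherel's theorem for the Fourier transform in `x`. -/
lemma inner_lv (U V : Dom) : Integrable (fun ξ => ip (fib ξ U) (fib ξ V)) ∧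
    inner ℂ (lv U) (lv V) = ∫ ξ, ip (fib ξ U) (fib ξ V) := by
  induction U using TensorProduct.induction_on with
  | zero => simp [ip_zero_left]
  | add U U' hU hU' =>
    simp only [map_add, ip_add_left, inner_add_left]
    exact ⟨hU.1.add hU'.1, by rw [hU.2, hU'.2, integral_add hU.1 hU'.1]⟩
  | tmul p a =>
    induction V using TensorProduct.induction_on with
    | zero => simp [ip_zero_right]
    | add U U' hU hU' =>
      simp only [map_add, ip_add_right, inner_add_right]
      exact ⟨hU.1.add hU'.1, by rw [hU.2, hU'.2, integral_add hU.1 hU'.1]⟩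
    | tmul p' b =>
      have e : ∀ ξ, ip (fib ξ (p ⊗ₜ a)) (fib ξ (p' ⊗ₜ b)) =
          (starRingEnd ℂ (a.1 ξ) * b.1 ξ) * ip (polyS p) (polyS p') := by
        intro ξ; rw [fib_tmul, fib_tmul, ip_smul_left, ip_smul_right, ip_md]; ring
      simp_rw [e]
      have hint : Integrable (fun ξ => starRingEnd ℂ (a.1 ξ) * b.1 ξ) := by
        have := (SchwartzMap.pairing (ContinuousLinearMap.mul ℂ ℂ) (conjS a.1) b.1).integrable
          (μ := volume)
        simpa [SchwartzMap.pairing_apply] using this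
      refine ⟨hint.mul_const _, ?_⟩
      rw [integral_mul_const, lv_apply, lv_apply, inner_toL]
      have h1 : ∫ q, conj (phys (p ⊗ₜ a) q) * phys (p' ⊗ₜ b) q =
          ∫ q : Phase, (starRingEnd ℂ (ifr a q.1) * ifr b q.1) *
            (starRingEnd ℂ (polyS p q.2) * polyS p' q.2) := by
        rw [← measurePreserving_shear.integral_comp shear.toHomeomorph.measurableEmbedding
          (fun q : Phase => (starRingEnd ℂ (ifr a q.1) * ifr b q.1) *
            (starRingEnd ℂ (polyS p q.2) * polyS p' q.2))]
        congr 1; ext q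
        rw [phys_tmul, phys_tmul, shear_apply, map_mul]; ring
      rw [h1, volume_eq_prod, integral_prod_mul (fun x => starRingEnd ℂ (ifr a x) * ifr b x)
        (fun v => starRingEnd ℂ (polyS p v) * polyS p' v), ← ip_eq, ← ip_eq]
      congr 1; rw [← ip_eq]
      have h2 := SchwartzMap.inner_fourier_toL2_eq (ifr a) (ifr b)
      unfold ip; rw [toH_apply, toH_apply, toH_apply, toH_apply, ← h2]; simp [ifr_eq]

lemma norm_lv_sq (U : Dom) : ‖lv U‖ ^ 2 = ∫ ξ, nn (fib ξ U) ^ 2 := by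
  have h := (inner_lv U U).2
  simp only [ip_self] at h
  rw [inner_self_eq_norm_sq_to_K] at h
  have h2 := h.trans integral_ofReal
  exact_mod_cast h2

lemma integrable_nn_sq (U : Dom) : Integrable (fun ξ => nn (fib ξ U) ^ 2) := by
  have h := (inner_lv U U).1
  simp only [ip_self] at h; exact h.re

/-! ### Density of the core -/

lemma ps_real (v : E3) : conj (ps v) = ps v := by rw [ps_apply]; exact conj_ofReal _

lemma ps_ne_zero (v : E3) : ps v ≠ 0 := by
  rw [ps_apply, Complex.ofReal_ne_zero]
  exact (mul_pos cN_pos (Real.exp_pos _)).ne'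

lemma norm_ps (v : E3) : ‖ps v‖ = cN * Real.exp (-‖v‖ ^ 2 / 4) := by
  rw [ps_apply, norm_real, Real.norm_of_nonneg (mul_nonneg cN_pos.le (Real.exp_pos _).le)]; ring_nf

lemma integrable_gaussian {c : ℝ} (hc : 0 < c) :
    Integrable (fun v : E3 => Real.exp (-c * ‖v‖ ^ 2)) := by
  have h := (GaussianFourier.integrable_cexp_neg_mul_sq_norm_add (V := E3) (b := (c : ℂ))
    (by simpa using hc) 0 0).re
  refine h.congr (Eventually.of_forall fun v => ?_)
  simp only [zero_mul, add_zero]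
  rw [show (-(c : ℂ) * (‖v‖ : ℂ) ^ 2) = ((-c * ‖v‖ ^ 2 : ℝ) : ℂ) by push_cast; rfl,
    ← Complex.ofReal_exp]
  rfl

lemma memLp_ps_mul_exp (r : ℝ) : MemLp (fun v : E3 => ‖ps v‖ * Real.exp (r * ‖v‖)) 2 volume := by
  have hG : MemLp (fun v : E3 => Real.exp (-(1 / 8) * ‖v‖ ^ 2)) 2 volume := by
    rw [memLp_two_iff_integrable_sq (by fun_prop)]
    refine (integrable_gaussian (c := 1 / 4) (by norm_num)).congr (Eventually.of_forall fun v => ?_)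
    dsimp only
    rw [← Real.exp_nat_mul]; congr 1; push_cast; ring
  refine (hG.const_mul (cN * Real.exp (2 * r ^ 2))).mono ?_ (Eventually.of_forall fun v => ?_)
  · exact ((ps.continuous.norm).mul (by fun_prop)).aestronglyMeasurable
  · have h1 := cN_pos.le
    rw [Real.norm_of_nonneg (by positivity), Real.norm_of_nonneg (by positivity), norm_ps, mul_assoc,
      mul_assoc, ← Real.exp_add, ← Real.exp_add]
    refine mul_le_mul_of_nonneg_left (Real.exp_le_exp.2 ?_) h1
    nlinarith [sq_nonneg (‖v‖ - 4 * r)]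

lemma sum_coord_mul (k v : E3) : ∑ j, (k j : ℂ) * (v j : ℂ) = ((inner ℝ k v : ℝ) : ℂ) := by
  simp only [PiLp.inner_apply, RCLike.inner_apply, conj_trivial, Complex.ofReal_sum,
    Complex.ofReal_mul]
  exact sum_congr rfl fun j _ => mul_comm _ _

open scoped Nat in
/-- **Completeness of the Hermite functions**: a square integrable function which is orthogonal to
all products of polynomials with the Gaussian vanishes, since then all Fourier coefficients of
its product with the Gaussian vanish. -/
lemma ae_eq_zero_of_forall_polyS {g : E3 → ℂ} (hg : MemLp g 2 volume)
    (h : ∀ p, ∫ v, conj (polyS p v) * g v = 0) : g =ᵐ[volume] 0 := by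
  have hps2 : MemLp ps 2 volume := ps.memLp 2
  have hint : Integrable (fun v => ps v * g v) := hps2.integrable_mul hg
  have hF : ∀ k : E3, ∫ v, exp (-(I * (inner ℝ k v : ℝ))) * (ps v * g v) = 0 := by
    intro k
    have hs := hasSum_integral_of_dominated_convergence (μ := (volume : Measure E3))
      (F := fun (n : ℕ) v => (-(I * (inner ℝ k v : ℝ))) ^ n / n ! * (ps v * g v))
      (f := fun v => exp (-(I * (inner ℝ k v : ℝ))) * (ps v * g v))
      (fun n v => (‖k‖ * ‖v‖) ^ n / n ! * (‖ps v‖ * ‖g v‖)) ?_ ?_ ?_ ?_ ?_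
    · refine hs.unique ?_
      have h0 : ∀ n : ℕ, ∫ v, (-(I * (inner ℝ k v : ℝ))) ^ n / n ! * (ps v * g v) = 0 := by
        intro n
        have h1 := h ((MvPolynomial.C I * ∑ j, MvPolynomial.C (k j : ℂ) * MvPolynomial.X j) ^ n)
        have h2 : ∀ v, (-(I * (inner ℝ k v : ℝ))) ^ n / n ! * (ps v * g v) =
            (1 / (n ! : ℂ)) * (conj (polyS ((MvPolynomial.C I *
              ∑ j, MvPolynomial.C (k j : ℂ) * MvPolynomial.X j) ^ n) v) * g v) := by
          intro v; rw [polyS_apply]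
          simp only [map_pow, map_mul, map_sum, MvPolynomial.eval_C, MvPolynomial.eval_X, ps_real,
            Complex.conj_I, conj_ofReal]
          rw [sum_coord_mul]; ring
        simp_rw [h2]
        rw [integral_const_mul, h1, mul_zero]
      simp_rw [h0]
      exact hasSum_zero
    · intro n; refine AEStronglyMeasurable.mul (Continuous.aestronglyMeasurable ?_) hint.1; fun_prop
    · intro n; refine Eventually.of_forall fun v => ?_
      rw [norm_mul, norm_mul, norm_div, norm_pow, norm_neg, norm_mul, Complex.norm_I, one_mul,
        norm_real, Complex.norm_natCast]
      gcongr; exact norm_inner_le_norm k v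
    · refine Eventually.of_forall fun v => ?_
      exact (Real.summable_pow_div_factorial _).mul_right _
    · have e : (fun v => ∑' n : ℕ, (‖k‖ * ‖v‖) ^ n / n ! * (‖ps v‖ * ‖g v‖)) =
          fun v => (‖ps v‖ * Real.exp (‖k‖ * ‖v‖)) * ‖g v‖ := by
        ext v; rw [tsum_mul_right, Real.exp_eq_exp_ℝ, NormedSpace.exp_eq_tsum_div]; ring
      rw [e]; exact (memLp_ps_mul_exp ‖k‖).integrable_mul hg.norm
    · refine Eventually.of_forall fun v => ?_
      have := NormedSpace.expSeries_div_hasSum_exp (𝔸 := ℂ) (-(I * (inner ℝ k v : ℝ)))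
      rw [← Complex.exp_eq_exp_ℂ] at this
      exact this.mul_right _
  have hF' : 𝓕 (fun v => ps v * g v) = 0 := by
    ext ξ; rw [Real.fourier_eq']
    simp only [Pi.zero_apply]
    rw [← hF ((2 * π) • ξ)]; congr 1; ext v
    rw [smul_eq_mul, real_inner_smul_left, real_inner_comm]; congr 2; push_cast; ring
  have hae : ∀ᵐ v, ps v * g v = 0 := by
    refine ae_eq_zero_of_integral_contDiff_smul_eq_zero hint.locallyIntegrable fun w hw hc => ?_
    set W : S3 := HasCompactSupport.toSchwartzMap (f := fun v => (w v : ℂ))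
      (hc.comp_left (g := fun x : ℝ => (x : ℂ)) (by simp)) (Complex.ofRealCLM.contDiff.comp hw)
      with hW
    have h1 := VectorFourier.integral_fourierIntegral_smul_eq_flip (μ := (volume : Measure E3))
      (ν := (volume : Measure E3)) (L := innerₗ E3) (e := Real.fourierChar)
      (f := fun v => ps v * g v) (g := (𝓕⁻ W : S3)) Real.continuous_fourierChar
      (by exact continuous_inner) hint (SchwartzMap.integrable _)
    have h2 : ∀ ξ, VectorFourier.fourierIntegral Real.fourierChar volume (innerₗ E3)
        (fun v => ps v * g v) ξ = 0 := fun ξ => congrFun hF' ξ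
    have h3 : ∀ v, VectorFourier.fourierIntegral Real.fourierChar volume (innerₗ E3).flip
        (𝓕⁻ W : S3) v = W v := by
      intro v; rw [flip_innerₗ]
      have : (𝓕 (𝓕⁻ W) : S3) v = W v := by rw [FourierTransform.fourier_fourierInv_eq]
      rw [← this, SchwartzMap.fourier_coe]; rfl
    simp only [h2, zero_smul, integral_zero, h3] at h1; rw [h1]; congr 1; ext v
    have hWv : W v = (w v : ℂ) := rfl
    rw [hWv, smul_eq_mul, Complex.real_smul, mul_comm]
  filter_upwards [hae] with v hv
  exact (mul_eq_zero.1 hv).resolve_left (ps_ne_zero v)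

/-- Inverse Fourier transforms of smooth functions with compact support are dense in `L²`. -/
lemma eq_zero_of_forall_ifr (H : Lp ℂ 2 (volume : Measure E3))
    (h : ∀ a : Sc, inner ℂ (toH (ifr a)) H = 0) : H = 0 := by
  have h1 : ∀ a : Sc, inner ℂ (toH a.1) (𝓕 H) = 0 := by
    intro a
    have h2 := MeasureTheory.Lp.inner_fourier_eq (toH (ifr a)) H
    rw [h a, toH_apply, SchwartzMap.toLp_fourier_eq, ifr_eq,
      FourierTransform.fourier_fourierInv_eq] at h2
    exact h2
  have h3 : (𝓕 H : Lp ℂ 2 (volume : Measure E3)) = 0 := by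
    rw [Lp.eq_zero_iff_ae_eq_zero]
    refine ae_eq_zero_of_integral_contDiff_smul_eq_zero
      ((Lp.memLp _).locallyIntegrable (by norm_num)) fun w hw hc => ?_
    set a : Sc := Sc.mk (fun v => (w v : ℂ)) (Complex.ofRealCLM.contDiff.comp hw)
      (hc.comp_left (g := fun x : ℝ => (x : ℂ)) (by simp)) with ha
    have h4 := h1 a
    rw [L2.inner_def] at h4; rw [← h4]
    refine integral_congr_ae ?_
    filter_upwards [a.1.coeFn_toLp 2] with v hv
    have hav : a.1 v = (w v : ℂ) := rfl
    rw [toH_apply, hv, RCLike.inner_apply, hav, Complex.real_smul, conj_ofReal, mul_comm]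
  have h5 := MeasureTheory.Lp.norm_fourier_eq H
  rw [h3, norm_zero] at h5
  exact norm_eq_zero.1 h5.symm

lemma inner_lv_tmul (p : MvPolynomial (Fin 3) ℂ) (a : Sc) (f : L2) {F : Phase → ℂ}
    (hF : F = fun q => (f : Phase → ℂ) (q.1 + q.2, q.2)) (hm : MemLp F 2 volume) :
    inner ℂ (lv (p ⊗ₜ a)) f = ∫ y, conj (ifr a y) * ∫ v, conj (polyS p v) * F (y, v) := by
  have h1 : inner ℂ (lv (p ⊗ₜ a)) f = ∫ q : Phase, conj (outer (polyS p) (ifr a) q) * F q := by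
    rw [L2.inner_def, ← measurePreserving_shear.integral_comp shear.toHomeomorph.measurableEmbedding
      (fun q => conj (outer (polyS p) (ifr a) q) * F q)]
    refine integral_congr_ae ?_
    filter_upwards [coeFn_toL (phys (p ⊗ₜ a))] with q hq
    rw [lv_apply, hq, RCLike.inner_apply, phys_tmul, outer_apply, shear_apply, hF]
    simp [mul_comm]
  have hi : Integrable (fun q : Phase => conj (outer (polyS p) (ifr a) q) * F q) :=
    MemLp.integrable_mul (((outer (polyS p) (ifr a)).memLp 2 volume).star) hm
  rw [h1, volume_eq_prod, integral_prod _ hi]; congr 1; ext y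
  rw [← integral_const_mul]; congr 1; ext v; simp; ring

/-- The core is dense in `L²`. -/
lemma denseRange_lv : DenseRange lv := by
  have hbot : (LinearMap.range lv)ᗮ = ⊥ := by
    rw [Submodule.eq_bot_iff]; intro f hf
    have hf' : ∀ U, inner ℂ (lv U) f = 0 := fun U => hf _ ⟨U, rfl⟩
    set F : Phase → ℂ := fun q => (f : Phase → ℂ) (q.1 + q.2, q.2) with hF
    have hsm : MeasurePreserving shear.symm (volume : Measure Phase) volume :=
      MeasurePreserving.symm shear.toHomeomorph.toMeasurableEquiv measurePreserving_shear
    have hm : MemLp F 2 volume := (Lp.memLp f).comp_measurePreserving hsm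
    have hsl : ∀ᵐ y : E3, MemLp (fun v => F (y, v)) 2 volume := by
      have h1 : Integrable (fun q => ‖F q‖ ^ 2) ((volume : Measure E3).prod volume) :=
        hm.integrable_norm_pow (by norm_num)
      have h2 : AEStronglyMeasurable F ((volume : Measure E3).prod volume) := hm.1
      filter_upwards [h1.prod_right_ae, h2.prodMk_left] with y h3 h4
      rwa [memLp_two_iff_integrable_sq_norm h4]
    have hp : ∀ p, ∀ᵐ y : E3, ∫ v, conj (polyS p v) * F (y, v) = 0 := by
      intro p
      set h : E3 → ℂ := fun y => ∫ v, conj (polyS p v) * F (y, v) with hh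
      have hmeas : AEStronglyMeasurable h volume := by
        have : AEStronglyMeasurable (fun q : Phase => conj (polyS p q.2) * F q)
            ((volume : Measure E3).prod volume) :=
          (Complex.continuous_conj.comp
            ((polyS p).continuous.comp continuous_snd)).aestronglyMeasurable.mul hm.1
        exact this.integral_prod_right'
      have hmem : MemLp h 2 volume := by
        refine ⟨hmeas, ?_⟩
        rw [eLpNorm_lt_top_iff_lintegral_rpow_enorm_lt_top (by norm_num) (by norm_num)]
        simp only [ENNReal.toReal_ofNat, ENNReal.rpow_ofNat]
        have hle : ∫⁻ y, ‖h y‖ₑ ^ 2 ≤ ∫⁻ y, (∫⁻ v, ‖polyS p v‖ₑ ^ 2) * ∫⁻ v, ‖F (y, v)‖ₑ ^ 2 := by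
          refine lintegral_mono_ae ?_
          filter_upwards [hsl] with y hy
          refine (enorm_integral_mul_sq_le ?_ hy.1.aemeasurable).trans (le_of_eq ?_)
          · have := (polyS p).continuous
            exact (Continuous.measurable (by fun_prop)).aemeasurable
          · congr 1
            exact lintegral_congr fun v => by rw [← ofReal_norm, ← ofReal_norm, RCLike.norm_conj]
        refine hle.trans_lt ?_
        have h5 : ∫⁻ v, ‖polyS p v‖ₑ ^ 2 ≠ ⊤ := by rw [lintegral_enorm_sq]; exact ofReal_ne_top
        rw [lintegral_const_mul' _ _ h5]
        refine mul_lt_top h5.lt_top ?_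
        have h6 := hm.2
        rw [eLpNorm_lt_top_iff_lintegral_rpow_enorm_lt_top (by norm_num) (by norm_num)] at h6
        simp only [ENNReal.toReal_ofNat, ENNReal.rpow_ofNat] at h6
        rw [volume_eq_prod, lintegral_prod _ (hm.1.enorm.pow_const 2)] at h6; exact h6
      have hz : hmem.toLp h = 0 := by
        refine eq_zero_of_forall_ifr _ fun a => ?_
        rw [L2.inner_def, ← hf' (p ⊗ₜ a), inner_lv_tmul p a f hF hm]
        refine integral_congr_ae ?_
        filter_upwards [(ifr a).coeFn_toLp 2, hmem.coeFn_toLp] with y h1 h2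
        rw [toH_apply, h1, h2, RCLike.inner_apply, mul_comm]
      rw [Lp.eq_zero_iff_ae_eq_zero] at hz
      filter_upwards [hz, hmem.coeFn_toLp] with y h1 h2
      exact h2.symm.trans h1
    have hall : ∀ᵐ y : E3, ∀ s : Fin 3 →₀ ℕ, ∫ v, conj (polyS (monomial s 1) v) * F (y, v) = 0 :=
      ae_all_iff.2 fun s => hp _
    have hae : ∀ᵐ y : E3, ∀ᵐ v : E3, F (y, v) = 0 := by
      filter_upwards [hall, hsl] with y h1 h2
      refine ae_eq_zero_of_forall_polyS h2 fun p => ?_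
      have e : ∀ v, conj (polyS p v) * F (y, v) = ∑ s ∈ p.support, conj (p.coeff s) *
            (conj (polyS (monomial s 1) v) * F (y, v)) := by
        intro v; conv_lhs => rw [p.as_sum]
        simp only [map_sum, Finset.sum_mul, sum_apply]
        refine sum_congr rfl fun s _ => ?_
        rw [← mul_assoc, ← map_mul, polyS_apply, polyS_apply]
        simp [MvPolynomial.eval_monomial, mul_assoc]
      simp_rw [e]
      rw [integral_finsetSum]
      · simp [integral_const_mul, h1]
      · intro s _; refine Integrable.const_mul ?_ _
        exact MemLp.integrable_mul ((polyS _).memLp 2 volume).star h2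
    have hF0 : F =ᵐ[volume] 0 := by
      obtain ⟨G, hGm, hG⟩ := hm.1
      rw [volume_eq_prod] at hG ⊢
      refine hG.trans ?_
      have hms : MeasurableSet {q : Phase | G q = 0} := hGm.measurable (measurableSet_singleton 0)
      refine (Measure.ae_prod_iff_ae_ae hms).2 ?_
      filter_upwards [hae, Measure.ae_ae_of_ae_prod hG] with y h1 h2
      filter_upwards [h1, h2] with v h3 h4
      rw [← h4, h3]
    rw [Lp.eq_zero_iff_ae_eq_zero]
    have h7 := measurePreserving_shear.quasiMeasurePreserving.ae_eq_comp hF0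
    filter_upwards [h7] with q hq
    simpa [hF] using hq
  have h := (Submodule.topologicalClosure_eq_top_iff).2 hbot
  rw [DenseRange, dense_iff_closure_eq]
  have h2 : (closure (LinearMap.range lv : Set L2)) = Set.univ := by
    rw [← Submodule.topologicalClosure_coe, h]; rfl
  rwa [LinearMap.coe_range] at h2

/-! ### Weak equations -/

/-- The bilinear pairing of `L²` with Schwartz functions. -/
def bp (w : L2) : S6 →L[ℂ] ℂ := (innerSL ℂ (star w)).comp toL

lemma integrable_mul_schwartz (w : L2) (Φ : S6) : Integrable (fun p => w p * Φ p) :=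
  (Lp.memLp w).integrable_mul (Φ.memLp 2 volume)

lemma bp_eq (w : L2) (Φ : S6) : bp w Φ = ∫ p, w p * Φ p := by
  change inner ℂ (star w) (toL Φ) = _
  rw [L2.inner_def]
  refine integral_congr_ae ?_
  filter_upwards [coeFn_toL Φ, Lp.coeFn_star w] with p h1 h2
  rw [h1, h2, RCLike.inner_apply, Pi.star_apply, ← starRingEnd_apply, RCLike.conj_conj, mul_comm]

lemma bp_eq_inner (w : L2) (Φ : S6) : bp w Φ = inner ℂ (star w) (toL Φ) := rfl

lemma bp_add (u w : L2) (Φ : S6) : bp (u + w) Φ = bp u Φ + bp w Φ := by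
  rw [bp_eq, bp_eq, bp_eq, ← integral_add (integrable_mul_schwartz _ _) (integrable_mul_schwartz _ _)]
  refine integral_congr_ae ?_
  filter_upwards [Lp.coeFn_add u w] with p h
  rw [h, Pi.add_apply, add_mul]

lemma bp_smul (c : ℂ) (w : L2) (Φ : S6) : bp (c • w) Φ = c * bp w Φ := by
  rw [bp_eq, bp_eq, ← integral_const_mul]
  refine integral_congr_ae ?_
  filter_upwards [Lp.coeFn_smul c w] with p h
  rw [h, Pi.smul_apply, smul_eq_mul, mul_assoc]

lemma norm_star_L2 (w : L2) : ‖star w‖ = ‖w‖ := by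
  rw [Lp.norm_def, Lp.norm_def]; congr 1
  refine eLpNorm_congr_norm_ae ?_
  filter_upwards [Lp.coeFn_star w] with p h
  rw [h, Pi.star_apply, norm_star]

/-- The pairing as a continuous linear functional of its first argument. -/
def bpL (Φ : S6) : L2 →L[ℂ] ℂ := LinearMap.mkContinuous
    { toFun := fun w => bp w Φ
      map_add' := fun u w => bp_add u w Φ
      map_smul' := fun c w => bp_smul c w Φ } ‖toL Φ‖ (fun w => by
        change ‖bp w Φ‖ ≤ _
        rw [bp_eq_inner, mul_comm]
        exact (norm_inner_le_norm _ _).trans (le_of_eq (by rw [norm_star_L2])))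

lemma bpL_apply (Φ : S6) (w : L2) : bpL Φ w = bp w Φ := rfl

lemma bp_neg (w : L2) (Φ : S6) : bp (-w) Φ = - bp w Φ := (bpL Φ).map_neg w

lemma bp_sub (u w : L2) (Φ : S6) : bp (u - w) Φ = bp u Φ - bp w Φ := (bpL Φ).map_sub u w

lemma bp_zero (Φ : S6) : bp 0 Φ = 0 := (bpL Φ).map_zero

lemma bp_sum {ι : Type*} (s : Finset ι) (w : ι → L2) (Φ : S6) :
    bp (∑ i ∈ s, w i) Φ = ∑ i ∈ s, bp (w i) Φ := map_sum (bpL Φ) w s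

lemma bp_toL (Ψ Φ : S6) : bp (toL Ψ) Φ = ∫ p, Ψ p * Φ p := by
  rw [bp_eq]; refine integral_congr_ae ?_
  filter_upwards [coeFn_toL Ψ] with p h
  rw [h]

lemma bp_toL_comm (Ψ Φ : S6) : bp (toL Ψ) Φ = bp (toL Φ) Ψ := by
  rw [bp_toL, bp_toL]; simp_rw [mul_comm]

lemma bp_qD (j : Fin 3) (Ψ Φ : S6) : bp (toL Ψ) (qD j Φ) = - bp (toL (qD j Ψ)) Φ := by
  rw [bp_toL, bp_toL]
  exact SchwartzMap.integral_mul_lineDerivOp_right_eq_neg_left Ψ Φ _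

lemma bp_qX (j : Fin 3) (Ψ Φ : S6) : bp (toL Ψ) (qX j Φ) = - bp (toL (qX j Ψ)) Φ := by
  rw [bp_toL, bp_toL]
  exact SchwartzMap.integral_mul_lineDerivOp_right_eq_neg_left Ψ Φ _

lemma bp_qM (j : Fin 3) (Ψ Φ : S6) : bp (toL Ψ) (qM j Φ) = bp (toL (qM j Ψ)) Φ := by
  rw [bp_toL, bp_toL]
  congr 1; ext p; simp; ring

lemma bp_qA (j : Fin 3) (Ψ Φ : S6) : bp (toL Ψ) (qA j Φ) = bp (toL (qC j Ψ)) Φ := by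
  simp only [qA, qC, add_apply, smul_apply, neg_apply, map_add, map_smul, map_neg, bp_qD, bp_qM,
    bp_add, bp_smul, bp_neg, smul_eq_mul]

lemma bp_qC (j : Fin 3) (Ψ Φ : S6) : bp (toL Ψ) (qC j Φ) = bp (toL (qA j Ψ)) Φ := by
  rw [bp_toL_comm, ← bp_qA, bp_toL_comm]

lemma qM_qX (j : Fin 3) (Φ : S6) : qX j (qM j Φ) = qM j (qX j Φ) := by
  ext p
  have h : HasFDerivAt (fun q : Phase => ((q.2 j : ℝ) : ℂ)) (Complex.ofRealCLM.comp ((pj j).comp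
        (ContinuousLinearMap.snd ℝ E3 E3))) p :=
    (Complex.ofRealCLM.comp ((pj j).comp (ContinuousLinearMap.snd ℝ E3 E3))).hasFDerivAt
  have h2 : (qM j Φ : Phase → ℂ) = (fun q : Phase => ((q.2 j : ℝ) : ℂ)) * ⇑Φ :=
    funext fun q => qM_apply j Φ q
  rw [qX_apply, h2, (h.mul (Φ.hasFDerivAt p)).fderiv, qM_apply, qX_apply]; simp

lemma bp_qPt (Ψ Φ : S6) : bp (toL Ψ) (qPt Φ) = bp (toL (qP Ψ)) Φ := by
  have e : qP Ψ = ∑ j, (qC j (qA j Ψ) + qM j (qX j Ψ)) := by simp [qP]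
  have e2 : qPt Φ = ∑ j, (qC j (qA j Φ) - qM j (qX j Φ)) := by simp [qPt]
  rw [e, e2]; simp only [map_sum, map_add, map_sub, bp_sum, bp_add]
  refine sum_congr rfl fun j _ => ?_
  rw [bp_qC, bp_qA, bp_qM, bp_qX, sub_neg_eq_add, qM_qX]

/-- The equation `P₀ w = f₀ + Σ A_j f_j + Σ A_j^* f'_j` in the sense of distributions. -/
def WData (w f0 : L2) (f1 f2 : Fin 3 → L2) : Prop := ∀ Φ : S6, bp w (qPt Φ) =
    bp f0 Φ + ∑ j, bp (f1 j) (qC j Φ) + ∑ j, bp (f2 j) (qA j Φ)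

/-- Smooth functions with compact support are dense in the Schwartz space. -/
lemma dense_compactSupport : Dense {Φ : S6 | HasCompactSupport Φ} := by
  intro Φ
  let χ : ContDiffBump (0 : Phase) := ⟨1, 2, by norm_num, by norm_num⟩
  have hχc : HasCompactSupport (fun p => (χ p : ℂ)) :=
    χ.hasCompactSupport.comp_left (g := fun x : ℝ => (x : ℂ)) (by simp)
  set X : S6 := hχc.toSchwartzMap (Complex.ofRealCLM.contDiff.comp χ.contDiff) with hX
  have hXv : ∀ p, X p = (χ p : ℂ) := fun p => rfl
  set L : ℕ → Phase →L[ℝ] Phase := fun n => ((n + 1 : ℝ)⁻¹) • ContinuousLinearMap.id ℝ Phase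
  have hL : ∀ n p, L n p = ((n + 1 : ℝ)⁻¹) • p := fun n p => rfl
  have hL1 : ∀ n, ‖L n‖ ≤ 1 := by
    intro n; refine ContinuousLinearMap.opNorm_le_bound _ zero_le_one fun p => ?_
    rw [hL, norm_smul]; gcongr
    rw [Real.norm_of_nonneg (by positivity)]
    exact inv_le_one_of_one_le₀ (by linarith [(Nat.cast_nonneg n : (0 : ℝ) ≤ n)])
  have hs : ∀ n, ContDiff ℝ ∞ (fun p => X (L n p)) := fun n => X.smooth'.comp (L n).contDiff
  have hc : ∀ n : ℕ, HasCompactSupport (fun p => X (L n p)) := by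
    intro n; exact hχc.comp_smul (c := ((n + 1 : ℝ)⁻¹)) (by positivity)
  set Ψ : ℕ → S6 := fun n =>
    ((hc n).mul_right (f' := ⇑Φ)).toSchwartzMap ((hs n).mul Φ.smooth')
  have hΨ : ∀ n p, Ψ n p = X (L n p) * Φ p := fun n p => rfl
  have hlim : Tendsto Ψ atTop (𝓝 Φ) := by
    rw [(schwartz_withSeminorms ℝ Phase ℂ).tendsto_nhds _ _]
    rintro ⟨k, m⟩ ε hε
    set D : ℝ := ∑ i ∈ Finset.range (m + 1), (m.choose i : ℝ) *
      ((SchwartzMap.seminorm ℝ 0 i X + 1) * SchwartzMap.seminorm ℝ (k + 1) (m - i) Φ) with hD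
    have hbound : ∀ n : ℕ, SchwartzMap.seminorm ℝ k m (Ψ n - Φ) ≤ D * (n + 1 : ℝ)⁻¹ := by
      intro n
      have hn : (0 : ℝ) < (n + 1 : ℝ) := by positivity
      have hD0 : 0 ≤ D := sum_nonneg fun _ _ => by positivity
      refine SchwartzMap.seminorm_le_bound ℝ k m _ (by positivity) fun p => ?_
      have e : (⇑(Ψ n - Φ) : Phase → ℂ) = fun p => (X (L n p) - 1) * Φ p := by
        ext p; rw [sub_apply, hΨ]; ring
      rw [e]
      have hs1 : ContDiff ℝ ∞ (fun p => X (L n p) - 1) := (hs n).sub contDiff_const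
      rcases lt_or_ge ‖p‖ (n + 1) with hp | hp
      · have hev : (fun p => (X (L n p) - 1) * Φ p) =ᶠ[𝓝 p] fun _ => 0 := by
          have : ∀ᶠ q in 𝓝 p, ‖q‖ < n + 1 := continuous_norm.continuousAt.eventually_lt_const hp
          filter_upwards [this] with q hq
          have h1 : χ (L n q) = 1 := by
            refine χ.one_of_mem_closedBall ?_
            rw [mem_closedBall_zero_iff, hL, norm_smul, norm_inv, Real.norm_of_nonneg hn.le]
            change _ ≤ (1 : ℝ)
            rw [inv_mul_le_iff₀ hn]; linarith
          rw [hXv, h1]; simp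
        have h0 : iteratedFDeriv ℝ m (fun p => (X (L n p) - 1) * Φ p) p = 0 := by
          rw [hev.iteratedFDeriv ℝ m |>.self_of_nhds]
          exact congrFun (iteratedFDeriv_fun_zero (𝕜 := ℝ) (n := m)) p
        rw [h0]; simp; positivity
      · have h1 := norm_iteratedFDeriv_mul_le (𝕜 := ℝ) (N := ∞) hs1 (Φ.smooth ⊤) p (n := m)
          (by exact_mod_cast le_top)
        refine (mul_le_mul_of_nonneg_left h1 (by positivity)).trans ?_
        rw [hD, Finset.sum_mul, mul_sum]
        refine sum_le_sum fun i hi => ?_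
        have h2 : ‖iteratedFDeriv ℝ i (fun p => X (L n p) - 1) p‖ ≤
            SchwartzMap.seminorm ℝ 0 i X + 1 := by
          have h3 : ‖iteratedFDeriv ℝ i (fun p => X (L n p)) p‖ ≤ SchwartzMap.seminorm ℝ 0 i X :=
            (norm_iteratedFDeriv_comp_clm_le (L n) (hL1 n) X i p).trans
              (SchwartzMap.norm_iteratedFDeriv_le_seminorm ℝ X i _)
          have h4 : ‖iteratedFDeriv ℝ i (fun _ : Phase => (1 : ℂ)) p‖ ≤ 1 := by
            rcases Nat.eq_zero_or_pos i with rfl | hi0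
            · simp
            · rw [iteratedFDeriv_const_of_ne hi0.ne']; simp
          have h5 : iteratedFDeriv ℝ i (fun p => X (L n p) - 1) p =
              iteratedFDeriv ℝ i (fun p => X (L n p)) p -
                iteratedFDeriv ℝ i (fun _ : Phase => (1 : ℂ)) p :=
            iteratedFDeriv_sub_apply ((hs n).of_le (by exact_mod_cast le_top)).contDiffAt
              contDiffAt_const
          rw [h5]; exact (norm_sub_le _ _).trans (add_le_add h3 h4)
        have h6 : ‖p‖ ^ k * ‖iteratedFDeriv ℝ (m - i) Φ p‖ ≤
            SchwartzMap.seminorm ℝ (k + 1) (m - i) Φ * (n + 1 : ℝ)⁻¹ := by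
          have h7 := SchwartzMap.le_seminorm ℝ (k + 1) (m - i) Φ p
          rw [← div_eq_mul_inv, le_div_iff₀ hn]
          refine le_trans ?_ h7; rw [pow_succ]
          have : 0 ≤ ‖p‖ ^ k * ‖iteratedFDeriv ℝ (m - i) Φ p‖ := by positivity
          nlinarith
        calc _ = (m.choose i : ℝ) * (‖iteratedFDeriv ℝ i (fun p => X (L n p) - 1) p‖ *
              (‖p‖ ^ k * ‖iteratedFDeriv ℝ (m - i) Φ p‖)) := by ring
          _ ≤ (m.choose i : ℝ) * ((SchwartzMap.seminorm ℝ 0 i X + 1) *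
              (SchwartzMap.seminorm ℝ (k + 1) (m - i) Φ * (n + 1 : ℝ)⁻¹)) := by gcongr
          _ = _ := by ring
    have h0 : Tendsto (fun n : ℕ => D * (n + 1 : ℝ)⁻¹) atTop (𝓝 0) := by
      have := (tendsto_one_div_add_atTop_nhds_zero_nat (𝕜 := ℝ)).const_mul D
      simpa using this
    filter_upwards [h0.eventually_lt_const hε] with n hn
    exact (hbound n).trans_lt hn
  exact mem_closure_of_tendsto hlim (Eventually.of_forall fun n => (hc n).mul_right)

/-- It suffices to test a weak equation with compactly supported functions. -/
lemma wData_of_test {w f0 : L2} {f1 f2 : Fin 3 → L2}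
    (h : ∀ Φ : S6, HasCompactSupport Φ → bp w (qPt Φ) =
      bp f0 Φ + ∑ j, bp (f1 j) (qC j Φ) + ∑ j, bp (f2 j) (qA j Φ)) : WData w f0 f1 f2 := by
  intro Φ
  have hc1 : Continuous fun Φ => bp w (qPt Φ) := (bp w).continuous.comp qPt.continuous
  have hc2 : Continuous fun Φ => bp f0 Φ + ∑ j, bp (f1 j) (qC j Φ) + ∑ j, bp (f2 j) (qA j Φ) := by
    refine ((bp f0).continuous.add ?_).add ?_
    · exact continuous_finsetSum _ fun j _ => (bp (f1 j)).continuous.comp (qC j).continuous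
    · exact continuous_finsetSum _ fun j _ => (bp (f2 j)).continuous.comp (qA j).continuous
  exact congrFun (Continuous.ext_on dense_compactSupport hc1 hc2 fun Φ hΦ => h Φ hΦ) Φ

/-- A test function as a Schwartz function. -/
def IsTest.toS {f : Phase → ℂ} (h : IsTest f) : S6 := h.2.toSchwartzMap h.1

@[simp] lemma IsTest.toS_apply {f : Phase → ℂ} (h : IsTest f) (p : Phase) : h.toS p = f p := rfl

lemma isTest_of_schwartz {Φ : S6} (h : HasCompactSupport Φ) : IsTest Φ := ⟨Φ.smooth', h⟩

lemma qC_qA_apply (j : Fin 3) (Φ : S6) (p : Phase) :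
    qC j (qA j Φ) p = - qD j (qD j Φ) p + ((p.2 j : ℂ) ^ 2 / 4 - 1 / 2) * Φ p := by
  have h : HasFDerivAt (fun q : Phase => ((q.2 j : ℝ) : ℂ)) (Complex.ofRealCLM.comp ((pj j).comp
        (ContinuousLinearMap.snd ℝ E3 E3))) p :=
    (Complex.ofRealCLM.comp ((pj j).comp (ContinuousLinearMap.snd ℝ E3 E3))).hasFDerivAt
  have h2 : (qM j Φ : Phase → ℂ) = (fun q : Phase => ((q.2 j : ℝ) : ℂ)) * ⇑Φ :=
    funext fun q => qM_apply j Φ q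
  have h3 : qD j (qM j Φ) p = Φ p + (p.2 j : ℂ) * qD j Φ p := by
    rw [qD_apply, h2, (h.mul (Φ.hasFDerivAt p)).fderiv, qD_apply]; simp; ring
  simp only [qC, qA, add_apply, smul_apply, neg_apply, map_add, map_smul, smul_eq_mul, qM_apply, h3]
  ring

lemma laplacian_slice (Φ : S6) (p : Phase) :
    Laplacian.laplacian (fun v : E3 => Φ (p.1, v)) p.2 = ∑ j, qD j (qD j Φ) p := by
  rw [InnerProductSpace.laplacian_eq_iteratedFDeriv_orthonormalBasis _
    (EuclideanSpace.basisFun (Fin 3) ℝ)]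
  refine sum_congr rfl fun j _ => ?_
  have hslice : ∀ (Ψ : S6) (v : E3), HasFDerivAt (fun v : E3 => Ψ (p.1, v))
      ((fderiv ℝ Ψ (p.1, v)).comp (ContinuousLinearMap.inr ℝ E3 E3)) v := by
    intro Ψ v; exact (Ψ.hasFDerivAt (p.1, v)).comp v (hasFDerivAt_prodMk_right p.1 v)
  have h1 : ∀ v, fderiv ℝ (fun v : E3 => Φ (p.1, v)) v (eb j) = qD j Φ (p.1, v) := by
    intro v; rw [(hslice Φ v).fderiv, qD_apply]; rfl
  rw [iteratedFDeriv_two_apply]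
  have h2 : DifferentiableAt ℝ (fderiv ℝ (fun v : E3 => Φ (p.1, v))) p.2 := by
    have hcd : ContDiff ℝ ∞ (fun v : E3 => Φ (p.1, v)) := Φ.smooth'.comp (by fun_prop)
    exact (contDiff_infty_iff_fderiv.1 hcd).2.differentiable (by simp) _
  have h3 : fderiv ℝ (fun v => fderiv ℝ (fun v : E3 => Φ (p.1, v)) v (eb j)) p.2 (eb j) =
      fderiv ℝ (fderiv ℝ (fun v : E3 => Φ (p.1, v))) p.2 (eb j) (eb j) := by
    rw [fderiv_clm_apply h2 (differentiableAt_const _)]; simp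
  simp only [h1] at h3
  rw [(hslice (qD j Φ) p.2).fderiv] at h3
  simp only [EuclideanSpace.basisFun_apply, Matrix.cons_val_zero, Matrix.cons_val_one]
  rw [← h3, qD_apply]; rfl

lemma fderiv_snd_sum (Φ : S6) (p : Phase) (a : E3) :
    fderiv ℝ Φ p (0, a) = ∑ j, (a j : ℂ) * qD j Φ p := by
  have : ((0, a) : Phase) = ∑ j, (a j) • ((0, eb j) : Phase) := by
    ext1
    · simp [Prod.fst_sum]
    · simp only [Prod.snd_sum, Prod.smul_snd]
      simpa using ((EuclideanSpace.basisFun (Fin 3) ℝ).sum_repr a).symm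
  rw [this, map_sum]
  simp only [map_smul, qD_apply, Complex.real_smul]

lemma fderiv_fst_sum (Φ : S6) (p : Phase) (a : E3) :
    fderiv ℝ Φ p (a, 0) = ∑ j, (a j : ℂ) * qX j Φ p := by
  have : ((a, 0) : Phase) = ∑ j, (a j) • ((eb j, 0) : Phase) := by
    ext1
    · simp only [Prod.fst_sum, Prod.smul_fst]
      simpa using ((EuclideanSpace.basisFun (Fin 3) ℝ).sum_repr a).symm
    · simp [Prod.snd_sum]
  rw [this, map_sum]
  simp only [map_smul, qX_apply, Complex.real_smul]

/-- The formal transpose of the full operator on Schwartz functions. -/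
lemma transposeP_eq (V : E3 → ℝ) (Φ : S6) (p : Phase) :
    transposeP V Φ p = qPt Φ p + ∑ j, (gradient V p.1 j : ℂ) * qD j Φ p := by
  have e2 : qPt Φ p = ∑ j, (qC j (qA j Φ) p - (p.2 j : ℂ) * qX j Φ p) := by simp [qPt]
  have hn := sum_sq_coord p.2
  rw [transposeP, laplacian_slice, fderiv_snd_sum, fderiv_fst_sum, e2]
  simp only [qC_qA_apply, Fin.sum_univ_three] at hn ⊢
  push_cast at hn ⊢
  linear_combination (-(1 : ℂ) / 4 * Φ p) * hn

lemma gradient_zero_apply (x : E3) : gradient (0 : E3 → ℝ) x = 0 := by simp [gradient]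

lemma transposeP_zero (Φ : S6) (p : Phase) : transposeP 0 Φ p = qPt Φ p := by
  rw [transposeP_eq, gradient_zero_apply]; simp

/-- For square integrable functions the weak equation extends to Schwartz test functions. -/
lemma weakEq_zero_iff (w f : L2) : WeakEq 0 w f ↔ WData w f 0 0 := by
  constructor
  · intro h; refine wData_of_test fun Φ hΦ => ?_
    have := h Φ (isTest_of_schwartz hΦ)
    simp only [transposeP_zero] at this
    simp only [Pi.zero_apply, bp_zero, Finset.sum_const_zero, add_zero]
    rw [bp_eq, bp_eq, this]
  · intro h g hg
    have := h hg.toS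
    simp only [Pi.zero_apply, bp_zero, Finset.sum_const_zero, add_zero] at this
    rw [bp_eq, bp_eq] at this
    simp only [← transposeP_zero] at this; exact this

/-- Elements of the core satisfy their equation weakly. -/
lemma wData_lv {U F0 : Dom} {F1 F2 : Fin 3 → Dom}
    (h : dP U = F0 + ∑ j, dA j (F1 j) + ∑ j, dC j (F2 j)) :
    WData (lv U) (lv F0) (fun j => lv (F1 j)) (fun j => lv (F2 j)) := by
  intro Φ; simp only [lv_apply]
  rw [bp_qPt, ← phys_dP, h]
  simp only [map_add, map_sum, bp_add, bp_sum, bp_qC, bp_qA, phys_dA, phys_dC]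

/-! ### The free resolvent -/

lemma norm_lv_le {ι : Type*} [Fintype ι] {U : Dom} {F : ι → Dom} {C : ℝ} (hC : 0 ≤ C)
    (h : ∀ ξ, nn (fib ξ U) ≤ C * ∑ i, nn (fib ξ (F i))) :
    ‖lv U‖ ≤ C * Fintype.card ι * ∑ i, ‖lv (F i)‖ := by
  have h1 : ‖lv U‖ ^ 2 ≤ C ^ 2 * Fintype.card ι * ∑ i, ‖lv (F i)‖ ^ 2 := by
    simp only [norm_lv_sq]
    rw [← integral_finsetSum _ fun i _ => integrable_nn_sq (F i), ← integral_const_mul]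
    refine integral_mono (integrable_nn_sq U)
      ((integrable_finsetSum _ fun i _ => integrable_nn_sq (F i)).const_mul _) fun ξ => ?_
    have h2 := pow_le_pow_left₀ (nn_nonneg _) (h ξ) 2
    have h3 := sq_sum_le_card_mul_sum_sq (s := (Finset.univ : Finset ι))
      (f := fun i => nn (fib ξ (F i)))
    rw [Finset.card_univ] at h3
    calc _ ≤ _ := h2
      _ = C ^ 2 * (∑ i, nn (fib ξ (F i))) ^ 2 := mul_pow _ _ _
      _ ≤ C ^ 2 * (Fintype.card ι * ∑ i, nn (fib ξ (F i)) ^ 2) := by gcongr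
      _ = _ := by ring
  have h4 : ∑ i, ‖lv (F i)‖ ^ 2 ≤ (∑ i, ‖lv (F i)‖) ^ 2 :=
    Finset.sum_sq_le_sq_sum_of_nonneg fun _ _ => norm_nonneg _
  have hS : 0 ≤ ∑ i, ‖lv (F i)‖ := sum_nonneg fun _ _ => norm_nonneg _
  rcases isEmpty_or_nonempty ι with hι | hι
  · simp only [Finset.univ_eq_empty, Finset.sum_empty, mul_zero] at h1 ⊢
    have h5 : ‖lv U‖ ^ 2 = 0 := le_antisymm h1 (sq_nonneg _)
    exact (pow_eq_zero_iff (by norm_num)).1 h5 |>.le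
  · have hc : (1 : ℝ) ≤ Fintype.card ι := by exact_mod_cast Fintype.card_pos
    refine (sq_le_sq₀ (norm_nonneg _) (by positivity)).1 (h1.trans ?_)
    rw [mul_pow, mul_pow]; gcongr
    exact le_self_pow₀ hc (by norm_num)

/-- The right hand side `F₀ + Σ A_j F_j + Σ A_j^* F'_j` in the core. -/
def dR (F0 : Dom) (F1 F2 : Fin 3 → Dom) : Dom := F0 + ∑ j, dA j (F1 j) + ∑ j, dC j (F2 j)

lemma fib_dR (ξ : E3) (F0 : Dom) (F1 F2 : Fin 3 → Dom) :
    fib ξ (dR F0 F1 F2) = rhs (fib ξ F0) (fun j => fib ξ (F1 j)) (fun j => fib ξ (F2 j)) := by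
  simp [dR, rhs, fib_dA, fib_dC]

/-- The size of a right hand side in the core. -/
def rN (F0 : Dom) (F1 F2 : Fin 3 → Dom) : ℝ := ‖lv F0‖ + ∑ j, ‖lv (F1 j)‖ + ∑ j, ‖lv (F2 j)‖

/-- The norm of `H¹` type in the core. -/
def hn (U : Dom) : ℝ := ‖lv U‖ + ∑ j, ‖lv (dA j U)‖

/-- The data of a right hand side as one family. -/
def dataFam {X : Type*} (F0 : X) (F1 F2 : Fin 3 → X) : Unit ⊕ Fin 3 ⊕ Fin 3 → X :=
  Sum.elim (fun _ => F0) (Sum.elim F1 F2)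

lemma sum_dataFam {X : Type*} (F0 : X) (F1 F2 : Fin 3 → X) (f : X → ℝ) :
    ∑ i, f (dataFam F0 F1 F2 i) = f F0 + ∑ j, f (F1 j) + ∑ j, f (F2 j) := by
  simp [dataFam, Fintype.sum_sum_type, add_assoc]

lemma lv_nonneg (U : Dom) : 0 ≤ ‖lv U‖ := norm_nonneg _

lemma rN_nonneg (F0 : Dom) (F1 F2 : Fin 3 → Dom) : 0 ≤ rN F0 F1 F2 :=
  add_nonneg (add_nonneg (norm_nonneg _) (sum_nonneg fun _ _ => norm_nonneg _))
    (sum_nonneg fun _ _ => norm_nonneg _)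

/-- Passing from estimates at fixed frequency to estimates in `L²`. -/
lemma hn_le_of_fib {U F0 : Dom} {F1 F2 : Fin 3 → Dom} {C : ℝ} (hC : 0 ≤ C)
    (h : ∀ ξ, nn (fib ξ U) + dn (fib ξ U) ≤
      C * rn (fib ξ F0) (fun j => fib ξ (F1 j)) (fun j => fib ξ (F2 j))) :
    hn U ≤ 28 * C * rN F0 F1 F2 := by
  have e : ∀ ξ, rn (fib ξ F0) (fun j => fib ξ (F1 j)) (fun j => fib ξ (F2 j)) =
      ∑ i, nn (fib ξ (dataFam F0 F1 F2 i)) := fun ξ => by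
    rw [sum_dataFam F0 F1 F2 (fun U => nn (fib ξ U))]; rfl
  have e2 : ∑ i, ‖lv (dataFam F0 F1 F2 i)‖ = rN F0 F1 F2 := by
    rw [sum_dataFam F0 F1 F2 (fun U => ‖lv U‖)]; rfl
  simp only [e] at h
  have hc : (Fintype.card (Unit ⊕ Fin 3 ⊕ Fin 3) : ℝ) = 7 := by norm_num [Fintype.card_sum]
  have h1 : ‖lv U‖ ≤ C * 7 * rN F0 F1 F2 := by
    rw [← e2, ← hc]
    exact norm_lv_le hC fun ξ => le_trans (by linarith [dn_nonneg (fib ξ U)]) (h ξ)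
  have h2 : ∀ j ∈ Finset.univ, ‖lv (dA j U)‖ ≤ C * 7 * rN F0 F1 F2 := by
    intro j _; rw [← e2, ← hc]
    refine norm_lv_le hC fun ξ => le_trans ?_ (h ξ); rw [fib_dA]
    have : nn (An j (fib ξ U)) ≤ dn (fib ξ U) :=
      Finset.single_le_sum (f := fun i => nn (An i (fib ξ U))) (fun i _ => nn_nonneg _)
        (Finset.mem_univ j)
    linarith [nn_nonneg (fib ξ U)]
  have h3 := sum_le_sum h2
  simp only [Finset.sum_const, Finset.card_univ, Fintype.card_fin, nsmul_eq_mul] at h3; unfold hn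
  push_cast at h3; linarith

lemma exists_hn_le {z : ℂ} (hz : ‖z‖ ≤ dl) (hz' : z ∉ halfLine) :
    ∃ C : ℝ, 0 < C ∧ ∀ (U F0 : Dom) (F1 F2 : Fin 3 → Dom),
      dP U - z • U = dR F0 F1 F2 → hn U ≤ C * rN F0 F1 F2 := by
  obtain ⟨C, hC, h⟩ := exists_apriori_resolvent hz hz'
  refine ⟨28 * C, by positivity, fun U F0 F1 F2 hU => hn_le_of_fib hC.le fun ξ => ?_⟩
  refine h (kk ξ) _ _ _ _ ?_
  rw [← fib_dR, ← hU, map_sub, map_smul, fib_dP]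

lemma norm_lv_le_hn (U : Dom) : ‖lv U‖ ≤ hn U :=
  le_add_of_nonneg_right (sum_nonneg fun _ _ => norm_nonneg _)

lemma norm_lv_dA_le_hn (j : Fin 3) (U : Dom) : ‖lv (dA j U)‖ ≤ hn U :=
  (Finset.single_le_sum (f := fun i => ‖lv (dA i U)‖) (fun _ _ => norm_nonneg _)
    (Finset.mem_univ j)).trans (le_add_of_nonneg_left (norm_nonneg _))

lemma dR_zero (F0 : Dom) : dR F0 0 0 = F0 := by simp [dR]

lemma rN_zero (F0 : Dom) : rN F0 0 0 = ‖lv F0‖ := by simp [rN]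

/-- The free resolvent `(P₀ - z)⁻¹`, the continuous extension of the inverse of `P₀ - z` on the
core. -/
def RR (z : ℂ) : L2 →L[ℂ] L2 := LinearMap.extendOfNorm lv (lv ∘ₗ (dP - z • LinearMap.id))

lemma exists_sol {z : ℂ} (hz' : z ∉ halfLine) (F : Dom) : ∃ U, dP U - z • U = F :=
  surjective_dP_sub hz' F

lemma denseRange_dP_sub {z : ℂ} (hz' : z ∉ halfLine) :
    DenseRange (lv ∘ₗ (dP - z • LinearMap.id) : Dom →ₗ[ℂ] L2) := by
  rw [DenseRange, LinearMap.coe_comp, (surjective_dP_sub hz').range_comp]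
  exact denseRange_lv

lemma RR_lv {z : ℂ} (hz : ‖z‖ ≤ dl) (hz' : z ∉ halfLine) {U F : Dom} (h : dP U - z • U = F) :
    RR z (lv F) = lv U := by
  obtain ⟨C, hC, hb⟩ := exists_hn_le hz hz'; rw [← h]
  refine LinearMap.extendOfNorm_eq (f := lv) (e := lv ∘ₗ (dP - z • LinearMap.id))
    (denseRange_dP_sub hz') ⟨C, fun U => ?_⟩ U
  refine (norm_lv_le_hn U).trans ?_
  have := hb U (dP U - z • U) 0 0 (dR_zero _).symm
  rwa [rN_zero] at this

/-- The bounded operator `(P₀ - z)⁻¹ A_j`. -/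
def RA (z : ℂ) (j : Fin 3) : L2 →L[ℂ] L2 :=
  LinearMap.extendOfNorm ((RR z).toLinearMap ∘ₗ lv ∘ₗ dA j) lv

/-- The bounded operator `(P₀ - z)⁻¹ A_j^*`. -/
def RC (z : ℂ) (j : Fin 3) : L2 →L[ℂ] L2 :=
  LinearMap.extendOfNorm ((RR z).toLinearMap ∘ₗ lv ∘ₗ dC j) lv

lemma sum_single_apply {M : Type*} [AddCommMonoid M] (f : Fin 3 → Dom → M) (h0 : ∀ i, f i 0 = 0)
    (j : Fin 3) (F : Dom) : ∑ i, f i ((Pi.single j F : Fin 3 → Dom) i) = f j F := by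
  rw [Finset.sum_eq_single j]
  · simp
  · intro i _ hi; rw [Pi.single_eq_of_ne hi, h0]
  · simp

lemma dR_dA (j : Fin 3) (F : Dom) : dR 0 (Pi.single j F) 0 = dA j F := by
  have := sum_single_apply (fun i => dA i) (by simp) j F
  simp [dR, this]

lemma dR_dC (j : Fin 3) (F : Dom) : dR 0 0 (Pi.single j F) = dC j F := by
  have := sum_single_apply (fun i => dC i) (by simp) j F
  simp [dR, this]

lemma rN_dA (j : Fin 3) (F : Dom) : rN 0 (Pi.single j F) 0 = ‖lv F‖ := by
  have := sum_single_apply (fun _ U => ‖lv U‖) (by simp) j F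
  simp [rN, this]

lemma rN_dC (j : Fin 3) (F : Dom) : rN 0 0 (Pi.single j F) = ‖lv F‖ := by
  have := sum_single_apply (fun _ U => ‖lv U‖) (by simp) j F
  simp [rN, this]

lemma RA_lv {z : ℂ} (hz : ‖z‖ ≤ dl) (hz' : z ∉ halfLine) (j : Fin 3) (F : Dom) :
    RA z j (lv F) = RR z (lv (dA j F)) := by
  obtain ⟨C, hC, hb⟩ := exists_hn_le hz hz'
  refine LinearMap.extendOfNorm_eq (f := (RR z).toLinearMap ∘ₗ lv ∘ₗ dA j) (e := lv)
    denseRange_lv ⟨C, fun F => ?_⟩ F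
  obtain ⟨U, hU⟩ := exists_sol hz' (dA j F)
  change ‖RR z (lv (dA j F))‖ ≤ _
  rw [RR_lv hz hz' hU]
  have := hb U 0 (Pi.single j F) 0 (hU.trans (dR_dA j F).symm)
  rw [rN_dA] at this
  exact (norm_lv_le_hn U).trans this

lemma RC_lv {z : ℂ} (hz : ‖z‖ ≤ dl) (hz' : z ∉ halfLine) (j : Fin 3) (F : Dom) :
    RC z j (lv F) = RR z (lv (dC j F)) := by
  obtain ⟨C, hC, hb⟩ := exists_hn_le hz hz'
  refine LinearMap.extendOfNorm_eq (f := (RR z).toLinearMap ∘ₗ lv ∘ₗ dC j) (e := lv)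
    denseRange_lv ⟨C, fun F => ?_⟩ F
  obtain ⟨U, hU⟩ := exists_sol hz' (dC j F)
  change ‖RR z (lv (dC j F))‖ ≤ _
  rw [RR_lv hz hz' hU]
  have := hb U 0 0 (Pi.single j F) (hU.trans (dR_dC j F).symm)
  rw [rN_dC] at this
  exact (norm_lv_le_hn U).trans this

/-! ### Reversal of the velocity -/

/-- The map `(x, v) ↦ (x, -v)`. -/
def vneg : Phase ≃L[ℝ] Phase :=
  (ContinuousLinearEquiv.refl ℝ E3).prodCongr (ContinuousLinearEquiv.neg ℝ)

@[simp] lemma vneg_apply (p : Phase) : vneg p = (p.1, -p.2) := rfl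

lemma measurePreserving_vneg : MeasurePreserving vneg (volume : Measure Phase) volume :=
  (MeasurePreserving.id (volume : Measure E3)).prod (Measure.measurePreserving_neg volume)

/-- Reversal of the velocity of Schwartz functions. -/
def qR : S6 →L[ℂ] S6 := SchwartzMap.compCLMOfContinuousLinearEquiv ℂ vneg

@[simp] lemma qR_apply (Φ : S6) (p : Phase) : qR Φ p = Φ (p.1, -p.2) := rfl

lemma fderiv_qR (Φ : S6) (p a : Phase) :
    fderiv ℝ (qR Φ) p a = fderiv ℝ Φ (p.1, -p.2) (a.1, -a.2) := by
  have h : HasFDerivAt (qR Φ) ((fderiv ℝ Φ (vneg p)).comp (vneg : Phase →L[ℝ] Phase)) p :=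
    (Φ.hasFDerivAt (vneg p)).comp p vneg.hasFDerivAt
  rw [h.fderiv]; rfl

lemma qA_qR (j : Fin 3) (Φ : S6) : qA j (qR Φ) = - qR (qA j Φ) := by
  ext p; rw [neg_apply, qR_apply, qA_apply, qA_apply, fderiv_qR]
  have : ((0, -eb j) : Phase) = -(0, eb j) := by simp
  simp only [this, map_neg, qR_apply, PiLp.neg_apply]
  push_cast; ring

lemma qC_qR (j : Fin 3) (Φ : S6) : qC j (qR Φ) = - qR (qC j Φ) := by
  ext p; rw [neg_apply, qR_apply, qC_apply, qC_apply, fderiv_qR]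
  have : ((0, -eb j) : Phase) = -(0, eb j) := by simp
  simp only [this, map_neg, qR_apply, PiLp.neg_apply]
  push_cast; ring

lemma qM_qR (j : Fin 3) (Φ : S6) : qM j (qR Φ) = - qR (qM j Φ) := by
  ext p; simp

lemma qX_qR (j : Fin 3) (Φ : S6) : qX j (qR Φ) = qR (qX j Φ) := by
  ext p; rw [qX_apply, qR_apply, qX_apply, fderiv_qR]; simp

/-- The formal transpose of the free operator is conjugate to the free operator by the reversal of
the velocity. -/
lemma qPt_qR (Φ : S6) : qPt (qR Φ) = qR (qP Φ) := by
  have e : qP Φ = ∑ j, (qC j (qA j Φ) + qM j (qX j Φ)) := by simp [qP]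
  have e2 : qPt (qR Φ) = ∑ j, (qC j (qA j (qR Φ)) - qM j (qX j (qR Φ))) := by simp [qPt]
  rw [e, e2, map_sum]
  refine sum_congr rfl fun j _ => ?_
  rw [qA_qR, map_neg, qC_qR, neg_neg, qX_qR, qM_qR, sub_neg_eq_add, map_add]

/-- An element of `L²` which annihilates the reflected core vanishes. -/
lemma eq_zero_of_bp_qR {d : L2} (h : ∀ F : Dom, bp d (qR (phys F)) = 0) : d = 0 := by
  set T := Lp.compMeasurePreservingₗᵢ ℂ (E := ℂ) (p := 2) vneg measurePreserving_vneg with hT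
  have hTq : ∀ Φ, T (toL Φ) = toL (qR Φ) := by
    intro Φ; refine Lp.ext ?_
    have h1 := Lp.coeFn_compMeasurePreserving (toL Φ) measurePreserving_vneg
    have h2 := measurePreserving_vneg.quasiMeasurePreserving.ae_eq_comp (coeFn_toL Φ)
    filter_upwards [h1, h2, coeFn_toL (qR Φ)] with p h3 h4 h5
    rw [h5]; exact h3.trans h4
  have hTT : ∀ f, T (T f) = f := by
    intro f; refine Lp.ext ?_
    have h1 := Lp.coeFn_compMeasurePreserving (T f) measurePreserving_vneg
    have h2 := measurePreserving_vneg.quasiMeasurePreserving.ae_eq_comp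
      (Lp.coeFn_compMeasurePreserving f measurePreserving_vneg)
    filter_upwards [h1, h2] with p h3 h4
    refine h3.trans (h4.trans ?_); simp
  have hall : ∀ x : L2, inner ℂ (star d) (T x) = 0 := by
    have hc1 : Continuous fun x : L2 => inner ℂ (star d) (T x) :=
      continuous_const.inner T.continuous
    refine fun x => congrFun (denseRange_lv.equalizer hc1 continuous_const ?_) x; ext F
    have := h F
    rw [bp_eq_inner, ← hTq] at this; exact this
  have h3 := hall (T (star d))
  rw [hTT, inner_self_eq_zero] at h3
  rw [← star_star d, h3]
  refine Lp.ext ?_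
  filter_upwards [Lp.coeFn_star (0 : L2), Lp.coeFn_zero ℂ 2 (volume : Measure Phase)] with p h1 h2
  rw [h1, Pi.star_apply, h2]; simp

lemma bp_sub_qPt {w f0 : L2} {f1 f2 : Fin 3 → L2} (h : WData w f0 f1 f2) (z : ℂ)
    {Y F : Dom} (hY : dP Y - z • Y = F) : bp w (qR (phys F)) =
      bp (f0 - z • w) (qR (phys Y)) + ∑ j, bp (f1 j) (qC j (qR (phys Y))) +
        ∑ j, bp (f2 j) (qA j (qR (phys Y))) := by
  have h1 := h (qR (phys Y))
  rw [← hY, map_sub, map_smul, map_sub, map_smul, phys_dP, ← qPt_qR, map_sub, map_smul, h1, bp_sub,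
    bp_smul, smul_eq_mul]
  ring

/-- The representation of weak solutions by means of the resolvent. In particular weak solutions
are unique. -/
lemma eq_resolvent {z : ℂ} (hz : ‖z‖ ≤ dl) (hz' : z ∉ halfLine) {w f0 : L2} {f1 f2 : Fin 3 → L2}
    (h : WData w f0 f1 f2) :
    w = RR z (f0 - z • w) + ∑ j, RA z j (f1 j) + ∑ j, RC z j (f2 j) := by
  rw [← sub_eq_zero]
  refine eq_zero_of_bp_qR fun F => ?_
  obtain ⟨Y, hY⟩ := exists_sol hz' F
  have hcore : ∀ {U G : Dom}, dP U - z • U = G →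
      bp (lv U) (qR (phys F)) = bp (lv G) (qR (phys Y)) := by
    intro U G hU
    have h1 : dP U = G + z • U := by rw [← hU]; abel
    have h2 := bp_sub_qPt (wData_lv (U := U) (F0 := G + z • U) (F1 := 0) (F2 := 0) (by simp [h1])) z hY
    simpa [bp_zero] using h2
  have hRR : ∀ f : L2, bp (RR z f) (qR (phys F)) = bp f (qR (phys Y)) := by
    refine fun f => congrFun (denseRange_lv.equalizer
      ((bpL (qR (phys F))).continuous.comp (RR z).continuous) (bpL (qR (phys Y))).continuous ?_) f
    ext G
    obtain ⟨U, hU⟩ := exists_sol hz' G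
    simp only [Function.comp_apply, bpL_apply]
    rw [RR_lv hz hz' hU, hcore hU]
  have hRA : ∀ (j : Fin 3) (f : L2), bp (RA z j f) (qR (phys F)) = bp f (qC j (qR (phys Y))) := by
    refine fun j f => congrFun (denseRange_lv.equalizer
      ((bpL (qR (phys F))).continuous.comp (RA z j).continuous)
      (bpL (qC j (qR (phys Y)))).continuous ?_) f
    ext G; simp only [Function.comp_apply, bpL_apply]
    rw [RA_lv hz hz', hRR, lv_apply, phys_dA, ← bp_qC]; rfl
  have hRC : ∀ (j : Fin 3) (f : L2), bp (RC z j f) (qR (phys F)) = bp f (qA j (qR (phys Y))) := by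
    refine fun j f => congrFun (denseRange_lv.equalizer
      ((bpL (qR (phys F))).continuous.comp (RC z j).continuous)
      (bpL (qA j (qR (phys Y)))).continuous ?_) f
    ext G; simp only [Function.comp_apply, bpL_apply]
    rw [RC_lv hz hz', hRR, lv_apply, phys_dC, ← bp_qA]; rfl
  rw [bp_sub, bp_add, bp_add, bp_sum, bp_sum, hRR, bp_sub_qPt h z hY]
  simp only [hRA, hRC]; ring

/-- Weak equations are preserved by limits. -/
lemma WData.of_tendsto {ι : Type*} {l : Filter ι} [l.NeBot] {w f0 : ι → L2}
    {f1 f2 : ι → Fin 3 → L2} {w' f0' : L2} {f1' f2' : Fin 3 → L2}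
    (h : ∀ i, WData (w i) (f0 i) (f1 i) (f2 i)) (hw : Tendsto w l (𝓝 w'))
    (h0 : Tendsto f0 l (𝓝 f0')) (h1 : ∀ j, Tendsto (fun i => f1 i j) l (𝓝 (f1' j)))
    (h2 : ∀ j, Tendsto (fun i => f2 i j) l (𝓝 (f2' j))) : WData w' f0' f1' f2' := by
  intro Φ
  have hc : ∀ (Ψ : S6) {u : ι → L2} {u' : L2}, Tendsto u l (𝓝 u') →
      Tendsto (fun i => bp (u i) Ψ) l (𝓝 (bp u' Ψ)) := fun Ψ u u' hu =>
    ((bpL Ψ).continuous.tendsto u').comp hu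
  refine tendsto_nhds_unique (hc (qPt Φ) hw) ?_
  simp only [fun i => h i Φ]
  exact ((hc Φ h0).add (tendsto_finsetSum _ fun j _ => hc _ (h1 j))).add
    (tendsto_finsetSum _ fun j _ => hc _ (h2 j))

/-- The operator `RR z` is the resolvent of the free operator with maximal domain. -/
lemma isFreeResolvent_RR {z : ℂ} (hz : ‖z‖ ≤ dl) (hz' : z ∉ halfLine) :
    IsFreeResolvent z (RR z) := by
  constructor
  · intro f; rw [weakEq_zero_iff]
    obtain ⟨u, hu, hlim⟩ := mem_closure_iff_seq_limit.1 (denseRange_lv f)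
    choose F hF using hu
    choose U hU using fun n => exists_sol hz' (F n)
    have hR : ∀ n, RR z (u n) = lv (U n) := fun n => by rw [← hF n, RR_lv hz hz' (hU n)]
    have hRlim : Tendsto (fun n => lv (U n)) atTop (𝓝 (RR z f)) := by
      simp only [← hR]
      exact ((RR z).continuous.tendsto f).comp hlim
    have hFlim : Tendsto (fun n => lv (F n)) atTop (𝓝 f) := by simpa only [hF] using hlim
    refine WData.of_tendsto (l := atTop) (w := fun n => lv (U n))
      (f0 := fun n => lv (F n) + z • lv (U n)) (f1 := fun _ => 0) (f2 := fun _ => 0) (fun n => ?_)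
      hRlim (hFlim.add (hRlim.const_smul z)) (fun j => tendsto_const_nhds)
      (fun j => tendsto_const_nhds)
    have h1 : dP (U n) = F n + z • U n := by rw [← hU n]; abel
    have h2 := wData_lv (U := U n) (F0 := F n + z • U n) (F1 := 0) (F2 := 0) (by simp [h1])
    simp only [map_add, map_smul, Pi.zero_apply, map_zero] at h2; exact h2
  · intro u g h; rw [weakEq_zero_iff] at h
    have := eq_resolvent hz hz' h
    simpa using this.symm

/-! ### Energy identity and regularity of weak solutions -/

lemma cauchySeq_of_norm_sub_le {ι X Y : Type*} [Fintype ι] [NormedAddCommGroup X]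
    [NormedAddCommGroup Y] {s : ι → ℕ → X} {l : ι → X} {y : ℕ → Y} {C : ℝ} (hC : 0 ≤ C)
    (hs : ∀ i, Tendsto (s i) atTop (𝓝 (l i)))
    (h : ∀ n m, ‖y n - y m‖ ≤ C * ∑ i, ‖s i n - s i m‖) : CauchySeq y := by
  have hx : CauchySeq (fun n i => s i n) := (tendsto_pi_nhds.2 hs).cauchySeq
  rw [Metric.cauchySeq_iff] at hx ⊢; intro ε hε
  set K : ℝ := C * Fintype.card ι + 1
  have hK : 0 < K := by positivity
  obtain ⟨N, hN⟩ := hx (ε / K) (by positivity)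
  refine ⟨N, fun m hm n hn => ?_⟩
  have h1 := hN m hm n hn
  rw [dist_eq_norm] at h1 ⊢
  have h2 : ∀ i ∈ Finset.univ, ‖s i m - s i n‖ ≤ ε / K := fun i _ =>
    (norm_le_pi_norm ((fun i => s i m) - fun i => s i n) i).trans h1.le
  have h3 := sum_le_sum h2
  rw [Finset.sum_const, nsmul_eq_mul, Finset.card_univ] at h3
  calc _ ≤ C * (Fintype.card ι * (ε / K)) := (h m n).trans (by gcongr)
    _ = (C * Fintype.card ι) * ε / K := by ring
    _ < K * ε / K := by
      gcongr; exact lt_add_one _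
    _ = ε := by field_simp

lemma inner_lv_dA (j : Fin 3) (U V : Dom) :
    inner ℂ (lv U) (lv (dA j V)) = inner ℂ (lv (dC j U)) (lv V) := by
  rw [(inner_lv _ _).2, (inner_lv _ _).2]
  simp only [fib_dA, fib_dC, ip_An]

lemma inner_lv_dC (j : Fin 3) (U V : Dom) :
    inner ℂ (lv U) (lv (dC j V)) = inner ℂ (lv (dA j U)) (lv V) := by
  rw [(inner_lv _ _).2, (inner_lv _ _).2]
  simp only [fib_dA, fib_dC, ip_Cr]

lemma re_inner_lv_dP (U : Dom) : (inner ℂ (lv U) (lv (dP U)) : ℂ).re = ∑ j, ‖lv (dA j U)‖ ^ 2 := by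
  have h := inner_lv U (dP U)
  have h2 : (∫ ξ, ip (fib ξ U) (fib ξ (dP U))).re = ∫ ξ, (ip (fib ξ U) (fib ξ (dP U))).re :=
    (integral_re h.1).symm
  rw [h.2, h2]; simp only [norm_lv_sq, fib_dP, re_ip_Pk, ← fib_dA]
  exact integral_finsetSum _ fun j _ => integrable_nn_sq (dA j U)

lemma norm_lv_dC_le (j : Fin 3) (U : Dom) : ‖lv (dC j U)‖ ≤ ‖lv (dA j U)‖ + ‖lv U‖ := by
  have h : ‖lv (dC j U)‖ ^ 2 = ‖lv (dA j U)‖ ^ 2 + ‖lv U‖ ^ 2 := by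
    simp only [norm_lv_sq, fib_dC, fib_dA, nn_Cr_sq]
    refine integral_add ?_ (integrable_nn_sq U)
    simp only [← fib_dA]
    exact integrable_nn_sq (dA j U)
  nlinarith [lv_nonneg (dC j U), lv_nonneg (dA j U), lv_nonneg U]

/-- The negative spectral parameter at which weak solutions are approximated. -/
def zN : ℂ := ((-dl : ℝ) : ℂ)

lemma norm_zN : ‖zN‖ ≤ dl := by rw [zN, norm_real, norm_neg, Real.norm_of_nonneg dl_pos.le]

lemma zN_notMem : zN ∉ halfLine := by
  rintro ⟨t, ht, h⟩
  have := Complex.ofReal_injective h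
  have h2 : (0 : ℝ) ≤ t := ht
  linarith [dl_pos]

/-- The constant of the estimate of solutions of `(P₀ - zN) U = F`. -/
def cR : ℝ := (exists_hn_le norm_zN zN_notMem).choose

lemma cR_pos : 0 < cR := (exists_hn_le norm_zN zN_notMem).choose_spec.1

lemma hn_le_cR {U F0 : Dom} {F1 F2 : Fin 3 → Dom} (h : dP U = dR F0 F1 F2) :
    hn U ≤ cR * (rN F0 F1 F2 + ‖lv U‖) := by
  have h1 := (exists_hn_le norm_zN zN_notMem).choose_spec.2 U (F0 - zN • U) F1 F2
    (by rw [h]; unfold dR; abel)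
  refine h1.trans (mul_le_mul_of_nonneg_left ?_ cR_pos.le)
  have h2 : ‖lv (F0 - zN • U)‖ ≤ ‖lv F0‖ + ‖lv U‖ := by
    rw [map_sub, map_smul]
    refine (norm_sub_le _ _).trans (add_le_add_right ?_ _); rw [norm_smul]
    exact mul_le_of_le_one_left (norm_nonneg _) (norm_zN.trans dl_le_one)
  unfold rN; linarith

/-- The size of the data of a weak equation. -/
def dataN (w f0 : L2) (f1 f2 : Fin 3 → L2) : ℝ := ‖f0‖ + ∑ j, ‖f1 j‖ + ∑ j, ‖f2 j‖ + ‖w‖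

/-- Weak solutions with square integrable data are limits of elements of the core, together with
their data and their first derivatives in the velocity. -/
lemma WData.exists_approx {w f0 : L2} {f1 f2 : Fin 3 → L2} (h : WData w f0 f1 f2) :
    ∃ (U F0 : ℕ → Dom) (F1 F2 : ℕ → Fin 3 → Dom) (a c : Fin 3 → L2),
      (∀ n, dP (U n) = dR (F0 n) (F1 n) (F2 n)) ∧
      Tendsto (fun n => lv (U n)) atTop (𝓝 w) ∧ Tendsto (fun n => lv (F0 n)) atTop (𝓝 f0) ∧
      (∀ j, Tendsto (fun n => lv (F1 n j)) atTop (𝓝 (f1 j))) ∧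
      (∀ j, Tendsto (fun n => lv (F2 n j)) atTop (𝓝 (f2 j))) ∧
      (∀ j, Tendsto (fun n => lv (dA j (U n))) atTop (𝓝 (a j))) ∧
      (∀ j, Tendsto (fun n => lv (dC j (U n))) atTop (𝓝 (c j))) := by
  have hseq : ∀ f : L2, ∃ F : ℕ → Dom, Tendsto (fun n => lv (F n)) atTop (𝓝 f) := by
    intro f
    obtain ⟨u, hu, hlim⟩ := mem_closure_iff_seq_limit.1 (denseRange_lv f)
    choose F hF using hu
    exact ⟨F, by simpa only [hF] using hlim⟩
  obtain ⟨G, hG⟩ := hseq (f0 - zN • w)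
  choose F1 hF1 using fun j => hseq (f1 j)
  choose F2 hF2 using fun j => hseq (f2 j)
  choose U hU using fun n => exists_sol zN_notMem (dR (G n) (fun j => F1 j n) (fun j => F2 j n))
  have hUw : Tendsto (fun n => lv (U n)) atTop (𝓝 w) := by
    have e : ∀ n, lv (U n) = RR zN (lv (G n)) + ∑ j, RA zN j (lv (F1 j n)) +
        ∑ j, RC zN j (lv (F2 j n)) := by
      intro n; rw [← RR_lv norm_zN zN_notMem (hU n)]
      simp only [dR, map_add, map_sum, RA_lv norm_zN zN_notMem, RC_lv norm_zN zN_notMem]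
    rw [eq_resolvent norm_zN zN_notMem h]; simp only [e]
    exact ((((RR zN).continuous.tendsto _).comp hG).add
      (tendsto_finsetSum _ fun j _ => ((RA zN j).continuous.tendsto _).comp (hF1 j))).add
      (tendsto_finsetSum _ fun j _ => ((RC zN j).continuous.tendsto _).comp (hF2 j))
  set F0 : ℕ → Dom := fun n => G n + zN • U n with hF0
  have hF0lim : Tendsto (fun n => lv (F0 n)) atTop (𝓝 f0) := by
    have := hG.add (hUw.const_smul zN)
    simpa [hF0] using this
  have hdP : ∀ n, dP (U n) = dR (F0 n) (fun j => F1 j n) (fun j => F2 j n) := by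
    intro n
    have : dP (U n) = dR (G n) (fun j => F1 j n) (fun j => F2 j n) + zN • U n := by
      rw [← hU n]; abel
    rw [this]; simp only [hF0, dR]; module
  have hdiff : ∀ n m, hn (U n - U m) ≤ cR * ∑ i : Option (Unit ⊕ Fin 3 ⊕ Fin 3),
      ‖i.elim (fun n => lv (U n)) (dataFam (fun n => lv (F0 n)) (fun j n => lv (F1 j n))
        (fun j n => lv (F2 j n))) n - i.elim (fun n => lv (U n))
        (dataFam (fun n => lv (F0 n)) (fun j n => lv (F1 j n)) (fun j n => lv (F2 j n))) m‖ := by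
    intro n m
    have h1 : dP (U n - U m) = dR (F0 n - F0 m) (fun j => F1 j n - F1 j m)
        (fun j => F2 j n - F2 j m) := by
      rw [map_sub, hdP, hdP]
      simp only [dR, map_sub, Finset.sum_sub_distrib]; abel
    refine (hn_le_cR h1).trans (le_of_eq ?_)
    rw [Fintype.sum_option]
    have h2 := sum_dataFam (fun n => lv (F0 n)) (fun j n => lv (F1 j n)) (fun j n => lv (F2 j n))
      (fun s => ‖s n - s m‖)
    simp only [Option.elim]; rw [h2, rN]
    simp only [map_sub]; ring
  have hlim : ∀ i : Option (Unit ⊕ Fin 3 ⊕ Fin 3), Tendsto (i.elim (fun n => lv (U n))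
      (dataFam (fun n => lv (F0 n)) (fun j n => lv (F1 j n)) (fun j n => lv (F2 j n)))) atTop
      (𝓝 (i.elim w (dataFam f0 f1 f2))) := by
    rintro (_ | (i | (i | i)))
    · exact hUw
    · exact hF0lim
    · exact hF1 i
    · exact hF2 i
  have hA : ∀ j, CauchySeq (fun n => lv (dA j (U n))) := fun j =>
    cauchySeq_of_norm_sub_le cR_pos.le hlim fun n m => by
      rw [← map_sub, ← map_sub]
      exact (norm_lv_dA_le_hn j _).trans (hdiff n m)
  have hC : ∀ j, CauchySeq (fun n => lv (dC j (U n))) := fun j =>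
    cauchySeq_of_norm_sub_le (mul_nonneg zero_le_two cR_pos.le) hlim fun n m => by
      rw [← map_sub, ← map_sub]
      refine (norm_lv_dC_le j _).trans ?_
      have h1 := norm_lv_dA_le_hn j (U n - U m)
      have h2 := norm_lv_le_hn (U n - U m)
      have h3 := hdiff n m
      linarith
  choose a ha using fun j => cauchySeq_tendsto_of_complete (hA j)
  choose c hc using fun j => cauchySeq_tendsto_of_complete (hC j)
  exact ⟨U, F0, fun n j => F1 j n, fun n j => F2 j n, a, c, hdP, hUw, hF0lim, hF1, hF2, ha, hc⟩

lemma tendsto_bp {u : ℕ → L2} {w : L2} (h : Tendsto u atTop (𝓝 w)) (Φ : S6) :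
    Tendsto (fun n => bp (u n) Φ) atTop (𝓝 (bp w Φ)) := ((bpL Φ).continuous.tendsto w).comp h

/-- **Energy identity** for weak solutions. -/
lemma WData.exists_energy {w f0 : L2} {f1 f2 : Fin 3 → L2} (h : WData w f0 f1 f2) :
    ∃ a c : Fin 3 → L2, (∀ j Φ, bp (a j) Φ = bp w (qC j Φ)) ∧ (∀ j Φ, bp (c j) Φ = bp w (qA j Φ)) ∧
      ∑ j, ‖a j‖ ^ 2 = (inner ℂ w f0 + ∑ j, inner ℂ (c j) (f1 j) +
        ∑ j, inner ℂ (a j) (f2 j) : ℂ).re ∧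
      (∀ j, ‖a j‖ ≤ cR * dataN w f0 f1 f2) ∧ (∀ j, ‖c j‖ ≤ 2 * cR * dataN w f0 f1 f2) := by
  obtain ⟨U, F0, F1, F2, a, c, hdP, hU, h0, h1, h2, ha, hc⟩ := h.exists_approx
  have hrN : Tendsto (fun n => cR * (rN (F0 n) (F1 n) (F2 n) + ‖lv (U n)‖)) atTop
      (𝓝 (cR * dataN w f0 f1 f2)) := by
    refine Tendsto.const_mul _ (Tendsto.add (Tendsto.add (Tendsto.add h0.norm ?_) ?_) hU.norm)
    · exact tendsto_finsetSum _ fun j _ => (h1 j).norm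
    · exact tendsto_finsetSum _ fun j _ => (h2 j).norm
  refine ⟨a, c, fun j Φ => ?_, fun j Φ => ?_, ?_, fun j => ?_, fun j => ?_⟩
  · refine tendsto_nhds_unique (tendsto_bp (ha j) Φ) ?_
    simp only [lv_apply, phys_dA, ← bp_qC]
    exact tendsto_bp hU _
  · refine tendsto_nhds_unique (tendsto_bp (hc j) Φ) ?_
    simp only [lv_apply, phys_dC, ← bp_qA]
    exact tendsto_bp hU _
  · have e : ∀ n, ∑ j, ‖lv (dA j (U n))‖ ^ 2 = (inner ℂ (lv (U n)) (lv (F0 n)) +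
        ∑ j, inner ℂ (lv (dC j (U n))) (lv (F1 n j)) +
        ∑ j, inner ℂ (lv (dA j (U n))) (lv (F2 n j)) : ℂ).re := by
      intro n; rw [← re_inner_lv_dP, hdP n]
      simp only [dR, map_add, map_sum, inner_add_right, inner_sum, inner_lv_dA, inner_lv_dC]
    refine tendsto_nhds_unique (tendsto_finsetSum _ fun j _ => ((ha j).norm.pow 2)) ?_
    simp only [e]; refine (Complex.continuous_re.tendsto _).comp ?_
    exact ((hU.inner h0).add (tendsto_finsetSum _ fun j _ => (hc j).inner (h1 j))).add
      (tendsto_finsetSum _ fun j _ => (ha j).inner (h2 j))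
  · refine le_of_tendsto_of_tendsto' (ha j).norm hrN fun n => ?_
    exact (norm_lv_dA_le_hn j _).trans (hn_le_cR (hdP n))
  · have h3 := hrN.const_mul 2
    rw [← mul_assoc] at h3
    refine le_of_tendsto_of_tendsto' (hc j).norm h3 fun n => ?_
    have := hn_le_cR (hdP n)
    have h4 := norm_lv_dC_le j (U n)
    have h5 := norm_lv_dA_le_hn j (U n)
    have h6 := norm_lv_le_hn (U n)
    linarith

/-! ### Translations -/

/-- Translation on `L²`: `(tau a f)(p) = f(p - a)`. -/
def tau (a : Phase) : L2 →ₗᵢ[ℂ] L2 :=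
  Lp.compMeasurePreservingₗᵢ ℂ (fun p => p - a) (measurePreserving_sub_right volume a)

lemma coeFn_tau (a : Phase) (f : L2) : ⇑(tau a f) =ᵐ[volume] fun p => (f : Phase → ℂ) (p - a) :=
  Lp.coeFn_compMeasurePreserving f (measurePreserving_sub_right volume a)

lemma tau_toL (a : Phase) (Φ : S6) : tau a (toL Φ) = toL (SchwartzMap.compSubConstCLM ℂ a Φ) := by
  refine Lp.ext ?_
  have h2 := (measurePreserving_sub_right (volume : Measure Phase)
    a).quasiMeasurePreserving.ae_eq_comp (coeFn_toL Φ)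
  filter_upwards [coeFn_tau a (toL Φ), h2, coeFn_toL (SchwartzMap.compSubConstCLM ℂ a Φ)]
    with p h3 h4 h5
  rw [h3, h5]; exact h4

lemma contDiff_char (h : E3) : ContDiff ℝ ∞ (fun ξ => exp (-(I * (inner ℝ (kk ξ) h : ℝ)))) := by
  have h1 : ContDiff ℝ ∞ (fun ξ => (inner ℝ (kk ξ) h : ℝ)) := contDiff_kk.inner ℝ contDiff_const
  exact (contDiff_const.mul (Complex.ofRealCLM.contDiff.comp h1)).neg.cexp

/-- Translation in `x` on the core. -/
def dT (h : E3) : Dom →ₗ[ℂ] Dom := TensorProduct.map LinearMap.id (mulc _ (contDiff_char h))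

lemma fib_dT (ξ h : E3) (U : Dom) :
    fib ξ (dT h U) = exp (-(I * (inner ℝ (kk ξ) h : ℝ))) • fib ξ U := by
  induction U using TensorProduct.induction_on with
  | zero => simp
  | add U V hU hV => simp only [map_add, hU, hV, smul_add]
  | tmul p a =>
    rw [dT, TensorProduct.map_tmul, LinearMap.id_apply, fib_tmul, fib_tmul, mulc_apply, mul_smul]

lemma ifr_mulc_char (h : E3) (a : Sc) (x : E3) : ifr (mulc _ (contDiff_char h) a) x =
    ifr a (x - h) := by
  rw [ifr_eq, ifr_eq, SchwartzMap.fourierInv_coe, SchwartzMap.fourierInv_coe, Real.fourierInv_eq',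
    Real.fourierInv_eq']
  congr 1; ext ξ
  rw [mulc_apply, smul_eq_mul, smul_eq_mul, ← mul_assoc, ← exp_add, inner_sub_right, kk,
    real_inner_smul_left]
  congr 2; push_cast; ring

lemma lv_dT (h : E3) (U : Dom) : lv (dT h U) = tau (h, 0) (lv U) := by
  rw [lv_apply, lv_apply, tau_toL]; congr 1
  induction U using TensorProduct.induction_on with
  | zero => simp
  | add U V hU hV => simp only [map_add, hU, hV]
  | tmul p a =>
    ext q
    rw [SchwartzMap.compSubConstCLM_apply, dT, TensorProduct.map_tmul, LinearMap.id_apply,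
      phys_tmul, phys_tmul, ifr_mulc_char]
    simp [sub_right_comm]

lemma norm_exp_sub_one_le (t : ℝ) : ‖exp (-(I * (t : ℂ))) - 1‖ ≤ 2 * |t| ^ (1 / 3 : ℝ) := by
  have e : -(I * (t : ℂ)) = I * ((-t : ℝ) : ℂ) := by push_cast; ring
  rw [e]; rcases le_total |t| 1 with h | h
  · refine (Real.norm_exp_I_mul_ofReal_sub_one_le).trans ?_
    rw [norm_neg, Real.norm_eq_abs]
    have h1 : |t| ^ (1 : ℝ) ≤ |t| ^ (1 / 3 : ℝ) := by
      rcases eq_or_lt_of_le (abs_nonneg t) with h0 | h0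
      · rw [← h0]; norm_num
      · exact Real.rpow_le_rpow_of_exponent_ge h0 h (by norm_num)
    rw [Real.rpow_one] at h1
    have : 0 ≤ |t| ^ (1 / 3 : ℝ) := by positivity
    linarith
  · have h1 : 1 ≤ |t| ^ (1 / 3 : ℝ) := Real.one_le_rpow h (by norm_num)
    refine (norm_sub_le _ _).trans ?_
    rw [mul_comm, Complex.norm_exp_ofReal_mul_I, norm_one]; linarith

/-- Hölder regularity in `x` of solutions in the core. -/
lemma norm_tau_fst_sub_le_core {U F0 : Dom} {F1 F2 : Fin 3 → Dom} (h : dP U = dR F0 F1 F2)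
    (y : E3) : ‖tau (y, 0) (lv U) - lv U‖ ≤
      176 * (1 + cR) * ‖y‖ ^ (1 / 3 : ℝ) * (rN F0 F1 F2 + ‖lv U‖) := by
  set Fam : (Unit ⊕ Fin 3 ⊕ Fin 3) ⊕ (Unit ⊕ Fin 3) → Dom :=
    Sum.elim (dataFam F0 F1 F2) (Sum.elim (fun _ => U) (fun j => dA j U)) with hFam
  have hsum : ∀ f : Dom → ℝ, ∑ i, f (Fam i) =
      (f F0 + ∑ j, f (F1 j) + ∑ j, f (F2 j)) + (f U + ∑ j, f (dA j U)) := by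
    intro f; rw [Fintype.sum_sum_type]
    simp only [hFam, Sum.elim_inl, Sum.elim_inr]
    rw [sum_dataFam F0 F1 F2 f, Fintype.sum_sum_type]; simp
  have hy : 0 ≤ ‖y‖ ^ (1 / 3 : ℝ) := by positivity
  have hfib : ∀ ξ, nn (fib ξ (dT y U - U)) ≤ 16 * ‖y‖ ^ (1 / 3 : ℝ) * ∑ i, nn (fib ξ (Fam i)) := by
    intro ξ; rw [hsum (fun U => nn (fib ξ U))]
    set w := fib ξ U
    set X := nn (fib ξ F0) + ∑ j, nn (fib ξ (F1 j)) + ∑ j, nn (fib ξ (F2 j)) +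
      (nn w + ∑ j, nn (fib ξ (dA j U))) with hX
    have hXe : X = rn (fib ξ F0) (fun j => fib ξ (F1 j)) (fun j => fib ξ (F2 j)) + nn w + dn w := by
      rw [hX, rn, dn]; simp only [fib_dA]; ring
    have hr := rn_nonneg (fib ξ F0) (fun j => fib ξ (F1 j)) (fun j => fib ξ (F2 j))
    have hd := dn_nonneg w
    have hw := nn_nonneg w
    have hX0 : 0 ≤ X := by rw [hXe]; linarith
    have e1 : fib ξ (dT y U - U) = (exp (-(I * (inner ℝ (kk ξ) y : ℝ))) - 1) • w := by
      rw [map_sub, fib_dT, sub_smul, one_smul]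
    rw [e1, nn_smul]
    have h1 : |(inner ℝ (kk ξ) y : ℝ)| ^ (1 / 3 : ℝ) ≤
        ‖kk ξ‖ ^ (1 / 3 : ℝ) * ‖y‖ ^ (1 / 3 : ℝ) := by
      rw [← Real.mul_rpow (norm_nonneg _) (norm_nonneg _)]
      exact Real.rpow_le_rpow (abs_nonneg _) (abs_real_inner_le_norm _ _) (by norm_num)
    have h2 : ‖kk ξ‖ ^ (1 / 3 : ℝ) * nn w ≤ 8 * X := by
      rcases le_total 1 ‖kk ξ‖ with hk | hk
      · have hk0 : 0 < ‖kk ξ‖ := by linarith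
        have h3 := rpow_mul_nn_sq_le hk (z := 0) (by simp) (w := w) (f0 := fib ξ F0)
          (f1 := fun j => fib ξ (F1 j)) (f2 := fun j => fib ξ (F2 j))
          (by rw [← fib_dR, ← h, fib_dP]; simp [w])
        rw [← hXe] at h3
        have h4 : (‖kk ξ‖ ^ (1 / 3 : ℝ)) ^ 2 * ‖kk ξ‖ ^ (-(2 / 3) : ℝ) = 1 := by
          rw [← Real.rpow_natCast, ← Real.rpow_mul hk0.le, ← Real.rpow_add hk0]; norm_num
        refine (sq_le_sq₀ (by positivity) (by positivity)).1 ?_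
        calc (‖kk ξ‖ ^ (1 / 3 : ℝ) * nn w) ^ 2 = (‖kk ξ‖ ^ (1 / 3 : ℝ)) ^ 2 * nn w ^ 2 := mul_pow _ _ _
          _ ≤ (‖kk ξ‖ ^ (1 / 3 : ℝ)) ^ 2 * (50 * ‖kk ξ‖ ^ (-(2 / 3) : ℝ) * X ^ 2) := by gcongr
          _ = 50 * X ^ 2 * ((‖kk ξ‖ ^ (1 / 3 : ℝ)) ^ 2 * ‖kk ξ‖ ^ (-(2 / 3) : ℝ)) := by ring
          _ ≤ (8 * X) ^ 2 := by rw [h4]; nlinarith [sq_nonneg X]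
      · have h3 : ‖kk ξ‖ ^ (1 / 3 : ℝ) ≤ 1 := Real.rpow_le_one (norm_nonneg _) hk (by norm_num)
        have h4 : ‖kk ξ‖ ^ (1 / 3 : ℝ) * nn w ≤ 1 * nn w := by gcongr
        have : nn w ≤ X := by rw [hXe]; linarith
        linarith
    calc _ ≤ (2 * (‖kk ξ‖ ^ (1 / 3 : ℝ) * ‖y‖ ^ (1 / 3 : ℝ))) * nn w := by
          gcongr; exact (norm_exp_sub_one_le _).trans (by gcongr)
      _ = 2 * ‖y‖ ^ (1 / 3 : ℝ) * (‖kk ξ‖ ^ (1 / 3 : ℝ) * nn w) := by ring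
      _ ≤ 2 * ‖y‖ ^ (1 / 3 : ℝ) * (8 * X) := by gcongr
      _ = _ := by ring
  have hmain := norm_lv_le (by positivity) hfib
  rw [hsum (fun U => ‖lv U‖), map_sub, lv_dT] at hmain
  have hc : (Fintype.card ((Unit ⊕ Fin 3 ⊕ Fin 3) ⊕ (Unit ⊕ Fin 3)) : ℝ) = 11 := by
    norm_num [Fintype.card_sum]
  rw [hc] at hmain
  have h1 := hn_le_cR h
  have h2 := rN_nonneg F0 F1 F2
  have h3 := lv_nonneg U
  refine hmain.trans ?_
  have h4 : (‖lv F0‖ + ∑ j, ‖lv (F1 j)‖ + ∑ j, ‖lv (F2 j)‖) + (‖lv U‖ + ∑ j, ‖lv (dA j U)‖) ≤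
      (1 + cR) * (rN F0 F1 F2 + ‖lv U‖) := by
    change rN F0 F1 F2 + hn U ≤ _
    nlinarith
  calc _ ≤ 16 * ‖y‖ ^ (1 / 3 : ℝ) * 11 * ((1 + cR) * (rN F0 F1 F2 + ‖lv U‖)) := by gcongr
    _ = _ := by ring

lemma WData.norm_tau_fst_sub_le {w f0 : L2} {f1 f2 : Fin 3 → L2} (h : WData w f0 f1 f2)
    (y : E3) : ‖tau (y, 0) w - w‖ ≤ 176 * (1 + cR) * ‖y‖ ^ (1 / 3 : ℝ) * dataN w f0 f1 f2 := by
  obtain ⟨U, F0, F1, F2, a, c, hdP, hU, h0, h1, h2, ha, hc⟩ := h.exists_approx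
  have hrN : Tendsto (fun n => 176 * (1 + cR) * ‖y‖ ^ (1 / 3 : ℝ) *
      (rN (F0 n) (F1 n) (F2 n) + ‖lv (U n)‖)) atTop
      (𝓝 (176 * (1 + cR) * ‖y‖ ^ (1 / 3 : ℝ) * dataN w f0 f1 f2)) := by
    refine Tendsto.const_mul _ (Tendsto.add (Tendsto.add (Tendsto.add h0.norm ?_) ?_) hU.norm)
    · exact tendsto_finsetSum _ fun j _ => (h1 j).norm
    · exact tendsto_finsetSum _ fun j _ => (h2 j).norm
  refine le_of_tendsto_of_tendsto' ((((tau (y, 0)).continuous.tendsto _).comp hU).sub hU).norm hrN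
    fun n => norm_tau_fst_sub_le_core (hdP n) y

/-- The restriction of a Schwartz function to a fixed position. -/
def slice (x : E3) : S6 →L[ℂ] S3 :=
  SchwartzMap.compCLMOfAntilipschitz ℂ (K := 1) (g := fun v : E3 => ((x, v) : Phase)) (by
      have h1 : (fun v : E3 => ((0, v) : Phase)).HasTemperateGrowth :=
        (ContinuousLinearMap.inr ℝ E3 E3).hasTemperateGrowth
      have h2 := (Function.HasTemperateGrowth.const (E := E3) ((x, 0) : Phase)).add h1
      have e : (fun v : E3 => ((x, v) : Phase)) = (fun _ : E3 => ((x, 0) : Phase)) +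
          fun v : E3 => ((0, v) : Phase) := by
        ext v <;> simp
      rw [e]; exact h2)
    (AntilipschitzWith.of_le_mul_dist fun v w => by simp [Prod.dist_eq])

@[simp] lemma slice_apply (x : E3) (Φ : S6) (v : E3) : slice x Φ v = Φ (x, v) := rfl

lemma pd_slice (j : Fin 3) (x : E3) (Φ : S6) : pd j (slice x Φ) = slice x (qD j Φ) := by
  ext v
  have h : HasFDerivAt (slice x Φ) ((fderiv ℝ Φ (x, v)).comp (ContinuousLinearMap.inr ℝ E3 E3)) v :=
    (Φ.hasFDerivAt (x, v)).comp v (hasFDerivAt_prodMk_right x v)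
  rw [pd_apply, h.fderiv, slice_apply, qD_apply]; simp

lemma integrable_norm_sq (Φ : S6) :
    Integrable (fun p => ‖Φ p‖ ^ 2) ((volume : Measure E3).prod volume) :=
  (Φ.memLp 2 volume).integrable_norm_pow (by norm_num)

lemma norm_toL_sq (Φ : S6) : ‖toL Φ‖ ^ 2 = ∫ x, nn (slice x Φ) ^ 2 := by
  have h : (‖toL Φ‖ ^ 2 : ℝ) = ∫ p, ‖Φ p‖ ^ 2 := by
    have h1 := inner_toL Φ Φ
    have h2 : ∀ p, conj (Φ p) * Φ p = ((‖Φ p‖ ^ 2 : ℝ) : ℂ) := by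
      intro p; rw [mul_comm, Complex.mul_conj, Complex.normSq_eq_norm_sq]
    simp_rw [h2] at h1
    rw [inner_self_eq_norm_sq_to_K] at h1
    exact_mod_cast h1.trans integral_ofReal
  rw [h, volume_eq_prod, integral_prod _ (integrable_norm_sq Φ)]
  simp only [nn_sq, slice_apply]

lemma integrable_nn_slice (Φ : S6) : Integrable (fun x => nn (slice x Φ) ^ 2) := by
  have := (integrable_norm_sq Φ).integral_prod_left
  simpa only [nn_sq, slice_apply] using this

lemma norm_tau_snd_sub_le_toL (Φ : S6) (y : E3) :
    ‖tau (0, y) (toL Φ) - toL Φ‖ ≤ 2 * ‖y‖ * ∑ j, ‖toL (qD j Φ)‖ := by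
  have h1 : ‖tau (0, y) (toL Φ) - toL Φ‖ ^ 2 ≤ 3 * ‖y‖ ^ 2 * ∑ j, ‖toL (qD j Φ)‖ ^ 2 := by
    rw [tau_toL, ← map_sub]
    simp only [norm_toL_sq]
    rw [← integral_finsetSum _ fun j _ => integrable_nn_slice (qD j Φ), ← integral_const_mul]
    refine integral_mono (integrable_nn_slice _)
      ((integrable_finsetSum _ fun j _ => integrable_nn_slice (qD j Φ)).const_mul _) fun x => ?_
    have e : slice x (SchwartzMap.compSubConstCLM ℂ (0, y) Φ - Φ) =
        tr y (slice x Φ) - slice x Φ := by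
      ext v; simp [SchwartzMap.compSubConstCLM_apply]
    have h2 := pow_le_pow_left₀ (nn_nonneg _) (nn_tr_sub_le y (slice x Φ)) 2
    have h3 := sq_sum_le_card_mul_sum_sq (s := (Finset.univ : Finset (Fin 3)))
      (f := fun j => nn (pd j (slice x Φ)))
    simp only [Finset.card_univ, Fintype.card_fin, pd_slice] at h2 h3; dsimp only; rw [e]
    calc _ ≤ _ := h2
      _ = ‖y‖ ^ 2 * (∑ j, nn (slice x (qD j Φ))) ^ 2 := mul_pow _ _ _
      _ ≤ ‖y‖ ^ 2 * ((3 : ℕ) * ∑ j, nn (slice x (qD j Φ)) ^ 2) := by gcongr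
      _ = _ := by push_cast; ring
  have h4 : ∑ j, ‖toL (qD j Φ)‖ ^ 2 ≤ (∑ j, ‖toL (qD j Φ)‖) ^ 2 :=
    Finset.sum_sq_le_sq_sum_of_nonneg fun _ _ => norm_nonneg _
  have hS : 0 ≤ ∑ j, ‖toL (qD j Φ)‖ := sum_nonneg fun _ _ => norm_nonneg _
  refine (sq_le_sq₀ (norm_nonneg _) (by positivity)).1 (h1.trans ?_)
  rw [mul_pow, mul_pow]; gcongr; norm_num

lemma qD_eq (j : Fin 3) (Φ : S6) : (2 : ℂ) • qD j Φ = qA j Φ - qC j Φ := by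
  ext p; simp only [smul_apply, sub_apply, qA_apply, qC_apply, qD_apply, smul_eq_mul]; ring

lemma WData.norm_tau_snd_sub_le {w f0 : L2} {f1 f2 : Fin 3 → L2} (h : WData w f0 f1 f2)
    (y : E3) : ‖tau (0, y) w - w‖ ≤ 9 * cR * ‖y‖ * dataN w f0 f1 f2 := by
  obtain ⟨U, F0, F1, F2, a, c, hdP, hU, h0, h1, h2, ha, hc⟩ := h.exists_approx
  have hrN : Tendsto (fun n => 9 * cR * ‖y‖ * (rN (F0 n) (F1 n) (F2 n) + ‖lv (U n)‖)) atTop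
      (𝓝 (9 * cR * ‖y‖ * dataN w f0 f1 f2)) := by
    refine Tendsto.const_mul _ (Tendsto.add (Tendsto.add (Tendsto.add h0.norm ?_) ?_) hU.norm)
    · exact tendsto_finsetSum _ fun j _ => (h1 j).norm
    · exact tendsto_finsetSum _ fun j _ => (h2 j).norm
  refine le_of_tendsto_of_tendsto' ((((tau (0, y)).continuous.tendsto _).comp hU).sub hU).norm hrN
    fun n => ?_
  refine (norm_tau_snd_sub_le_toL _ y).trans ?_
  have hD : ∀ j ∈ Finset.univ, ‖toL (qD j (phys (U n)))‖ ≤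
      3 / 2 * (cR * (rN (F0 n) (F1 n) (F2 n) + ‖lv (U n)‖)) := by
    intro j _
    have e := congrArg (fun f => ‖toL f‖) (qD_eq j (phys (U n)))
    simp only [map_smul, map_sub, norm_smul, Complex.norm_ofNat] at e
    have h3 := norm_sub_le (toL (qA j (phys (U n)))) (toL (qC j (phys (U n))))
    rw [← phys_dA, ← phys_dC, ← lv_apply, ← lv_apply] at h3
    rw [← phys_dA, ← phys_dC, ← lv_apply, ← lv_apply] at e
    have h4 := norm_lv_dC_le j (U n)
    have h5 := norm_lv_dA_le_hn j (U n)
    have h6 := norm_lv_le_hn (U n)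
    have h7 := hn_le_cR (hdP n)
    linarith
  have h8 := sum_le_sum hD
  simp only [Finset.sum_const, Finset.card_univ, Fintype.card_fin, nsmul_eq_mul] at h8
  push_cast at h8
  have hy := norm_nonneg y
  calc _ ≤ 2 * ‖y‖ * (3 * (3 / 2 * (cR * (rN (F0 n) (F1 n) (F2 n) + ‖lv (U n)‖)))) := by gcongr
    _ = _ := by ring

/-! ### Weights -/

lemma one_le_bracket (x : E3) : 1 ≤ bracket x := Real.one_le_sqrt.2 (by nlinarith [sq_nonneg ‖x‖])

lemma bracket_pos (x : E3) : 0 < bracket x := one_pos.trans_le (one_le_bracket x)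

lemma continuous_bracket : Continuous bracket := by unfold bracket; fun_prop

lemma bracket_rpow (x : E3) (r : ℝ) : bracket x ^ r = (1 + ‖x‖ ^ 2) ^ (r / 2) := by
  rw [bracket, Real.sqrt_eq_rpow, ← Real.rpow_mul (by positivity)]
  congr 1; ring

lemma continuous_bracket_rpow (r : ℝ) : Continuous fun x : E3 => bracket x ^ r :=
  continuous_bracket.rpow_const fun x => Or.inl (bracket_pos x).ne'

/-- The weight `⟨x⟩^{2s}`. -/
def wt (s : ℝ) (x : E3) : ℝ≥0∞ := ofReal (bracket x ^ (2 * s))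

lemma measurable_wt (s : ℝ) : Measurable (wt s) :=
  (continuous_bracket_rpow _).measurable.ennreal_ofReal

lemma wt_mul (s t : ℝ) (x : E3) : wt s x * wt t x = wt (s + t) x := by
  have := bracket_pos x
  rw [wt, wt, wt, ← ofReal_mul (by positivity), ← Real.rpow_add this]
  congr 2; ring

lemma wt_mono {s t : ℝ} (h : s ≤ t) (x : E3) : wt s x ≤ wt t x :=
  ofReal_le_ofReal (Real.rpow_le_rpow_of_exponent_le (one_le_bracket x) (by linarith))

lemma wt_zero (x : E3) : wt 0 x = 1 := by simp [wt]

lemma wt_neg_mul (s : ℝ) (x : E3) : wt (-s) x * wt s x = 1 := by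
  rw [wt_mul, neg_add_cancel, wt_zero]

lemma wt_mul_neg (s : ℝ) (x : E3) : wt s x * wt (-s) x = 1 := by
  rw [wt_mul, add_neg_cancel, wt_zero]

lemma wt_ne_top (s : ℝ) (x : E3) : wt s x ≠ ⊤ := ofReal_ne_top

lemma wt_ne_zero (s : ℝ) (x : E3) : wt s x ≠ 0 := by
  have := bracket_pos x
  simp only [wt, ne_eq, ENNReal.ofReal_eq_zero, not_le]; positivity

lemma wt_neg_eq (s : ℝ) (x : E3) : wt s (-x) = wt s x := by simp [wt, bracket]

lemma bracket_add_sq_le (x y : E3) : 1 + ‖x + y‖ ^ 2 ≤ 2 * ((1 + ‖x‖ ^ 2) * (1 + ‖y‖ ^ 2)) := by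
  have h := norm_add_le x y
  have h2 : ‖x + y‖ ^ 2 ≤ (‖x‖ + ‖y‖) ^ 2 := by gcongr
  nlinarith [sq_nonneg (‖x‖ - ‖y‖), sq_nonneg (‖x‖ * ‖y‖)]

/-- The constant in Peetre's inequality. -/
def cW (s : ℝ) : ℝ≥0∞ := ofReal (2 ^ |s|)

lemma cW_ne_top (s : ℝ) : cW s ≠ ⊤ := ofReal_ne_top

lemma wt_add_le_of_nonneg {s : ℝ} (hs : 0 ≤ s) (x y : E3) :
    wt s (x + y) ≤ cW s * wt s x * wt s y := by
  have := bracket_pos x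
  have := bracket_pos y
  rw [cW, wt, wt, wt, ← ofReal_mul (by positivity), ← ofReal_mul (by positivity)]
  refine ofReal_le_ofReal ?_
  rw [bracket_rpow, bracket_rpow, bracket_rpow, abs_of_nonneg hs, mul_div_cancel_left₀ _ two_ne_zero,
    mul_assoc, ← Real.mul_rpow (by positivity) (by positivity),
    ← Real.mul_rpow (by positivity) (by positivity)]
  exact Real.rpow_le_rpow (by positivity) (bracket_add_sq_le x y) hs

/-- Peetre's inequality. -/
lemma wt_add_le (s : ℝ) (x y : E3) : wt s (x + y) ≤ cW s * wt s x * wt |s| y := by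
  rcases le_total 0 s with hs | hs
  · rw [abs_of_nonneg hs]; exact wt_add_le_of_nonneg hs x y
  · rw [abs_of_nonpos hs]
    have h := wt_add_le_of_nonneg (neg_nonneg.2 hs) (x + y) (-y)
    rw [add_neg_cancel_right, wt_neg_eq] at h
    have hc : cW (-s) = cW s := by simp [cW]
    calc wt s (x + y) = wt s x * (wt (-s) x * wt s (x + y)) := by
          rw [← mul_assoc, wt_mul_neg, one_mul]
      _ ≤ wt s x * (cW (-s) * wt (-s) (x + y) * wt (-s) y * wt s (x + y)) := by gcongr
      _ = cW s * wt s x * wt (-s) y * (wt (-s) (x + y) * wt s (x + y)) := by rw [hc]; ring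
      _ = _ := by rw [wt_neg_mul, mul_one]

lemma lintegral_wt_lt_top {s : ℝ} (hs : 3 / 2 < s) : ∫⁻ x : E3, wt (-s) x < ⊤ := by
  have h := integrable_rpow_neg_one_add_norm_sq (E := E3) (μ := volume) (r := 2 * s)
    (by simp; linarith)
  have h2 := h.lintegral_lt_top
  refine lt_of_eq_of_lt (lintegral_congr fun x => ?_) h2
  rw [wt, bracket_rpow]; congr 2; ring

lemma lintegral_lintegral_mul_sub {f g : E3 → ℝ≥0∞} (hf : Measurable f) (hg : Measurable g) :
    ∫⁻ x, ∫⁻ y, f x * g (x - y) = (∫⁻ x, f x) * ∫⁻ y, g y := by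
  have : ∀ x, ∫⁻ y, f x * g (x - y) = f x * ∫⁻ y, g y := fun x => by
    rw [lintegral_const_mul _ (by fun_prop), lintegral_sub_left_eq_self]
  simp only [this]
  rw [lintegral_mul_const _ hf]

lemma lintegral_lintegral_sub_mul {f g : E3 → ℝ≥0∞} (hf : Measurable f) (hg : Measurable g) :
    ∫⁻ x, ∫⁻ y, g (x - y) * f y = (∫⁻ x, g x) * ∫⁻ y, f y := by
  rw [lintegral_lintegral_swap (by fun_prop)]
  have : ∀ y, ∫⁻ x, g (x - y) * f y = (∫⁻ x, g x) * f y := fun y => by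
    rw [lintegral_mul_const _ (by fun_prop), lintegral_sub_right_eq_self]
  simp only [this]
  rw [lintegral_const_mul _ hf]

/-- A product of powers is bounded by the extreme products: the exponent vector is a convex
combination of `(q, q, 0)`, `(0, q, q)` and `(q, 0, q)`. -/
lemma mul_rpow_le_three {A B D a b c q : ℝ} (hA : 0 < A) (hB : 0 < B) (hD : 0 < D) (hq : 0 < q)
    (ha : a ≤ q) (hb : b ≤ q) (hc : c ≤ q) (h : a + b + c = 2 * q) :
    A ^ (-a) * B ^ (-b) * D ^ (-c) ≤
      A ^ (-q) * B ^ (-q) + B ^ (-q) * D ^ (-q) + A ^ (-q) * D ^ (-q) := by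
  have hw : ∀ x, x ≤ q → 0 ≤ 1 - x / q := fun x hx => by rw [sub_nonneg, div_le_one hq]; exact hx
  have hsum : (1 - c / q) + (1 - a / q) + (1 - b / q) = 1 := by field_simp; linarith
  have key := Real.geom_mean_le_arith_mean3_weighted (hw c hc) (hw a ha) (hw b hb)
    (p₁ := A ^ (-q) * B ^ (-q)) (p₂ := B ^ (-q) * D ^ (-q)) (p₃ := A ^ (-q) * D ^ (-q))
    (by positivity) (by positivity) (by positivity) hsum
  have hle1 : ∀ x p : ℝ, 0 ≤ x → 0 ≤ p → (1 - x / q) * p ≤ p := fun x p hx hp => by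
    have : 0 ≤ x / q := by positivity
    nlinarith
  refine le_trans (le_of_eq ?_) (key.trans (add_le_add (add_le_add
    (hle1 c _ (by linarith) (by positivity)) (hle1 a _ (by linarith) (by positivity)))
    (hle1 b _ (by linarith) (by positivity))))
  rw [Real.mul_rpow (by positivity) (by positivity), Real.mul_rpow (by positivity) (by positivity),
    Real.mul_rpow (by positivity) (by positivity), ← Real.rpow_mul hA.le, ← Real.rpow_mul hA.le,
    ← Real.rpow_mul hB.le, ← Real.rpow_mul hB.le, ← Real.rpow_mul hD.le, ← Real.rpow_mul hD.le]
  have e1 : A ^ (-a) = A ^ (-q * (1 - c / q)) * A ^ (-q * (1 - b / q)) := by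
    rw [← Real.rpow_add hA]; congr 1; field_simp; linarith
  have e2 : B ^ (-b) = B ^ (-q * (1 - c / q)) * B ^ (-q * (1 - a / q)) := by
    rw [← Real.rpow_add hB]; congr 1; field_simp; linarith
  have e3 : D ^ (-c) = D ^ (-q * (1 - a / q)) * D ^ (-q * (1 - b / q)) := by
    rw [← Real.rpow_add hD]; congr 1; field_simp; linarith
  rw [e1, e2, e3]; ring

lemma wt_mul_wt_mul_wt_le {a b c q : ℝ} (hq : 0 < q) (ha : a ≤ q) (hb : b ≤ q) (hc : c ≤ q)
    (h : a + b + c = 2 * q) (x y w : E3) : wt (-a) x * wt (-b) y * wt (-c) w ≤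
      wt (-q) x * wt (-q) y + wt (-q) y * wt (-q) w + wt (-q) x * wt (-q) w := by
  have := bracket_pos x
  have := bracket_pos y
  have := bracket_pos w
  simp only [wt]
  rw [← ofReal_mul (by positivity), ← ofReal_mul (by positivity),
    ← ofReal_mul (by positivity), ← ofReal_mul (by positivity),
    ← ofReal_mul (by positivity), ← ENNReal.ofReal_add (by positivity) (by positivity),
    ← ENNReal.ofReal_add (by positivity) (by positivity)]
  refine ofReal_le_ofReal ?_
  simp only [Real.rpow_mul (bracket_pos _).le]
  exact mul_rpow_le_three (by positivity) (by positivity) (by positivity) hq ha hb hc h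

lemma wt_mul_wt_le {a b : ℝ} (ha : 0 ≤ a) (hb : 0 ≤ b) (x y : E3) :
    wt (-a) x * wt (-b) y ≤ wt (-(a + b)) x + wt (-(a + b)) y := by
  have anti : ∀ (s : ℝ) (x y : E3), 0 ≤ s → bracket x ≤ bracket y → wt (-s) y ≤ wt (-s) x := by
    intro s x y hs h
    exact ofReal_le_ofReal (Real.rpow_le_rpow_of_nonpos (bracket_pos x) h (by linarith))
  rcases le_total (bracket x) (bracket y) with h | h
  · refine le_trans ?_ le_self_add
    rw [neg_add, ← wt_mul]; gcongr
    exact anti b x y hb h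
  · refine le_trans ?_ le_add_self
    rw [neg_add, ← wt_mul]; gcongr
    exact anti a y x ha h

/-- The square of the Coulomb kernel. -/
def kap (w : E3) : ℝ≥0∞ := ofReal ((‖w‖⁻¹) ^ 2)

lemma measurable_kap : Measurable kap := by unfold kap; fun_prop

lemma lintegral_kap_ball : ∫⁻ w in ball (0 : E3) 1, kap w < ⊤ := by
  have h : IntegrableOn (fun w : E3 => (‖w‖⁻¹) ^ 2) (ball 0 1) := by
    rw [integrableOn_fun_norm_addHaar volume (f := fun r => (r⁻¹) ^ 2)]
    have : IntegrableOn (fun _ : ℝ => (1 : ℝ)) (Set.Ioo (0 : ℝ) 1) := integrableOn_const (by simp)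
    refine this.congr_fun (fun r hr => ?_) measurableSet_Ioo
    have : r ≠ 0 := hr.1.ne'
    simp only [finrank_euclideanSpace, Fintype.card_fin, smul_eq_mul]; field_simp
  exact Integrable.lintegral_lt_top h

lemma kap_le (w : E3) : kap w ≤ 2 * wt (-1) w + (ball (0 : E3) 1).indicator kap w := by
  by_cases hw : w ∈ ball (0 : E3) 1
  · rw [Set.indicator_of_mem hw]; exact le_add_self
  · have e2 : ∀ r : ℝ, 2 * ofReal r = ofReal (2 * r) := fun r => by
      rw [ofReal_mul zero_le_two, ENNReal.ofReal_ofNat]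
    rw [Set.indicator_of_notMem hw, add_zero, kap, wt, bracket_rpow, e2]
    refine ofReal_le_ofReal ?_
    simp only [Metric.mem_ball, dist_zero_right, not_lt] at hw
    have : (0 : ℝ) < ‖w‖ := by linarith
    rw [show (2 * -1 / 2 : ℝ) = -1 by norm_num, Real.rpow_neg_one, inv_pow, ← div_eq_mul_inv,
      inv_eq_one_div, div_le_div_iff₀ (by positivity) (by positivity)]
    nlinarith

/-- The weighted Hilbert–Schmidt norm of the Coulomb kernel is finite. -/
lemma lintegral_wt_kap_wt_lt_top {s σ : ℝ} (hs : 1 / 2 < s) (hσ : 1 / 2 < σ) (h : 2 < s + σ) :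
    ∫⁻ x, ∫⁻ y, wt (-s) x * kap (x - y) * wt (-σ) y < ⊤ := by
  wlog hs' : s ≤ 3 / 2 generalizing s
  · refine lt_of_le_of_lt (lintegral_mono fun x => lintegral_mono fun y => ?_)
      (this (s := 3 / 2) (by norm_num) (by linarith) le_rfl)
    gcongr; exact wt_mono (by linarith) x
  wlog hσ' : σ ≤ 3 / 2 generalizing σ
  · refine lt_of_le_of_lt (lintegral_mono fun x => lintegral_mono fun y => ?_)
      (this (σ := 3 / 2) (by norm_num) (by linarith) le_rfl)
    gcongr; exact wt_mono (by linarith) y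
  set q := (s + 1 + σ) / 2 with hq
  have hq' : 3 / 2 < q := by rw [hq]; linarith
  have hW := lintegral_wt_lt_top hq'
  have hW2 := lintegral_wt_lt_top (s := s + σ) (by linarith)
  set k0 := (ball (0 : E3) 1).indicator kap with hk0
  have hk0m : Measurable k0 := measurable_kap.indicator measurableSet_ball
  have hk0i : ∫⁻ w, k0 w < ⊤ := by
    rw [hk0, lintegral_indicator measurableSet_ball]; exact lintegral_kap_ball
  have hm := measurable_wt (-q)
  have hm2 := measurable_wt (-(s + σ))
  have hpt : ∀ x y : E3, wt (-s) x * kap (x - y) * wt (-σ) y ≤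
      2 * (wt (-q) x * wt (-q) (x - y) + wt (-q) (x - y) * wt (-q) y + wt (-q) x * wt (-q) y) +
        (wt (-(s + σ)) x * k0 (x - y) + k0 (x - y) * wt (-(s + σ)) y) := by
    intro x y
    calc _ ≤ wt (-s) x * (2 * wt (-1) (x - y) + k0 (x - y)) * wt (-σ) y := by
          gcongr; exact kap_le _
      _ = 2 * (wt (-s) x * wt (-1) (x - y) * wt (-σ) y) +
          k0 (x - y) * (wt (-s) x * wt (-σ) y) := by ring
      _ ≤ 2 * (wt (-q) x * wt (-q) (x - y) + wt (-q) (x - y) * wt (-q) y +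
          wt (-q) x * wt (-q) y) + k0 (x - y) * (wt (-(s + σ)) x + wt (-(s + σ)) y) := by
          gcongr
          · exact wt_mul_wt_mul_wt_le (by linarith) (by linarith) (by linarith) (by linarith)
              (by rw [hq]; ring) _ _ _
          · exact wt_mul_wt_le (by linarith) (by linarith) _ _
      _ = _ := by ring
  refine lt_of_le_of_lt (lintegral_mono fun x => lintegral_mono (hpt x)) ?_
  have e1 := lintegral_lintegral_mul_sub hm hm
  have e2 := lintegral_lintegral_sub_mul hm hm
  have e3 : ∫⁻ x, ∫⁻ y, wt (-q) x * wt (-q) y = (∫⁻ x, wt (-q) x) * ∫⁻ y, wt (-q) y := by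
    simp only [lintegral_const_mul _ hm]
    rw [lintegral_mul_const _ hm]
  have e4 := lintegral_lintegral_mul_sub hm2 hk0m
  have e5 := lintegral_lintegral_sub_mul hm2 hk0m
  have i1 : ∀ x, ∫⁻ y, (2 * (wt (-q) x * wt (-q) (x - y) + wt (-q) (x - y) * wt (-q) y +
      wt (-q) x * wt (-q) y) + (wt (-(s + σ)) x * k0 (x - y) + k0 (x - y) * wt (-(s + σ)) y)) =
      2 * ((∫⁻ y, wt (-q) x * wt (-q) (x - y)) + (∫⁻ y, wt (-q) (x - y) * wt (-q) y) +
      ∫⁻ y, wt (-q) x * wt (-q) y) + ((∫⁻ y, wt (-(s + σ)) x * k0 (x - y)) +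
        ∫⁻ y, k0 (x - y) * wt (-(s + σ)) y) := by
    intro x
    rw [lintegral_add_left (by fun_prop), lintegral_const_mul _ (by fun_prop),
      lintegral_add_left (by fun_prop), lintegral_add_left (by fun_prop),
      lintegral_add_left (by fun_prop)]
  simp only [i1]
  have m1 : Measurable fun x => ∫⁻ y, wt (-q) x * wt (-q) (x - y) :=
    Measurable.lintegral_prod_right' (f := fun p : E3 × E3 => wt (-q) p.1 * wt (-q) (p.1 - p.2))
      (by fun_prop)
  have m2 : Measurable fun x => ∫⁻ y, wt (-q) (x - y) * wt (-q) y :=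
    Measurable.lintegral_prod_right' (f := fun p : E3 × E3 => wt (-q) (p.1 - p.2) * wt (-q) p.2)
      (by fun_prop)
  have m3 : Measurable fun x => ∫⁻ y, wt (-q) x * wt (-q) y :=
    Measurable.lintegral_prod_right' (f := fun p : E3 × E3 => wt (-q) p.1 * wt (-q) p.2)
      (by fun_prop)
  have m4 : Measurable fun x => ∫⁻ y, wt (-(s + σ)) x * k0 (x - y) :=
    Measurable.lintegral_prod_right' (f := fun p : E3 × E3 => wt (-(s + σ)) p.1 * k0 (p.1 - p.2))
      (by fun_prop)
  rw [lintegral_add_left (by fun_prop), lintegral_const_mul _ (by fun_prop),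
    lintegral_add_left (by fun_prop), lintegral_add_left (by fun_prop),
    lintegral_add_left (by fun_prop), e1, e2, e3, e4, e5]
  have t1 := mul_lt_top hW hW
  have t2 := mul_lt_top hW2 hk0i
  have t3 := mul_lt_top hk0i hW2
  exact ENNReal.add_lt_top.2 ⟨mul_lt_top (by simp) (ENNReal.add_lt_top.2
    ⟨ENNReal.add_lt_top.2 ⟨t1, t1⟩, t1⟩), ENNReal.add_lt_top.2 ⟨t2, t3⟩⟩

/-! ### Weighted spaces -/

/-- The restriction to a smaller measure. -/
def incl {μ ν : Measure Phase} (h : ν ≤ μ) : Lp ℂ 2 μ →L[ℂ] Lp ℂ 2 ν := LinearMap.mkContinuous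
    { toFun := fun f => ((Lp.memLp f).mono_measure h).toLp f
      map_add' := fun f g => by
        rw [← MemLp.toLp_add]
        exact MemLp.toLp_congr _ _ ((Measure.absolutelyContinuous_of_le h).ae_le (Lp.coeFn_add f g))
      map_smul' := fun c f => by
        rw [RingHom.id_apply, ← MemLp.toLp_const_smul]
        exact MemLp.toLp_congr _ _
          ((Measure.absolutelyContinuous_of_le h).ae_le (Lp.coeFn_smul c f)) } 1
    fun f => by
      rw [one_mul]; change ‖MemLp.toLp f ((Lp.memLp f).mono_measure h)‖ ≤ ‖f‖
      rw [Lp.norm_toLp, Lp.norm_def]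
      exact ENNReal.toReal_mono (Lp.eLpNorm_ne_top f) (eLpNorm_mono_measure _ h)

lemma coeFn_incl {μ ν : Measure Phase} (h : ν ≤ μ) (f : Lp ℂ 2 μ) : incl h f =ᵐ[ν] f :=
  MemLp.coeFn_toLp ((Lp.memLp f).mono_measure h)

lemma enorm_Lp_sq {μ : Measure Phase} (f : Lp ℂ 2 μ) : ‖f‖ₑ ^ 2 = ∫⁻ p, ‖f p‖ₑ ^ 2 ∂μ := by
  rw [Lp.enorm_def, eLpNorm_eq_lintegral_rpow_enorm_toReal (by norm_num) (by norm_num)]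
  simp only [ENNReal.toReal_ofNat, ENNReal.rpow_ofNat]
  rw [← ENNReal.rpow_natCast, ← ENNReal.rpow_mul]; norm_num

lemma eLpNorm_sq {α : Type*} [MeasurableSpace α] {μ : Measure α} (f : α → ℂ) :
    eLpNorm f 2 μ ^ 2 = ∫⁻ p, ‖f p‖ₑ ^ 2 ∂μ := by
  rw [eLpNorm_eq_lintegral_rpow_enorm_toReal (by norm_num) (by norm_num)]
  simp only [ENNReal.toReal_ofNat, ENNReal.rpow_ofNat]
  rw [← ENNReal.rpow_natCast, ← ENNReal.rpow_mul]; norm_num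

lemma measurable_wt_fst (s : ℝ) : Measurable fun p : Phase => wt s p.1 :=
  (measurable_wt s).comp measurable_fst

lemma lintegral_weightedVolume (s : ℝ) (f : Phase → ℝ≥0∞) :
    ∫⁻ p, f p ∂(weightedVolume s) = ∫⁻ p, wt s p.1 * f p :=
  lintegral_withDensity_eq_lintegral_mul_non_measurable _ (measurable_wt_fst s)
    (ae_of_all _ fun p => (wt_ne_top s p.1).lt_top) f

lemma weightedVolume_zero : weightedVolume 0 = (volume : Measure Phase) := by
  have : weightedVolume 0 = (volume : Measure Phase).withDensity 1 := by
    unfold weightedVolume; congr 1; funext p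
    exact wt_zero p.1
  rw [this, withDensity_one]

lemma weightedVolume_mono {s t : ℝ} (h : s ≤ t) : weightedVolume s ≤ weightedVolume t :=
  withDensity_mono (ae_of_all _ fun p => wt_mono h p.1)

lemma volume_le_weightedVolume {s : ℝ} (h : 0 ≤ s) :
    (volume : Measure Phase) ≤ weightedVolume s := by
  rw [← weightedVolume_zero]; exact weightedVolume_mono h

lemma weightedVolume_le_volume {s : ℝ} (h : 0 ≤ s) :
    weightedVolume (-s) ≤ (volume : Measure Phase) := by
  rw [← weightedVolume_zero]; exact weightedVolume_mono (by linarith)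

lemma ae_weightedVolume_iff (s : ℝ) {P : Phase → Prop} :
    (∀ᵐ p ∂(weightedVolume s), P p) ↔ ∀ᵐ p, P p := by
  rw [show weightedVolume s = volume.withDensity (fun p : Phase => wt s p.1) from rfl,
    ae_withDensity_iff (measurable_wt_fst s)]
  exact ⟨fun h => h.mono fun p hp => hp (wt_ne_zero s p.1), fun h => h.mono fun p hp _ => hp⟩

lemma aeEq_weightedVolume_iff (s : ℝ) {f g : Phase → ℂ} :
    f =ᵐ[weightedVolume s] g ↔ f =ᵐ[volume] g := ae_weightedVolume_iff s

lemma aestronglyMeasurable_weightedVolume (s : ℝ) {f : Phase → ℂ} :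
    AEStronglyMeasurable f (weightedVolume s) ↔ AEStronglyMeasurable f volume := by
  constructor <;> rintro ⟨g, hg, h⟩ <;> exact ⟨g, hg, by simpa [aeEq_weightedVolume_iff] using h⟩

/-! ### The kernel of the resolvent of the Laplacian -/

/-- The Yukawa kernel `e^{-λ|x|} / (4π|x|)`, the kernel of `(-Δ + λ²)⁻¹`. -/
def Yk (l : ℂ) (x : E3) : ℂ := exp (-l * ‖x‖) / (4 * π * ‖x‖)

lemma measurable_Yk (l : ℂ) : Measurable (Yk l) := by unfold Yk; fun_prop

lemma norm_Yk (l : ℂ) (x : E3) : ‖Yk l x‖ = Real.exp (-l.re * ‖x‖) / (4 * π * ‖x‖) := by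
  have : 0 ≤ 4 * π * ‖x‖ := by positivity
  rw [Yk, norm_div, norm_exp]; congr 1
  · simp
  · rw [show (4 * π * ‖x‖ : ℂ) = ((4 * π * ‖x‖ : ℝ) : ℂ) by push_cast; ring,
      norm_real, Real.norm_of_nonneg this]

lemma integrable_Yk {l : ℂ} (hl : 0 < l.re) : Integrable (Yk l) := by
  rw [← integrable_norm_iff (measurable_Yk l).aestronglyMeasurable]
  simp only [norm_Yk]
  rw [integrable_fun_norm_addHaar volume (f := fun r => Real.exp (-l.re * r) / (4 * π * r))]
  have h := (integrableOn_rpow_mul_exp_neg_mul_rpow (s := 1) (p := 1) (by norm_num) one_pos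
    hl).const_mul ((4 * π)⁻¹)
  refine IntegrableOn.congr_fun h (fun r hr => ?_) measurableSet_Ioi
  have : r ≠ 0 := (Set.mem_Ioi.1 hr).ne'
  simp only [finrank_euclideanSpace, Fintype.card_fin, smul_eq_mul, Real.rpow_one]; field_simp

lemma integrable_norm_Yk_sq {l : ℂ} (hl : 0 < l.re) : Integrable (fun x => ‖Yk l x‖ ^ 2) := by
  simp only [norm_Yk]
  rw [integrable_fun_norm_addHaar volume (f := fun r => (Real.exp (-l.re * r) / (4 * π * r)) ^ 2)]
  have h := (exp_neg_integrableOn_Ioi 0 (b := 2 * l.re) (by linarith)).const_mul (((4 * π) ^ 2)⁻¹)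
  refine IntegrableOn.congr_fun h (fun r hr => ?_) measurableSet_Ioi
  have : r ≠ 0 := (Set.mem_Ioi.1 hr).ne'
  simp only [finrank_euclideanSpace, Fintype.card_fin, smul_eq_mul]
  rw [show -(2 * l.re) * r = -l.re * r + -l.re * r by ring, Real.exp_add]
  field_simp

/-- The identification of `ℝ³` with `ℝ × ℂ`. -/
def axial : E3 ≃ᵐ ℝ × ℂ := ((MeasurableEquiv.toLp 2 (Fin 3 → ℝ)).symm.trans
    (MeasurableEquiv.piFinSuccAbove (fun _ : Fin 3 => ℝ) 0)).trans
      (MeasurableEquiv.prodCongr (MeasurableEquiv.refl ℝ) Complex.measurableEquivPi.symm)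

lemma measurePreserving_axial : MeasurePreserving axial volume volume :=
  ((volume_preserving_piFinSuccAbove (fun _ : Fin 3 => ℝ) 0).comp
    (PiLp.volume_preserving_ofLp (Fin 3))).trans ((MeasurePreserving.id (volume : Measure ℝ)).prod
        (Complex.volume_preserving_equiv_pi.symm))

lemma axial_fst (x : E3) : (axial x).1 = x 0 := rfl

lemma norm_eq_axial (x : E3) : ‖x‖ = Real.sqrt ((axial x).1 ^ 2 + ‖(axial x).2‖ ^ 2) := by
  have : ‖(axial x).2‖ ^ 2 = x 1 ^ 2 + x 2 ^ 2 := by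
    rw [← Complex.normSq_eq_norm_sq, Complex.normSq_apply]
    have h : (axial x).2 = x 1 + x 2 * I :=
      Complex.measurableEquivPi_symm_apply (Fin.removeNth 0 x.ofLp)
    have h1 : ((axial x).2).re = x 1 := by simp [h]
    have h2 : ((axial x).2).im = x 2 := by simp [h]
    rw [h1, h2]; ring
  rw [this, axial_fst, EuclideanSpace.norm_eq]; congr 1
  simp [Fin.sum_univ_three]; ring

/-- The integral of the Yukawa kernel over a plane. -/
lemma integral_plane {l : ℂ} (hl : 0 < l.re) {s : ℝ} (hs : s ≠ 0) :
    ∫ c : ℂ, exp (-l * Real.sqrt (s ^ 2 + ‖c‖ ^ 2)) /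
      (4 * π * Real.sqrt (s ^ 2 + ‖c‖ ^ 2)) = exp (-l * |s|) / (2 * l) := by
  have hl0 : l ≠ 0 := by rintro rfl; simp at hl
  have hpos : ∀ y : ℝ, 0 < s ^ 2 + y ^ 2 := fun y => by positivity
  rw [integral_fun_norm_addHaar volume (fun r : ℝ => exp (-l * Real.sqrt (s ^ 2 + r ^ 2)) /
      (4 * π * Real.sqrt (s ^ 2 + r ^ 2)))]
  have hd : ∀ y ∈ Set.Ici (0 : ℝ), HasDerivAt
      (fun r : ℝ => -(exp (-l * Real.sqrt (s ^ 2 + r ^ 2)) / (4 * π * l)))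
      (y ^ (Module.finrank ℝ ℂ - 1) • (exp (-l * Real.sqrt (s ^ 2 + y ^ 2)) /
        (4 * π * Real.sqrt (s ^ 2 + y ^ 2)))) y := by
    intro y _
    have h1 : HasDerivAt (fun r : ℝ => s ^ 2 + r ^ 2) (2 * y) y := by
      simpa using (hasDerivAt_pow 2 y).const_add (s ^ 2)
    have h2 := (h1.sqrt (hpos y).ne').ofReal_comp
    have h3 := ((h2.const_mul (-l)).cexp.div_const (4 * π * l)).neg
    refine h3.congr_deriv ?_
    have h4 : (Real.sqrt (s ^ 2 + y ^ 2) : ℂ) ≠ 0 := by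
      exact_mod_cast (Real.sqrt_pos.2 (hpos y)).ne'
    have h5 : (π : ℂ) ≠ 0 := by exact_mod_cast Real.pi_ne_zero
    simp only [Complex.finrank_real_complex, Nat.reduceSub, pow_one, Complex.real_smul]; push_cast
    field_simp
  have hsq : ∀ y : ℝ, 0 ≤ y → y ≤ Real.sqrt (s ^ 2 + y ^ 2) := fun y _ =>
    Real.le_sqrt_of_sq_le (by nlinarith [sq_nonneg s])
  have hint : IntegrableOn (fun y : ℝ => y ^ (Module.finrank ℝ ℂ - 1) •
      (exp (-l * Real.sqrt (s ^ 2 + y ^ 2)) /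
        (4 * π * Real.sqrt (s ^ 2 + y ^ 2)))) (Set.Ioi 0) := by
    refine Integrable.mono' (exp_neg_integrableOn_Ioi 0 hl) (by fun_prop)
      ((ae_restrict_iff' measurableSet_Ioi).2 (ae_of_all _ fun y hy => ?_))
    have hy0 : (0 : ℝ) < y := hy
    have hS := Real.sqrt_pos.2 (hpos y)
    have e : ‖(4 * π * Real.sqrt (s ^ 2 + y ^ 2) : ℂ)‖ = 4 * π * Real.sqrt (s ^ 2 + y ^ 2) := by
      rw [show (4 * π * Real.sqrt (s ^ 2 + y ^ 2) : ℂ) =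
        ((4 * π * Real.sqrt (s ^ 2 + y ^ 2) : ℝ) : ℂ) by push_cast; ring, norm_real,
        Real.norm_of_nonneg (by positivity)]
    rw [norm_smul, norm_div, norm_exp, e]
    simp only [Complex.finrank_real_complex, Nat.reduceSub, pow_one, Real.norm_of_nonneg hy0.le]
    have h1 : (-l * (Real.sqrt (s ^ 2 + y ^ 2) : ℂ)).re = -l.re * Real.sqrt (s ^ 2 + y ^ 2) := by
      simp
    rw [h1, mul_div_assoc', div_le_iff₀ (by positivity), mul_comm]
    have h2 : Real.exp (-l.re * Real.sqrt (s ^ 2 + y ^ 2)) ≤ Real.exp (-l.re * y) := by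
      refine Real.exp_le_exp.2 ?_
      nlinarith [hsq y hy0.le]
    have h3 : y ≤ 4 * π * Real.sqrt (s ^ 2 + y ^ 2) := by nlinarith [hsq y hy0.le, Real.pi_gt_three]
    gcongr
  have hlim : Tendsto (fun r : ℝ =>
      -(exp (-l * Real.sqrt (s ^ 2 + r ^ 2)) / (4 * π * l))) atTop (𝓝 0) := by
    have h1 : Tendsto (fun r : ℝ => exp (-l * Real.sqrt (s ^ 2 + r ^ 2))) atTop (𝓝 0) := by
      rw [Complex.tendsto_exp_nhds_zero_iff]
      have h2 : Tendsto (fun r : ℝ => Real.sqrt (s ^ 2 + r ^ 2)) atTop atTop :=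
        tendsto_atTop_mono' _ ((eventually_ge_atTop 0).mono hsq) tendsto_id
      have h3 := h2.const_mul_atTop_of_neg (neg_neg_iff_pos.2 hl)
      refine h3.congr fun r => by simp
    simpa using (h1.div_const (4 * π * l)).neg
  rw [integral_Ioi_of_hasDerivAt_of_tendsto' hd hint hlim]
  have h6 : volume.real (ball (0 : ℂ) 1) = π := by simp [Measure.real, Complex.volume_ball]
  have h5 : (π : ℂ) ≠ 0 := by exact_mod_cast Real.pi_ne_zero
  rw [h6, Complex.finrank_real_complex]
  have h7 : Real.sqrt (s ^ 2 + 0 ^ 2) = |s| := by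
    rw [zero_pow two_ne_zero, add_zero, Real.sqrt_sq_eq_abs]
  rw [h7]; simp only [Complex.real_smul, nsmul_eq_mul]; field_simp; push_cast; ring

lemma integral_exp_abs {l : ℂ} (hl : 0 < l.re) (k : ℝ) :
    ∫ s : ℝ, exp (-(I * (k * s))) * exp (-l * |s|) = 2 * l / (k ^ 2 + l ^ 2) := by
  have e1 : Set.EqOn (fun s : ℝ => exp ((l - I * k) * s))
      (fun s : ℝ => exp (-(I * (k * s))) * exp (-l * |s|))
      (Set.Iic 0) := by
    intro s hs; simp only
    rw [abs_of_nonpos hs, ← exp_add]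
    congr 1; push_cast; ring
  have e2 : Set.EqOn (fun s : ℝ => exp ((-l - I * k) * s))
      (fun s : ℝ => exp (-(I * (k * s))) * exp (-l * |s|))
      (Set.Ioi 0) := by
    intro s hs; simp only
    rw [abs_of_pos hs, ← exp_add]; congr 1; ring
  have r1 : 0 < (l - I * k).re := by simpa using hl
  have r2 : (-l - I * k).re < 0 := by simpa using hl
  rw [← intervalIntegral.integral_Iic_add_Ioi
    ((integrableOn_exp_mul_complex_Iic r1 0).congr_fun e1 measurableSet_Iic)
    ((integrableOn_exp_mul_complex_Ioi r2 0).congr_fun e2 measurableSet_Ioi),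
    ← setIntegral_congr_fun measurableSet_Iic e1, ← setIntegral_congr_fun measurableSet_Ioi e2,
    integral_exp_mul_complex_Iic r1, integral_exp_mul_complex_Ioi r2]
  have n1 : l - I * k ≠ 0 := fun h => by rw [h] at r1; simp at r1
  have n2 : l + I * k ≠ 0 := fun h => by
    have : -l - I * k = 0 := by rw [← neg_eq_zero]; rw [← h]; ring
    rw [this] at r2; simp at r2
  have e3 : (k : ℂ) ^ 2 + l ^ 2 = (l - I * k) * (l + I * k) := by
    linear_combination ((k : ℂ) ^ 2) * Complex.I_sq
  rw [e3, show -l - I * k = -(l + I * k) by ring]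
  simp only [Complex.ofReal_zero, mul_zero, Complex.exp_zero]; field_simp; ring

/-- The Fourier transform of the Yukawa kernel. -/
lemma fourier_Yk {l : ℂ} (hl : 0 < l.re) (ξ : E3) : 𝓕 (Yk l) ξ = (ksq ξ + l ^ 2)⁻¹ := by
  have hl0 : l ≠ 0 := by rintro rfl; simp at hl
  have hn : ‖ξ‖ = ‖‖ξ‖ • eb 0‖ := by simp [norm_smul, eb]
  set R := (ℝ ∙ (ξ - ‖ξ‖ • eb 0))ᗮ.reflection with hR
  have hRξ : R ξ = ‖ξ‖ • eb 0 := Submodule.reflection_sub hn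
  rw [Real.fourier_eq']
  have h1 : ∫ v : E3, exp (((-2 * π * inner ℝ v ξ : ℝ) : ℂ) * I) • Yk l v =
      ∫ v : E3, exp (-(I * ((‖kk ξ‖ : ℝ) * (v 0 : ℝ)))) * Yk l v := by
    rw [← R.measurePreserving.integral_comp R.toHomeomorph.measurableEmbedding
      (fun v : E3 => exp (-(I * ((‖kk ξ‖ : ℝ) * (v 0 : ℝ)))) * Yk l v)]
    refine integral_congr_ae (ae_of_all _ fun v => ?_)
    have e1 : (R v : E3) 0 = inner ℝ (R v) (eb 0) := by simp [eb, EuclideanSpace.inner_single_right]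
    have e2 : ‖ξ‖ * (R v : E3) 0 = inner ℝ v ξ := by
      rw [← R.inner_map_map v ξ, hRξ, inner_smul_right, e1]
    have e3 : ‖kk ξ‖ = 2 * π * ‖ξ‖ := by rw [kk, norm_smul, Real.norm_of_nonneg (by positivity)]
    simp only [smul_eq_mul, Yk, LinearIsometryEquiv.norm_map]; rw [e3]; congr 2
    rw [← e2]; push_cast; ring
  rw [h1]
  set F : ℝ × ℂ → ℂ := fun q => exp (-(I * ((‖kk ξ‖ : ℝ) * (q.1 : ℝ)))) *
    (exp (-l * Real.sqrt (q.1 ^ 2 + ‖q.2‖ ^ 2)) / (4 * π * Real.sqrt (q.1 ^ 2 + ‖q.2‖ ^ 2))) with hF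
  have h2 : ∀ v : E3, exp (-(I * ((‖kk ξ‖ : ℝ) * (v 0 : ℝ)))) * Yk l v = F (axial v) := by
    intro v; simp only [hF, Yk]
    rw [← norm_eq_axial, axial_fst]
  have hFi : Integrable F := by
    rw [← measurePreserving_axial.integrable_comp_emb axial.measurableEmbedding]
    have : F ∘ axial = fun v : E3 =>
        exp (-(I * ((‖kk ξ‖ : ℝ) * (v 0 : ℝ)))) * Yk l v :=
      funext fun v => (h2 v).symm
    rw [this]
    refine (integrable_Yk hl).bdd_mul (c := 1) (Measurable.aestronglyMeasurable (by fun_prop))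
      (ae_of_all _ fun v => ?_)
    rw [norm_exp]; simp
  simp only [h2]
  rw [measurePreserving_axial.integral_comp axial.measurableEmbedding, volume_eq_prod,
    integral_prod _ (by rwa [← volume_eq_prod])]
  have h3 : (fun s : ℝ => ∫ c : ℂ, F (s, c)) =ᵐ[volume] fun s : ℝ =>
      (exp (-(I * ((‖kk ξ‖ : ℝ) * s))) * exp (-l * |s|)) / (2 * l) := by
    have : ∀ᵐ s : ℝ, s ≠ 0 := by simp [ae_iff]
    filter_upwards [this] with s hs
    simp only [hF]
    rw [integral_const_mul, integral_plane hl hs, mul_div_assoc]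
  rw [integral_congr_ae h3, integral_div, integral_exp_abs hl, ksq, Complex.ofReal_pow]; field_simp

/-- Off the half line, `-z` has a square root with positive real part. -/
lemma exists_sqrt {z : ℂ} (hz : z ∉ halfLine) : ∃ l : ℂ, 0 < l.re ∧ l ^ 2 = -z ∧ ‖l‖ ^ 2 = ‖z‖ := by
  obtain ⟨l, hl⟩ := IsAlgClosed.exists_pow_nat_eq (-z) two_pos
  have hn : ‖l‖ ^ 2 = ‖z‖ := by rw [← norm_pow, hl, norm_neg]
  have h0 : l.re ≠ 0 := by
    intro h; refine hz ⟨l.im ^ 2, Set.mem_Ici.2 (sq_nonneg _), ?_⟩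
    have : l = l.im * I := by apply Complex.ext <;> simp [h]
    rw [← neg_eq_iff_eq_neg.2 hl, this, mul_pow, Complex.I_sq]; simp
  rcases lt_or_gt_of_ne h0 with h | h
  · exact ⟨-l, by simpa using h, by rw [neg_sq, hl], by rw [norm_neg, hn]⟩
  · exact ⟨l, h, hl, hn⟩

/-! ### The slowly varying part of the resolvent as an integral operator -/

lemma integral_mul_fourierInv {η a : E3 → ℂ} (hη : Integrable η) (ha : Integrable a) (c : ℝ)
    (x : E3) : ∫ w, η w * 𝓕⁻ a (x - c • w) = 𝓕⁻ (fun ξ => 𝓕 η (c • ξ) * a ξ) x := by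
  simp only [Real.fourierInv_eq', Real.fourier_eq', smul_eq_mul]
  have h1 : ∀ w, η w * ∫ ξ, exp (((2 * π * inner ℝ ξ (x - c • w) : ℝ) : ℂ) *
      I) * a ξ = ∫ ξ, exp (((2 * π * inner ℝ ξ (x - c • w) : ℝ) : ℂ) *
      I) * (η w * a ξ) := fun w => by
    rw [← integral_const_mul]; congr 1; ext ξ; ring
  simp only [h1]
  rw [integral_integral_swap]
  · refine integral_congr_ae (ae_of_all _ fun ξ => ?_); simp only
    rw [← integral_mul_const, ← integral_const_mul]
    refine integral_congr_ae (ae_of_all _ fun w => ?_); simp only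
    rw [inner_sub_right, inner_smul_right, inner_smul_right, real_inner_comm w ξ,
      show ((2 * π * (inner ℝ ξ x - c * inner ℝ w ξ) : ℝ) : ℂ) * I =
        ((2 * π * inner ℝ ξ x : ℝ) : ℂ) * I +
        ((-2 * π * (c * inner ℝ w ξ) : ℝ) : ℂ) * I by push_cast; ring,
      exp_add]
    ring
  · refine (hη.mul_prod ha).bdd_mul (c := 1) ?_ (ae_of_all _ fun p => ?_)
    · exact Continuous.aestronglyMeasurable (by fun_prop)
    · rw [Complex.norm_exp_ofReal_mul_I]

lemma cs_eq (k v : E3) : cs k v = exp (I * (inner ℝ k v : ℝ)) * ps v := by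
  rw [ps, cs_apply, cs_apply, csPhase, csPhase, exp_add, inner_zero_left]; simp; ring_nf

lemma md_ps (k : E3) : md k ps = cs (-k) := by
  ext v; rw [md_apply, cs_eq, inner_neg_left]; simp

/-- The Schwartz function `p(v) ψ(v)²`. -/
def psq : MvPolynomial (Fin 3) ℂ →ₗ[ℂ] S3 := (SchwartzMap.smulLeftCLM ℂ ps).toLinearMap ∘ₗ polyS

lemma psq_apply (p : MvPolynomial (Fin 3) ℂ) (v : E3) : psq p v = ps v * polyS p v :=
  SchwartzMap.smulLeftCLM_apply_apply ps.hasTemperateGrowth _ _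

lemma ip_cs_md (ξ : E3) (p : MvPolynomial (Fin 3) ℂ) :
    ip (cs (kk ξ)) (md (kk ξ) (polyS p)) = 𝓕 (psq p) ((2 : ℝ) • ξ) := by
  rw [ip_eq, SchwartzMap.fourier_coe, Real.fourier_eq']
  refine integral_congr_ae (ae_of_all _ fun v => ?_)
  simp only [smul_eq_mul]
  rw [cs_eq, md_apply, psq_apply, map_mul, ps_real, ← Complex.exp_conj, kk, inner_smul_left,
    inner_smul_right, real_inner_comm ξ v, map_mul, Complex.conj_I, conj_ofReal,
    show ∀ a b c d : ℂ, a * b * (c * d) = (a * c) * (b * d) by intros; ring, ← exp_add]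
  congr 2; simp only [conj_trivial]
  push_cast; ring

/-- The Gaussian multiplier `e^{-|k|²}`. -/
def gS : S3 := expSchwartz (fun ξ : E3 => ((-(4 * π ^ 2) * ‖ξ‖ ^ 2 : ℝ) : ℂ))
    (Function.HasTemperateGrowth.comp Function.Complex.hasTemperateGrowth_ofReal
      ((Function.HasTemperateGrowth.const (-(4 * π ^ 2) : ℝ)).mul
        (Function.hasTemperateGrowth_norm_sq (H := E3)))) (c := 4 * π ^ 2) (by positivity)
    (fun v => by rw [Complex.ofReal_re])

lemma gS_apply (ξ : E3) : gS ξ = exp (-ksq ξ) := by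
  have : gS ξ = exp ((-(4 * π ^ 2) * ‖ξ‖ ^ 2 : ℝ) : ℂ) := rfl
  rw [this, ksq, kk, norm_smul, Real.norm_of_nonneg (by positivity)]
  congr 1; push_cast; ring

/-- The symbol `e^{-|k|²} ⟨χ_k, e^{-ik·v} p ψ⟩`. -/
def symH (p : MvPolynomial (Fin 3) ℂ) (ξ : E3) : ℂ := gS ξ * 𝓕 (psq p) ((2 : ℝ) • ξ)

lemma contDiff_symH (p : MvPolynomial (Fin 3) ℂ) : ContDiff ℝ ∞ (symH p) :=
  gS.smooth'.mul ((𝓕 (psq p)).smooth'.comp (contDiff_const_smul (2 : ℝ)))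

/-- The amplitude `e^{-|k|²} ⟨χ_k, U⟩` of an element of the core. -/
def dH : Dom →ₗ[ℂ] Sc :=
  TensorProduct.lift (LinearMap.mk₂ ℂ (fun p (a : Sc) => mulc (symH p) (contDiff_symH p) a)
    (fun p q a => by ext ξ; simp [symH, FourierTransform.fourier_add]; ring)
    (fun c p a => by ext ξ; simp [symH, FourierTransform.fourier_smul]; ring)
    (fun p a b => by simp)
    (fun c p a => by simp))

lemma dH_tmul (p : MvPolynomial (Fin 3) ℂ) (a : Sc) (ξ : E3) :
    (dH (p ⊗ₜ a)).1 ξ = gS ξ * 𝓕 (psq p) ((2 : ℝ) • ξ) * a.1 ξ := by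
  simp [dH, symH]

lemma dH_apply (U : Dom) (ξ : E3) : (dH U).1 ξ = gS ξ * ip (cs (kk ξ)) (fib ξ U) := by
  induction U using TensorProduct.induction_on with
  | zero => simp [ip_zero_right]
  | add U V hU hV => rw [map_add, map_add, ip_add_right, mul_add, ← hU, ← hV]; rfl
  | tmul p a => rw [dH_tmul, fib_tmul, ip_smul_right, ip_cs_md]; ring

lemma contDiff_resolventSymbol {z : ℂ} (hz : z ∉ halfLine) :
    ContDiff ℝ ∞ (fun ξ => exp (3 * z) * (ksq ξ - z)⁻¹) := by
  have h := contDiff_symbol_inv hz 0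
  simp only [Nat.cast_zero, add_zero] at h
  exact contDiff_const.mul h

/-- The slowly varying part of the solution of `(P₀ - z) u = F` in the core. -/
def dB {z : ℂ} (hz : z ∉ halfLine) : Dom →ₗ[ℂ] Dom :=
  (TensorProduct.mk ℂ _ _ (1 : MvPolynomial (Fin 3) ℂ)) ∘ₗ
    mulc _ (contDiff_resolventSymbol hz) ∘ₗ dH

lemma fib_dB {z : ℂ} (hz : z ∉ halfLine) (F : Dom) (ξ : E3) : fib ξ (dB hz F) =
    (exp (3 * z) * (ksq ξ - z)⁻¹ * exp (-ksq ξ) * ip (cs (kk ξ)) (fib ξ F)) • cs (-kk ξ) := by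
  simp only [dB, LinearMap.comp_apply, TensorProduct.mk_apply, fib_tmul, polyS_one, md_ps,
    mulc_apply, dH_apply, gS_apply]
  congr 1; ring

/-- The convolution of `K` and `h`. -/
def cv (K h : E3 → ℂ) (x : E3) : ℂ := ∫ y, K (x - y) * h y

lemma cv_eq (K h : E3 → ℂ) (x : E3) : cv K h x = ∫ w, K w * h (x - w) := by
  rw [cv, ← integral_sub_left_eq_self (fun w => K w * h (x - w)) volume x]; simp

/-- The average `∫∫ Q(y - y', w) f(y', w) dy' dw`. -/
def av (Q f : Phase → ℂ) (y : E3) : ℂ := ∫ p, Q (y - p.1, p.2) * f p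

/-- The reflection `(x, v) ↦ (-x, v)`. -/
def xneg : Phase ≃L[ℝ] Phase :=
  (ContinuousLinearEquiv.neg ℝ).prodCongr (ContinuousLinearEquiv.refl ℝ E3)

@[simp] lemma xneg_apply (p : Phase) : xneg p = (-p.1, p.2) := rfl

/-- The function `(x, v) ↦ Q(y - x, v)`. -/
def reflx (y : E3) (Q : S6) : S6 := SchwartzMap.compSubConstCLM ℂ ((y, 0) : Phase)
    (SchwartzMap.compCLMOfContinuousLinearEquiv ℂ xneg Q)

lemma reflx_apply (y : E3) (Q : S6) (p : Phase) : reflx y Q p = Q (y - p.1, p.2) := by simp [reflx]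

lemma qC_reflx (y : E3) (Q : S6) (j : Fin 3) : qC j (reflx y Q) = reflx y (qC j Q) := by
  ext p
  have e : (reflx y Q : Phase → ℂ) = fun p : Phase => Q (xneg (p - (y, 0))) := by
    ext p; simp [reflx_apply]
  have h : HasFDerivAt (reflx y Q) ((fderiv ℝ Q (xneg (p - (y, 0)))).comp
      (xneg : Phase →L[ℝ] Phase)) p := by
    rw [e]
    exact (Q.hasFDerivAt (xneg (p - (y, 0)))).comp p
      (xneg.hasFDerivAt.comp p ((hasFDerivAt_id p).sub_const (y, 0)))
  rw [qC_apply, reflx_apply, reflx_apply, qC_apply, h.fderiv]; simp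

lemma qA_reflx (y : E3) (Q : S6) (j : Fin 3) : qA j (reflx y Q) = reflx y (qA j Q) := by
  have h1 := qA_add_qC j (reflx y Q)
  have h2 : qM j (reflx y Q) = reflx y (qM j Q) := by ext p; simp [reflx_apply]
  have h3 : reflx y (qA j Q) + reflx y (qC j Q) = reflx y (qM j Q) := by
    rw [← qA_add_qC]; ext p; simp [reflx_apply]
  rw [← h2, ← h1, qC_reflx] at h3
  exact (add_right_cancel h3).symm

lemma av_eq_bp (Q Ψ : S6) (y : E3) : av Q Ψ y = bp (toL Ψ) (reflx y Q) := by
  rw [bp_toL, av]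
  refine integral_congr_ae (ae_of_all _ fun p => ?_)
  simp only [reflx_apply]; ring

lemma av_qA (Q Ψ : S6) (j : Fin 3) : av Q (qA j Ψ) = av (qC j Q) Ψ := by
  ext y; rw [av_eq_bp, av_eq_bp, ← bp_qC, qC_reflx]

lemma av_qC (Q Ψ : S6) (j : Fin 3) : av Q (qC j Ψ) = av (qA j Q) Ψ := by
  ext y; rw [av_eq_bp, av_eq_bp, ← bp_qA, qA_reflx]

/-- The kernel `ψ(w) g(x - w)`, with `g` the Gaussian whose Fourier transform is `e^{-|k|²}`. -/
def Q0 : S6 := SchwartzMap.compCLMOfContinuousLinearEquiv ℂ shear (outer ps (𝓕⁻ gS))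

lemma Q0_apply (p : Phase) : Q0 p = ps p.2 * 𝓕⁻ gS (p.1 - p.2) := by simp [Q0]

lemma integrable_schwartz_mul (Φ Ψ : S6) : Integrable (fun p => Φ p * Ψ p) :=
  (Φ.memLp 2 volume).integrable_mul (Ψ.memLp 2 volume)

lemma av_Q0_phys_tmul (p : MvPolynomial (Fin 3) ℂ) (a : Sc) (y : E3) :
    av Q0 (phys (p ⊗ₜ a)) y = ifr (dH (p ⊗ₜ a)) y := by
  have hi : Integrable (fun q : Phase => Q0 (y - q.1, q.2) * phys (p ⊗ₜ a) q) := by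
    have := integrable_schwartz_mul (reflx y Q0) (phys (p ⊗ₜ a))
    simpa only [reflx_apply] using this
  rw [av, volume_eq_prod, integral_prod_symm _ (by rwa [← volume_eq_prod])]
  have hin : ∀ w : E3, ∫ x : E3, Q0 (y - x, w) * phys (p ⊗ₜ a) (x, w) =
      psq p w * 𝓕⁻ (fun ξ => gS ξ * a.1 ξ) (y - (2 : ℝ) • w) := by
    intro w
    have h1 := integral_mul_fourierInv (𝓕⁻ gS : S3).integrable (a.1.integrable) 1 (y - (2 : ℝ) • w)
    have h2 : 𝓕 (⇑(𝓕⁻ gS : S3)) = gS := by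
      rw [← SchwartzMap.fourier_coe, FourierTransform.fourier_fourierInv_eq]
    simp only [one_smul] at h1; rw [h2] at h1
    rw [← h1, ← integral_const_mul, ← integral_sub_left_eq_self _ volume (y - w)]
    refine integral_congr_ae (ae_of_all _ fun u => ?_)
    simp only [Q0_apply, phys_tmul, psq_apply, ifr_eq, SchwartzMap.fourierInv_coe]
    rw [show y - (y - w - u) - w = u by abel, show y - w - u - w = y - (2 : ℝ) • w - u by
      rw [two_smul]; abel]
    ring
  simp only [hin]
  have hga : Integrable (fun ξ => gS ξ * a.1 ξ) :=
    (gS.memLp 2 volume).integrable_mul (a.1.memLp 2 volume)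
  rw [integral_mul_fourierInv (psq p).integrable hga 2 y, ifr_eq, SchwartzMap.fourierInv_coe]
  refine congrArg (fun f : E3 → ℂ => 𝓕⁻ f y) (funext fun ξ => ?_)
  rw [dH_tmul, SchwartzMap.fourier_coe]; ring

lemma av_add (Q Ψ₁ Ψ₂ : S6) (y : E3) : av Q (Ψ₁ + Ψ₂ : S6) y = av Q Ψ₁ y + av Q Ψ₂ y := by
  rw [av_eq_bp, av_eq_bp, av_eq_bp, map_add, bp_add]

lemma av_Q0_phys (U : Dom) (y : E3) : av Q0 (phys U) y = ifr (dH U) y := by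
  induction U using TensorProduct.induction_on with
  | zero => rw [map_zero, map_zero, map_zero, av_eq_bp, map_zero, bp_zero]; rfl
  | add U V hU hV => rw [map_add, map_add, map_add, av_add, hU, hV]; rfl
  | tmul p a => exact av_Q0_phys_tmul p a y

/-- The kernel representation of the slowly varying part. -/
lemma phys_dB {z l : ℂ} (hz : z ∉ halfLine) (hl : 0 < l.re) (hlz : l ^ 2 = -z) (F : Dom)
    (q : Phase) : phys (dB hz F) q =
      ps q.2 * cv (fun x => exp (3 * z) * Yk l x) (av Q0 (phys F)) (q.1 - q.2) := by
  simp only [dB, LinearMap.comp_apply, TensorProduct.mk_apply, phys_tmul, polyS_one]; congr 1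
  rw [cv_eq]
  have h1 := integral_mul_fourierInv ((integrable_Yk hl).const_mul (exp (3 * z)))
    (dH F).1.integrable 1 (q.1 - q.2)
  simp only [one_smul] at h1
  have h2 : av Q0 (phys F) = 𝓕⁻ (dH F).1 := by ext y; rw [av_Q0_phys, ifr_eq]
  rw [h2, SchwartzMap.fourierInv_coe, h1, ifr_eq, SchwartzMap.fourierInv_coe]
  refine congrArg (fun f : E3 → ℂ => 𝓕⁻ f (q.1 - q.2)) (funext fun ξ => ?_)
  have h3 : 𝓕 (fun x => exp (3 * z) * Yk l x) ξ = exp (3 * z) * 𝓕 (Yk l) ξ := by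
    rw [Real.fourier_eq', Real.fourier_eq', ← integral_const_mul]
    refine integral_congr_ae (ae_of_all _ fun v => ?_)
    simp only [smul_eq_mul]; ring
  rw [h3, fourier_Yk hl, hlz, mulc_apply, sub_eq_add_neg]

/-! ### The rapidly varying part of the resolvent -/

lemma norm_cexp_sub_cexp_le {M : ℝ} {a b : ℂ} (ha : a.re ≤ M) (hb : b.re ≤ M) :
    ‖exp a - exp b‖ ≤ Real.exp M * ‖a - b‖ := by
  refine (convex_halfSpace_re_le M).norm_image_sub_le_of_norm_hasDerivWithin_le (𝕜 := ℂ)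
    (f := exp) (f' := exp)
    (fun x _ => (Complex.hasDerivAt_exp x).hasDerivWithinAt) (fun x hx => ?_) hb ha
  rw [norm_exp]; exact Real.exp_le_exp.2 hx

/-- The entire function `(1 - e^{-3ζ}) / ζ`. -/
def fz (ζ : ℂ) : ℂ := ∫ t in (0 : ℝ)..3, exp (-ζ * t)

lemma fz_mul (ζ : ℂ) : fz ζ * ζ = 1 - exp (-3 * ζ) := by
  rcases eq_or_ne ζ 0 with rfl | h
  · simp
  · rw [fz, integral_exp_mul_complex (neg_ne_zero.2 h)]
    have : exp (-ζ * (3 : ℝ)) = exp (-3 * ζ) := by congr 1; push_cast; ring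
    rw [this]; simp only [Complex.ofReal_zero, mul_zero, Complex.exp_zero]; field_simp; ring

lemma norm_fz_le {ζ : ℂ} (h : -1 ≤ ζ.re) : ‖fz ζ‖ ≤ 3 * Real.exp 3 := by
  refine (intervalIntegral.norm_integral_le_of_norm_le_const (C := Real.exp 3) fun t ht => ?_).trans
    (by rw [sub_zero, abs_of_pos (by norm_num)]; linarith)
  rw [Set.uIoc_of_le (by norm_num)] at ht
  rw [norm_exp]; refine Real.exp_le_exp.2 ?_
  have : (-ζ * (t : ℂ)).re = -ζ.re * t := by simp
  rw [this]; nlinarith [ht.1, ht.2]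

lemma norm_fz_sub_le {ζ η : ℂ} (h : -1 ≤ ζ.re) (h' : -1 ≤ η.re) :
    ‖fz ζ - fz η‖ ≤ 9 * Real.exp 3 * ‖ζ - η‖ := by
  have hc : ∀ ζ : ℂ, IntervalIntegrable (fun t : ℝ => exp (-ζ * t)) volume 0 3 := fun ζ =>
    Continuous.intervalIntegrable (by fun_prop) _ _
  rw [fz, fz, ← intervalIntegral.integral_sub (hc ζ) (hc η)]
  refine (intervalIntegral.norm_integral_le_of_norm_le_const (C := Real.exp 3 * (3 * ‖ζ - η‖))
    fun t ht => ?_).trans (by rw [sub_zero, abs_of_pos (by norm_num)]; linarith)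
  rw [Set.uIoc_of_le (by norm_num)] at ht
  have hre : ∀ ζ : ℂ, -1 ≤ ζ.re → (-ζ * (t : ℂ)).re ≤ 3 := fun ζ hζ => by
    have : (-ζ * (t : ℂ)).re = -ζ.re * t := by simp
    rw [this]; nlinarith [ht.1, ht.2]
  refine (norm_cexp_sub_cexp_le (hre ζ h) (hre η h')).trans ?_; gcongr
  rw [← sub_mul, norm_mul, show -ζ - -η = -(ζ - η) by ring, norm_neg, norm_real,
    Real.norm_of_nonneg ht.1.le, mul_comm]
  exact mul_le_mul_of_nonneg_right ht.2 (norm_nonneg _)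

section
variable {z z' : ℂ} {x : ℝ}

lemma neg_one_le_re (hz : ‖z‖ ≤ 1) (hx : 0 ≤ x) : -1 ≤ ((x : ℂ) - z).re := by
  have := (Complex.abs_re_le_norm z).trans hz
  have := (abs_le.1 this).2
  simp only [Complex.sub_re, Complex.ofReal_re]; linarith

lemma norm_exp_three_le (hz : ‖z‖ ≤ 1) (hx : 0 ≤ x) : ‖exp (-3 * ((x : ℂ) - z))‖ ≤ Real.exp 3 := by
  rw [norm_exp]
  have h := neg_one_le_re hz hx
  have : (-3 * ((x : ℂ) - z)).re = -3 * ((x : ℂ) - z).re := by simp [Complex.mul_re]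
  rw [this]; exact Real.exp_le_exp.2 (by linarith)

lemma one_add_le_norm (hz : ‖z‖ ≤ 1) (hx : 0 ≤ x) : 1 + x ≤ 2 + ‖(x : ℂ) - z‖ := by
  have h := norm_sub_norm_le (x : ℂ) z
  rw [norm_real, Real.norm_of_nonneg hx] at h; linarith

lemma mul_norm_fz_le (hz : ‖z‖ ≤ 1) (hx : 0 ≤ x) : (1 + x) * ‖fz (x - z)‖ ≤ 1 + 7 * Real.exp 3 := by
  have h1 := norm_fz_le (neg_one_le_re hz hx)
  have h2 : ‖(x : ℂ) - z‖ * ‖fz (x - z)‖ ≤ 1 + Real.exp 3 := by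
    rw [mul_comm, ← norm_mul, fz_mul]
    exact (norm_sub_le _ _).trans (by simpa using norm_exp_three_le hz hx)
  have h3 := mul_le_mul_of_nonneg_right (one_add_le_norm hz hx) (norm_nonneg (fz (x - z)))
  linarith

lemma mul_norm_fz_sub_le (hz : ‖z‖ ≤ 1) (hz' : ‖z'‖ ≤ 1) (hx : 0 ≤ x) :
    (1 + x) * ‖fz (x - z) - fz (x - z')‖ ≤ 24 * Real.exp 3 * ‖z - z'‖ := by
  have hζ := neg_one_le_re hz hx
  have hζ' := neg_one_le_re hz' hx
  have hsub : ((x : ℂ) - z) - (x - z') = -(z - z') := by ring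
  have h1 := norm_fz_sub_le hζ hζ'
  rw [hsub, norm_neg] at h1
  have h2 : ‖(x : ℂ) - z‖ * ‖fz (x - z) - fz (x - z')‖ ≤ 6 * Real.exp 3 * ‖z - z'‖ := by
    have e : (fz (x - z) - fz (x - z')) * ((x : ℂ) - z) =
        (exp (-3 * ((x : ℂ) - z')) - exp (-3 * ((x : ℂ) - z))) + (z - z') * fz (x - z') := by
      linear_combination fz_mul ((x : ℂ) - z) - fz_mul ((x : ℂ) - z')
    have hre : ∀ w : ℂ, -1 ≤ ((x : ℂ) - w).re → (-3 * ((x : ℂ) - w)).re ≤ 3 := fun w hw => by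
      have : (-3 * ((x : ℂ) - w)).re = -3 * ((x : ℂ) - w).re := by simp [Complex.mul_re]
      rw [this]; linarith
    have h3 := norm_cexp_sub_cexp_le (hre z' hζ') (hre z hζ)
    have h4 : ‖(-3 * ((x : ℂ) - z')) - (-3 * ((x : ℂ) - z))‖ = 3 * ‖z - z'‖ := by
      rw [show (-3 * ((x : ℂ) - z')) - (-3 * ((x : ℂ) - z)) = -(3 * (z - z')) by ring, norm_neg,
        norm_mul]
      norm_num
    rw [h4] at h3; rw [mul_comm, ← norm_mul, e]
    refine (norm_add_le _ _).trans ?_; rw [norm_mul]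
    have h5 := mul_le_mul_of_nonneg_left (norm_fz_le hζ') (norm_nonneg (z - z'))
    linarith
  have h3 := mul_le_mul_of_nonneg_right (one_add_le_norm hz hx)
    (norm_nonneg (fz (x - z) - fz (x - z')))
  linarith

lemma mul_norm_exp_sub_le (hz : ‖z‖ ≤ 1) (hz' : ‖z'‖ ≤ 1) (hx : 0 ≤ x) :
    (1 + x) * ‖exp (3 * z) * exp (-x) - exp (3 * z') * exp (-x)‖ ≤ 3 * Real.exp 3 * ‖z - z'‖ := by
  have hre : ∀ z : ℂ, ‖z‖ ≤ 1 → (3 * z).re ≤ 3 := fun z hz => by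
    have := (abs_le.1 ((Complex.abs_re_le_norm z).trans hz)).2
    have e : (3 * z).re = 3 * z.re := by simp [Complex.mul_re]
    rw [e]; linarith
  have h1 := norm_cexp_sub_cexp_le (hre z hz) (hre z' hz')
  rw [← mul_sub, norm_mul] at h1
  have h2 : (1 + x) * ‖exp (-(x : ℂ))‖ ≤ 1 := by
    rw [norm_exp]; simp only [Complex.neg_re, Complex.ofReal_re]
    rw [Real.exp_neg, ← div_eq_mul_inv, div_le_one (Real.exp_pos _)]
    linarith [Real.add_one_le_exp x]
  rw [← sub_mul, norm_mul]; norm_num at h1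
  calc _ = ‖exp (3 * z) - exp (3 * z')‖ *
        ((1 + x) * ‖exp (-(x : ℂ))‖) := by ring
    _ ≤ (Real.exp 3 * (3 * ‖z - z'‖)) * 1 := by gcongr
    _ = _ := by ring

lemma mul_norm_exp_le (hz : ‖z‖ ≤ 1) (hx : 0 ≤ x) :
    (1 + x) * ‖exp (3 * z) * exp (-x)‖ ≤ Real.exp 3 := by
  have h1 : ‖exp (3 * z)‖ ≤ Real.exp 3 := by
    rw [norm_exp]
    have := (abs_le.1 ((Complex.abs_re_le_norm z).trans hz)).2
    have e : (3 * z).re = 3 * z.re := by simp [Complex.mul_re]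
    rw [e]; exact Real.exp_le_exp.2 (by linarith)
  have h2 : (1 + x) * ‖exp (-(x : ℂ))‖ ≤ 1 := by
    rw [norm_exp]; simp only [Complex.neg_re, Complex.ofReal_re]
    rw [Real.exp_neg, ← div_eq_mul_inv, div_le_one (Real.exp_pos _)]
    linarith [Real.add_one_le_exp x]
  rw [norm_mul]
  calc _ = ‖exp (3 * z)‖ * ((1 + x) * ‖exp (-(x : ℂ))‖) := by ring
    _ ≤ Real.exp 3 * 1 := by gcongr
    _ = _ := mul_one _

end

lemma Pk_cs_neg (k : E3) : Pk k (cs (-k)) = ((‖k‖ ^ 2 : ℝ) : ℂ) • cs (-k) := by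
  rw [Pk_apply, osc_apply, mulk_eq, ← sum_sq_coord, Finset.sum_smul, Finset.smul_sum,
    ← sum_add_distrib]
  refine sum_congr rfl fun j _ => ?_
  rw [← An_add_Cr, An_cs, map_smul]
  simp only [PiLp.neg_apply, Complex.ofReal_neg, smul_add, smul_smul]
  have : I * ((k j : ℂ) * (I * -(k j : ℂ))) = (k j : ℂ) * k j := by
    linear_combination (-(k j : ℂ) * k j) * Complex.I_sq
  rw [this]; module

lemma norm_ip_cs_rhs_le (k : E3) (f0 : S3) (f1 f2 : Fin 3 → S3) :
    ‖ip (cs k) (rhs f0 f1 f2)‖ ≤ 7 * (1 + ‖k‖ ^ 2) * rn f0 f1 f2 := by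
  refine (norm_ip_rhs_le _ _ _ _).trans ?_; rw [mul_comm]
  refine mul_le_mul_of_nonneg_right ((mn_cs_le k).trans ?_) (rn_nonneg _ _ _)
  nlinarith [sq_nonneg (‖k‖ - 1)]

lemma apriori_sub (k : E3) {z : ℂ} (hz : ‖z‖ ≤ dl) {w f0 : S3} {f1 f2 : Fin 3 → S3}
    {c : ℂ} (hw : Pk k w - z • w = rhs f0 f1 f2 - c • cs (-k)) :
    nn w + dn w ≤ cA * (rn f0 f1 f2 + ‖c‖ + ‖ip (cs k) w‖) := by
  have h : Pk k w - z • w = rhs (f0 - c • cs (-k)) f1 f2 := by rw [hw]; unfold rhs; abel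
  refine (apriori k hz h).trans ?_
  have := cA_pos
  have h2 : nn (f0 - c • cs (-k)) ≤ nn f0 + ‖c‖ := by
    refine (nn_sub_le _ _).trans ?_
    rw [nn_smul, nn_cs, mul_one]
  gcongr; unfold rn; linarith

/-- The remainder of the solution `u` of `(P_k - z) u = f` after the slowly varying part is
removed. -/
def fibT (k : E3) (z : ℂ) (u f : S3) : S3 :=
  u - (exp (3 * z) * (((‖k‖ ^ 2 : ℝ) : ℂ) - z)⁻¹ * exp (-((‖k‖ ^ 2 : ℝ) : ℂ)) *
    ip (cs k) f) • cs (-k)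

section
variable {k : E3} {z z' : ℂ} {u u' f : S3}

lemma ne_of_notMem (hz : z ∉ halfLine) : ((‖k‖ ^ 2 : ℝ) : ℂ) - z ≠ 0 := fun h =>
  hz ⟨‖k‖ ^ 2, Set.mem_Ici.2 (sq_nonneg _), sub_eq_zero.1 h⟩

lemma Pk_fibT (hz : z ∉ halfLine) (hu : Pk k u - z • u = f) :
    Pk k (fibT k z u f) - z • fibT k z u f =
      f - (exp (3 * z) * exp (-((‖k‖ ^ 2 : ℝ) : ℂ)) * ip (cs k) f) • cs (-k) := by
  have hne := ne_of_notMem (k := k) hz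
  rw [fibT, map_sub, map_smul, Pk_cs_neg, ← hu]
  set n := ((‖k‖ ^ 2 : ℝ) : ℂ)
  set β := ip (cs k) (Pk k u - z • u)
  have e : exp (3 * z) * exp (-n) * β = (exp (3 * z) * (n - z)⁻¹ * exp (-n) * β) * (n - z) := by
    field_simp
  rw [e]; module

lemma ip_cs_fibT (hz : z ∉ halfLine) (hu : Pk k u - z • u = f) :
    ip (cs k) (fibT k z u f) = fz (((‖k‖ ^ 2 : ℝ) : ℂ) - z) * ip (cs k) f := by
  have hne := ne_of_notMem (k := k) hz
  have h1 : ip (cs k) f = (((‖k‖ ^ 2 : ℝ) : ℂ) - z) * ip (cs k) u := by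
    rw [← hu, ip_sub_right, ip_smul_right, ip_cs_Pk]; ring
  have h2 : ip (cs k) (cs (-k)) = exp (-2 * ((‖k‖ ^ 2 : ℝ) : ℂ)) := by
    rw [ip_cs_cs, sub_neg_eq_add, ← two_smul ℝ k, norm_smul, Complex.ofReal_exp]; congr 1; push_cast
    norm_num; ring
  have h3 := fz_mul (((‖k‖ ^ 2 : ℝ) : ℂ) - z)
  rw [fibT, ip_sub_right, ip_smul_right, h2]
  set n := ((‖k‖ ^ 2 : ℝ) : ℂ)
  have h4 : exp (-3 * (n - z)) = exp (3 * z) * exp (-n) * exp (-2 * n) := by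
    rw [← exp_add, ← exp_add]; congr 1; ring
  rw [h4] at h3
  have h5 : ip (cs k) u = (n - z)⁻¹ * ip (cs k) f := by rw [h1]; field_simp
  have h6 : fz (n - z) = (1 - exp (3 * z) * exp (-n) * exp (-2 * n)) *
      (n - z)⁻¹ := by rw [← h3]; field_simp
  rw [h5, h6]; ring

end

/-- The constant in the bound for the remainder. -/
def cT : ℝ := cA * (8 + 56 * Real.exp 3)

lemma cT_pos : 0 < cT := by have := cA_pos; unfold cT; positivity

lemma fibT_le {k : E3} {z : ℂ} (hz : ‖z‖ ≤ dl) (hz' : z ∉ halfLine) {u f0 : S3}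
    {f1 f2 : Fin 3 → S3} (hu : Pk k u - z • u = rhs f0 f1 f2) :
    nn (fibT k z u (rhs f0 f1 f2)) + dn (fibT k z u (rhs f0 f1 f2)) ≤ cT * rn f0 f1 f2 := by
  have hz1 := hz.trans dl_le_one
  have hx : 0 ≤ ‖k‖ ^ 2 := sq_nonneg _
  have h1 := apriori_sub k hz (Pk_fibT hz' hu)
  rw [ip_cs_fibT hz' hu, norm_mul _ (ip (cs k) (rhs f0 f1 f2)), norm_mul (fz _)] at h1
  have hβ := norm_ip_cs_rhs_le k f0 f1 f2
  have hr := rn_nonneg f0 f1 f2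
  have hcA := cA_pos
  have key : ∀ (e : ℂ) (C : ℝ), (1 + ‖k‖ ^ 2) * ‖e‖ ≤ C →
      ‖e‖ * ‖ip (cs k) (rhs f0 f1 f2)‖ ≤ 7 * C * rn f0 f1 f2 := by
    intro e C he
    calc _ ≤ ‖e‖ * (7 * (1 + ‖k‖ ^ 2) * rn f0 f1 f2) := by gcongr
      _ = 7 * ((1 + ‖k‖ ^ 2) * ‖e‖) * rn f0 f1 f2 := by ring
      _ ≤ _ := by gcongr
  have a1 := key _ _ (mul_norm_exp_le hz1 hx)
  have a2 := key _ _ (mul_norm_fz_le hz1 hx)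
  refine h1.trans ?_
  rw [cT, mul_assoc]
  refine mul_le_mul_of_nonneg_left ?_ hcA.le; linarith

lemma fibT_sub_le {k : E3} {z z' : ℂ} (hz : ‖z‖ ≤ dl) (hz1 : z ∉ halfLine) (hz' : ‖z'‖ ≤ dl)
    (hz1' : z' ∉ halfLine) {u u' f0 : S3} {f1 f2 : Fin 3 → S3}
    (hu : Pk k u - z • u = rhs f0 f1 f2) (hu' : Pk k u' - z' • u' = rhs f0 f1 f2) :
    nn (fibT k z u (rhs f0 f1 f2) - fibT k z' u' (rhs f0 f1 f2)) +
      dn (fibT k z u (rhs f0 f1 f2) - fibT k z' u' (rhs f0 f1 f2)) ≤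
        (cA * (cT + 189 * Real.exp 3) * ‖z - z'‖) * rn f0 f1 f2 := by
  have hzl := hz.trans dl_le_one
  have hzl' := hz'.trans dl_le_one
  have hx : 0 ≤ ‖k‖ ^ 2 := sq_nonneg _
  set t := fibT k z u (rhs f0 f1 f2) with ht
  set t' := fibT k z' u' (rhs f0 f1 f2) with ht'
  have e1 := Pk_fibT hz1 hu
  have e2 := Pk_fibT hz1' hu'
  rw [← ht] at e1
  rw [← ht'] at e2
  set β := ip (cs k) (rhs f0 f1 f2) with hβ0
  have hw : Pk k (t - t') - z • (t - t') = rhs ((z - z') • t') 0 0 -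
      ((exp (3 * z) * exp (-((‖k‖ ^ 2 : ℝ) : ℂ)) -
        exp (3 * z') * exp (-((‖k‖ ^ 2 : ℝ) : ℂ))) * β) • cs (-k) := by
    have : Pk k (t - t') - z • (t - t') =
        (Pk k t - z • t) - (Pk k t' - z' • t') + (z - z') • t' := by
      rw [map_sub]; module
    rw [this, e1, e2]
    simp only [rhs, Pi.zero_apply, map_zero, Finset.sum_const_zero]; module
  have h1 := apriori_sub k hz hw
  have h2 : ip (cs k) (t - t') = (fz (((‖k‖ ^ 2 : ℝ) : ℂ) - z) - fz (((‖k‖ ^ 2 : ℝ) : ℂ) - z')) * β := by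
    rw [ip_sub_right, ht, ht', ip_cs_fibT hz1 hu, ip_cs_fibT hz1' hu', sub_mul]
  have h3 : rn ((z - z') • t') 0 0 ≤ ‖z - z'‖ * (cT * rn f0 f1 f2) := by
    have h4 := fibT_le hz' hz1' hu'
    rw [← ht'] at h4
    have h5 : rn ((z - z') • t') 0 0 = ‖z - z'‖ * nn t' := by
      have : nn (0 : S3) = 0 := by simpa using nn_smul 0 (0 : S3)
      simp [rn, nn_smul, this]
    rw [h5]; gcongr
    linarith [dn_nonneg t']
  rw [h2, norm_mul, norm_mul] at h1
  have hβ := norm_ip_cs_rhs_le k f0 f1 f2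
  rw [← hβ0] at hβ
  have hr := rn_nonneg f0 f1 f2
  have hcA := cA_pos
  have key : ∀ (e : ℂ) (C : ℝ), (1 + ‖k‖ ^ 2) * ‖e‖ ≤ C → ‖e‖ * ‖β‖ ≤ 7 * C * rn f0 f1 f2 := by
    intro e C he
    calc _ ≤ ‖e‖ * (7 * (1 + ‖k‖ ^ 2) * rn f0 f1 f2) := by gcongr
      _ = 7 * ((1 + ‖k‖ ^ 2) * ‖e‖) * rn f0 f1 f2 := by ring
      _ ≤ _ := by gcongr
  have a1 := key _ _ (mul_norm_exp_sub_le hzl hzl' hx)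
  have a2 := key _ _ (mul_norm_fz_sub_le hzl hzl' hx)
  refine h1.trans ?_
  calc _ ≤ cA * (‖z - z'‖ * (cT * rn f0 f1 f2) + 7 * (3 * Real.exp 3 * ‖z - z'‖) * rn f0 f1 f2 +
        7 * (24 * Real.exp 3 * ‖z - z'‖) * rn f0 f1 f2) := by gcongr
    _ = _ := by ring

lemma fib_sub_dB {z : ℂ} (hz : z ∉ halfLine) (U F : Dom) (ξ : E3) :
    fib ξ (U - dB hz F) = fibT (kk ξ) z (fib ξ U) (fib ξ F) := by
  rw [map_sub, fib_dB]; rfl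

/-- The remainder depends Lipschitz continuously on the spectral parameter, up to the
spectrum. -/
lemma hn_sub_dB_sub_le {z z' : ℂ} (hz : ‖z‖ ≤ dl) (hz1 : z ∉ halfLine) (hz' : ‖z'‖ ≤ dl)
    (hz1' : z' ∉ halfLine) {U U' F0 : Dom} {F1 F2 : Fin 3 → Dom}
    (hU : dP U - z • U = dR F0 F1 F2) (hU' : dP U' - z' • U' = dR F0 F1 F2) :
    hn ((U - dB hz1 (dR F0 F1 F2)) - (U' - dB hz1' (dR F0 F1 F2))) ≤
      28 * (cA * (cT + 189 * Real.exp 3) * ‖z - z'‖) * rN F0 F1 F2 := by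
  have := cA_pos
  have := cT_pos
  have hf : ∀ {z : ℂ} {U : Dom}, dP U - z • U = dR F0 F1 F2 → ∀ ξ, Pk (kk ξ) (fib ξ U) -
      z • fib ξ U = rhs (fib ξ F0) (fun j => fib ξ (F1 j)) (fun j => fib ξ (F2 j)) := by
    intro z U h ξ; rw [← fib_dR, ← h, map_sub, map_smul, fib_dP]
  refine hn_le_of_fib (by positivity) fun ξ => ?_
  rw [map_sub, fib_sub_dB, fib_sub_dB, fib_dR]
  exact fibT_sub_le hz hz1 hz' hz1' (hf hU ξ) (hf hU' ξ)

/-! ### Weighted bounds for the slowly varying part -/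

lemma exists_enorm_schwartz_le (Q : S6) {m : ℝ} (hm : 0 ≤ m) :
    ∃ C : ℝ≥0∞, C ≠ ⊤ ∧ ∀ p : Phase, ‖Q p‖ₑ ≤ C * wt (-m) p.1 * wt (-m) p.2 := by
  obtain ⟨k, hk⟩ := exists_nat_ge (4 * m)
  set C : ℝ := 2 ^ k * (Finset.Iic (k, 0)).sup (fun m => SchwartzMap.seminorm ℝ m.1 m.2) Q with hC
  refine ⟨ofReal C, ofReal_ne_top, fun p => ?_⟩
  have h1 := SchwartzMap.one_add_le_sup_seminorm_apply (𝕜 := ℝ) (m := (k, 0)) (k := k) (n := 0)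
    le_rfl le_rfl Q p
  rw [norm_iteratedFDeriv_zero, ← hC] at h1
  have hb : ∀ x : E3, ‖x‖ ≤ ‖p‖ → bracket x ≤ 1 + ‖p‖ := fun x hx =>
    Real.sqrt_le_iff.2 ⟨by positivity, by nlinarith [norm_nonneg x]⟩
  have h2 : bracket p.1 ^ (2 * m) * bracket p.2 ^ (2 * m) ≤ (1 + ‖p‖) ^ k := by
    calc _ ≤ (1 + ‖p‖) ^ (2 * m) * (1 + ‖p‖) ^ (2 * m) := by
          have := bracket_pos p.1
          have := bracket_pos p.2
          gcongr
          · exact hb _ (norm_fst_le p)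
          · exact hb _ (norm_snd_le p)
      _ = (1 + ‖p‖) ^ (4 * m) := by rw [← Real.rpow_add (by positivity)]; congr 1; ring
      _ ≤ (1 + ‖p‖) ^ (k : ℝ) := Real.rpow_le_rpow_of_exponent_le (by linarith [norm_nonneg p]) hk
      _ = _ := Real.rpow_natCast _ _
  have h3 : ‖Q p‖ₑ * (wt m p.1 * wt m p.2) ≤ ofReal C := by
    have := bracket_pos p.1
    have := bracket_pos p.2
    rw [wt, wt, ← ofReal_mul (by positivity), ← ofReal_norm, ← ofReal_mul (by positivity)]
    refine ofReal_le_ofReal (le_trans ?_ h1); rw [mul_comm]; gcongr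
  calc ‖Q p‖ₑ = ‖Q p‖ₑ * (wt m p.1 * wt m p.2) * (wt (-m) p.1 * wt (-m) p.2) := by
        rw [show ∀ a b c d e : ℝ≥0∞, a * (b * c) * (d * e) = a * (b * d) * (c * e) by intros; ring,
          wt_mul_neg, wt_mul_neg, mul_one, mul_one]
    _ ≤ ofReal C * (wt (-m) p.1 * wt (-m) p.2) := by gcongr
    _ = _ := by ring

lemma wt_half_sq (s : ℝ) (x : E3) : wt (s / 2) x ^ 2 = wt s x := by rw [sq, wt_mul, add_halves]

lemma wt_neg_le_one {s : ℝ} (hs : 0 ≤ s) (x : E3) : wt (-s) x ≤ 1 := by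
  rw [← wt_zero x]; exact wt_mono (by linarith) x

lemma measurable_av (Q : S6) {f : Phase → ℂ} (hf : Measurable f) : Measurable (av Q f) := by
  have h : StronglyMeasurable fun q : E3 × Phase => Q (q.1 - q.2.1, q.2.2) * f q.2 := by
    refine Measurable.stronglyMeasurable (Measurable.mul ?_ (hf.comp measurable_snd))
    exact Q.continuous.measurable.comp (by fun_prop)
  exact (h.integral_prod_right' (ν := (volume : Measure Phase))).measurable

/-- Averaging by a Schwartz function is bounded between weighted spaces. -/
lemma exists_lintegral_av_le (Q : S6) {σ : ℝ} (hσ : 0 ≤ σ) :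
    ∃ C : ℝ≥0∞, C ≠ ⊤ ∧ ∀ f : Phase → ℂ, Measurable f →
      ∫⁻ y, wt σ y * ‖av Q f y‖ₑ ^ 2 ≤ C * ∫⁻ p : Phase, wt σ p.1 * ‖f p‖ₑ ^ 2 := by
  obtain ⟨C, hC, hQ⟩ := exists_enorm_schwartz_le Q (m := σ + 2) (by linarith)
  set m := σ + 2 with hm
  set A : ℝ≥0∞ := ∫⁻ x : E3, wt (-m) x with hA
  have hAt : A < ⊤ := lintegral_wt_lt_top (by linarith)
  set B : ℝ≥0∞ := ∫⁻ x : E3, wt (-2) x with hB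
  have hBt : B < ⊤ := lintegral_wt_lt_top (by norm_num)
  have hwm := measurable_wt (-m)
  have hwm2 := measurable_wt (-m / 2)
  have hw2 := measurable_wt (-2)
  have hws := measurable_wt σ
  refine ⟨C ^ 2 * (A * A) * (cW σ * B), ?_, fun f hf => ?_⟩
  · exact mul_ne_top (mul_ne_top (ENNReal.pow_ne_top hC)
      (mul_ne_top hAt.ne hAt.ne)) (mul_ne_top (cW_ne_top _) hBt.ne)
  have hfe : Measurable fun p => ‖f p‖ₑ := hf.enorm
  have hpt : ∀ y, ‖av Q f y‖ₑ ^ 2 ≤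
      C ^ 2 * (A * A) * ∫⁻ p : Phase, wt (-m) (y - p.1) * ‖f p‖ₑ ^ 2 := by
    intro y
    have h1 : ‖av Q f y‖ₑ ≤ C * ∫⁻ p : Phase, (wt (-m / 2) (y - p.1) * wt (-m / 2) p.2) *
        (wt (-m / 2) (y - p.1) * wt (-m / 2) p.2 * ‖f p‖ₑ) := by
      rw [← lintegral_const_mul _ (by fun_prop)]
      refine (enorm_integral_le_lintegral_enorm _).trans (lintegral_mono fun p => ?_)
      rw [enorm_mul]
      refine (mul_le_mul_left (hQ (y - p.1, p.2)) _).trans (le_of_eq ?_)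
      simp only [← wt_half_sq (-m)]; ring
    have h2 := sq_lintegral_mul_le (μ := (volume : Measure Phase))
      (f := fun p : Phase => wt (-m / 2) (y - p.1) * wt (-m / 2) p.2)
      (g := fun p : Phase => wt (-m / 2) (y - p.1) * wt (-m / 2) p.2 * ‖f p‖ₑ)
      (by fun_prop) (by fun_prop)
    have h3 : ∫⁻ p : Phase, (wt (-m / 2) (y - p.1) * wt (-m / 2) p.2) ^ 2 = A * A := by
      simp only [mul_pow, wt_half_sq]
      rw [volume_eq_prod, lintegral_prod _ (by fun_prop)]
      simp only [lintegral_const_mul _ hwm]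
      rw [lintegral_mul_const _ (by fun_prop), lintegral_sub_left_eq_self]
    have h4 : ∫⁻ p : Phase, (wt (-m / 2) (y - p.1) * wt (-m / 2) p.2 * ‖f p‖ₑ) ^ 2 ≤
        ∫⁻ p : Phase, wt (-m) (y - p.1) * ‖f p‖ₑ ^ 2 := by
      refine lintegral_mono fun p => ?_
      simp only [mul_pow, wt_half_sq]; gcongr
      exact mul_le_of_le_one_right zero_le (wt_neg_le_one (by linarith) _)
    calc ‖av Q f y‖ₑ ^ 2 ≤ (C * _) ^ 2 := by gcongr
      _ = C ^ 2 * _ := mul_pow _ _ _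
      _ ≤ C ^ 2 * ((A * A) * ∫⁻ p : Phase, wt (-m) (y - p.1) * ‖f p‖ₑ ^ 2) := by
          gcongr; refine h2.trans ?_; rw [h3]; gcongr
      _ = _ := by ring
  have hmeas : Measurable fun y => ∫⁻ p : Phase, wt (-m) (y - p.1) * ‖f p‖ₑ ^ 2 :=
    Measurable.lintegral_prod_right' (ν := (volume : Measure Phase))
      (f := fun q : E3 × Phase => wt (-m) (q.1 - q.2.1) * ‖f q.2‖ₑ ^ 2) (by fun_prop)
  calc ∫⁻ y, wt σ y * ‖av Q f y‖ₑ ^ 2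
      ≤ ∫⁻ y, C ^ 2 * (A * A) * (wt σ y * ∫⁻ p : Phase, wt (-m) (y - p.1) * ‖f p‖ₑ ^ 2) := by
        refine lintegral_mono fun y => ?_
        calc _ ≤ wt σ y * (C ^ 2 * (A * A) * ∫⁻ p : Phase, wt (-m) (y - p.1) * ‖f p‖ₑ ^ 2) := by
              gcongr; exact hpt y
          _ = _ := by ring
    _ = C ^ 2 * (A * A) * ∫⁻ y, ∫⁻ p : Phase, wt σ y * (wt (-m) (y - p.1) * ‖f p‖ₑ ^ 2) := by
        rw [lintegral_const_mul _ (by fun_prop)]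
        congr 1; refine lintegral_congr fun y => ?_
        rw [lintegral_const_mul _ (by fun_prop)]
    _ = C ^ 2 * (A * A) * ∫⁻ p : Phase, ∫⁻ y, wt σ y * (wt (-m) (y - p.1) * ‖f p‖ₑ ^ 2) := by
        rw [lintegral_lintegral_swap (by fun_prop)]
    _ ≤ C ^ 2 * (A * A) * ∫⁻ p : Phase, (cW σ * B) * (wt σ p.1 * ‖f p‖ₑ ^ 2) := by
        gcongr with p; rw [← lintegral_add_right_eq_self _ p.1]
        calc _ ≤ ∫⁻ t : E3, wt (-2) t * (cW σ * wt σ p.1 * ‖f p‖ₑ ^ 2) := by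
              refine lintegral_mono fun t => ?_
              rw [add_sub_cancel_right, add_comm t]
              calc _ ≤ (cW σ * wt σ p.1 * wt |σ| t) * (wt (-m) t * ‖f p‖ₑ ^ 2) := by
                    gcongr; exact wt_add_le _ _ _
                _ = (wt σ t * wt (-m) t) * (cW σ * wt σ p.1 * ‖f p‖ₑ ^ 2) := by
                    rw [abs_of_nonneg hσ]; ring
                _ = _ := by rw [wt_mul, hm]; congr 2; ring
          _ = _ := by rw [lintegral_mul_const _ hw2]; ring
    _ = _ := by
        rw [lintegral_const_mul _ (by fun_prop : Measurable fun p : Phase => wt σ p.1 * ‖f p‖ₑ ^ 2)]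
        ring

/-- The weighted Hilbert–Schmidt norm of the convolution with `D`. -/
def Jn (s σ : ℝ) (D : E3 → ℂ) : ℝ≥0∞ :=
  ∫⁻ q : E3 × E3, wt (-s) q.1 * ‖D (q.1 - q.2)‖ₑ ^ 2 * wt (-σ) q.2

lemma measurable_Jn (s σ : ℝ) {D : E3 → ℂ} (hD : Measurable D) : Measurable fun q : E3 × E3 =>
    wt (-s) q.1 * ‖D (q.1 - q.2)‖ₑ ^ 2 * wt (-σ) q.2 := by
  have hw1 := measurable_wt (-s)
  have hw2 := measurable_wt (-σ)
  have hDe : Measurable fun y => ‖D y‖ₑ := hD.enorm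
  fun_prop

lemma measurable_cv {D h : E3 → ℂ} (hD : Measurable D) (hh : Measurable h) :
    Measurable (cv D h) := by
  have h : StronglyMeasurable fun q : E3 × E3 => D (q.1 - q.2) * h q.2 :=
    (((hD.comp (by fun_prop : Measurable fun q : E3 × E3 => q.1 - q.2))).mul
      (hh.comp measurable_snd)).stronglyMeasurable
  exact (h.integral_prod_right' (ν := (volume : Measure E3))).measurable

lemma enorm_cv_sq_le (σ : ℝ) {D h : E3 → ℂ} (hD : Measurable D) (hh : Measurable h) (x : E3) :
    ‖cv D h x‖ₑ ^ 2 ≤ (∫⁻ y, ‖D (x - y)‖ₑ ^ 2 * wt (-σ) y) * ∫⁻ y, wt σ y * ‖h y‖ₑ ^ 2 := by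
  have hDx : Measurable fun y => ‖D (x - y)‖ₑ := (hD.comp (measurable_const.sub measurable_id)).enorm
  have h1 : ‖cv D h x‖ₑ ≤ ∫⁻ y, (‖D (x - y)‖ₑ * wt (-σ / 2) y) * (wt (σ / 2) y * ‖h y‖ₑ) := by
    refine (enorm_integral_le_lintegral_enorm _).trans (le_of_eq (lintegral_congr fun y => ?_))
    rw [enorm_mul, show ∀ a b c d : ℝ≥0∞, a * b * (c * d) = a * (b * c) * d by intros; ring,
      wt_mul, neg_div, neg_add_cancel, wt_zero, mul_one]
  have hw1 := measurable_wt (-σ / 2)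
  have hw2 := measurable_wt (σ / 2)
  refine (pow_le_pow_left₀ zero_le h1 2).trans ((sq_lintegral_mul_le (by fun_prop)
    (by fun_prop)).trans (le_of_eq ?_))
  simp only [mul_pow, wt_half_sq]

lemma lintegral_cv_le (s σ : ℝ) {D h : E3 → ℂ} (hD : Measurable D) (hh : Measurable h) :
    ∫⁻ x, wt (-s) x * ‖cv D h x‖ₑ ^ 2 ≤ Jn s σ D * ∫⁻ y, wt σ y * ‖h y‖ₑ ^ 2 := by
  have hm := measurable_Jn s σ hD
  have hw2 := measurable_wt (-σ)
  rw [Jn, volume_eq_prod, lintegral_prod _ hm.aemeasurable,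
    ← lintegral_mul_const _ hm.lintegral_prod_right']
  refine lintegral_mono fun x => ?_
  have hDx : Measurable fun y => ‖D (x - y)‖ₑ := (hD.comp (measurable_const.sub measurable_id)).enorm
  refine (mul_le_mul_right (enorm_cv_sq_le σ hD hh x) _).trans (le_of_eq ?_)
  have hmx : Measurable fun y => ‖D (x - y)‖ₑ ^ 2 * wt (-σ) y := by fun_prop
  rw [← mul_assoc, ← lintegral_const_mul _ hmx]
  simp only [mul_assoc]

/-- The constant in the passage from functions of `x` to functions of `(x, v)`. -/
def cPs (s : ℝ) : ℝ≥0∞ := cW (-s) * ∫⁻ v, ‖ps v‖ₑ ^ 2 * wt |(-s)| v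

lemma cPs_ne_top (s : ℝ) : cPs s ≠ ⊤ := by
  refine mul_ne_top (cW_ne_top _) ?_
  have h : ∃ C : ℝ≥0∞, C ≠ ⊤ ∧ ∀ v, ‖ps v‖ₑ ≤ C * wt (-(|(-s)| + 2)) v := by
    obtain ⟨C, hC, h⟩ := exists_enorm_schwartz_le (outer ps ps) (m := |(-s)| + 2) (by positivity)
    refine ⟨C * ‖ps 0‖ₑ⁻¹, mul_ne_top hC (by simp [ps_ne_zero]), fun v => ?_⟩
    have h1 := h (0, v)
    have h0 : ‖ps 0‖ₑ ≠ 0 := by simp [ps_ne_zero]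
    rw [outer_apply, enorm_mul] at h1
    have h2 : wt (-(|(-s)| + 2)) (0 : E3) = 1 := by simp [wt, bracket]
    rw [h2, mul_one] at h1
    calc ‖ps v‖ₑ = ‖ps v‖ₑ * ‖ps 0‖ₑ * ‖ps 0‖ₑ⁻¹ := by
          rw [mul_assoc, ENNReal.mul_inv_cancel h0 enorm_ne_top, mul_one]
      _ ≤ (C * wt (-(|(-s)| + 2)) v) * ‖ps 0‖ₑ⁻¹ := by gcongr
      _ = _ := by ring
  obtain ⟨C, hC, h⟩ := h
  refine ne_top_of_le_ne_top (b := C ^ 2 * ∫⁻ v : E3, wt (-2) v) (mul_ne_top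
    (ENNReal.pow_ne_top hC) (lintegral_wt_lt_top (by norm_num)).ne) ?_
  rw [← lintegral_const_mul _ (measurable_wt _)]
  refine lintegral_mono fun v => ?_
  set a := |(-s)|
  have ha : 0 ≤ a := abs_nonneg _
  calc _ ≤ (C * wt (-(a + 2)) v) ^ 2 * wt a v := by gcongr; exact h v
    _ = C ^ 2 * (wt (-(a + 2)) v * (wt (-(a + 2)) v * wt a v)) := by ring
    _ ≤ C ^ 2 * (1 * (wt (-(a + 2)) v * wt a v)) := by gcongr; exact wt_neg_le_one (by linarith) v
    _ = _ := by rw [one_mul, wt_mul]; congr 2; ring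

lemma lintegral_ps_mul_le (s : ℝ) {N : E3 → ℂ} (hN : Measurable N) :
    ∫⁻ q : Phase, wt (-s) q.1 * ‖ps q.2 * N (q.1 - q.2)‖ₑ ^ 2 ≤
      cPs s * ∫⁻ x, wt (-s) x * ‖N x‖ₑ ^ 2 := by
  have hw := measurable_wt (-s)
  have hw2 := measurable_wt |(-s)|
  have hNe : Measurable fun y => ‖N y‖ₑ := hN.enorm
  have hps : Measurable fun v => ‖ps v‖ₑ := ps.continuous.measurable.enorm
  simp only [enorm_mul, mul_pow]
  have hm : Measurable fun q : Phase => wt (-s) q.1 * (‖ps q.2‖ₑ ^ 2 * ‖N (q.1 - q.2)‖ₑ ^ 2) :=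
    (hw.comp measurable_fst).mul (((hps.comp measurable_snd).pow_const 2).mul
      ((hNe.comp (measurable_fst.sub measurable_snd)).pow_const 2))
  rw [volume_eq_prod, lintegral_prod_symm' _ hm]
  calc _ ≤ ∫⁻ v : E3, (‖ps v‖ₑ ^ 2 * wt |(-s)| v) * (cW (-s) * ∫⁻ x, wt (-s) x * ‖N x‖ₑ ^ 2) := by
        refine lintegral_mono fun v => ?_
        rw [← lintegral_add_right_eq_self _ v, ← lintegral_const_mul _ (by fun_prop),
          ← lintegral_const_mul _ (by fun_prop)]
        refine lintegral_mono fun x => ?_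
        simp only [add_sub_cancel_right]
        calc _ ≤ (cW (-s) * wt (-s) x * wt |(-s)| v) * (‖ps v‖ₑ ^ 2 * ‖N x‖ₑ ^ 2) := by
              gcongr; exact wt_add_le _ _ _
          _ = _ := by ring
    _ = _ := by rw [lintegral_mul_const _ (by fun_prop), cPs]; ring

/-! ### The kernel near the threshold -/

/-- The square root of `-z` with positive real part, for `z` off the half line. -/
def sqz (z : ℂ) : ℂ := open scoped Classical in
  if h : z ∉ halfLine then (exists_sqrt h).choose else 0

lemma sqz_spec {z : ℂ} (hz : z ∉ halfLine) :
    0 < (sqz z).re ∧ sqz z ^ 2 = -z ∧ ‖sqz z‖ ^ 2 = ‖z‖ := by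
  rw [sqz, dif_pos hz]; exact (exists_sqrt hz).choose_spec

/-- The kernel of the slowly varying part. -/
def Dz (z : ℂ) (x : E3) : ℂ := exp (3 * z) * Yk (sqz z) x

lemma measurable_Dz (z : ℂ) : Measurable (Dz z) := (measurable_Yk _).const_mul _

lemma lintegral_Dz_lt_top {z : ℂ} (hz : z ∉ halfLine) : ∫⁻ x, ‖Dz z x‖ₑ ^ 2 < ⊤ := by
  have h := ((integrable_norm_Yk_sq (sqz_spec hz).1).const_mul (‖exp (3 * z)‖ ^ 2)).lintegral_lt_top
  refine lt_of_eq_of_lt (lintegral_congr fun x => ?_) h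
  rw [← mul_pow, ← norm_mul, ofReal_pow (norm_nonneg _), ofReal_norm]; rfl

lemma tendsto_sqz : Tendsto sqz (𝓝[halfLineᶜ] 0) (𝓝 0) := by
  rw [tendsto_zero_iff_norm_tendsto_zero]
  have h : Tendsto (fun z : ℂ => Real.sqrt ‖z‖) (𝓝[halfLineᶜ] 0) (𝓝 0) := by
    have : Continuous fun z : ℂ => Real.sqrt ‖z‖ := by fun_prop
    simpa using (this.tendsto 0).mono_left nhdsWithin_le_nhds
  refine h.congr' ?_
  filter_upwards [self_mem_nhdsWithin] with z hz
  rw [← (sqz_spec hz).2.2, Real.sqrt_sq (norm_nonneg _)]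

lemma tendsto_Dz (x : E3) : Tendsto (fun z => Dz z x) (𝓝[halfLineᶜ] 0) (𝓝 (Yk 0 x)) := by
  have h1 : Tendsto (fun z : ℂ => exp (3 * z)) (𝓝[halfLineᶜ] 0) (𝓝 1) := by
    have hc : Continuous fun z : ℂ => exp (3 * z) := by fun_prop
    have := (hc.tendsto 0).mono_left (nhdsWithin_le_nhds (s := halfLineᶜ))
    rwa [mul_zero, Complex.exp_zero] at this
  have h2 : Tendsto (fun z : ℂ => Yk (sqz z) x) (𝓝[halfLineᶜ] 0) (𝓝 (Yk 0 x)) := by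
    have hc : Continuous fun l : ℂ => Yk l x := by unfold Yk; fun_prop
    exact (hc.tendsto 0).comp tendsto_sqz
  have h3 := h1.mul h2
  rw [one_mul] at h3; exact h3

lemma enorm_sub_sq_le (a b : ℂ) : ‖a - b‖ₑ ^ 2 ≤ 2 * ‖a‖ₑ ^ 2 + 2 * ‖b‖ₑ ^ 2 := by
  have h : ‖a - b‖ ^ 2 ≤ 2 * ‖a‖ ^ 2 + 2 * ‖b‖ ^ 2 := by
    have := norm_sub_le a b
    nlinarith [norm_nonneg (a - b), norm_nonneg a, norm_nonneg b, sq_nonneg (‖a‖ - ‖b‖)]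
  have h2 := ofReal_le_ofReal h
  rw [ENNReal.ofReal_add (by positivity) (by positivity), ofReal_mul (by norm_num),
    ofReal_mul (by norm_num), ofReal_pow (norm_nonneg _),
    ofReal_pow (norm_nonneg _), ofReal_pow (norm_nonneg _), ofReal_norm, ofReal_norm,
    ofReal_norm] at h2
  simpa using h2

lemma enorm_Yk_sq_le {l : ℂ} (hl : 0 ≤ l.re) (x : E3) : ‖Yk l x‖ₑ ^ 2 ≤ kap x := by
  rw [← ofReal_norm, ← ofReal_pow (norm_nonneg _), kap, norm_Yk]
  refine ofReal_le_ofReal (pow_le_pow_left₀ (by positivity) ?_ 2)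
  rw [div_eq_mul_inv, mul_inv]
  have h1 : Real.exp (-l.re * ‖x‖) ≤ 1 := Real.exp_le_one_iff.2 (by
    have := mul_nonneg hl (norm_nonneg x); linarith)
  have h2 : (4 * π)⁻¹ ≤ 1 := inv_le_one_of_one_le₀ (by nlinarith [Real.pi_gt_three])
  calc _ ≤ 1 * (1 * ‖x‖⁻¹) := by gcongr
    _ = _ := by ring

lemma enorm_Dz_sq_le {z : ℂ} (hz : ‖z‖ ≤ 1) (hz' : z ∉ halfLine) (x : E3) :
    ‖Dz z x‖ₑ ^ 2 ≤ ofReal (Real.exp 3) ^ 2 * kap x := by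
  rw [Dz, enorm_mul, mul_pow]
  refine mul_le_mul' (pow_le_pow_left' ?_ 2) (enorm_Yk_sq_le (sqz_spec hz').1.le _)
  rw [← ofReal_norm]
  refine ofReal_le_ofReal ?_
  have := mul_norm_exp_le hz (le_refl (0 : ℝ))
  simpa using this

lemma tendsto_weight_mul_Dz (a b : ℝ≥0∞) (ha : a ≠ ⊤) (hb : b ≠ ⊤) (x : E3) :
    Tendsto (fun z => a * ‖Dz z x - Yk 0 x‖ₑ ^ 2 * b) (𝓝[halfLineᶜ] 0) (𝓝 0) := by
  have h1 := ((tendsto_Dz x).sub_const (Yk 0 x)).enorm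
  rw [sub_self, enorm_zero] at h1
  have h2 : Tendsto (fun z => ‖Dz z x - Yk 0 x‖ₑ ^ 2) (𝓝[halfLineᶜ] 0) (𝓝 0) := by
    have := ((ENNReal.continuous_pow 2).tendsto 0).comp h1
    rwa [zero_pow two_ne_zero] at this
  have h3 := ENNReal.Tendsto.mul_const (ENNReal.Tendsto.const_mul h2 (Or.inr ha)) (Or.inr hb)
  rwa [mul_zero, zero_mul] at h3

/-- The kernels converge in the weighted Hilbert–Schmidt norm. -/
lemma tendsto_Jn {s σ : ℝ} (hs : 1 / 2 < s) (hσ : 1 / 2 < σ) (h : 2 < s + σ) :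
    Tendsto (fun z => Jn s σ (fun x => Dz z x - Yk 0 x)) (𝓝[halfLineᶜ] 0) (𝓝 0) := by
  have hw1 := measurable_wt (-s)
  have hw2 := measurable_wt (-σ)
  have hk := measurable_kap
  obtain ⟨c, hct, hc⟩ : ∃ c : ℝ≥0∞, c ≠ ⊤ ∧ c = 2 * ofReal (Real.exp 3) ^ 2 + 2 :=
    ⟨_, ENNReal.add_ne_top.2 ⟨mul_ne_top ENNReal.ofNat_ne_top
      (ENNReal.pow_ne_top ofReal_ne_top), ENNReal.ofNat_ne_top⟩, rfl⟩
  have hball : ∀ᶠ z : ℂ in 𝓝[halfLineᶜ] 0, ‖z‖ ≤ 1 := by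
    refine nhdsWithin_le_nhds ?_
    filter_upwards [Metric.closedBall_mem_nhds (0 : ℂ) one_pos] with z hz
    simpa using hz
  have key := tendsto_lintegral_filter_of_dominated_convergence (μ := (volume : Measure (E3 × E3)))
    (l := 𝓝[halfLineᶜ] (0 : ℂ)) (f := fun _ => 0)
    (F := fun z q => wt (-s) q.1 * ‖Dz z (q.1 - q.2) - Yk 0 (q.1 - q.2)‖ₑ ^ 2 * wt (-σ) q.2)
    (fun q => c * (wt (-s) q.1 * kap (q.1 - q.2) * wt (-σ) q.2))
    (Eventually.of_forall fun z => measurable_Jn s σ ((measurable_Dz z).sub (measurable_Yk 0)))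
    ?_ ?_ (ae_of_all _ fun q => tendsto_weight_mul_Dz _ _ (wt_ne_top _ _) (wt_ne_top _ _) _)
  · rw [lintegral_zero] at key; exact key
  · filter_upwards [hball, self_mem_nhdsWithin] with z hz hz'
    refine ae_of_all _ fun q => ?_
    have h1 := enorm_Dz_sq_le hz hz' (q.1 - q.2)
    have h2 := enorm_Yk_sq_le (l := 0) le_rfl (q.1 - q.2)
    have h3 : ‖Dz z (q.1 - q.2) - Yk 0 (q.1 - q.2)‖ₑ ^ 2 ≤ c * kap (q.1 - q.2) := by
      refine (enorm_sub_sq_le _ _).trans ?_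
      rw [hc, add_mul, mul_assoc]
      exact add_le_add (mul_le_mul_right h1 _) (mul_le_mul_right h2 _)
    calc _ ≤ wt (-s) q.1 * (c * kap (q.1 - q.2)) * wt (-σ) q.2 := by gcongr
      _ = _ := by ring
  · rw [lintegral_const_mul _ (by fun_prop), volume_eq_prod, lintegral_prod _ (by fun_prop)]
    exact mul_ne_top hct (lintegral_wt_kap_wt_lt_top hs hσ h).ne

lemma Jn_sub_le (s σ : ℝ) {D E F : E3 → ℂ} (hD : Measurable D) (hE : Measurable E)
    (hF : Measurable F) : Jn s σ (fun x => D x - E x) ≤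
      2 * Jn s σ (fun x => D x - F x) + 2 * Jn s σ (fun x => E x - F x) := by
  have h1 := measurable_Jn s σ (hD.sub hF)
  have h2 := measurable_Jn s σ (hE.sub hF)
  simp only [Pi.sub_apply] at h1 h2; unfold Jn
  rw [← lintegral_const_mul _ h1, ← lintegral_const_mul _ h2, ← lintegral_add_left (h1.const_mul _)]
  refine lintegral_mono fun q => ?_
  set w := q.1 - q.2
  calc _ = wt (-s) q.1 * ‖(D w - F w) - (E w - F w)‖ₑ ^ 2 * wt (-σ) q.2 := by
        rw [sub_sub_sub_cancel_right]
    _ ≤ wt (-s) q.1 * (2 * ‖D w - F w‖ₑ ^ 2 + 2 * ‖E w - F w‖ₑ ^ 2) * wt (-σ) q.2 := by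
        gcongr; exact enorm_sub_sq_le _ _
    _ = _ := by ring

section

/-! ### The resolvent kernels near the threshold -/

/-- The operators `R z` are, on the core, the resolvent applied after the fixed operator `D`, and
averaging `D F` against `Q0` amounts to averaging `F` against `Q`. The instances are `D = 1`,
`A_j`, `A_j^*`. -/
structure IsChannel (D : Dom →ₗ[ℂ] Dom) (R : ℂ → L2 →L[ℂ] L2) (Q : S6) : Prop where
  apply_lv : ∀ {z}, ‖z‖ ≤ dl → z ∉ halfLine → ∀ F, R z (lv F) = RR z (lv (D F))
  av_phys : ∀ F, av Q0 (phys (D F)) = av Q (phys F)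
  data : ∀ F, ∃ F0 F1 F2, D F = dR F0 F1 F2 ∧ rN F0 F1 F2 = ‖lv F‖

lemma isChannel_RR : IsChannel LinearMap.id RR Q0 :=
  ⟨fun _ _ _ => rfl, fun _ => rfl, fun F => ⟨F, 0, 0, (dR_zero F).symm, rN_zero F⟩⟩

lemma isChannel_RA (j : Fin 3) : IsChannel (dA j) (fun z => RA z j) (qC j Q0) :=
  ⟨fun hz hz' F => RA_lv hz hz' j F, fun F => by rw [phys_dA, av_qA],
    fun F => ⟨0, Pi.single j F, 0, (dR_dA j F).symm, rN_dA j F⟩⟩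

lemma isChannel_RC (j : Fin 3) : IsChannel (dC j) (fun z => RC z j) (qA j Q0) :=
  ⟨fun hz hz' F => RC_lv hz hz' j F, fun F => by rw [phys_dC, av_qC],
    fun F => ⟨0, 0, Pi.single j F, (dR_dC j F).symm, rN_dC j F⟩⟩

lemma memLp_two_of_lintegral {α : Type*} [MeasurableSpace α] {μ : Measure α} {f : α → ℂ}
    (hf : AEStronglyMeasurable f μ) (h : ∫⁻ x, ‖f x‖ₑ ^ 2 ∂μ < ⊤) : MemLp f 2 μ := by
  refine ⟨hf, ?_⟩
  rw [← eLpNorm_sq] at h; by_contra hc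
  rw [not_lt, top_le_iff] at hc; simp [hc] at h

lemma integrable_cv {D h : E3 → ℂ} (hD : Measurable D) (hD2 : ∫⁻ x, ‖D x‖ₑ ^ 2 < ⊤)
    (hh : Measurable h) (hh2 : ∫⁻ x, ‖h x‖ₑ ^ 2 < ⊤) (x : E3) :
    Integrable fun y => D (x - y) * h y := by
  refine MemLp.integrable_mul (p := 2) (q := 2) (memLp_two_of_lintegral
    (hD.comp (measurable_const.sub measurable_id)).aestronglyMeasurable ?_)
    (memLp_two_of_lintegral hh.aestronglyMeasurable hh2)
  rw [← lintegral_sub_left_eq_self (fun y => ‖D y‖ₑ ^ 2) x] at hD2; exact hD2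

lemma integrable_av (Q : S6) {f : Phase → ℂ} (hf : MemLp f 2 volume) (y : E3) :
    Integrable fun p : Phase => Q (y - p.1, p.2) * f p := by
  have := ((reflx y Q).memLp 2 volume).integrable_mul hf
  simpa only [Pi.mul_def, reflx_apply] using this

lemma lintegral_av_lt_top (Q : S6) {f : Phase → ℂ} (hf : Measurable f)
    (hf2 : MemLp f 2 volume) : ∫⁻ y, ‖av Q f y‖ₑ ^ 2 < ⊤ := by
  obtain ⟨C, hC, h⟩ := exists_lintegral_av_le Q (le_refl (0 : ℝ))
  have := h f hf
  simp only [wt_zero, one_mul] at this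
  rw [← eLpNorm_sq (fun p => f p)] at this
  exact this.trans_lt (mul_lt_top hC.lt_top (ENNReal.pow_lt_top hf2.2))

lemma av_congr (Q : S6) {f g : Phase → ℂ} (h : f =ᵐ[volume] g) : av Q f = av Q g := by
  ext y; refine integral_congr_ae ?_
  filter_upwards [h] with p hp
  rw [hp]

lemma measurable_coe_L2 (f : L2) : Measurable (f : Phase → ℂ) := (Lp.stronglyMeasurable f).measurable

/-- The averaged convolution is, at every point, continuous on `L²`. -/
lemma tendsto_cv_av (Q : S6) {D : E3 → ℂ} (hD : Measurable D)
    (hD2 : ∫⁻ x, ‖D x‖ₑ ^ 2 < ⊤) {f : ℕ → L2} {g : L2} (h : Tendsto f atTop (𝓝 g)) (x : E3) :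
    Tendsto (fun n => cv D (av Q (f n)) x) atTop (𝓝 (cv D (av Q g) x)) := by
  obtain ⟨C, hC, hav⟩ := exists_lintegral_av_le Q (le_refl (0 : ℝ))
  simp only [wt_zero, one_mul] at hav
  have hm : ∀ f : L2, Measurable (av Q f) := fun f => measurable_av Q (measurable_coe_L2 f)
  have hfin : ∀ f : L2, ∫⁻ y, ‖av Q f y‖ₑ ^ 2 < ⊤ := fun f =>
    lintegral_av_lt_top Q (measurable_coe_L2 f) (Lp.memLp f)
  have hsub : ∀ n, cv D (av Q (f n)) x - cv D (av Q g) x = cv D (av Q (f n - g : L2)) x := by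
    intro n
    rw [cv, cv, ← integral_sub (integrable_cv hD hD2 (hm _) (hfin _) x)
      (integrable_cv hD hD2 (hm _) (hfin _) x), cv]
    refine integral_congr_ae (ae_of_all _ fun y => ?_); simp only
    rw [← mul_sub, av_congr Q (Lp.coeFn_sub (f n) g)]; congr 1
    rw [av, av, ← integral_sub (integrable_av Q (Lp.memLp _) y) (integrable_av Q (Lp.memLp _) y), av]
    simp only [Pi.sub_apply, mul_sub]
  set I := ∫⁻ y, ‖D y‖ₑ ^ 2 with hI
  have hb : ∀ n, ‖cv D (av Q (f n)) x - cv D (av Q g) x‖ₑ ^ 2 ≤ I * (C * ‖f n - g‖ₑ ^ 2) := by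
    intro n; rw [hsub]
    refine (enorm_cv_sq_le 0 hD (hm _) x).trans ?_
    simp only [neg_zero, wt_zero, one_mul, mul_one]
    rw [lintegral_sub_left_eq_self (fun y => ‖D y‖ₑ ^ 2) x, enorm_Lp_sq]
    exact mul_le_mul_right (hav _ (measurable_coe_L2 _)) _
  rw [tendsto_iff_norm_sub_tendsto_zero]
  have hb' : ∀ n, ‖cv D (av Q (f n)) x - cv D (av Q g) x‖ ^ 2 ≤ (I * C).toReal * ‖f n - g‖ ^ 2 := by
    intro n
    have := ENNReal.toReal_mono (mul_ne_top hD2.ne (mul_ne_top hC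
      (ENNReal.pow_ne_top enorm_ne_top))) (hb n)
    simpa [ENNReal.toReal_mul, ENNReal.toReal_pow, mul_assoc] using this
  have h0 : Tendsto (fun n => (I * C).toReal * ‖f n - g‖ ^ 2) atTop (𝓝 0) := by
    have := ((tendsto_iff_norm_sub_tendsto_zero.1 h).pow 2).const_mul (I * C).toReal
    simpa using this
  have h1 := squeeze_zero (fun n => by positivity) hb' h0
  have h2 := (Real.continuous_sqrt.tendsto 0).comp h1
  simpa [Function.comp_def, Real.sqrt_sq (norm_nonneg _)] using h2

namespace IsChannel

variable {D : Dom →ₗ[ℂ] Dom} {R : ℂ → L2 →L[ℂ] L2} {Q : S6}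

lemma norm_sub_le (h : IsChannel D R Q) {z z' : ℂ} (hz : ‖z‖ ≤ dl) (hz1 : z ∉ halfLine)
    (hz' : ‖z'‖ ≤ dl) (hz1' : z' ∉ halfLine) (F : Dom) :
    ‖(R z (lv F) - R z' (lv F)) - (lv (dB hz1 (D F)) - lv (dB hz1' (D F)))‖ ≤
      28 * (cA * (cT + 189 * Real.exp 3) * ‖z - z'‖) * ‖lv F‖ := by
  obtain ⟨U, hU⟩ := exists_sol hz1 (D F)
  obtain ⟨U', hU'⟩ := exists_sol hz1' (D F)
  obtain ⟨F0, F1, F2, hF, hN⟩ := h.data F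
  rw [h.apply_lv hz hz1, h.apply_lv hz' hz1', RR_lv hz hz1 hU, RR_lv hz' hz1' hU', ← hN]
  have h1 := hn_sub_dB_sub_le hz hz1 hz' hz1' (hU.trans hF) (hU'.trans hF)
  rw [← hF] at h1
  refine le_trans (le_of_eq ?_) ((norm_lv_le_hn _).trans h1)
  rw [map_sub, map_sub, map_sub]; congr 1; abel

lemma lv_dB_sub (h : IsChannel D R Q) {z z' : ℂ} (hz1 : z ∉ halfLine) (hz1' : z' ∉ halfLine)
    (F : Dom) : (lv (dB hz1 (D F)) - lv (dB hz1' (D F)) : L2) =ᵐ[volume] fun q : Phase =>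
      ps q.2 * cv (fun x => Dz z x - Dz z' x) (av Q (lv F)) (q.1 - q.2) := by
  have hlv : ∀ U : Dom, (lv U : Phase → ℂ) =ᵐ[volume] phys U := fun U => by
    rw [lv_apply]; exact coeFn_toL _
  have hm : Measurable (av Q (lv F)) := measurable_av Q (measurable_coe_L2 _)
  have hfin := lintegral_av_lt_top Q (measurable_coe_L2 (lv F)) (Lp.memLp _)
  filter_upwards [Lp.coeFn_sub (lv (dB hz1 (D F))) (lv (dB hz1' (D F))), hlv (dB hz1 (D F)),
    hlv (dB hz1' (D F))] with q hq h1 h2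
  rw [hq, Pi.sub_apply, h1, h2, phys_dB hz1 (sqz_spec hz1).1 (sqz_spec hz1).2.1,
    phys_dB hz1' (sqz_spec hz1').1 (sqz_spec hz1').2.1, h.av_phys, av_congr Q (hlv F).symm,
    ← mul_sub]
  congr 1
  have i1 := integrable_cv (measurable_Dz z) (lintegral_Dz_lt_top hz1) hm hfin (q.1 - q.2)
  have i2 := integrable_cv (measurable_Dz z') (lintegral_Dz_lt_top hz1') hm hfin (q.1 - q.2)
  have := integral_sub i1 i2
  simp only [cv, sub_mul]
  exact this.symm

/-- The difference of two resolvents is a small operator on `L²` plus an operator given by the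
difference of the Yukawa kernels. -/
lemma exists_repr (h : IsChannel D R Q) {z z' : ℂ} (hz : ‖z‖ ≤ dl) (hz1 : z ∉ halfLine)
    (hz' : ‖z'‖ ≤ dl) (hz1' : z' ∉ halfLine) (f : L2) :
    ∃ t : L2, ‖t‖ ≤ 28 * (cA * (cT + 189 * Real.exp 3) * ‖z - z'‖) * ‖f‖ ∧
      ((R z f - R z' f - t : L2) : Phase → ℂ) =ᵐ[volume] fun q =>
        ps q.2 * cv (fun x => Dz z x - Dz z' x) (av Q f) (q.1 - q.2) := by
  set c : ℝ := 28 * (cA * (cT + 189 * Real.exp 3) * ‖z - z'‖) with hc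
  set T0 : Dom →ₗ[ℂ] L2 := ((R z - R z' : L2 →L[ℂ] L2) : L2 →ₗ[ℂ] L2) ∘ₗ lv -
    (lv ∘ₗ dB hz1 ∘ₗ D - lv ∘ₗ dB hz1' ∘ₗ D) with hT0
  have hb : ∀ F, ‖T0 F‖ ≤ c * ‖lv F‖ := fun F => h.norm_sub_le hz hz1 hz' hz1' F
  set T : L2 →L[ℂ] L2 := T0.extendOfNorm lv
  have hT : ∀ F, T (lv F) = T0 F := fun F =>
    LinearMap.extendOfNorm_eq (f := T0) (e := lv) denseRange_lv ⟨c, hb⟩ F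
  have hTn : ‖T f‖ ≤ c * ‖f‖ :=
    LinearMap.norm_extendOfNorm_apply_le (f := T0) (e := lv) denseRange_lv c hb f
  refine ⟨T f, hTn, ?_⟩
  obtain ⟨u, hu, hlim⟩ := mem_closure_iff_seq_limit.1 (denseRange_lv f)
  choose F hF using hu
  have hlim' : Tendsto (fun n => R z (u n) - R z' (u n) - T (u n)) atTop
      (𝓝 (R z f - R z' f - T f)) :=
    ((((R z).continuous.tendsto f).comp hlim).sub (((R z').continuous.tendsto f).comp hlim)).sub
      ((T.continuous.tendsto f).comp hlim)
  obtain ⟨φ, hφ, hae⟩ := (tendstoInMeasure_of_tendsto_Lp hlim').exists_seq_tendsto_ae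
  have hEq : ∀ n, ((R z (u n) - R z' (u n) - T (u n) : L2) : Phase → ℂ) =ᵐ[volume] fun q =>
      ps q.2 * cv (fun x => Dz z x - Dz z' x) (av Q (u n)) (q.1 - q.2) := by
    intro n; rw [← hF n, hT]
    have : R z (lv (F n)) - R z' (lv (F n)) - T0 (F n) =
        lv (dB hz1 (D (F n))) - lv (dB hz1' (D (F n))) := by
      simp [hT0]
    rw [this]; exact h.lv_dB_sub hz1 hz1' (F n)
  have hDm : Measurable fun x => Dz z x - Dz z' x := (measurable_Dz z).sub (measurable_Dz z')
  have hD2 : ∫⁻ x, ‖Dz z x - Dz z' x‖ₑ ^ 2 < ⊤ := by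
    refine (lintegral_mono fun x => enorm_sub_sq_le _ _).trans_lt ?_
    have hm : ∀ z, Measurable fun x => ‖Dz z x‖ₑ := fun z => (measurable_Dz z).enorm
    have hm1 := hm z
    have hm2 := hm z'
    rw [lintegral_add_left (by fun_prop), lintegral_const_mul _ (by fun_prop),
      lintegral_const_mul _ (by fun_prop)]
    exact ENNReal.add_lt_top.2 ⟨mul_lt_top (by simp) (lintegral_Dz_lt_top hz1),
      mul_lt_top (by simp) (lintegral_Dz_lt_top hz1')⟩
  filter_upwards [hae, ae_all_iff.2 hEq] with q hq1 hq2
  refine tendsto_nhds_unique hq1 ?_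
  simp only [hq2]
  exact ((tendsto_cv_av Q hDm hD2 (hlim.comp hφ.tendsto_atTop) (q.1 - q.2)).const_mul _)

/-- The resolvents form a Cauchy family at the threshold in the weighted operator norm. -/
lemma eventually_cauchy (h : IsChannel D R Q) {s σ : ℝ} (hs : 1 / 2 < s) (hσ : 1 / 2 < σ)
    (hsσ : 2 < s + σ) {ε : ℝ} (hε : 0 < ε) :
    ∀ᶠ p in 𝓝[halfLineᶜ] (0 : ℂ) ×ˢ 𝓝[halfLineᶜ] (0 : ℂ), ∀ f : L2,
      eLpNorm (R p.1 f - R p.2 f : L2) 2 (weightedVolume (-s)) ≤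
        ofReal ε * eLpNorm f 2 (weightedVolume σ) := by
  obtain ⟨C, hC, hav⟩ := exists_lintegral_av_le Q (σ := σ) (by linarith)
  have hcA := cA_pos
  have hcT := cT_pos
  set c : ℝ := 28 * (cA * (cT + 189 * Real.exp 3)) with hc
  have hc0 : 0 < c := by positivity
  set E : ℝ≥0∞ := ofReal (ε / 2) ^ 2 with hE
  have hEpos : 0 < E := by rw [hE]; exact ENNReal.pow_pos (ENNReal.ofReal_pos.2 (by linarith)) 2
  -- eventually the kernel part is small
  have hJ : ∀ᶠ p in 𝓝[halfLineᶜ] (0 : ℂ) ×ˢ 𝓝[halfLineᶜ] (0 : ℂ),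
      cPs s * (Jn s σ (fun x => Dz p.1 x - Dz p.2 x) * C) ≤ E := by
    have h0 := tendsto_Jn hs hσ hsσ
    have h1 : Tendsto (fun p : ℂ × ℂ => cPs s * ((2 * Jn s σ (fun x => Dz p.1 x - Yk 0 x) +
        2 * Jn s σ (fun x => Dz p.2 x - Yk 0 x)) * C))
        (𝓝[halfLineᶜ] (0 : ℂ) ×ˢ 𝓝[halfLineᶜ] (0 : ℂ)) (𝓝 0) := by
      have a := ENNReal.Tendsto.const_mul (a := 2) (h0.comp (tendsto_fst (g := 𝓝[halfLineᶜ] (0 : ℂ)))) (Or.inr (by simp))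
      have b := ENNReal.Tendsto.const_mul (a := 2) (h0.comp (tendsto_snd (f := 𝓝[halfLineᶜ] (0 : ℂ)))) (Or.inr (by simp))
      have c := ENNReal.Tendsto.const_mul (a := cPs s) (ENNReal.Tendsto.mul_const (b := C) (a.add b)
        (Or.inr hC)) (Or.inr (cPs_ne_top s))
      rw [mul_zero, add_zero, zero_mul, mul_zero] at c; exact c
    filter_upwards [(tendsto_order.1 h1).2 E hEpos] with p hp
    refine le_trans ?_ hp.le; gcongr
    exact Jn_sub_le s σ (measurable_Dz _) (measurable_Dz _) (measurable_Yk 0)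
  have hball : ∀ᶠ z in 𝓝[halfLineᶜ] (0 : ℂ), z ∉ halfLine ∧ ‖z‖ ≤ dl ∧ ‖z‖ ≤ ε / (4 * c) := by
    have hd := dl_pos
    filter_upwards [self_mem_nhdsWithin, nhdsWithin_le_nhds (Metric.closedBall_mem_nhds (0 : ℂ) hd),
      nhdsWithin_le_nhds (Metric.closedBall_mem_nhds (0 : ℂ) (by positivity : 0 < ε / (4 * c)))]
      with z h1 h2 h3
    exact ⟨h1, by simpa using h2, by simpa using h3⟩
  filter_upwards [hJ, tendsto_fst.eventually hball, tendsto_snd.eventually hball]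
    with p hp ⟨h1, h2, h3⟩ ⟨h1', h2', h3'⟩ f
  obtain ⟨t, ht, hrep⟩ := h.exists_repr h2 h1 h2' h1' f
  set N : E3 → ℂ := cv (fun x => Dz p.1 x - Dz p.2 x) (av Q f) with hN
  have hDm : Measurable fun x => Dz p.1 x - Dz p.2 x := (measurable_Dz _).sub (measurable_Dz _)
  have hNm : Measurable N := measurable_cv hDm (measurable_av Q (measurable_coe_L2 f))
  have hrep' : ((R p.1 f - R p.2 f : L2) : Phase → ℂ) =ᵐ[volume]
      fun q => t q + ps q.2 * N (q.1 - q.2) := by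
    filter_upwards [hrep, Lp.coeFn_sub (R p.1 f - R p.2 f) t] with q e1 e2
    rw [← e1, e2, Pi.sub_apply]; ring
  have hGm : Measurable fun q : Phase => ps q.2 * N (q.1 - q.2) :=
    (ps.continuous.measurable.comp measurable_snd).mul
      (hNm.comp (measurable_fst.sub measurable_snd))
  rw [eLpNorm_congr_ae ((aeEq_weightedVolume_iff _).2 hrep')]
  refine (eLpNorm_add_le (f := (t : Phase → ℂ)) (g := fun q : Phase => ps q.2 * N (q.1 - q.2))
    (measurable_coe_L2 t).aestronglyMeasurable hGm.aestronglyMeasurable one_le_two).trans ?_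
  have hσ0 : (0 : ℝ) ≤ σ := by linarith
  have a1 : eLpNorm t 2 (weightedVolume (-s)) ≤
      ofReal (ε / 2) * eLpNorm f 2 (weightedVolume σ) := by
    refine (eLpNorm_mono_measure _ (weightedVolume_le_volume (by linarith))).trans ?_
    rw [← Lp.enorm_def]
    have hzz : ‖p.1 - p.2‖ ≤ ε / (2 * c) := by
      refine (_root_.norm_sub_le _ _).trans ((add_le_add h3 h3').trans (le_of_eq ?_))
      field_simp; norm_num
    have ht2 : ‖t‖ ≤ (ε / 2) * ‖f‖ := by
      refine ht.trans (mul_le_mul_of_nonneg_right ?_ (norm_nonneg _))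
      calc _ = c * ‖p.1 - p.2‖ := by rw [hc]; ring
        _ ≤ c * (ε / (2 * c)) := by gcongr
        _ = ε / 2 := by field_simp
    calc ‖t‖ₑ = ofReal ‖t‖ := (ofReal_norm t).symm
      _ ≤ ofReal (ε / 2 * ‖f‖) := ofReal_le_ofReal ht2
      _ = ofReal (ε / 2) * eLpNorm f 2 volume := by
          rw [ofReal_mul (by linarith), ofReal_norm, Lp.enorm_def]
      _ ≤ _ := by gcongr; exact volume_le_weightedVolume hσ0
  have a2 : eLpNorm (fun q : Phase => ps q.2 * N (q.1 - q.2)) 2 (weightedVolume (-s)) ≤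
      ofReal (ε / 2) * eLpNorm f 2 (weightedVolume σ) := by
    refine (ENNReal.pow_le_pow_left_iff two_ne_zero).1 ?_
    rw [mul_pow, eLpNorm_sq, eLpNorm_sq, lintegral_weightedVolume, lintegral_weightedVolume]
    calc _ ≤ cPs s * ∫⁻ x, wt (-s) x * ‖N x‖ₑ ^ 2 := lintegral_ps_mul_le s hNm
      _ ≤ cPs s * (Jn s σ (fun x => Dz p.1 x - Dz p.2 x) *
          (C * ∫⁻ q : Phase, wt σ q.1 * ‖f q‖ₑ ^ 2)) := by
          gcongr; refine (lintegral_cv_le s σ hDm (measurable_av Q (measurable_coe_L2 f))).trans ?_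
          gcongr; exact hav _ (measurable_coe_L2 f)
      _ = (cPs s * (Jn s σ (fun x => Dz p.1 x - Dz p.2 x) * C)) *
          ∫⁻ q : Phase, wt σ q.1 * ‖f q‖ₑ ^ 2 := by ring
      _ ≤ _ := by gcongr
  calc _ ≤ _ := add_le_add a1 a2
    _ = _ := by rw [← add_mul, ← ENNReal.ofReal_add (by linarith) (by linarith), add_halves]

end IsChannel

end

/-! ### Threshold limits in weighted spaces -/

instance neBot_nhdsWithin_halfLine : (𝓝[halfLineᶜ] (0 : ℂ)).NeBot := by
  rw [← mem_closure_iff_nhdsWithin_neBot, mem_closure_iff_seq_limit]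
  refine ⟨fun n => ((-(1 / ((n : ℝ) + 1)) : ℝ) : ℂ), fun n => ?_, ?_⟩
  · rintro ⟨x, hx, h⟩
    have h' : x = -(1 / ((n : ℝ) + 1)) := Complex.ofReal_injective h
    have : 0 < 1 / ((n : ℝ) + 1) := by positivity
    simp only [Set.mem_Ici] at hx; linarith
  · have h := (tendsto_one_div_add_atTop_nhds_zero_nat (𝕜 := ℝ)).neg
    rw [neg_zero] at h
    exact (Complex.continuous_ofReal.tendsto 0).comp h

lemma eventually_near : ∀ᶠ z in 𝓝[halfLineᶜ] (0 : ℂ), ‖z‖ ≤ dl ∧ z ∉ halfLine := by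
  filter_upwards [self_mem_nhdsWithin, nhdsWithin_le_nhds (Metric.closedBall_mem_nhds (0 : ℂ) dl_pos)]
    with z h1 h2
  exact ⟨by simpa using h2, h1⟩

/-- An operator on `L²`, seen as an operator from `L^{2,σ}` to `L^{2,-s}`. -/
def wop {s σ : ℝ} (hs : 0 ≤ s) (hσ : 0 ≤ σ) (T : L2 →L[ℂ] L2) : L2w σ →L[ℂ] L2w (-s) :=
  incl (weightedVolume_le_volume hs) ∘L T ∘L incl (volume_le_weightedVolume hσ)

lemma norm_le_of_enorm_le {E F : Type*} [SeminormedAddCommGroup E] [SeminormedAddCommGroup F]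
    {x : E} {y : F} {ε : ℝ} (hε : 0 ≤ ε) (h : ‖x‖ₑ ≤ ofReal ε * ‖y‖ₑ) : ‖x‖ ≤ ε * ‖y‖ := by
  rwa [← ofReal_norm, ← ofReal_norm, ← ofReal_mul hε,
    ENNReal.ofReal_le_ofReal_iff (by positivity)] at h

lemma IsChannel.exists_limit {D : Dom →ₗ[ℂ] Dom} {R : ℂ → L2 →L[ℂ] L2} {Q : S6}
    (h : IsChannel D R Q) {s σ : ℝ} (hs : 1 / 2 < s) (hσ : 1 / 2 < σ) (hsσ : 2 < s + σ)
    (hs0 : 0 ≤ s) (hσ0 : 0 ≤ σ) :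
    ∃ G : L2w σ →L[ℂ] L2w (-s), Tendsto (fun z => wop hs0 hσ0 (R z)) (𝓝[halfLineᶜ] 0) (𝓝 G) := by
  rw [← cauchy_map_iff_exists_tendsto, cauchy_map_iff',
    Metric.uniformity_basis_dist_le.tendsto_right_iff]
  intro ε hε; filter_upwards [h.eventually_cauchy hs hσ hsσ hε] with p hp
  simp only [dist_eq_norm]
  refine ContinuousLinearMap.opNorm_le_bound _ hε.le fun f => norm_le_of_enorm_le hε.le ?_
  have h1 : (wop hs0 hσ0 (R p.1) - wop hs0 hσ0 (R p.2)) f =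
      incl (weightedVolume_le_volume hs0) (R p.1 (incl (volume_le_weightedVolume hσ0) f) -
        R p.2 (incl (volume_le_weightedVolume hσ0) f)) := by
    rw [map_sub]; rfl
  rw [h1, Lp.enorm_def, Lp.enorm_def, eLpNorm_congr_ae (coeFn_incl _ _)]
  refine (hp _).trans (le_of_eq ?_)
  rw [eLpNorm_congr_ae ((aeEq_weightedVolume_iff σ).2
    (coeFn_incl (volume_le_weightedVolume hσ0) f))]

lemma eLpNorm_sub_eq {s σ : ℝ} (hs : 0 ≤ s) (hσ : 0 ≤ σ) (T : L2 →L[ℂ] L2)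
    (G : L2w σ →L[ℂ] L2w (-s)) (f : L2w σ) (g : L2)
    (hg : ⇑g =ᵐ[volume] (f : Phase → ℂ)) :
    eLpNorm (fun p => (T g : Phase → ℂ) p - (G f : Phase → ℂ) p) 2 (weightedVolume (-s)) =
      ‖(wop hs hσ T - G) f‖ₑ := by
  have hgf : incl (volume_le_weightedVolume hσ) f = g := Lp.ext ((coeFn_incl _ f).trans hg.symm)
  have h1 : (wop hs hσ T - G) f = incl (weightedVolume_le_volume hs) (T g) - G f := by
    rw [← hgf]; rfl
  rw [h1, Lp.enorm_def]
  refine eLpNorm_congr_ae ?_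
  filter_upwards [Lp.coeFn_sub (incl (weightedVolume_le_volume hs) (T g)) (G f),
    coeFn_incl (weightedVolume_le_volume hs) (T g)] with p h2 h3
  rw [h2, Pi.sub_apply, h3]

/-- Convergence of the resolvents in operator norm identifies the limit `G₀`. -/
lemma isG0_of_tendsto {s s' σ : ℝ} (hs : 0 ≤ s) (hσ : 0 ≤ σ) (hss : s ≤ s')
    {G : L2w σ →L[ℂ] L2w (-s)}
    (h : Tendsto (fun z => wop hs hσ (RR z)) (𝓝[halfLineᶜ] 0) (𝓝 G)) :
    IsG0 σ (-s') (incl (weightedVolume_mono (neg_le_neg hss)) ∘L G) := by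
  intro ε hε
  have h1 := (tendsto_iff_norm_sub_tendsto_zero.1 h).eventually_le_const hε
  filter_upwards [h1, eventually_near] with z hz ⟨hz1, hz2⟩
  refine ⟨RR z, isFreeResolvent_RR hz1 hz2, fun f g hg => ?_⟩
  have hle := weightedVolume_mono (neg_le_neg hss)
  calc _ = eLpNorm (fun p => (RR z g : Phase → ℂ) p - (G f : Phase → ℂ) p) 2
        (weightedVolume (-s')) := by
        refine eLpNorm_congr_ae ?_
        filter_upwards [coeFn_incl hle (G f)] with p hp
        rw [← hp]; rfl
    _ ≤ eLpNorm (fun p => (RR z g : Phase → ℂ) p - (G f : Phase → ℂ) p) 2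
        (weightedVolume (-s)) := eLpNorm_mono_measure _ hle
    _ = ‖(wop hs hσ (RR z) - G) f‖ₑ := eLpNorm_sub_eq hs hσ _ _ f g hg
    _ ≤ _ := by
        rw [← ofReal_norm, ← ofReal_norm, ← ofReal_mul hε.le]
        exact ofReal_le_ofReal ((ContinuousLinearMap.le_opNorm _ f).trans (by gcongr))

/-! ### The potential as a multiplication operator -/

/-- The coordinate `∂_j V` of the force. -/
def dV (V : E3 → ℝ) (j : Fin 3) (x : E3) : ℝ := gradient V x j

lemma continuous_gradient {V : E3 → ℝ} (hV : ContDiff ℝ 1 V) : Continuous (gradient V) :=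
  (InnerProductSpace.toDual ℝ E3).symm.continuous.comp (hV.continuous_fderiv (by simp))

lemma continuous_dV {V : E3 → ℝ} (hV : ContDiff ℝ 1 V) (j : Fin 3) : Continuous (dV V j) :=
  (pj j).continuous.comp (continuous_gradient hV)

lemma abs_dV_le {V : E3 → ℝ} {ρ C : ℝ}
    (hVC : ∀ x : E3, ‖gradient V x‖ ≤ C * bracket x ^ (-ρ - 1)) (j : Fin 3) (x : E3) :
    |dV V j x| ≤ |C| * bracket x ^ (-ρ - 1) := by
  have hb := bracket_pos x
  calc |dV V j x| ≤ ‖gradient V x‖ := by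
        simpa [dV] using norm_coord_le (gradient V x) j
    _ ≤ C * bracket x ^ (-ρ - 1) := hVC x
    _ ≤ _ := by gcongr; exact le_abs_self C

lemma wt_mul_dV_sq_le {V : E3 → ℝ} {ρ C : ℝ}
    (hVC : ∀ x : E3, ‖gradient V x‖ ≤ C * bracket x ^ (-ρ - 1)) (σ : ℝ) (j : Fin 3) (x : E3) :
    wt σ x * ‖dV V j x‖ₑ ^ 2 ≤ ofReal |C| ^ 2 * wt (σ - (1 + ρ)) x := by
  have hb := bracket_pos x
  have h1 : ‖dV V j x‖ₑ ^ 2 ≤ ofReal |C| ^ 2 * wt (-(1 + ρ)) x := by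
    rw [← ofReal_norm, Real.norm_eq_abs, ← ofReal_pow (abs_nonneg _),
      ← ofReal_pow (abs_nonneg _), wt, ← ofReal_mul (by positivity)]
    refine ofReal_le_ofReal ?_
    refine (pow_le_pow_left₀ (abs_nonneg _) (abs_dV_le hVC j x) 2).trans (le_of_eq ?_)
    rw [mul_pow, ← Real.rpow_natCast (bracket x ^ (-ρ - 1)), ← Real.rpow_mul hb.le]
    congr 2; push_cast; ring
  calc _ ≤ wt σ x * (ofReal |C| ^ 2 * wt (-(1 + ρ)) x) := by gcongr
    _ = _ := by rw [mul_left_comm, wt_mul, sub_eq_add_neg]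

lemma eLpNorm_mul_le {g : E3 → ℝ} {σ τ c : ℝ}
    (hb : ∀ x, wt σ x * ‖g x‖ₑ ^ 2 ≤ ofReal c ^ 2 * wt τ x) (f : Phase → ℂ) :
    eLpNorm (fun p : Phase => (g p.1 : ℂ) * f p) 2 (weightedVolume σ) ≤
      ofReal c * eLpNorm f 2 (weightedVolume τ) := by
  refine (ENNReal.pow_le_pow_left_iff two_ne_zero).1 ?_
  rw [mul_pow, eLpNorm_sq, eLpNorm_sq, lintegral_weightedVolume, lintegral_weightedVolume,
    ← lintegral_const_mul' _ _ (ENNReal.pow_ne_top ofReal_ne_top)]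
  refine lintegral_mono fun p => ?_
  have he : ‖(g p.1 : ℂ)‖ₑ = ‖g p.1‖ₑ := by simp [enorm_eq_nnnorm, Complex.nnnorm_real]
  rw [enorm_mul, mul_pow, ← mul_assoc, ← mul_assoc, he]
  exact mul_le_mul_left (hb _) _

lemma memLp_mul {g : E3 → ℝ} (hg : Continuous g) {σ τ c : ℝ}
    (hb : ∀ x, wt σ x * ‖g x‖ₑ ^ 2 ≤ ofReal c ^ 2 * wt τ x) {f : Phase → ℂ}
    (hf : MemLp f 2 (weightedVolume τ)) :
    MemLp (fun p : Phase => (g p.1 : ℂ) * f p) 2 (weightedVolume σ) := by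
  refine ⟨?_, (eLpNorm_mul_le hb f).trans_lt (mul_lt_top ENNReal.ofReal_lt_top hf.2)⟩
  rw [aestronglyMeasurable_weightedVolume]
  have h1 := (aestronglyMeasurable_weightedVolume τ).1 hf.1
  have h2 : Continuous fun p : Phase => (g p.1 : ℂ) := by fun_prop
  exact h2.aestronglyMeasurable.mul h1

/-- Multiplication by a function of the position, between weighted spaces. -/
def mulW {g : E3 → ℝ} (hg : Continuous g) {σ τ c : ℝ} (hc : 0 ≤ c)
    (hb : ∀ x, wt σ x * ‖g x‖ₑ ^ 2 ≤ ofReal c ^ 2 * wt τ x) : L2w τ →L[ℂ] L2w σ :=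
  LinearMap.mkContinuous
    { toFun := fun f => (memLp_mul hg hb (Lp.memLp f)).toLp
      map_add' := fun f f' => by
        rw [← MemLp.toLp_add]
        refine MemLp.toLp_congr _ _ ((aeEq_weightedVolume_iff σ).2 ?_)
        filter_upwards [(aeEq_weightedVolume_iff τ).1 (Lp.coeFn_add f f')] with p hp
        rw [hp]; exact mul_add _ _ _
      map_smul' := fun a f => by
        rw [← MemLp.toLp_const_smul]
        refine MemLp.toLp_congr _ _ ((aeEq_weightedVolume_iff σ).2 ?_)
        filter_upwards [(aeEq_weightedVolume_iff τ).1 (Lp.coeFn_smul a f)] with p hp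
        rw [hp]; exact mul_left_comm _ _ _ } c fun f => by
    refine norm_le_of_enorm_le hc ?_
    simp only [LinearMap.coe_mk, AddHom.coe_mk, Lp.enorm_def]
    rw [eLpNorm_congr_ae (MemLp.coeFn_toLp _)]
    exact eLpNorm_mul_le hb f

lemma coeFn_mulW {g : E3 → ℝ} (hg : Continuous g) {σ τ c : ℝ} (hc : 0 ≤ c)
    (hb : ∀ x, wt σ x * ‖g x‖ₑ ^ 2 ≤ ofReal c ^ 2 * wt τ x) (f : L2w τ) :
    (mulW hg hc hb f : Phase → ℂ) =ᵐ[volume] fun p => (g p.1 : ℂ) * f p :=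
  (aeEq_weightedVolume_iff σ).1 (MemLp.coeFn_toLp (memLp_mul hg hb (Lp.memLp f)))

/-! ### The operators `R₀(z) W` and their limit -/

/-- The weak equation for `R₀(z) (∑ A_j f_{1,j} + ∑ A_j^* f_{2,j})`. -/
lemma wData_resolvent {z : ℂ} (hz : ‖z‖ ≤ dl) (hz' : z ∉ halfLine) (f1 f2 : Fin 3 → L2) :
    WData (∑ j, RA z j (f1 j) + ∑ j, RC z j (f2 j))
      (z • (∑ j, RA z j (f1 j) + ∑ j, RC z j (f2 j))) f1 f2 := by
  have hseq : ∀ f : L2, ∃ F : ℕ → Dom, Tendsto (fun n => lv (F n)) atTop (𝓝 f) := by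
    intro f
    obtain ⟨u, hu, hlim⟩ := mem_closure_iff_seq_limit.1 (denseRange_lv f)
    choose F hF using hu
    exact ⟨F, by simpa only [hF] using hlim⟩
  choose F1 h1 using fun j => hseq (f1 j)
  choose F2 h2 using fun j => hseq (f2 j)
  set w : ℕ → L2 := fun n => ∑ j, RA z j (lv (F1 j n)) + ∑ j, RC z j (lv (F2 j n)) with hw
  have hlim : Tendsto w atTop (𝓝 (∑ j, RA z j (f1 j) + ∑ j, RC z j (f2 j))) :=
    (tendsto_finsetSum _ fun j _ => ((RA z j).continuous.tendsto _).comp (h1 j)).add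
      (tendsto_finsetSum _ fun j _ => ((RC z j).continuous.tendsto _).comp (h2 j))
  refine WData.of_tendsto (w := w) (f0 := fun n => z • w n) (fun n => ?_) hlim (hlim.const_smul z)
    h1 h2 (f1 := fun n j => lv (F1 j n)) (f2 := fun n j => lv (F2 j n))
  obtain ⟨U, hU⟩ := exists_sol hz' (∑ j, dA j (F1 j n) + ∑ j, dC j (F2 j n))
  have hwn : w n = lv U := by
    rw [← RR_lv hz hz' hU]
    simp only [hw, RA_lv hz hz', RC_lv hz hz', map_add, map_sum]
  have h3 := wData_lv (U := U) (F0 := z • U) (F1 := fun j => F1 j n) (F2 := fun j => F2 j n)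
    (by rw [add_assoc, ← hU]; abel)
  simpa only [hwn, map_smul] using h3

/-- The operator `R₀(z) W`, with `W` written as `½ ∑ (A_j^* - A_j) M_j` for the multiplications `M_j`
by `∂_j V`. -/
def Kz {s σ τ : ℝ} (hs : 0 ≤ s) (hσ : 0 ≤ σ) (M : Fin 3 → L2w τ →L[ℂ] L2w σ) (z : ℂ) :
    L2w τ →L[ℂ] L2w (-s) :=
  ∑ j, (1 / 2 : ℂ) • ((wop hs hσ (RC z j) - wop hs hσ (RA z j)) ∘L M j)

/-- The preimage of `Kz` in `L²`. -/
lemma Kz_apply {s σ τ : ℝ} (hs : 0 ≤ s) (hσ : 0 ≤ σ) (M : Fin 3 → L2w τ →L[ℂ] L2w σ) (z : ℂ)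
    (u : L2w τ) : Kz hs hσ M z u = incl (weightedVolume_le_volume hs)
      (∑ j, RA z j (-(1 / 2 : ℂ) • incl (volume_le_weightedVolume hσ) (M j u)) +
        ∑ j, RC z j ((1 / 2 : ℂ) • incl (volume_le_weightedVolume hσ) (M j u))) := by
  simp only [Kz, sum_apply, ← sum_add_distrib, map_sum]
  refine sum_congr rfl fun j _ => ?_
  simp only [wop, smul_apply, ContinuousLinearMap.comp_apply, sub_apply, map_add, map_smul, smul_sub,
    neg_smul, map_neg]
  abel

lemma exists_limit_Kz {s σ τ : ℝ} (hs : 1 / 2 < s) (hσ : 1 / 2 < σ) (hsσ : 2 < s + σ)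
    (hs0 : 0 ≤ s) (hσ0 : 0 ≤ σ) (M : Fin 3 → L2w τ →L[ℂ] L2w σ) :
    ∃ K : L2w τ →L[ℂ] L2w (-s), Tendsto (Kz hs0 hσ0 M) (𝓝[halfLineᶜ] 0) (𝓝 K) := by
  choose A hA using fun j => (isChannel_RA j).exists_limit hs hσ hsσ hs0 hσ0
  choose C hC using fun j => (isChannel_RC j).exists_limit hs hσ hsσ hs0 hσ0
  refine ⟨∑ j, (1 / 2 : ℂ) • ((C j - A j) ∘L M j), tendsto_finsetSum _ fun j _ => ?_⟩
  have h1 := (hC j).sub (hA j)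
  have h2 : Continuous fun T : L2w σ →L[ℂ] L2w (-s) => (1 / 2 : ℂ) • (T ∘L M j) := by fun_prop
  exact (h2.tendsto _).comp h1

/-- Integration by parts in the velocity, with a bounded factor depending on the position only. -/
lemma integral_mul_qD {g : E3 → ℝ} (hg : Continuous g) {c : ℝ} (hc : ∀ x, |g x| ≤ c) (j : Fin 3)
    (Φ Ψ : S6) :
    ∫ p : Phase, (g p.1 : ℂ) * (Φ p * qD j Ψ p) = - ∫ p : Phase, (g p.1 : ℂ) * (qD j Φ p * Ψ p) := by
  have hgm : AEStronglyMeasurable (fun p : Phase => (g p.1 : ℂ)) volume :=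
    (by fun_prop : Continuous fun p : Phase => (g p.1 : ℂ)).aestronglyMeasurable
  have hi : ∀ Φ Ψ : S6, Integrable fun p : Phase => (g p.1 : ℂ) * Φ p * Ψ p := by
    intro Φ Ψ
    have := (integrable_schwartz_mul Φ Ψ).bdd_mul (c := c) hgm
      (ae_of_all _ fun p => by simpa using hc p.1)
    simpa only [mul_assoc] using this
  have hline : ∀ (Φ : S6) p, HasLineDerivAt ℝ Φ (qD j Φ p) p ((0, eb j) : Phase) :=
    fun Φ p => by rw [qD_apply]; exact (Φ.hasFDerivAt p).hasLineDerivAt _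
  have key := integral_bilinear_hasLineDerivAt_right_eq_neg_left_of_integrable
    (μ := (volume : Measure Phase)) (B := ContinuousLinearMap.mul ℝ ℂ) (v := ((0, eb j) : Phase))
    (f := fun p : Phase => (g p.1 : ℂ) * Φ p) (f' := fun p => (g p.1 : ℂ) * qD j Φ p)
    (g := Ψ) (g' := qD j Ψ) (by simpa using hi (qD j Φ) Ψ) (by simpa using hi Φ (qD j Ψ))
    (by simpa using hi Φ Ψ) (fun p _ => ?_) (fun p _ => hline Ψ p)
  · simpa only [ContinuousLinearMap.mul_apply', mul_assoc] using key
  · have h := (hline Φ p).const_mul (g p.1 : ℂ)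
    have e : (fun t : ℝ => (g p.1 : ℂ) * Φ (p + t • ((0, eb j) : Phase))) =
        fun t : ℝ => (g (p + t • ((0, eb j) : Phase)).1 : ℂ) * Φ (p + t • ((0, eb j) : Phase)) := by
      ext t; simp
    rw [e] at h; exact h

/-! ### The limit operator solves the free equation -/

lemma exists_lintegral_mul_schwartz_le (s : ℝ) (Φ : S6) :
    ∃ c : ℝ, 0 ≤ c ∧ ∀ f : Phase → ℂ, AEStronglyMeasurable f volume →
      ∫⁻ p, ‖f p * Φ p‖ₑ ≤ ofReal c * eLpNorm f 2 (weightedVolume (-s)) := by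
  obtain ⟨C, hC, hΦ⟩ := exists_enorm_schwartz_le Φ (m := |s| + 2) (by positivity)
  set B : ℝ≥0∞ := ∫⁻ p : Phase, (wt (s / 2) p.1 * ‖Φ p‖ₑ) ^ 2 with hB
  have hBt : B < ⊤ := by
    have h1 : ∀ p : Phase, (wt (s / 2) p.1 * ‖Φ p‖ₑ) ^ 2 ≤ C ^ 2 * (wt (-2) p.1 * wt (-2) p.2) := by
      intro p
      calc _ ≤ (wt (s / 2) p.1 * (C * wt (-(|s| + 2)) p.1 * wt (-(|s| + 2)) p.2)) ^ 2 := by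
            gcongr; exact hΦ p
        _ = C ^ 2 * (wt (s + (-(|s| + 2) + -(|s| + 2))) p.1 *
            wt (-(|s| + 2) + -(|s| + 2)) p.2) := by
            rw [← wt_mul, ← wt_mul, ← wt_mul, ← wt_half_sq s]; ring
        _ ≤ _ := by
            have := le_abs_self s
            have := abs_nonneg s
            gcongr <;> exact wt_mono (by linarith) _
    have hw := measurable_wt (-2)
    refine (lintegral_mono h1).trans_lt ?_
    rw [lintegral_const_mul _ (by fun_prop), volume_eq_prod,
      lintegral_prod_mul hw.aemeasurable hw.aemeasurable]
    have := lintegral_wt_lt_top (s := 2) (by norm_num)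
    exact mul_lt_top (ENNReal.pow_lt_top hC.lt_top) (mul_lt_top this this)
  refine ⟨Real.sqrt B.toReal, Real.sqrt_nonneg _, fun f hf => ?_⟩
  refine (ENNReal.pow_le_pow_left_iff two_ne_zero).1 ?_
  rw [mul_pow, eLpNorm_sq, lintegral_weightedVolume, ← ofReal_pow (Real.sqrt_nonneg _),
    Real.sq_sqrt ENNReal.toReal_nonneg, ENNReal.ofReal_toReal hBt.ne, mul_comm]
  have hw1 := (measurable_wt_fst (-s / 2)).aemeasurable (μ := (volume : Measure Phase))
  have hw2 := (measurable_wt_fst (s / 2)).aemeasurable (μ := (volume : Measure Phase))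
  have h := sq_lintegral_mul_le (hw1.mul hf.enorm) (hw2.mul Φ.continuous.measurable.enorm.aemeasurable)
  calc _ = (∫⁻ p : Phase, wt (-s / 2) p.1 * ‖f p‖ₑ * (wt (s / 2) p.1 * ‖Φ p‖ₑ)) ^ 2 := by
        congr 1; refine lintegral_congr fun p => ?_
        rw [enorm_mul, show ∀ a b c d : ℝ≥0∞, a * b * (c * d) = a * c * (b * d) by intros; ring,
          wt_mul, show -s / 2 + s / 2 = 0 by ring, wt_zero, one_mul]
    _ ≤ _ := h
    _ = _ := by
        congr 1; refine lintegral_congr fun p => ?_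
        rw [Pi.mul_apply, mul_pow, wt_half_sq]

lemma integrable_mul_schwartz_weighted (s : ℝ) {f : Phase → ℂ}
    (hf : MemLp f 2 (weightedVolume (-s))) (Φ : S6) : Integrable (fun p => f p * Φ p) := by
  obtain ⟨c, hc, h⟩ := exists_lintegral_mul_schwartz_le s Φ
  have hm := (aestronglyMeasurable_weightedVolume (-s)).1 hf.1
  exact ⟨hm.mul Φ.continuous.aestronglyMeasurable,
    (h f hm).trans_lt (mul_lt_top ENNReal.ofReal_lt_top hf.2)⟩

lemma tendsto_integral_mul_schwartz {ι : Type*} {l : Filter ι} {s : ℝ} {w : ι → L2w (-s)}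
    {w' : L2w (-s)} (h : Tendsto w l (𝓝 w')) (Φ : S6) :
    Tendsto (fun i => ∫ p, (w i : Phase → ℂ) p * Φ p) l (𝓝 (∫ p, w' p * Φ p)) := by
  obtain ⟨c, hc, hb⟩ := exists_lintegral_mul_schwartz_le s Φ
  rw [tendsto_iff_norm_sub_tendsto_zero]
  have h0 : Tendsto (fun i => c * ‖w i - w'‖) l (𝓝 0) := by
    simpa using (tendsto_iff_norm_sub_tendsto_zero.1 h).const_mul c
  refine squeeze_zero (fun _ => norm_nonneg _) (fun i => ?_) h0
  refine norm_le_of_enorm_le hc ?_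
  have hi := fun u : L2w (-s) => integrable_mul_schwartz_weighted s (Lp.memLp u) Φ
  rw [← integral_sub (hi _) (hi _), Lp.enorm_def]
  refine le_trans (enorm_integral_le_lintegral_enorm _) (le_trans (le_of_eq ?_)
    (hb _ ((aestronglyMeasurable_weightedVolume (-s)).1 (Lp.memLp (w i - w')).1)))
  refine lintegral_congr_ae ?_
  filter_upwards [(aeEq_weightedVolume_iff (-s)).1 (Lp.coeFn_sub (w i) w')] with p hp
  rw [hp, Pi.sub_apply, sub_mul]

lemma integral_eq_bp {s : ℝ} (hs : 0 ≤ s) (w : L2) (Φ : S6) :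
    ∫ p, (incl (weightedVolume_le_volume hs) w : Phase → ℂ) p * Φ p = bp w Φ := by
  rw [bp_eq]; refine integral_congr_ae ?_
  filter_upwards [(aeEq_weightedVolume_iff (-s)).1 (coeFn_incl (weightedVolume_le_volume hs) w)]
    with p hp
  rw [hp]

lemma qA_sub_qC (j : Fin 3) (Φ : S6) : qA j Φ - qC j Φ = (2 : ℂ) • qD j Φ := by
  ext p; simp [qA_apply, qC_apply, qD_apply]; ring

section

variable {V : E3 → ℝ} {s σ t : ℝ} (hs : 0 ≤ s) (hσ : 0 ≤ σ) {M : Fin 3 → L2w (-t) →L[ℂ] L2w σ}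

/-- The pairing of the data of `R₀(z) W u` with a Schwartz function. -/
lemma sum_bp_eq (hM : ∀ j u, ⇑(M j u) =ᵐ[volume]
      fun p => (dV V j p.1 : ℂ) * u p) (u : L2w (-t)) (Φ : S6) :
    ∑ j, bp (-(1 / 2 : ℂ) • incl (volume_le_weightedVolume hσ) (M j u)) (qC j Φ) +
      ∑ j, bp ((1 / 2 : ℂ) • incl (volume_le_weightedVolume hσ) (M j u)) (qA j Φ) =
    ∑ j, ∫ p, (dV V j p.1 : ℂ) * u p * qD j Φ p := by
  rw [← sum_add_distrib]
  refine sum_congr rfl fun j _ => ?_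
  set f := incl (volume_le_weightedVolume hσ) (M j u) with hf
  have h1 : bp (-(1 / 2 : ℂ) • f) (qC j Φ) + bp ((1 / 2 : ℂ) • f) (qA j Φ) = bp f (qD j Φ) := by
    have h2 := congrArg (bp f) (qA_sub_qC j Φ)
    rw [map_sub, map_smul, smul_eq_mul] at h2
    rw [bp_smul, bp_smul]
    linear_combination (1 / 2 : ℂ) * h2
  rw [h1, bp_eq]
  refine integral_congr_ae ?_
  filter_upwards [hM j u, coeFn_incl (volume_le_weightedVolume hσ) (M j u)] with p h2 h3
  rw [hf, h3, h2]

/-- `P₀ K u = W u`, for the limit `K` of `R₀(z) W`. -/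
lemma integral_limit_Kz (hM : ∀ j u, ⇑(M j u) =ᵐ[volume]
      fun p => (dV V j p.1 : ℂ) * u p) {K : L2w (-t) →L[ℂ] L2w (-s)}
    (hK : Tendsto (Kz hs hσ M) (𝓝[halfLineᶜ] 0) (𝓝 K)) (u : L2w (-t)) (Φ : S6) :
    ∫ p, (K u : Phase → ℂ) p * qPt Φ p = ∑ j, ∫ p, (dV V j p.1 : ℂ) * u p * qD j Φ p := by
  have hKu : Tendsto (fun z => Kz hs hσ M z u) (𝓝[halfLineᶜ] 0) (𝓝 (K u)) :=
    ((ContinuousLinearMap.apply ℂ _ u).continuous.tendsto K).comp hK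
  have hz : Tendsto (fun z : ℂ => z) (𝓝[halfLineᶜ] 0) (𝓝 0) := nhdsWithin_le_nhds
  have h1 := tendsto_integral_mul_schwartz hKu (qPt Φ)
  have h2 := (hz.mul (tendsto_integral_mul_schwartz hKu Φ)).add_const
    (∑ j, ∫ p, (dV V j p.1 : ℂ) * u p * qD j Φ p)
  rw [zero_mul, zero_add] at h2
  refine tendsto_nhds_unique (h1.congr' ?_) h2
  filter_upwards [eventually_near] with z ⟨hz1, hz2⟩
  rw [Kz_apply, integral_eq_bp hs, integral_eq_bp hs,
    wData_resolvent hz1 hz2 _ _ Φ, bp_smul, ← sum_bp_eq hσ hM, add_assoc]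

lemma integral_W_mul (hVc : ∀ j, Continuous (dV V j)) {c : ℝ} (hVb : ∀ j x, |dV V j x| ≤ c)
    (Ψ Φ : S6) :
    ∫ p, W V Ψ p * Φ p = ∑ j, ∫ p, (dV V j p.1 : ℂ) * (Ψ p * qD j Φ p) := by
  have h1 : ∀ p, W V Ψ p * Φ p = -∑ j, (dV V j p.1 : ℂ) * (qD j Ψ p * Φ p) := by
    intro p; rw [W, fderiv_snd_sum, neg_mul, Finset.sum_mul]
    simp only [mul_assoc, dV]
  simp only [h1]
  rw [integral_neg, integral_finsetSum]
  · rw [← Finset.sum_neg_distrib]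
    refine sum_congr rfl fun j _ => ?_
    rw [← integral_mul_qD (hVc j) (hVb j)]
  · intro j _
    have hc1 : Continuous fun p : Phase => (dV V j p.1 : ℂ) :=
      Complex.continuous_ofReal.comp ((hVc j).comp continuous_fst)
    exact (integrable_schwartz_mul (qD j Ψ) Φ).bdd_mul (c := c) hc1.aestronglyMeasurable
      (ae_of_all _ fun p => by simpa using hVb j p.1)

/-- The identity `R₀(z) W φ = Kz φ` for test functions. -/
lemma RR_eq_of_test (hVc : ∀ j, Continuous (dV V j)) {c : ℝ} (hVb : ∀ j x, |dV V j x| ≤ c)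
    (hM : ∀ j u, ⇑(M j u) =ᵐ[volume] fun p => (dV V j p.1 : ℂ) * u p)
    {z : ℂ} (hz1 : ‖z‖ ≤ dl) (hz2 : z ∉ halfLine) (Ψ : S6) {u : L2w (-t)} {g : L2}
    (hu : ⇑u =ᵐ[volume] Ψ) (hg : ⇑g =ᵐ[volume] W V Ψ) :
    RR z g = ∑ j, RA z j (-(1 / 2 : ℂ) • incl (volume_le_weightedVolume hσ) (M j u)) +
        ∑ j, RC z j ((1 / 2 : ℂ) • incl (volume_le_weightedVolume hσ) (M j u)) := by
  have hr : WData (RR z g) (g + z • RR z g) 0 0 :=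
    (weakEq_zero_iff _ _).1 ((isFreeResolvent_RR hz1 hz2).1 g)
  -- the datum `W φ` in divergence form
  have hr2 : WData (RR z g) (z • RR z g)
      (fun j => -(1 / 2 : ℂ) • incl (volume_le_weightedVolume hσ) (M j u))
      (fun j => (1 / 2 : ℂ) • incl (volume_le_weightedVolume hσ) (M j u)) := by
    intro Φ
    have hgW : bp g Φ = ∑ j, ∫ p, (dV V j p.1 : ℂ) * u p * qD j Φ p := by
      have h1 : bp g Φ = ∫ p, W V Ψ p * Φ p := by
        rw [bp_eq]; refine integral_congr_ae ?_
        filter_upwards [hg] with p h4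
        rw [h4]
      rw [h1, integral_W_mul hVc hVb]
      refine sum_congr rfl fun j _ => integral_congr_ae ?_
      filter_upwards [hu] with p hp
      rw [hp, mul_assoc]
    have h2 := hr Φ
    simp only [Pi.zero_apply, bp_zero, Finset.sum_const_zero, add_zero] at h2
    rw [h2, add_assoc, sum_bp_eq hσ hM, bp_add, add_comm, hgW]
  have h3 := eq_resolvent hz1 hz2 hr2
  rw [sub_self, map_zero, zero_add] at h3; exact h3

lemma limit_Kz_eq_of_test (hVc : ∀ j, Continuous (dV V j)) {c : ℝ}
    (hVb : ∀ j x, |dV V j x| ≤ c) (hM : ∀ j u, ⇑(M j u) =ᵐ[volume] fun p => (dV V j p.1 : ℂ) * u p)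
    {K : L2w (-t) →L[ℂ] L2w (-s)} (hK : Tendsto (Kz hs hσ M) (𝓝[halfLineᶜ] 0) (𝓝 K))
    {G : L2w σ →L[ℂ] L2w (-s)}
    (hG : Tendsto (fun z => wop hs hσ (RR z)) (𝓝[halfLineᶜ] 0) (𝓝 G))
    (Ψ : S6) {u : L2w (-t)} {f : L2w σ}
    (hu : ⇑u =ᵐ[volume] Ψ) (hf : ⇑f =ᵐ[volume] W V Ψ) : K u = G f := by
  have h1 : Tendsto (fun z => Kz hs hσ M z u) (𝓝[halfLineᶜ] 0) (𝓝 (K u)) :=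
    ((ContinuousLinearMap.apply ℂ _ u).continuous.tendsto K).comp hK
  have h2 : Tendsto (fun z => wop hs hσ (RR z) f) (𝓝[halfLineᶜ] 0) (𝓝 (G f)) :=
    ((ContinuousLinearMap.apply ℂ _ f).continuous.tendsto G).comp hG
  refine tendsto_nhds_unique (h1.congr' ?_) h2
  filter_upwards [eventually_near] with z ⟨hz1, hz2⟩
  rw [Kz_apply, ← RR_eq_of_test hσ hVc hVb hM hz1 hz2 Ψ hu
    ((coeFn_incl (volume_le_weightedVolume hσ) f).trans hf)]
  rfl

/-- The identification of `K` with the extension of `G₀ W`. -/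
lemma isG0W_of_tendsto (hst : s ≤ t) (hVc : ∀ j, Continuous (dV V j)) {c : ℝ}
    (hVb : ∀ j x, |dV V j x| ≤ c) (hM : ∀ j u, ⇑(M j u) =ᵐ[volume] fun p => (dV V j p.1 : ℂ) * u p)
    {K : L2w (-t) →L[ℂ] L2w (-s)} (hK : Tendsto (Kz hs hσ M) (𝓝[halfLineᶜ] 0) (𝓝 K))
    {G : L2w σ →L[ℂ] L2w (-s)}
    (hG : Tendsto (fun z => wop hs hσ (RR z)) (𝓝[halfLineᶜ] 0) (𝓝 G)) :
    IsG0W V σ (-t) (incl (weightedVolume_mono (neg_le_neg hst)) ∘L G)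
      (incl (weightedVolume_mono (neg_le_neg hst)) ∘L K) := by
  intro φ hφ u f hu hf
  have h := limit_Kz_eq_of_test hs hσ hVc hVb hM hK hG hφ.toS hu hf
  rw [ContinuousLinearMap.comp_apply, ContinuousLinearMap.comp_apply, h]

end

/-! ### Averaging over cells -/

/-- A basis of the phase space; the cells are translates of its fundamental domain. -/
def bs : Module.Basis (Fin (Module.finrank ℝ Phase)) ℝ Phase := Module.finBasis ℝ Phase

/-- A bound for the diameter of the unit cells. -/
def cellR : ℝ := ∑ i, ‖bs i‖

lemma cellR_nonneg : 0 ≤ cellR := sum_nonneg fun _ _ => norm_nonneg _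

/-- The lattice point labelling the cell of `p`, for cells of size `δ`. -/
def cellIdx (δ : ℝ) (p : Phase) : Phase := ZSpan.floor bs (δ⁻¹ • p)

/-- The cell with label `i`. -/
def cell (δ : ℝ) (i : Phase) : Set Phase := {p | cellIdx δ p = i}

lemma cellIdx_mem (δ : ℝ) (p : Phase) :
    cellIdx δ p ∈ Submodule.span ℤ (Set.range bs) := (ZSpan.floor bs (δ⁻¹ • p)).2

lemma norm_smul_sub_cellIdx_le (δ : ℝ) (p : Phase) : ‖δ⁻¹ • p - cellIdx δ p‖ ≤ cellR :=
  ZSpan.norm_fract_le bs (δ⁻¹ • p)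

lemma cell_eq {δ : ℝ} {i : Phase} (hi : i ∈ Submodule.span ℤ (Set.range bs)) :
    cell δ i = (fun p : Phase => δ⁻¹ • p) ⁻¹' ((fun p => p + -i) ⁻¹' ZSpan.fundamentalDomain bs) := by
  ext p; simp only [cell, Set.mem_ofPred_eq, Set.mem_preimage, ← ZSpan.fract_eq_self]
  rw [ZSpan.fract_add_ZSpan bs _ (neg_mem hi), ZSpan.fract_apply, cellIdx, ← sub_eq_add_neg,
    sub_right_inj]

lemma measurableSet_cell {δ : ℝ} {i : Phase} (hi : i ∈ Submodule.span ℤ (Set.range bs)) :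
    MeasurableSet (cell δ i) := by
  rw [cell_eq hi]
  exact (measurable_const_smul _) ((measurable_add_const _)
    (ZSpan.fundamentalDomain_measurableSet bs))

lemma volume_cell {δ : ℝ} (hδ : 0 < δ) {i : Phase}
    (hi : i ∈ Submodule.span ℤ (Set.range bs)) : (volume : Measure Phase) (cell δ i) =
      ofReal (δ ^ Module.finrank ℝ Phase) * volume (ZSpan.fundamentalDomain bs) := by
  rw [cell_eq hi, Measure.addHaar_preimage_smul _ (inv_ne_zero hδ.ne'), measure_preimage_add_right,
    inv_pow, inv_inv, abs_of_pos (by positivity)]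

lemma volume_fundamentalDomain_ne_top : (volume : Measure Phase) (ZSpan.fundamentalDomain bs) ≠ ⊤ :=
  (ZSpan.fundamentalDomain_isBounded bs).measure_lt_top.ne

/-- The ratio of the volumes of a ball and of a cell of the same scale. -/
def cellC : ℝ≥0∞ := (volume (ZSpan.fundamentalDomain bs))⁻¹ *
  (volume : Measure Phase) (closedBall 0 (2 * cellR))

lemma cellC_ne_top : cellC ≠ ⊤ :=
  mul_ne_top (ENNReal.inv_ne_top.2 (ZSpan.measure_fundamentalDomain_ne_zero bs))
    Metric.isBounded_closedBall.measure_lt_top.ne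

lemma norm_sub_le_of_mem_cell {δ : ℝ} (hδ : 0 < δ) {p q : Phase}
    (h : cellIdx δ p = cellIdx δ q) : ‖p - q‖ ≤ δ * (2 * cellR) := by
  have h1 := norm_smul_sub_cellIdx_le δ p
  have h2 := norm_smul_sub_cellIdx_le δ q
  have h3 : p - q = δ • ((δ⁻¹ • p - cellIdx δ p) - (δ⁻¹ • q - cellIdx δ q)) := by
    rw [h, sub_sub_sub_cancel_right, smul_sub, smul_smul, smul_smul, mul_inv_cancel₀ hδ.ne',
      one_smul, one_smul]
  rw [h3, norm_smul, Real.norm_of_nonneg hδ.le]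
  have := norm_sub_le (δ⁻¹ • p - cellIdx δ p) (δ⁻¹ • q - cellIdx δ q)
  gcongr; linarith

/-- Pointwise estimate of the deviation from the mean over a cell. -/
lemma enorm_sub_average_sq_le {δ : ℝ} (hδ : 0 < δ) (f : L2) (p : Phase) :
    ‖f p - (((volume : Measure Phase) (cell δ (cellIdx δ p))).toReal : ℂ)⁻¹ *
        ∫ q in cell δ (cellIdx δ p), f q‖ₑ ^ 2 ≤
      (volume (cell δ (cellIdx δ p)))⁻¹ *
        ∫⁻ y in closedBall (0 : Phase) (δ * (2 * cellR)), ‖f p - f (p + y)‖ₑ ^ 2 := by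
  have hmem := cellIdx_mem δ p
  set E := cell δ (cellIdx δ p) with hE
  set d : ℝ≥0∞ := volume E with hd
  have hEm : MeasurableSet E := measurableSet_cell hmem
  have hd0 : d ≠ 0 := by
    rw [hd, hE, volume_cell hδ hmem]
    exact mul_ne_zero (by simp; positivity) (ZSpan.measure_fundamentalDomain_ne_zero bs)
  have hdt : d ≠ ⊤ := by
    rw [hd, hE, volume_cell hδ hmem]
    exact mul_ne_top ofReal_ne_top volume_fundamentalDomain_ne_top
  have hdr : (d.toReal : ℂ) ≠ 0 := by exact_mod_cast (ENNReal.toReal_pos hd0 hdt).ne'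
  have : IsFiniteMeasure (volume.restrict E) := ⟨by rw [Measure.restrict_apply_univ]; exact hdt.lt_top⟩
  have hfi : Integrable (fun q => f q) (volume.restrict E) :=
    ((Lp.memLp f).restrict E).integrable one_le_two
  have hfm := measurable_coe_L2 f
  have h1 : f p - (d.toReal : ℂ)⁻¹ * ∫ q in E, f q = (d.toReal : ℂ)⁻¹ * ∫ q in E, (f p - f q) := by
    rw [integral_sub (integrable_const _) hfi, integral_const, measureReal_restrict_apply_univ, mul_sub,
      measureReal_def, ← hd, Complex.real_smul, inv_mul_cancel_left₀ hdr]
  have h2 : ‖((d.toReal : ℂ)⁻¹)‖ₑ = d⁻¹ := by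
    rw [enorm_inv hdr, ← ofReal_norm, norm_real, Real.norm_of_nonneg ENNReal.toReal_nonneg,
      ENNReal.ofReal_toReal hdt]
  have h3 : ‖∫ q in E, (f p - f q)‖ₑ ^ 2 ≤ d * ∫⁻ q in E, ‖f p - f q‖ₑ ^ 2 := by
    have hm : Measurable fun q => ‖f p - f q‖ₑ := (measurable_const.sub hfm).enorm
    have := sq_lintegral_mul_le (μ := volume.restrict E) (f := fun _ => 1)
      (g := fun q => ‖f p - f q‖ₑ) aemeasurable_const hm.aemeasurable
    simp only [one_mul, one_pow, lintegral_const, Measure.restrict_apply_univ] at this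
    refine le_trans ?_ this; gcongr
    exact enorm_integral_le_lintegral_enorm _
  have h4 : ∫⁻ q in E, ‖f p - f q‖ₑ ^ 2 ≤
      ∫⁻ y in closedBall (0 : Phase) (δ * (2 * cellR)), ‖f p - f (p + y)‖ₑ ^ 2 := by
    rw [← lintegral_indicator hEm, ← lintegral_indicator Metric.isClosed_closedBall.measurableSet,
      ← lintegral_add_left_eq_self _ p]
    refine lintegral_mono fun y => ?_
    by_cases hy : p + y ∈ E
    · have hyb : y ∈ closedBall (0 : Phase) (δ * (2 * cellR)) := by
        have h5 := norm_sub_le_of_mem_cell hδ (p := p) (q := p + y) (Eq.symm hy)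
        rw [sub_add_cancel_left, norm_neg] at h5; simpa using h5
      rw [Set.indicator_of_mem hy, Set.indicator_of_mem hyb]
    · rw [Set.indicator_of_notMem hy]; exact zero_le
  rw [h1, enorm_mul, mul_pow, h2]
  calc _ ≤ d⁻¹ ^ 2 * (d * ∫⁻ q in E, ‖f p - f q‖ₑ ^ 2) := by gcongr
    _ = d⁻¹ * ∫⁻ q in E, ‖f p - f q‖ₑ ^ 2 := by
        rw [← mul_assoc, sq, mul_assoc d⁻¹ d⁻¹ d, ENNReal.inv_mul_cancel hd0 hdt, mul_one]
    _ ≤ _ := by gcongr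

/-- Averages over finitely many cells approximate a function with small translation differences. -/
lemma exists_cellAverage {δ : ℝ} (hδ : 0 < δ) (R : ℝ) :
    ∃ (P : L2 →L[ℂ] L2) (S : Set Phase), IsCompactOperator P ∧ MeasurableSet S ∧
      closedBall 0 R ⊆ S ∧ (∀ f : L2, ∀ᵐ p, p ∉ S → P f p = 0) ∧
      ∀ (f : L2) (η : ℝ≥0∞), (∀ y, ‖y‖ ≤ δ * (2 * cellR) → ‖tau y f - f‖ₑ ≤ η) →
        ∫⁻ p in S, ‖f p - P f p‖ₑ ^ 2 ≤ cellC * η ^ 2 := by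
  classical
  have hfin := ZSpan.setFinite_inter bs
    (Metric.isBounded_closedBall (x := (0 : Phase)) (r := δ⁻¹ * R + cellR))
  set I : Finset Phase := hfin.toFinset with hI
  have hIm : ∀ i ∈ I, i ∈ Submodule.span ℤ (Set.range bs) := fun i hi =>
    ((hfin.mem_toFinset).1 hi).2
  set E : I → Set Phase := fun i => cell δ i with hE
  have hEm : ∀ i, MeasurableSet (E i) := fun i => measurableSet_cell (hIm _ i.2)
  set d : ℝ≥0∞ := ofReal (δ ^ Module.finrank ℝ Phase) * volume (ZSpan.fundamentalDomain bs) with hd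
  have hEv : ∀ i, volume (E i) = d := fun i => volume_cell hδ (hIm _ i.2)
  have hdt : d ≠ ⊤ := mul_ne_top ofReal_ne_top volume_fundamentalDomain_ne_top
  have hEt : ∀ i, volume (E i) ≠ ⊤ := fun i => by rw [hEv]; exact hdt
  set e : I → L2 := fun i => indicatorConstLp 2 (hEm i) (hEt i) (1 : ℂ) with he
  set P : L2 →L[ℂ] L2 := ∑ i, ((innerSL ℂ (e i)).smulRight ((d.toReal : ℂ)⁻¹ • e i)) with hP
  have hPae : ∀ f : L2, ∀ᵐ p, P f p = ∑ i, (∫ q in E i, f q) * ((d.toReal : ℂ)⁻¹ *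
      (E i).indicator (fun _ => (1 : ℂ)) p) := by
    intro f
    have h1 : P f = ∑ i, (∫ q in E i, f q) • (d.toReal : ℂ)⁻¹ • e i := by
      simp only [hP, sum_apply, ContinuousLinearMap.smulRight_apply, innerSL_apply_apply, he,
        L2.inner_indicatorConstLp_one]
    have h2 : ∀ i, ∀ᵐ p, ((∫ q in E i, f q) • (d.toReal : ℂ)⁻¹ • e i : L2) p =
        (∫ q in E i, f q) * ((d.toReal : ℂ)⁻¹ * (E i).indicator (fun _ => (1 : ℂ)) p) := by
      intro i
      filter_upwards [Lp.coeFn_smul (∫ q in E i, f q) ((d.toReal : ℂ)⁻¹ • e i),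
        Lp.coeFn_smul (d.toReal : ℂ)⁻¹ (e i),
        indicatorConstLp_coeFn (p := 2) (hs := hEm i) (hμs := hEt i) (c := (1 : ℂ))] with p a b c
      rw [a, Pi.smul_apply, b, Pi.smul_apply, c, smul_eq_mul, smul_eq_mul]
    rw [h1]
    filter_upwards [Lp.coeFn_finsetSum Finset.univ
      (fun i => (∫ q in E i, f q) • (d.toReal : ℂ)⁻¹ • e i), ae_all_iff.2 h2] with p a b
    rw [a, Finset.sum_apply]
    exact sum_congr rfl fun i _ => b i
  refine ⟨P, ⋃ i, E i, ?_, MeasurableSet.iUnion hEm, fun p hp => ?_, fun f => ?_, fun f η hη => ?_⟩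
  · rw [hP, FunLike.coe_sum]
    refine Finset.sum_induction _ (fun g : L2 → L2 => IsCompactOperator g) (fun _ _ h1 h2 => h1.add h2)
      isCompactOperator_zero fun i _ => ?_
    have h1 : IsCompactOperator ((ContinuousLinearMap.id ℂ ℂ).smulRight ((d.toReal : ℂ)⁻¹ • e i)) :=
      isCompactOperator_of_locallyCompactSpace_rng _
    exact h1.comp_clm (innerSL ℂ (e i))
  · have h1 : cellIdx δ p ∈ I := by
      rw [hI, hfin.mem_toFinset]
      refine ⟨?_, cellIdx_mem δ p⟩
      have h2 := norm_smul_sub_cellIdx_le δ p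
      have h3 : ‖cellIdx δ p‖ ≤ ‖δ⁻¹ • p‖ + ‖δ⁻¹ • p - cellIdx δ p‖ := norm_le_norm_add_norm_sub (δ⁻¹ • p) (cellIdx δ p)
      rw [norm_smul, Real.norm_of_nonneg (by positivity)] at h3
      have h4 : δ⁻¹ * ‖p‖ ≤ δ⁻¹ * R := by gcongr; simpa using hp
      simp only [Metric.mem_closedBall, dist_zero_right]; linarith
    exact Set.mem_iUnion.2 ⟨⟨_, h1⟩, rfl⟩
  · filter_upwards [hPae f] with p hp hpS
    rw [hp]; refine Finset.sum_eq_zero fun i _ => ?_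
    rw [Set.indicator_of_notMem fun h => hpS (Set.mem_iUnion.2 ⟨i, h⟩), mul_zero, mul_zero]
  · have hfm := measurable_coe_L2 f
    set B := closedBall (0 : Phase) (δ * (2 * cellR)) with hB
    have hpt : ∀ᵐ p, p ∈ (⋃ i, E i) → ‖f p - P f p‖ₑ ^ 2 ≤
        d⁻¹ * ∫⁻ y in B, ‖f p - f (p + y)‖ₑ ^ 2 := by
      filter_upwards [hPae f] with p hp hpS
      obtain ⟨i, hi⟩ := Set.mem_iUnion.1 hpS
      have hi' : cellIdx δ p = i := hi
      have hval : P f p = (d.toReal : ℂ)⁻¹ * ∫ q in E i, f q := by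
        rw [hp, Finset.sum_eq_single i]
        · rw [Set.indicator_of_mem hi, mul_one, mul_comm]
        · intro k _ hk; rw [Set.indicator_of_notMem, mul_zero, mul_zero]; intro h
          exact hk (Subtype.ext ((show cellIdx δ p = k from h).symm.trans hi'))
        · simp
      have := enorm_sub_average_sq_le hδ f p
      rw [hi', show cell δ i = E i from rfl, hEv i] at this; rwa [hval]
    have hmeas : Measurable fun q : Phase × Phase => ‖f q.1 - f (q.1 + q.2)‖ₑ ^ 2 :=
      ((hfm.comp measurable_fst).sub
        (hfm.comp (measurable_fst.add measurable_snd))).enorm.pow_const 2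
    calc _ ≤ ∫⁻ p in ⋃ i, E i, d⁻¹ * ∫⁻ y in B, ‖f p - f (p + y)‖ₑ ^ 2 := by
          refine lintegral_mono_ae ?_
          rw [ae_restrict_iff' (MeasurableSet.iUnion hEm)]; exact hpt
      _ ≤ ∫⁻ p, d⁻¹ * ∫⁻ y in B, ‖f p - f (p + y)‖ₑ ^ 2 := setLIntegral_le_lintegral _ _
      _ = d⁻¹ * ∫⁻ y in B, ∫⁻ p, ‖f p - f (p + y)‖ₑ ^ 2 := by
          rw [lintegral_const_mul _ hmeas.lintegral_prod_right',
            lintegral_lintegral_swap hmeas.aemeasurable]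
      _ ≤ d⁻¹ * ∫⁻ _ in B, η ^ 2 := by
          refine mul_le_mul_right (setLIntegral_mono measurable_const fun y hy => ?_) _
          have h1 : ∫⁻ p, ‖f p - f (p + y)‖ₑ ^ 2 = ‖tau (-y) f - f‖ₑ ^ 2 := by
            rw [enorm_Lp_sq]
            refine lintegral_congr_ae ?_
            filter_upwards [Lp.coeFn_sub (tau (-y) f) f, coeFn_tau (-y) f] with p a b
            rw [a, Pi.sub_apply, b, sub_neg_eq_add, enorm_sub_rev]
          rw [h1]; gcongr
          exact hη (-y) (by simpa [hB] using hy)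
      _ = cellC * η ^ 2 := by
          rw [setLIntegral_const, hB, Measure.addHaar_closedBall_mul _ _ hδ.le (by
            have := cellR_nonneg; positivity), cellC, hd, ENNReal.mul_inv (Or.inl ?_) (Or.inl (by simp))]
          · have hx : ofReal (δ ^ Module.finrank ℝ Phase) ≠ 0 := by simp; positivity
            rw [show ∀ a b c e g : ℝ≥0∞, a * b * (c * (g * e)) = (a * g) * (b * e * c) by
              intros; ring, ENNReal.inv_mul_cancel hx ofReal_ne_top, one_mul]
          · simp; positivity

/-! ### Compactness -/

lemma opNorm_le_of_enorm_sq_le {E F : Type*} [NormedAddCommGroup E] [NormedSpace ℂ E]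
    [NormedAddCommGroup F] [NormedSpace ℂ F] (A : E →L[ℂ] F) {b : ℝ≥0∞} (hb : b ≠ ⊤)
    (h : ∀ m, ‖A m‖ₑ ^ 2 ≤ b * ‖m‖ₑ ^ 2) : ‖A‖ ≤ Real.sqrt b.toReal := by
  refine A.opNorm_le_bound (Real.sqrt_nonneg _) fun m => norm_le_of_enorm_le (Real.sqrt_nonneg _) ?_
  refine (ENNReal.pow_le_pow_left_iff two_ne_zero).1 ?_
  rw [mul_pow, ← ofReal_pow (Real.sqrt_nonneg _), Real.sq_sqrt ENNReal.toReal_nonneg,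
    ENNReal.ofReal_toReal hb]
  exact h m

/-- A compactness criterion: equicontinuity under translations and a bounded velocity moment give
compactness into a space with a decaying weight. -/
lemma isCompactOperator_incl_comp {s : ℝ} (hs : 0 < s) (T : L2 →L[ℂ] L2) {c : ℝ≥0∞} (hc : c ≠ ⊤)
    (hτ : ∀ η : ℝ, 0 < η → ∃ r : ℝ, 0 < r ∧ ∀ m y, ‖y‖ ≤ r → ‖tau y (T m) - T m‖ₑ ≤ ofReal η * ‖m‖ₑ)
    (hv : ∀ m, ∫⁻ p : Phase, ‖p.2‖ₑ ^ 2 * ‖T m p‖ₑ ^ 2 ≤ c * ‖m‖ₑ ^ 2) :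
    IsCompactOperator (incl (weightedVolume_le_volume hs.le) ∘L T) := by
  let J := incl (weightedVolume_le_volume hs.le)
  let b : ℕ → ℝ≥0∞ := fun n => cellC * ofReal (1 / ((n : ℝ) + 1)) ^ 2 +
    (ofReal (((n : ℝ) + 1) ^ (-(2 * s))) * ‖T‖ₑ ^ 2 + ofReal (((n : ℝ) + 1) ^ (-2 : ℝ)) * c)
  have hstep : ∀ n, ∃ P : L2 →L[ℂ] L2, IsCompactOperator P ∧
      ∀ m, ‖(J ∘L (P ∘L T) - J ∘L T) m‖ₑ ^ 2 ≤ b n * ‖m‖ₑ ^ 2 := by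
    intro n
    set R : ℝ := (n : ℝ) + 1 with hR
    obtain ⟨r, hr, hτr⟩ := hτ (1 / R) (by positivity)
    have hcr := cellR_nonneg
    obtain ⟨P, S, hP, hSm, hRS, hP0, hPS⟩ :=
      exists_cellAverage (δ := r / (2 * cellR + 1)) (by positivity) R
    have hδ : r / (2 * cellR + 1) * (2 * cellR) ≤ r := by
      rw [div_mul_eq_mul_div, div_le_iff₀ (by positivity)]; nlinarith
    refine ⟨P, hP, fun m => ?_⟩
    set w := T m with hw
    have h1 := hPS w (ofReal (1 / R) * ‖m‖ₑ) fun y hy => hτr m y (hy.trans hδ)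
    have hwm : Measurable fun p => ‖w p‖ₑ := (measurable_coe_L2 w).enorm
    have hPm : Measurable fun p => ‖w p - P w p‖ₑ ^ 2 :=
      ((measurable_coe_L2 w).sub (measurable_coe_L2 (P w))).enorm.pow_const 2
    have h2 : ∀ᵐ p : Phase, wt (-s) p.1 * ‖w p - P w p‖ₑ ^ 2 ≤
        S.indicator (fun p => ‖w p - P w p‖ₑ ^ 2) p + (ofReal (R ^ (-(2 * s))) * ‖w p‖ₑ ^ 2 +
          ofReal (R ^ (-2 : ℝ)) * (‖p.2‖ₑ ^ 2 * ‖w p‖ₑ ^ 2)) := by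
      filter_upwards [hP0 w] with p hp
      by_cases hpS : p ∈ S
      · rw [Set.indicator_of_mem hpS]
        refine le_trans ?_ le_self_add
        calc _ ≤ 1 * ‖w p - P w p‖ₑ ^ 2 := by gcongr; exact wt_neg_le_one hs.le _
          _ = _ := one_mul _
      · rw [hp hpS, sub_zero, Set.indicator_of_notMem hpS, zero_add]
        have hlt : R < ‖p‖ := by
          by_contra hcon
          exact hpS (hRS (by simpa using not_lt.1 hcon))
        rcases lt_max_iff.1 (by rwa [Prod.norm_def] at hlt) with hx | hx
        · refine le_trans ?_ le_self_add; gcongr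
          refine ofReal_le_ofReal ?_; rw [mul_neg]
          have hb : R ≤ bracket p.1 := hx.le.trans (by
            rw [bracket]; exact Real.le_sqrt_of_sq_le (by linarith))
          exact Real.rpow_le_rpow_of_nonpos (by positivity) hb (by linarith)
        · refine le_trans ?_ le_add_self
          rw [← mul_assoc]
          refine mul_le_mul_left ((wt_neg_le_one hs.le _).trans ?_) _
          rw [← ofReal_norm, ← ofReal_pow (norm_nonneg _), ← ofReal_mul (by positivity),
            ENNReal.one_le_ofReal, Real.rpow_neg (by positivity), Real.rpow_two,
            inv_mul_eq_div, one_le_div (by positivity)]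
          exact pow_le_pow_left₀ (by positivity) hx.le 2
    have h3 : ‖(J ∘L (P ∘L T) - J ∘L T) m‖ₑ ^ 2 =
        ∫⁻ p : Phase, wt (-s) p.1 * ‖w p - P w p‖ₑ ^ 2 := by
      have e : (J ∘L (P ∘L T) - J ∘L T) m = J (P w - w) := by rw [map_sub]; rfl
      rw [e, enorm_Lp_sq, lintegral_weightedVolume]
      refine lintegral_congr_ae ?_
      filter_upwards [(aeEq_weightedVolume_iff (-s)).1 (coeFn_incl
        (weightedVolume_le_volume hs.le) (P w - w)), Lp.coeFn_sub (P w) w] with p a b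
      rw [a, b, Pi.sub_apply, enorm_sub_rev]
    have hwT : ‖w‖ₑ ≤ ‖T‖ₑ * ‖m‖ₑ := by
      rw [← ofReal_norm, ← ofReal_norm, ← ofReal_norm, ← ofReal_mul (norm_nonneg _)]
      exact ofReal_le_ofReal (T.le_opNorm m)
    have hsnd : Measurable fun p : Phase => ‖p.2‖ₑ := measurable_snd.enorm
    rw [h3]; refine (lintegral_mono_ae h2).trans ?_
    rw [lintegral_add_left (hPm.indicator hSm), lintegral_indicator hSm,
      lintegral_add_left (by fun_prop), lintegral_const_mul _ (by fun_prop),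
      lintegral_const_mul _ (by fun_prop), ← enorm_Lp_sq, add_mul, add_mul]
    refine add_le_add (h1.trans (le_of_eq (by ring))) (add_le_add ?_ ?_)
    · rw [mul_assoc, ← mul_pow]; gcongr
    · rw [mul_assoc]; gcongr; exact hv m
  choose P hP hPb using hstep
  have hbt : ∀ n, b n ≠ ⊤ := fun n => ENNReal.add_ne_top.2
    ⟨mul_ne_top cellC_ne_top (by simp), ENNReal.add_ne_top.2
      ⟨mul_ne_top ofReal_ne_top (by simp), mul_ne_top ofReal_ne_top hc⟩⟩
  have hb0 : Tendsto b atTop (𝓝 0) := by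
    have hR : Tendsto (fun n : ℕ => (n : ℝ) + 1) atTop atTop :=
      tendsto_atTop_add_const_right _ _ tendsto_natCast_atTop_atTop
    have t0 : ∀ {f : ℕ → ℝ}, Tendsto f atTop (𝓝 0) →
        Tendsto (fun n => ofReal (f n)) atTop (𝓝 0) := fun h => by
      simpa using ENNReal.tendsto_ofReal h
    have t1 := ((ENNReal.continuous_pow 2).tendsto 0).comp
      (t0 (tendsto_one_div_add_atTop_nhds_zero_nat (𝕜 := ℝ)))
    have t2 := t0 ((tendsto_rpow_neg_atTop (by linarith : 0 < 2 * s)).comp hR)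
    have t3 := t0 ((tendsto_rpow_neg_atTop (by norm_num : (0 : ℝ) < 2)).comp hR)
    rw [zero_pow two_ne_zero] at t1
    have := (ENNReal.Tendsto.const_mul t1 (Or.inr cellC_ne_top)).add
      ((ENNReal.Tendsto.mul_const t2 (Or.inr (by simp : ‖T‖ₑ ^ 2 ≠ ⊤))).add
        (ENNReal.Tendsto.mul_const t3 (Or.inr hc)))
    rw [mul_zero, zero_mul, zero_mul, add_zero, add_zero] at this; exact this
  refine isCompactOperator_of_tendsto (l := atTop) (F := fun n => J ∘L (P n ∘L T)) ?_
    (Eventually.of_forall fun n => ((hP n).comp_clm T).clm_comp J)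
  rw [tendsto_iff_norm_sub_tendsto_zero]
  have h0 : Tendsto (fun n => Real.sqrt (b n).toReal) atTop (𝓝 0) := by
    have := (Real.continuous_sqrt.tendsto _).comp
      ((ENNReal.tendsto_toReal (ENNReal.zero_ne_top)).comp hb0)
    rw [ENNReal.toReal_zero, Real.sqrt_zero] at this; exact this
  exact squeeze_zero (fun _ => norm_nonneg _)
    (fun n => opNorm_le_of_enorm_sq_le _ (hbt n) (hPb n)) h0

lemma WData.norm_tau_sub_le {w f0 : L2} {f1 f2 : Fin 3 → L2} (h : WData w f0 f1 f2) (y : Phase) :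
    ‖tau y w - w‖ ≤ (176 * (1 + cR) * ‖y‖ ^ (1 / 3 : ℝ) + 9 * cR * ‖y‖) * dataN w f0 f1 f2 := by
  have hcR := cR_pos.le
  have hN : 0 ≤ dataN w f0 f1 f2 := by unfold dataN; positivity
  have hadd : tau y w = tau (y.1, 0) (tau (0, y.2) w) := by
    refine Lp.ext ?_
    have h2 := (measurePreserving_sub_right (volume : Measure Phase)
      (y.1, 0)).quasiMeasurePreserving.ae_eq_comp (coeFn_tau (0, y.2) w)
    filter_upwards [coeFn_tau y w, coeFn_tau (y.1, 0) (tau (0, y.2) w), h2] with p a b c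
    rw [a, b]; refine Eq.trans ?_ c.symm
    simp only [Function.comp_apply]; congr 1; ext <;> simp
  have h1 := h.norm_tau_fst_sub_le y.1
  have h2 := h.norm_tau_snd_sub_le y.2
  have h3 : ‖y.1‖ ^ (1 / 3 : ℝ) ≤ ‖y‖ ^ (1 / 3 : ℝ) :=
    Real.rpow_le_rpow (norm_nonneg _) (norm_fst_le y) (by norm_num)
  calc ‖tau y w - w‖ = ‖tau (y.1, 0) (tau (0, y.2) w - w) + (tau (y.1, 0) w - w)‖ := by
        rw [hadd, map_sub]; congr 1; abel
    _ ≤ ‖tau (0, y.2) w - w‖ + ‖tau (y.1, 0) w - w‖ := by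
        refine (norm_add_le _ _).trans (le_of_eq ?_)
        rw [LinearIsometry.norm_map]
    _ ≤ 9 * cR * ‖y‖ * dataN w f0 f1 f2 + 176 * (1 + cR) * ‖y‖ ^ (1 / 3 : ℝ) * dataN w f0 f1 f2 := by
        refine add_le_add (h2.trans ?_) (h1.trans ?_)
        · gcongr; exact norm_snd_le y
        · gcongr
    _ = _ := by ring

/-- Weak solutions have a first moment in the velocity. -/
lemma WData.lintegral_moment_le {w f0 : L2} {f1 f2 : Fin 3 → L2} (h : WData w f0 f1 f2) :
    ∫⁻ p : Phase, ‖p.2‖ₑ ^ 2 * ‖w p‖ₑ ^ 2 ≤ 3 * ofReal (3 * cR * dataN w f0 f1 f2) ^ 2 := by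
  obtain ⟨a, c, ha, hc, -, hna, hnc⟩ := h.exists_energy
  have hcoord : ∀ j, ((a j + c j : L2) : Phase → ℂ) =ᵐ[volume] fun p => (p.2 j : ℂ) * w p := by
    intro j
    have hloc : LocallyIntegrable (fun p : Phase => (p.2 j : ℂ) * w p) :=
      ((Lp.memLp w).locallyIntegrable one_le_two).continuous_mul (by fun_prop)
    refine ae_eq_of_integral_contDiff_smul_eq ((Lp.memLp _).locallyIntegrable one_le_two) hloc ?_
    intro g hg hgc
    have hgt : IsTest fun p => (g p : ℂ) :=
      ⟨Complex.ofRealCLM.contDiff.comp hg, hgc.comp_left (g := fun x : ℝ => (x : ℂ)) (by simp)⟩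
    have h1 : bp (a j + c j) hgt.toS = bp w (qM j hgt.toS) := by
      rw [bp_add, ha, hc, ← map_add, add_comm, qA_add_qC]
    rw [bp_eq, bp_eq] at h1
    simp only [qM_apply, IsTest.toS_apply] at h1
    simp only [Complex.real_smul]
    rw [show (fun p : Phase => (g p : ℂ) * ((a j + c j : L2) : Phase → ℂ) p) =
      fun p => ((a j + c j : L2) : Phase → ℂ) p * (g p : ℂ) by ext; ring, h1]
    congr 1; ext p; ring
  have h1 : ∫⁻ p : Phase, ‖p.2‖ₑ ^ 2 * ‖w p‖ₑ ^ 2 = ∑ j, ‖a j + c j‖ₑ ^ 2 := by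
    have hm : ∀ j, Measurable fun p => ‖((a j + c j : L2) : Phase → ℂ) p‖ₑ ^ 2 :=
      fun j => (measurable_coe_L2 _).enorm.pow_const 2
    simp only [enorm_Lp_sq]
    rw [← lintegral_finsetSum _ fun j _ => hm j]
    refine lintegral_congr_ae ?_
    filter_upwards [ae_all_iff.2 hcoord] with p hp
    simp only [hp, enorm_mul, mul_pow, ← Finset.sum_mul]; congr 1
    rw [← ofReal_norm, ← ofReal_pow (norm_nonneg _), EuclideanSpace.real_norm_sq_eq,
      ENNReal.ofReal_sum_of_nonneg fun _ _ => sq_nonneg _]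
    refine sum_congr rfl fun j _ => ?_
    rw [← ofReal_norm, norm_real, ← ofReal_pow (norm_nonneg _), Real.norm_eq_abs, sq_abs]
  rw [h1]
  calc _ ≤ ∑ _j : Fin 3, ofReal (3 * cR * dataN w f0 f1 f2) ^ 2 := by
        refine sum_le_sum fun j _ => ?_
        rw [← ofReal_norm]; gcongr
        have := norm_add_le (a j) (c j)
        have := hna j
        have := hnc j
        linarith
    _ = _ := by simp

/-- Operators producing weak solutions with controlled data are compact into weighted spaces. -/
lemma isCompactOperator_of_wData {s : ℝ} (hs : 0 < s) (T : L2 →L[ℂ] L2) {C : ℝ} (hC : 0 ≤ C)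
    (h : ∀ m, ∃ f0 f1 f2, WData (T m) f0 f1 f2 ∧ dataN (T m) f0 f1 f2 ≤ C * ‖m‖) :
    IsCompactOperator (incl (weightedVolume_le_volume hs.le) ∘L T) := by
  have hcR := cR_pos.le
  refine isCompactOperator_incl_comp hs T (c := 3 * ofReal (3 * cR * C) ^ 2)
    (mul_ne_top (by simp) (by simp)) (fun η hη => ?_) fun m => ?_
  · have hcont : ContinuousAt (fun t : ℝ => (176 * (1 + cR) * t ^ (1 / 3 : ℝ) + 9 * cR * t) * C) 0 := by
      have : ContinuousAt (fun t : ℝ => t ^ (1 / 3 : ℝ)) 0 :=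
        Real.continuousAt_rpow_const 0 _ (Or.inr (by norm_num))
      fun_prop
    have hev := hcont.tendsto.eventually_lt_const (u := η) (by
      rw [Real.zero_rpow (by norm_num)]; simpa using hη)
    obtain ⟨r, hr, hball⟩ := Metric.eventually_nhds_iff.1 hev
    refine ⟨r / 2, by positivity, fun m y hy => ?_⟩
    obtain ⟨f0, f1, f2, hw, hN⟩ := h m
    have h1 := hball (y := ‖y‖) (by rw [dist_zero_right, norm_norm]; linarith)
    rw [← ofReal_norm, ← ofReal_norm, ← ofReal_mul hη.le]
    refine ofReal_le_ofReal ((hw.norm_tau_sub_le y).trans ?_)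
    calc _ ≤ (176 * (1 + cR) * ‖y‖ ^ (1 / 3 : ℝ) + 9 * cR * ‖y‖) * (C * ‖m‖) := by gcongr
      _ = ((176 * (1 + cR) * ‖y‖ ^ (1 / 3 : ℝ) + 9 * cR * ‖y‖) * C) * ‖m‖ := by ring
      _ ≤ _ := by gcongr
  · obtain ⟨f0, f1, f2, hw, hN⟩ := h m
    refine hw.lintegral_moment_le.trans ?_
    have h1 : ofReal (3 * cR * dataN (T m) f0 f1 f2) ≤ ofReal (3 * cR * C) * ‖m‖ₑ := by
      rw [← ofReal_norm, ← ofReal_mul (by positivity)]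
      refine ofReal_le_ofReal ?_
      rw [mul_assoc (3 * cR) C]; gcongr
    calc _ ≤ 3 * (ofReal (3 * cR * C) * ‖m‖ₑ) ^ 2 := by gcongr
      _ = _ := by ring

lemma isCompactOperator_Kz {s σ τ : ℝ} (hs : 0 < s) (hσ : 0 ≤ σ) (M : Fin 3 → L2w τ →L[ℂ] L2w σ)
    {z : ℂ} (hz : ‖z‖ ≤ dl) (hz' : z ∉ halfLine) : IsCompactOperator (Kz hs.le hσ M z) := by
  have hdata : ∀ (T : L2 →L[ℂ] L2), (∀ m, ∃ f1 f2, WData (T m) (z • T m) f1 f2 ∧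
      ∑ j, ‖f1 j‖ + ∑ j, ‖f2 j‖ = ‖m‖) → IsCompactOperator (wop (σ := σ) hs.le hσ T) := by
    intro T hT
    refine IsCompactOperator.comp_clm (isCompactOperator_of_wData hs T
      (C := ‖z‖ * ‖T‖ + 1 + ‖T‖) (by positivity) fun m => ?_) _
    obtain ⟨f1, f2, hw, hN⟩ := hT m
    refine ⟨_, f1, f2, hw, ?_⟩
    have h1 := T.le_opNorm m
    have h2 : ‖z‖ * ‖T m‖ ≤ ‖z‖ * (‖T‖ * ‖m‖) := by gcongr
    rw [dataN, norm_smul]; linarith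
  have hsingle : ∀ (F : Fin 3 → L2 →L[ℂ] L2) (j : Fin 3) (m : L2),
      ∑ i, F i ((Pi.single j m : Fin 3 → L2) i) = F j m ∧
      ∑ i, ‖(Pi.single j m : Fin 3 → L2) i‖ = ‖m‖ := by
    intro F j m; constructor <;> rw [Finset.sum_eq_single j] <;> simp +contextual
  have hA : ∀ j, IsCompactOperator (wop (σ := σ) hs.le hσ (RA z j)) := fun j => hdata _ fun m => by
    refine ⟨Pi.single j m, 0, ?_, by simp [(hsingle (RA z) j m).2]⟩
    simpa [(hsingle (RA z) j m).1] using wData_resolvent hz hz' (Pi.single j m) 0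
  have hC : ∀ j, IsCompactOperator (wop (σ := σ) hs.le hσ (RC z j)) := fun j => hdata _ fun m => by
    refine ⟨0, Pi.single j m, ?_, by simp [(hsingle (RC z) j m).2]⟩
    simpa [(hsingle (RC z) j m).1] using wData_resolvent hz hz' 0 (Pi.single j m)
  rw [Kz, FunLike.coe_sum]
  refine Finset.sum_induction _ (fun g : L2w τ → L2w (-s) => IsCompactOperator g)
    (fun _ _ h1 h2 => h1.add h2) isCompactOperator_zero fun j _ => ?_
  exact (((hC j).sub (hA j)).comp_clm (M j)).smul (1 / 2 : ℂ)

/-! ### Gauge covariance of the energy identity -/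

lemma wt_zero_mul_sq_le (g : E3 →ᵇ ℝ) (x : E3) : wt 0 x * ‖g x‖ₑ ^ 2 ≤ ofReal ‖g‖ ^ 2 * wt 0 x := by
  rw [mul_comm]; gcongr
  rw [← ofReal_norm]
  exact ofReal_le_ofReal (g.norm_coe_le_norm x)

/-- Multiplication on `L²` by a bounded continuous function of the position. -/
def mulL (g : E3 →ᵇ ℝ) : L2 →L[ℂ] L2 :=
  incl weightedVolume_zero.ge ∘L mulW g.continuous (norm_nonneg g) (wt_zero_mul_sq_le g) ∘L
    incl weightedVolume_zero.le

lemma coeFn_mulL (g : E3 →ᵇ ℝ) (f : L2) : ⇑(mulL g f) =ᵐ[volume] fun p => (g p.1 : ℂ) * f p := by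
  refine (coeFn_incl weightedVolume_zero.ge _).trans
    ((coeFn_mulW g.continuous (norm_nonneg g) (wt_zero_mul_sq_le g) _).trans ?_)
  filter_upwards [(aeEq_weightedVolume_iff 0).1 (coeFn_incl weightedVolume_zero.le f)] with p hp
  exact congrArg _ hp

lemma norm_mulL_le (g : E3 →ᵇ ℝ) {c : ℝ} (hc : ∀ x, |g x| ≤ c) (f : L2) : ‖mulL g f‖ ≤ c * ‖f‖ := by
  refine Lp.norm_le_mul_norm_of_ae_le_mul ?_
  filter_upwards [coeFn_mulL g f] with p hp
  rw [hp, norm_mul, norm_real]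
  exact mul_le_mul_of_nonneg_right (hc _) (norm_nonneg _)

lemma bp_mulL (g : E3 →ᵇ ℝ) (f : L2) (Φ : S6) :
    bp (mulL g f) Φ = ∫ p, (g p.1 : ℂ) * (f p * Φ p) := by
  rw [bp_eq]; refine integral_congr_ae ?_
  filter_upwards [coeFn_mulL g f] with p hp
  rw [hp, mul_assoc]

lemma mulL_add (g g' : E3 →ᵇ ℝ) (f : L2) : mulL (g + g') f = mulL g f + mulL g' f := by
  refine Lp.ext ?_
  filter_upwards [coeFn_mulL g f, coeFn_mulL g' f, coeFn_mulL (g + g') f,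
    Lp.coeFn_add (mulL g f) (mulL g' f)] with p h1 h2 h3 h4
  rw [h4, Pi.add_apply, h1, h2, h3]; simp [add_mul]

/-- Complex conjugation of Schwartz functions on the phase space. -/
def conjP (Φ : S6) : S6 := SchwartzMap.postcompCLM (𝕜 := ℝ) (Complex.conjCLE : ℂ →L[ℝ] ℂ) Φ

lemma conjP_apply (Φ : S6) (p : Phase) : conjP Φ p = conj (Φ p) := by simp [conjP]

lemma qC_conjP (j : Fin 3) (Φ : S6) : qC j (conjP Φ) = conjP (qC j Φ) := by
  ext p; rw [qC_apply, conjP_apply, conjP_apply, qC_apply]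
  have : (conjP Φ : Phase → ℂ) = (Complex.conjCLE : ℂ →L[ℝ] ℂ) ∘ Φ := by ext; simp [conjP_apply]
  rw [this, ((Complex.conjCLE : ℂ →L[ℝ] ℂ).hasFDerivAt.comp p (Φ.hasFDerivAt p)).fderiv]
  simp [map_ofNat conj 2]

lemma integral_mul_qC (g : E3 →ᵇ ℝ) (j : Fin 3) (Ψ Φ : S6) :
    ∫ p : Phase, (g p.1 : ℂ) * (Ψ p * qC j Φ p) = ∫ p : Phase, (g p.1 : ℂ) * (qA j Ψ p * Φ p) := by
  have hi : ∀ Ψ Φ : S6, Integrable fun p : Phase => (g p.1 : ℂ) * (Ψ p * Φ p) :=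
    fun Ψ Φ => (integrable_schwartz_mul Ψ Φ).bdd_mul (c := ‖g‖)
      (by fun_prop : Continuous fun p : Phase => (g p.1 : ℂ)).aestronglyMeasurable
      (ae_of_all _ fun p => by simpa using g.norm_coe_le_norm p.1)
  have h := integral_mul_qD g.continuous g.norm_coe_le_norm j Ψ Φ
  have e1 : ∀ p : Phase, (g p.1 : ℂ) * (Ψ p * qC j Φ p) =
      (g p.1 : ℂ) * (Ψ p * ((1 / 2 : ℂ) • qM j Φ) p) - (g p.1 : ℂ) * (Ψ p * qD j Φ p) := by
    intro p; simp [qC]; ring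
  have e2 : ∀ p : Phase, (g p.1 : ℂ) * (qA j Ψ p * Φ p) =
      (g p.1 : ℂ) * (Ψ p * ((1 / 2 : ℂ) • qM j Φ) p) + (g p.1 : ℂ) * (qD j Ψ p * Φ p) := by
    intro p; simp [qA]; ring
  simp only [e1, e2]
  rw [integral_sub (hi _ _) (hi _ _), integral_add (hi _ _) (hi _ _), h, sub_neg_eq_add]

lemma bp_mulL_toL_qC (g : E3 →ᵇ ℝ) (j : Fin 3) (Ψ Φ : S6) :
    bp (mulL g (toL Ψ)) (qC j Φ) = bp (mulL g (toL (qA j Ψ))) Φ := by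
  rw [bp_mulL, bp_mulL]
  trans ∫ p : Phase, (g p.1 : ℂ) * (Ψ p * qC j Φ p)
  · refine integral_congr_ae ?_
    filter_upwards [coeFn_toL Ψ] with p hp
    rw [hp]
  · rw [integral_mul_qC]
    refine integral_congr_ae ?_
    filter_upwards [coeFn_toL (qA j Ψ)] with p hp
    rw [hp]

lemma inner_qC_mulL (g : E3 →ᵇ ℝ) (j : Fin 3) (Ψ : S6) :
    inner ℂ (toL (qC j Ψ)) (mulL g (toL Ψ)) = inner ℂ (mulL g (toL Ψ)) (toL (qA j Ψ)) := by
  rw [L2.inner_def, L2.inner_def]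
  trans ∫ p : Phase, (g p.1 : ℂ) * (Ψ p * qC j (conjP Ψ) p)
  · refine integral_congr_ae ?_
    filter_upwards [coeFn_toL (qC j Ψ), coeFn_toL Ψ, coeFn_mulL g (toL Ψ)] with p h1 h2 h3
    rw [h1, h3, h2, qC_conjP, conjP_apply, RCLike.inner_apply]; ring
  · rw [integral_mul_qC]
    refine integral_congr_ae ?_
    filter_upwards [coeFn_toL (qA j Ψ), coeFn_toL Ψ, coeFn_mulL g (toL Ψ)] with p h1 h2 h3
    rw [h1, h3, h2, conjP_apply, RCLike.inner_apply, map_mul, conj_ofReal]; ring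

/-- Lower order terms given by real multiplications enter the energy identity only through the sum
`g₁ + g₂`: the antisymmetric part, in which a potential appears, drops out. -/
lemma WData.exists_annihilated {w : L2} {g1 g2 : Fin 3 → E3 →ᵇ ℝ} {t : ℝ}
    (h : WData w 0 (fun j => mulL (g1 j) w) (fun j => mulL (g2 j) w))
    (ht : ∀ j x, |(g1 j + g2 j) x| ≤ 2 * t) :
    ∃ a : Fin 3 → L2, (∀ j g Φ, bp (mulL g w) (qC j Φ) = bp (mulL g (a j)) Φ) ∧
      ∀ j, ‖a j‖ ≤ 3 * (t * ‖w‖) := by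
  have uniq : ∀ {f f' : L2}, (∀ Φ, bp f Φ = bp f' Φ) → f = f' := fun {f f'} hf =>
    sub_eq_zero.1 (eq_zero_of_bp_qR fun F => by rw [bp_sub, hf, sub_self])
  obtain ⟨U, F0, F1, F2, a, c, hdP, hU, h0, h1, h2, ha, hc⟩ := h.exists_approx
  obtain ⟨a', c', ha', hc', hE, -⟩ := h.exists_energy
  have haa : a = a' := funext fun j => uniq fun Φ => by
    rw [ha']; refine tendsto_nhds_unique (((bpL Φ).continuous.tendsto _).comp (ha j)) ?_
    refine Tendsto.congr (fun n => ?_) (((bpL (qC j Φ)).continuous.tendsto _).comp hU)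
    simp only [Function.comp_apply, bpL_apply, lv_apply, phys_dA, bp_qC]
  have hcc : c = c' := funext fun j => uniq fun Φ => by
    rw [hc']; refine tendsto_nhds_unique (((bpL Φ).continuous.tendsto _).comp (hc j)) ?_
    refine Tendsto.congr (fun n => ?_) (((bpL (qA j Φ)).continuous.tendsto _).comp hU)
    simp only [Function.comp_apply, bpL_apply, lv_apply, phys_dC, bp_qA]
  subst haa hcc
  have hm : ∀ g, Tendsto (fun n => mulL g (lv (U n))) atTop (𝓝 (mulL g w)) :=
    fun g => ((mulL g).continuous.tendsto _).comp hU
  have hgc : ∀ j g, inner ℂ (c j) (mulL g w) = inner ℂ (mulL g w) (a j) := fun j g => by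
    refine tendsto_nhds_unique ((hc j).inner (hm g)) (((hm g).inner (ha j)).congr fun n => ?_)
    rw [lv_apply, lv_apply, lv_apply, phys_dA, phys_dC, inner_qC_mulL]
  refine ⟨a, fun j g Φ => ?_, fun j => ?_⟩
  · refine tendsto_nhds_unique (((bpL _).continuous.tendsto _).comp (hm g)) ?_
    refine Tendsto.congr (fun n => ?_)
      (((bpL Φ).continuous.tendsto _).comp (((mulL g).continuous.tendsto _).comp (ha j)))
    simp only [Function.comp_apply, bpL_apply, lv_apply, phys_dA, bp_mulL_toL_qC]
  · have e : ∀ j, (inner ℂ (c j) (mulL (g1 j) w) + inner ℂ (a j) (mulL (g2 j) w) : ℂ).re ≤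
        ‖a j‖ * (2 * t * ‖w‖) := fun j => by
      rw [hgc, Complex.add_re, ← inner_conj_symm, Complex.conj_re, ← Complex.add_re,
        ← inner_add_right, ← mulL_add]
      refine (Complex.re_le_norm _).trans ((norm_inner_le_norm _ _).trans ?_); gcongr
      exact norm_mulL_le _ (ht j) _
    have h3 : ∑ j, ‖a j‖ ^ 2 ≤ ∑ j, ‖a j‖ * (2 * t * ‖w‖) := by
      rw [hE, inner_zero_right, zero_add, ← sum_add_distrib, Complex.re_sum]
      exact sum_le_sum fun j _ => e j
    -- completing the squares
    have h4 : ∑ j, (‖a j‖ - t * ‖w‖) ^ 2 ≤ 3 * (t * ‖w‖) ^ 2 := by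
      have : ∑ j, (‖a j‖ - t * ‖w‖) ^ 2 = ∑ j, ‖a j‖ ^ 2 - ∑ j, ‖a j‖ * (2 * t * ‖w‖) +
          3 * (t * ‖w‖) ^ 2 := by simp only [Fin.sum_univ_three]; ring
      linarith
    have h5 := (Finset.single_le_sum (f := fun j => (‖a j‖ - t * ‖w‖) ^ 2)
      (fun _ _ => sq_nonneg _) (Finset.mem_univ j)).trans h4
    have htn : 0 ≤ t := by linarith [(abs_nonneg _).trans (ht 0 0)]
    have h6 : 0 ≤ t * ‖w‖ := by positivity
    have := abs_le_of_sq_le_sq (a := ‖a j‖ - t * ‖w‖) (b := 2 * (t * ‖w‖)) (by nlinarith) (by positivity)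
    linarith [le_of_abs_le this]

/-! ### First order equations for zero energy solutions -/

/-- The cutoff `(1 + t²|x|²)^{-1/2}`. -/
def chi (t : ℝ) (x : E3) : ℝ := bracket (t • x) ^ (-1 : ℝ)

lemma chi_eq (t : ℝ) (x : E3) : chi t x = (1 + ‖t • x‖ ^ 2) ^ (-1 / 2 : ℝ) := bracket_rpow _ _

lemma chi_nonneg (t : ℝ) (x : E3) : 0 ≤ chi t x := Real.rpow_nonneg (bracket_pos _).le _

lemma chi_le_one (t : ℝ) (x : E3) : chi t x ≤ 1 :=
  Real.rpow_le_one_of_one_le_of_nonpos (one_le_bracket _) (by norm_num)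

lemma continuous_chi (t : ℝ) : Continuous (chi t) :=
  (continuous_bracket_rpow (-1)).comp (continuous_const_smul t)

lemma hasTemperateGrowth_chi (t : ℝ) : (fun p : Phase => (chi t p.1 : ℂ)).HasTemperateGrowth := by
  have h1 := (t • ContinuousLinearMap.fst ℝ E3 E3).hasTemperateGrowth
  have h2 := (Function.hasTemperateGrowth_one_add_norm_sq_rpow E3 (-1 / 2)).comp h1
  convert Complex.ofRealCLM.hasTemperateGrowth.comp h2 using 2 with p
  simp [chi_eq]

/-- The logarithmic derivative `∂_j χ / χ` of the cutoff. -/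
def bt (t : ℝ) (j : Fin 3) (x : E3) : ℝ := -(t ^ 2 * x j) / (1 + ‖t • x‖ ^ 2)

lemma continuous_bt (t : ℝ) (j : Fin 3) : Continuous (bt t j) := by
  unfold bt; refine Continuous.div (by fun_prop) (by fun_prop) fun x => by positivity

lemma abs_bt_le {t : ℝ} (ht : 0 ≤ t) (j : Fin 3) (x : E3) : |bt t j x| ≤ t := by
  rw [bt, abs_div, abs_neg, abs_mul, abs_of_pos (a := 1 + _) (by positivity),
    div_le_iff₀ (by positivity), abs_of_nonneg (sq_nonneg t), norm_smul, Real.norm_of_nonneg ht]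
  have h1 : |x j| ≤ ‖x‖ := by simpa using norm_coord_le x j
  nlinarith [mul_le_mul_of_nonneg_left h1 (sq_nonneg t), mul_nonneg ht (sq_nonneg (t * ‖x‖ - 1)),
    mul_nonneg ht (sq_nonneg (t * ‖x‖))]

lemma hasFDerivAt_chi (t : ℝ) (x : E3) : ∃ L : E3 →L[ℝ] ℝ, HasFDerivAt (chi t) L x ∧
    ∀ j, L (eb j) = bt t j x * chi t x := by
  have h1 : HasFDerivAt (fun y : E3 => t • y) (t • ContinuousLinearMap.id ℝ E3) x :=
    (hasFDerivAt_id x).const_smul t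
  have h2 := ((h1.norm_sq).const_add 1).rpow_const (p := -1 / 2) (Or.inl (by positivity))
  refine ⟨_, h2.congr_of_eventuallyEq (Eventually.of_forall fun y => chi_eq t y), fun j => ?_⟩
  have e : inner ℝ x (eb j) = x j := by simp [eb, EuclideanSpace.inner_single_right]
  rw [Real.rpow_sub_one (by positivity), ← chi_eq, bt]
  simp [e]; field_simp

/-- Multiplication of Schwartz functions by the cutoff. -/
def qK (t : ℝ) : S6 →L[ℂ] S6 := SchwartzMap.smulLeftCLM ℂ (fun p : Phase => (chi t p.1 : ℂ))

lemma qK_apply (t : ℝ) (Φ : S6) (p : Phase) : qK t Φ p = (chi t p.1 : ℂ) * Φ p :=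
  SchwartzMap.smulLeftCLM_apply_apply (hasTemperateGrowth_chi t) Φ p

lemma fderiv_qK (t : ℝ) (Φ : S6) (p : Phase) (j : Fin 3) :
    fderiv ℝ (qK t Φ) p (0, eb j) = chi t p.1 * fderiv ℝ Φ p (0, eb j) ∧
    fderiv ℝ (qK t Φ) p (eb j, 0) =
      chi t p.1 * fderiv ℝ Φ p (eb j, 0) + bt t j p.1 * chi t p.1 * Φ p := by
  obtain ⟨L, hL, hLe⟩ := hasFDerivAt_chi t p.1
  have h1 : HasFDerivAt (fun q : Phase => (chi t q.1 : ℂ))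
      (Complex.ofRealCLM.comp (L.comp (ContinuousLinearMap.fst ℝ E3 E3))) p :=
    (Complex.ofRealCLM.hasFDerivAt).comp p (hL.comp p hasFDerivAt_fst)
  have h2 : (qK t Φ : Phase → ℂ) = (fun q : Phase => (chi t q.1 : ℂ)) * ⇑Φ :=
    funext fun q => qK_apply t Φ q
  rw [h2, (h1.mul (Φ.hasFDerivAt p)).fderiv]
  simp [hLe, mul_comm]

lemma qA_qK (t : ℝ) (j : Fin 3) (Φ : S6) : qA j (qK t Φ) = qK t (qA j Φ) := by
  ext p; rw [qA_apply, (fderiv_qK t Φ p j).1, qK_apply, qK_apply, qA_apply]; ring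

lemma qC_qK (t : ℝ) (j : Fin 3) (Φ : S6) : qC j (qK t Φ) = qK t (qC j Φ) := by
  ext p; rw [qC_apply, (fderiv_qK t Φ p j).1, qK_apply, qK_apply, qC_apply]; ring

lemma qPt_apply (Φ : S6) (p : Phase) :
    qPt Φ p = ∑ j, (qC j (qA j Φ) p - (p.2 j : ℂ) * qX j Φ p) := by
  simp [qPt]

/-- The position space cutoff commutes with the operator up to lower order terms. -/
lemma qPt_qK_add (t : ℝ) (F : Fin 3 → E3 →ᵇ ℝ) (Φ : S6) (p : Phase) :
    qPt (qK t Φ) p + ∑ j, (F j p.1 : ℂ) * qD j (qK t Φ) p = chi t p.1 * (qPt Φ p -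
      ∑ j, (((bt t j p.1 + F j p.1 / 2 : ℝ) : ℂ) * qC j Φ p +
        ((bt t j p.1 - F j p.1 / 2 : ℝ) : ℂ) * qA j Φ p)) := by
  rw [qPt_apply, qPt_apply, ← sum_add_distrib, ← Finset.sum_sub_distrib, mul_sum]
  refine sum_congr rfl fun j _ => ?_
  rw [qA_qK, qC_qK, qK_apply, qX_apply, qD_apply, (fderiv_qK t Φ p j).1, (fderiv_qK t Φ p j).2,
    ← qX_apply, qC_apply j Φ, qA_apply j Φ]
  push_cast; ring

/-- The function `∂_j χ / χ` as a bounded continuous function. -/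
def btB (t : ℝ) (ht : 0 ≤ t) (j : Fin 3) : E3 →ᵇ ℝ :=
  BoundedContinuousFunction.ofNormedAddCommGroup (bt t j) (continuous_bt t j) t (abs_bt_le ht j)

lemma wData_cutoff {u : Phase → ℂ} {F : Fin 3 → E3 →ᵇ ℝ} (hu : ∀ Φ : S6, HasCompactSupport Φ →
      ∫ p, u p * (qPt Φ p + ∑ j, (F j p.1 : ℂ) * qD j Φ p) = 0)
    {t : ℝ} (ht : 0 ≤ t) {w : L2} (hw : ⇑w =ᵐ[volume] fun p => (chi t p.1 : ℂ) * u p) :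
    WData w 0 (fun j => mulL (btB t ht j + (1 / 2 : ℝ) • F j) w)
      (fun j => mulL (btB t ht j - (1 / 2 : ℝ) • F j) w) := by
  refine wData_of_test fun Φ hΦ => ?_
  have h0 := hu (qK t Φ) (by
    rw [show (qK t Φ : Phase → ℂ) = (fun q : Phase => (chi t q.1 : ℂ)) * ⇑Φ from
      funext fun q => qK_apply t Φ q]
    exact hΦ.mul_left)
  have hi := fun (w : L2) (Ψ : S6) => integrable_mul_schwartz w Ψ
  rw [bp_zero, zero_add]
  simp only [bp_eq]
  rw [← sum_add_distrib]
  simp only [← integral_add (hi _ _) (hi _ _)]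
  rw [← integral_finsetSum _ fun j _ => (hi _ _).fun_add (hi _ _), ← sub_eq_zero,
    ← integral_sub (hi _ _) (integrable_finsetSum _ fun j _ => (hi _ _).fun_add (hi _ _)), ← h0]
  refine integral_congr_ae ?_
  have h1 := ae_all_iff.2 fun j => coeFn_mulL (btB t ht j + (1 / 2 : ℝ) • F j) w
  have h2 := ae_all_iff.2 fun j => coeFn_mulL (btB t ht j - (1 / 2 : ℝ) • F j) w
  filter_upwards [hw, h1, h2] with p h3 h4 h5
  simp only [h4, h5, qPt_qK_add, mul_sub, mul_sum]; rw [h3]; congr 1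
  · ring
  · refine sum_congr rfl fun j _ => ?_
    have e : btB t ht j p.1 = bt t j p.1 := rfl
    simp only [BoundedContinuousFunction.coe_add, BoundedContinuousFunction.coe_sub, Pi.add_apply,
      Pi.sub_apply, BoundedContinuousFunction.coe_smul, smul_eq_mul, e]
    push_cast; ring

lemma wt_zero_mul_chi_sq_le {s t : ℝ} (hs0 : 0 ≤ s) (hs : s ≤ 1) (ht : 0 < t) (ht1 : t ≤ 1)
    (x : E3) : wt 0 x * ‖chi t x‖ₑ ^ 2 ≤ ofReal (t ^ (-s)) ^ 2 * wt (-s) x := by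
  have hb := bracket_pos x
  have hle : t * bracket x ≤ bracket (t • x) := by
    rw [bracket, bracket, norm_smul, Real.norm_of_nonneg ht.le, mul_pow,
      ← Real.sqrt_sq ht.le, ← Real.sqrt_mul (sq_nonneg t), Real.sqrt_sq ht.le]
    exact Real.sqrt_le_sqrt (by nlinarith [sq_nonneg ‖x‖])
  have h1 : chi t x ≤ t ^ (-s) * bracket x ^ (-s) := by
    rw [← Real.mul_rpow ht.le hb.le]
    exact (Real.rpow_le_rpow_of_exponent_le (one_le_bracket _) (by linarith)).trans
      (Real.rpow_le_rpow_of_nonpos (by positivity) hle (by linarith))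
  rw [wt_zero, one_mul, ← ofReal_norm, Real.norm_of_nonneg (chi_nonneg t x), wt,
    ← ofReal_pow (chi_nonneg t x), ← ofReal_pow (by positivity),
    ← ofReal_mul (by positivity)]
  refine ofReal_le_ofReal ((pow_le_pow_left₀ (chi_nonneg t x) h1 2).trans (le_of_eq ?_))
  rw [mul_pow, ← Real.rpow_natCast (bracket x ^ (-s)), ← Real.rpow_mul hb.le]
  congr 2; push_cast; ring

section

variable {u : Phase → ℂ} {F : Fin 3 → E3 →ᵇ ℝ} {s : ℝ}

lemma norm_integral_cutoff_le (hs0 : 0 ≤ s) (hs : s ≤ 1) (hu : MemLp u 2 (weightedVolume (-s)))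
    (hP : ∀ Φ : S6, HasCompactSupport Φ → ∫ p, u p * (qPt Φ p + ∑ j, (F j p.1 : ℂ) * qD j Φ p) = 0)
    (g : E3 →ᵇ ℝ) (j : Fin 3) (Φ : S6) {t : ℝ} (ht : 0 < t) (ht1 : t ≤ 1) :
    ‖∫ p, (chi t p.1 : ℂ) * ((g p.1 : ℂ) * (u p * qC j Φ p))‖ ≤
      ‖bpL Φ‖ * (‖g‖ * (3 * (t ^ (1 - s) * (eLpNorm u 2 (weightedVolume (-s))).toReal))) := by
  have hwt := wt_zero_mul_chi_sq_le hs0 hs ht ht1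
  have hm := memLp_mul (continuous_chi t) hwt hu
  have hle := eLpNorm_mul_le hwt u
  rw [weightedVolume_zero] at hm hle
  have hw := hm.coeFn_toLp
  obtain ⟨a, ha, hna⟩ := (wData_cutoff hP ht.le hw).exists_annihilated (t := t) fun j x => by
    have e : (btB t ht.le j + (1 / 2 : ℝ) • F j + (btB t ht.le j - (1 / 2 : ℝ) • F j)) x =
        2 * bt t j x := by
      have e : btB t ht.le j x = bt t j x := rfl
      simp only [BoundedContinuousFunction.coe_add, BoundedContinuousFunction.coe_sub, Pi.add_apply,
        Pi.sub_apply, BoundedContinuousFunction.coe_smul, e]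
      ring
    rw [e, abs_mul, abs_two]
    have := abs_bt_le ht.le j x
    gcongr
  have hN : ‖hm.toLp‖ ≤ t ^ (-s) * (eLpNorm u 2 (weightedVolume (-s))).toReal := by
    rw [Lp.norm_toLp, ← ENNReal.toReal_ofReal (by positivity : 0 ≤ t ^ (-s)), ← ENNReal.toReal_mul]
    exact ENNReal.toReal_mono (mul_ne_top ofReal_ne_top hu.2.ne) hle
  have e1 : ∫ p, (chi t p.1 : ℂ) * ((g p.1 : ℂ) * (u p * qC j Φ p)) = bpL Φ (mulL g (a j)) := by
    rw [bpL_apply, ← ha, bp_mulL]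
    refine integral_congr_ae ?_
    filter_upwards [hw] with p hp
    rw [hp]; ring
  rw [e1]; refine (ContinuousLinearMap.le_opNorm _ _).trans ?_; gcongr
  refine (norm_mulL_le g g.norm_coe_le_norm _).trans ?_; gcongr
  refine (hna j).trans ?_
  rw [sub_eq_add_neg, Real.rpow_add ht, Real.rpow_one, mul_assoc]; gcongr

lemma integrable_mul_mul_schwartz (hu : MemLp u 2 (weightedVolume (-s))) (g : E3 →ᵇ ℝ)
    (Φ : S6) : Integrable fun p => (g p.1 : ℂ) * (u p * Φ p) :=
  (integrable_mul_schwartz_weighted s hu Φ).bdd_mul (c := ‖g‖)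
    (by fun_prop : Continuous fun p : Phase => (g p.1 : ℂ)).aestronglyMeasurable
    (ae_of_all _ fun p => by simpa using g.norm_coe_le_norm p.1)

/-- Zero energy solutions are annihilated by `∂_{v_j} + v_j / 2`. The energy of the cut-off solution
is of order `t^{1-s}`, hence vanishes in the limit. -/
lemma integral_mul_qC_eq_zero (hs0 : 0 ≤ s) (hs : s < 1) (hu : MemLp u 2 (weightedVolume (-s)))
    (hP : ∀ Φ : S6, HasCompactSupport Φ → ∫ p, u p * (qPt Φ p + ∑ j, (F j p.1 : ℂ) * qD j Φ p) = 0)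
    (g : E3 →ᵇ ℝ) (j : Fin 3) (Φ : S6) :
    ∫ p, (g p.1 : ℂ) * (u p * qC j Φ p) = 0 := by
  have hi := integrable_mul_mul_schwartz hu g (qC j Φ)
  have ht : Tendsto (fun n : ℕ => 1 / ((n : ℝ) + 1)) atTop (𝓝 0) :=
    tendsto_one_div_add_atTop_nhds_zero_nat
  have h1 : Tendsto (fun n : ℕ => ∫ p, (chi (1 / ((n : ℝ) + 1)) p.1 : ℂ) *
      ((g p.1 : ℂ) * (u p * qC j Φ p))) atTop (𝓝 (∫ p, (g p.1 : ℂ) * (u p * qC j Φ p))) := by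
    refine tendsto_integral_of_dominated_convergence _ (fun n => ?_) hi.norm (fun n => ?_) ?_
    · have hc := continuous_chi (1 / ((n : ℝ) + 1))
      exact (by fun_prop : Continuous fun p : Phase =>
        (chi (1 / ((n : ℝ) + 1)) p.1 : ℂ)).aestronglyMeasurable.mul hi.1
    · refine ae_of_all _ fun p => ?_
      rw [norm_mul, norm_real, Real.norm_of_nonneg (chi_nonneg _ _)]
      exact mul_le_of_le_one_left (norm_nonneg _) (chi_le_one _ _)
    · refine ae_of_all _ fun p => ?_
      have hc : Continuous fun t : ℝ => (chi t p.1 : ℂ) := Complex.continuous_ofReal.comp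
        ((continuous_bracket_rpow (-1)).comp (continuous_id.smul continuous_const))
      have h2 := ((hc.tendsto 0).comp ht).mul_const ((g p.1 : ℂ) * (u p * qC j Φ p))
      simpa [chi, bracket] using h2
  have h2 : Tendsto (fun n : ℕ => ‖bpL Φ‖ * (‖g‖ * (3 * ((1 / ((n : ℝ) + 1)) ^ (1 - s) *
      (eLpNorm u 2 (weightedVolume (-s))).toReal)))) atTop (𝓝 0) := by
    have h3 := ht.rpow_const (p := 1 - s) (Or.inr (by linarith))
    rw [Real.zero_rpow (by linarith)] at h3
    simpa using (((h3.mul_const _).const_mul 3).const_mul ‖g‖).const_mul ‖bpL Φ‖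
  refine norm_eq_zero.1 (le_antisymm (le_of_tendsto_of_tendsto' h1.norm h2 fun n => ?_)
    (norm_nonneg _))
  exact norm_integral_cutoff_le hs0 hs.le hu hP g j Φ (by positivity)
    ((div_le_one (by positivity)).2 (by linarith [n.cast_nonneg (α := ℝ)]))

end

lemma lineDeriv_comm (a b : Phase) (Φ : S6) : ∂_{a} (∂_{b} Φ) = ∂_{b} (∂_{a} Φ) := by
  ext p
  have h : ∀ a b : Phase, (∂_{a} (∂_{b} Φ) : S6) p = fderiv ℝ (fderiv ℝ Φ) p a b := by
    intro a b
    have h3 : ((∂_{b} Φ : S6) : Phase → ℂ) = fun q => fderiv ℝ Φ q b := by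
      ext; rw [SchwartzMap.lineDerivOp_apply_eq_fderiv]
    have hd : DifferentiableAt ℝ (fderiv ℝ Φ) p :=
      ((Φ.smooth 2).fderiv_right (m := 1) (by norm_num)).differentiable (by norm_num) p
    rw [SchwartzMap.lineDerivOp_apply_eq_fderiv, h3, fderiv_clm_apply hd (by fun_prop)]
    simp
  rw [h, h]; exact ((Φ.smooth 2).contDiffAt.isSymmSndFDerivAt (by simp)).eq _ _

lemma lineDeriv_qM (a : Phase) (k : Fin 3) (Φ : S6) :
    ∂_{a} (qM k Φ) = qM k (∂_{a} Φ) + (a.2 k : ℂ) • Φ := by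
  ext p
  have h : HasFDerivAt (fun q : Phase => ((q.2 k : ℝ) : ℂ)) (Complex.ofRealCLM.comp ((pj k).comp
        (ContinuousLinearMap.snd ℝ E3 E3))) p :=
    (Complex.ofRealCLM.comp ((pj k).comp (ContinuousLinearMap.snd ℝ E3 E3))).hasFDerivAt
  have h2 : (qM k Φ : Phase → ℂ) = (fun q : Phase => ((q.2 k : ℝ) : ℂ)) * ⇑Φ :=
    funext fun q => qM_apply k Φ q
  rw [SchwartzMap.lineDerivOp_apply_eq_fderiv, h2, (h.mul (Φ.hasFDerivAt p)).fderiv]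
  simp [SchwartzMap.lineDerivOp_apply_eq_fderiv, mul_comm]

lemma qX_qC (j k : Fin 3) (Φ : S6) : qX j (qC k Φ) = qC k (qX j Φ) := by
  have h1 : qX j (qD k Φ) = qD k (qX j Φ) := lineDeriv_comm _ _ _
  have h2 : qX j (qM k Φ) = qM k (qX j Φ) := (lineDeriv_qM (eb j, 0) k Φ).trans (by simp; rfl)
  simp [qC, h1, h2]

lemma qD_qM (j k : Fin 3) (Φ : S6) :
    qD j (qM k Φ) = qM k (qD j Φ) + (eb j k : ℂ) • Φ := lineDeriv_qM (0, eb j) k Φ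

lemma qD_qC (j k : Fin 3) (Φ : S6) : qD j (qC k Φ) = qC k (qD j Φ) + ((eb j k : ℂ) / 2) • Φ := by
  have h1 : qD j (qD k Φ) = qD k (qD j Φ) := lineDeriv_comm _ _ _
  have h2 := qD_qM j k Φ
  generalize (eb j k : ℂ) = c at *
  ext p; simp [qC, h1, h2]; ring

lemma qM_qC (j k : Fin 3) (Φ : S6) : qM j (qC k Φ) = qC k (qM j Φ) + (eb k j : ℂ) • Φ := by
  have h2 := qD_qM k j Φ
  generalize (eb k j : ℂ) = c at *
  ext p; simp [qC, h2]; ring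

/-- The commutators of the transposed operator with `-∂_{v_k} + v_k / 2`. -/
lemma qPt_qC_add (F : Fin 3 → E3 →ᵇ ℝ) (k : Fin 3) (Φ : S6) (p : Phase) :
    qPt (qC k Φ) p + ∑ j, (F j p.1 : ℂ) * qD j (qC k Φ) p =
      ∑ j, (qC j (qA j (qC k Φ)) p - qC k (qM j (qX j Φ)) p + F j p.1 * qC k (qD j Φ) p) -
        (qX k Φ p - F k p.1 / 2 * Φ p) := by
  have e : qX k Φ p - F k p.1 / 2 * Φ p =
      ∑ j, ((eb k j : ℂ) * qX j Φ p - F j p.1 * ((eb j k : ℂ) / 2 * Φ p)) := by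
    fin_cases k <;> simp [Fin.sum_univ_three, eb] <;> ring
  rw [qPt_apply, ← sum_add_distrib, e, ← Finset.sum_sub_distrib]
  refine sum_congr rfl fun j _ => ?_
  rw [qX_qC, ← qM_apply, qM_qC, qD_qC]
  simp only [add_apply, smul_apply, smul_eq_mul]; ring

section

variable {u : Phase → ℂ} {F : Fin 3 → E3 →ᵇ ℝ} {s : ℝ}

/-- The velocity derivatives of a zero energy solution. -/
lemma integral_mul_qD_eq (hs0 : 0 ≤ s) (hs : s < 1) (hu : MemLp u 2 (weightedVolume (-s)))
    (hP : ∀ Φ : S6, HasCompactSupport Φ →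
      ∫ p, u p * (qPt Φ p + ∑ j, (F j p.1 : ℂ) * qD j Φ p) = 0) (k : Fin 3) (Φ : S6) :
    ∫ p, u p * (qD k Φ p - (p.2 k : ℂ) / 2 * Φ p) = 0 := by
  have h := integral_mul_qC_eq_zero hs0 hs hu hP (BoundedContinuousFunction.const E3 1) k Φ
  rw [← neg_eq_zero, ← integral_neg, ← h]; congr 1; ext p
  simp [qC]; ring

/-- The position derivatives of a zero energy solution. -/
lemma integral_mul_qX_eq (hs0 : 0 ≤ s) (hs : s < 1) (hu : MemLp u 2 (weightedVolume (-s)))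
    (hP : ∀ Φ : S6, HasCompactSupport Φ →
      ∫ p, u p * (qPt Φ p + ∑ j, (F j p.1 : ℂ) * qD j Φ p) = 0) (k : Fin 3) (Φ : S6)
    (hΦ : HasCompactSupport Φ) : ∫ p, u p * (qX k Φ p - (F k p.1 : ℂ) / 2 * Φ p) = 0 := by
  have hΦ' : HasCompactSupport (qC k Φ) := by
    have e : (qC k Φ : Phase → ℂ) = (fun p => -(fderiv ℝ Φ p (0, eb k))) +
        (fun p : Phase => (p.2 k : ℂ) / 2) * ⇑Φ := funext fun p => qC_apply k Φ p
    rw [e]; exact (hΦ.fderiv_apply ℝ (0, eb k)).neg.add hΦ.mul_left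
  have hz := integral_mul_qC_eq_zero hs0 hs hu hP
  have h1 := fun j Ψ => hz (BoundedContinuousFunction.const E3 1) j Ψ
  simp only [BoundedContinuousFunction.const_apply, Complex.ofReal_one, one_mul] at h1
  have i1 := fun Ψ => integrable_mul_schwartz_weighted s hu Ψ
  have i2 := fun g Ψ => integrable_mul_mul_schwartz hu g Ψ
  have h := hP _ hΦ'
  have e : ∀ p, u p * (qPt (qC k Φ) p + ∑ j, (F j p.1 : ℂ) * qD j (qC k Φ) p) =
      ∑ j, (u p * qC j (qA j (qC k Φ)) p - u p * qC k (qM j (qX j Φ)) p +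
        F j p.1 * (u p * qC k (qD j Φ) p)) - (u p * (qX k Φ p - F k p.1 / 2 * Φ p)) := fun p => by
    rw [qPt_qC_add, mul_sub, mul_sum]; congr 1
    refine sum_congr rfl fun j _ => ?_; ring
  have i3 : Integrable fun p => u p * (qX k Φ p - F k p.1 / 2 * Φ p) := by
    refine ((i1 (qX k Φ)).sub ((i2 (F k) Φ).const_mul (1 / 2))).congr (ae_of_all _ fun p => ?_)
    simp only [Pi.sub_apply]; ring
  have i5 : ∀ j, Integrable fun p =>
      u p * qC j (qA j (qC k Φ)) p - u p * qC k (qM j (qX j Φ)) p := fun j => (i1 _).sub (i1 _)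
  have i4 := fun j => (i5 j).fun_add (i2 (F j) (qC k (qD j Φ)))
  simp only [e] at h
  rw [integral_sub (integrable_finsetSum _ fun j _ => i4 j) i3,
    integral_finsetSum _ fun j _ => i4 j] at h
  have h0 : ∀ j, ∫ p, (u p * qC j (qA j (qC k Φ)) p - u p * qC k (qM j (qX j Φ)) p +
      F j p.1 * (u p * qC k (qD j Φ) p)) = 0 := fun j => by
    rw [integral_add (i5 j) (i2 _ _), integral_sub (i1 _) (i1 _), h1, h1, hz, sub_zero, add_zero]
  simpa [h0] using h

end

/-! ### Uniqueness -/

/-- A sequence of bump functions shrinking to the origin. -/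
def bump (n : ℕ) : ContDiffBump (0 : Phase) :=
  ⟨1 / ((n : ℝ) + 1) / 2, 1 / ((n : ℝ) + 1), by positivity, half_lt_self (by positivity)⟩

lemma tendsto_bump : Tendsto (fun n => (bump n).rOut) atTop (𝓝 0) :=
  tendsto_one_div_add_atTop_nhds_zero_nat

/-- Regularization by convolution with a bump function. -/
def moll (n : ℕ) (G : Phase → ℂ) : Phase → ℂ :=
  (bump n).normed volume ⋆[ContinuousLinearMap.lsmul ℝ ℝ, volume] G

instance : (volume : Measure Phase).IsNegInvariant :=
  Measure.IsAddHaarMeasure.isNegInvariant_of_regular _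

lemma norm_moll_le {G : Phase → ℂ} (hG : Continuous G) (hc : HasCompactSupport G) :
    ∃ C, ∀ n p, ‖moll n G p‖ ≤ (Metric.cthickening 1 (tsupport G)).indicator (fun _ => C) p := by
  obtain ⟨C, hC⟩ := hc.exists_bound_of_continuous hG
  refine ⟨3 * C, fun n p => ?_⟩
  have hd := fun ε h => (bump n).dist_normed_convolution_le (x₀ := p) (ε := ε)
    (hG.aestronglyMeasurable (μ := volume)) h
  by_cases hp : p ∈ Metric.cthickening 1 (tsupport G)
  · have h1 := hd (2 * C) fun x _ => (dist_le_norm_add_norm _ _).trans (by linarith [hC x, hC p])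
    rw [Set.indicator_of_mem hp]
    have h2 := norm_le_norm_add_norm_sub (G p) (moll n G p)
    rw [← dist_eq_norm, dist_comm] at h2
    exact h2.trans (by rw [moll]; linarith [hC p])
  · have h0 : ∀ x, dist x p ≤ 1 → G x = 0 := fun x hx => by
      by_contra h
      exact hp (Metric.mem_cthickening_of_dist_le p x 1 _ (subset_tsupport _ h) (by rwa [dist_comm]))
    have hr : (bump n).rOut ≤ 1 :=
      (div_le_one (by positivity)).2 (by linarith [n.cast_nonneg (α := ℝ)])
    have hp0 := h0 p (by simp)
    have h1 := hd 0 fun x hx => by rw [h0 x (hx.le.trans hr), hp0, dist_self]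
    rw [hp0, dist_zero_right] at h1
    rwa [Set.indicator_of_notMem hp]

lemma moll_eq (n : ℕ) (G : Phase → ℂ) : moll n G =
    G ⋆[(ContinuousLinearMap.lsmul ℝ ℝ).flip, volume] (bump n).normed volume :=
  (convolution_flip _).symm

/-- First order equations extend to continuously differentiable test functions. -/
lemma integral_fderiv_sub_eq_zero {u c : Phase → ℂ} (hu : LocallyIntegrable u) (hc : Continuous c)
    {a : Phase} (h : ∀ Φ : Phase → ℂ, IsTest Φ → ∫ p, u p * (fderiv ℝ Φ p a - c p * Φ p) = 0)
    {Θ : Phase → ℂ} (hΘ : ContDiff ℝ 1 Θ) (hs : HasCompactSupport Θ) :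
    ∫ p, u p * (fderiv ℝ Θ p a - c p * Θ p) = 0 := by
  have hD : Continuous fun p => fderiv ℝ Θ p a := (hΘ.continuous_fderiv (by simp)).clm_apply continuous_const
  have hDs : HasCompactSupport fun p => fderiv ℝ Θ p a := hs.fderiv_apply ℝ a
  obtain ⟨C0, h0⟩ := norm_moll_le hΘ.continuous hs
  obtain ⟨C1, h1⟩ := norm_moll_le hD hDs
  have hb := fun n => ((bump n).continuous_normed (μ := volume)).locallyIntegrable (μ := volume)
  have hfd : ∀ n p, fderiv ℝ (moll n Θ) p a = moll n (fun p => fderiv ℝ Θ p a) p := fun n p => by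
    rw [moll, (hs.hasFDerivAt_convolution_right _ (hb n) hΘ p).fderiv, convolution_precompR_apply _
      (hb n) (hs.fderiv ℝ) (hΘ.continuous_fderiv (by simp))]
    rfl
  have hK := hs.isCompact.cthickening (r := 1)
  have hK1 := hDs.isCompact.cthickening (r := 1)
  have hcs : ∀ n, HasCompactSupport (moll n Θ) := fun n =>
    HasCompactSupport.intro hK fun p hp => by
      have := h0 n p
      rwa [Set.indicator_of_notMem hp, norm_le_zero_iff] at this
  have hsm : ∀ n, ContDiff ℝ ((⊤ : ℕ∞) : WithTop ℕ∞) (moll n Θ) := fun n => by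
    rw [moll_eq]
    exact (bump n).hasCompactSupport_normed.contDiff_convolution_right _
      hΘ.continuous.locallyIntegrable (bump n).contDiff_normed
  have ht : ∀ {G : Phase → ℂ}, Continuous G → ∀ p, Tendsto (fun n => moll n G p) atTop (𝓝 (G p)) :=
    fun hG p => ContDiffBump.convolution_tendsto_right_of_continuous tendsto_bump hG p
  have hi : ∀ {A : Set Phase}, IsCompact A → ∀ C : ℝ, ∀ {g : Phase → ℂ}, Continuous g →
      Integrable fun p => ‖u p * g p‖ * A.indicator (fun _ => C) p := fun {A} hA C {g} hg => by
    have h3 := ((hu.integrableOn_isCompact hA).mul_continuousOn hg.continuousOn hA).norm.mul_const C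
    refine ((integrable_indicator_iff hA.measurableSet).2 h3).congr (ae_of_all _ fun p => ?_)
    by_cases hp : p ∈ A <;> simp [hp]
  refine tendsto_nhds_unique (tendsto_integral_of_dominated_convergence
    (F := fun n p => u p * (fderiv ℝ (moll n Θ) p a - c p * moll n Θ p)) _ (fun n => ?_)
    ((hi hK1 C1 (continuous_const (y := (1 : ℂ)))).add (hi hK C0 hc)) (fun n => ?_)
    (ae_of_all _ fun p => ?_)) (by simp only [fun n => h _ ⟨hsm n, hcs n⟩]; exact tendsto_const_nhds)
  · have h3 : Continuous fun p => fderiv ℝ (moll n Θ) p a :=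
      ((hsm n).continuous_fderiv (by simp)).clm_apply continuous_const
    exact hu.aestronglyMeasurable.mul (h3.sub (hc.mul (hsm n).continuous)).aestronglyMeasurable
  · refine ae_of_all _ fun p => ?_
    simp only [hfd, mul_sub, ← mul_assoc, Pi.add_apply, mul_one]
    refine (norm_sub_le _ _).trans ?_
    rw [norm_mul _ (moll n _ p), norm_mul _ (moll n Θ p)]; gcongr
    exacts [h1 n p, h0 n p]
  · simp only [hfd]
    exact ((ht hD p).sub ((ht hΘ.continuous p).const_mul _)).const_mul _

/-- The coordinate directions of the phase space. -/
def axes : Set Phase := {a | ∃ j, a = (eb j, 0) ∨ a = (0, eb j)}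

lemma clm_eq_zero {L : Phase →L[ℝ] ℂ} (h : ∀ a ∈ axes, L a = 0) : L = 0 := by
  ext1 <;> refine ContinuousLinearMap.coe_injective
    ((EuclideanSpace.basisFun (Fin 3) ℝ).toBasis.ext fun j => ?_)
  · simpa [eb] using h _ ⟨j, Or.inl rfl⟩
  · simpa [eb] using h _ ⟨j, Or.inr rfl⟩

/-- A locally integrable function whose weak gradient vanishes is constant. -/
lemma ae_eq_const_of_integral_fderiv_eq_zero {f : Phase → ℂ} (hf : LocallyIntegrable f)
    (h : ∀ ψ : Phase → ℝ, ContDiff ℝ 1 ψ → HasCompactSupport ψ → ∀ a ∈ axes,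
      ∫ p, fderiv ℝ ψ p a • f p = 0) : ∃ c : ℂ, f =ᵐ[volume] fun _ => c := by
  have hconst : ∀ n p, moll n f p = moll n f 0 := fun n p => by
    have hg := (bump n).hasCompactSupport_normed (μ := volume)
    have hg1 : ContDiff ℝ 1 ((bump n).normed volume) := (bump n).contDiff_normed
    have hd := fun q => hg.hasFDerivAt_convolution_right
      (ContinuousLinearMap.lsmul ℝ ℝ : ℝ →L[ℝ] ℂ →L[ℝ] ℂ).flip hf hg1 q
    rw [moll_eq]
    refine is_const_of_fderiv_eq_zero (𝕜 := ℝ) (fun q => (hd q).differentiableAt) (fun q => ?_) _ _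
    refine clm_eq_zero fun a ha => ?_
    rw [(hd q).fderiv, convolution_precompR_apply _ hf (hg.fderiv ℝ)
      (hg1.continuous_fderiv (by simp))]
    have h2 := h (fun t => (bump n).normed volume (q - t)) (by fun_prop)
      (hg.comp_homeomorph (Homeomorph.subLeft q)) a ha
    have e : ∀ t, fderiv ℝ (fun t => (bump n).normed volume (q - t)) t a =
        -fderiv ℝ ((bump n).normed volume) (q - t) a := fun t => by
      have h3 := (hg1.differentiable (by simp) (q - t)).hasFDerivAt.comp t
        ((hasFDerivAt_id t).const_sub q)
      have h4 : fderiv ℝ (fun t => (bump n).normed volume (q - t)) t = _ := h3.fderiv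
      rw [h4]; simp
    simp only [e, neg_smul, integral_neg, neg_eq_zero] at h2; exact h2
  have hl := ContDiffBump.ae_convolution_tendsto_right_of_locallyIntegrable (K := 2) tendsto_bump
    (Eventually.of_forall fun n => by simp only [bump]; linarith) hf
  obtain ⟨p0, hp0⟩ := hl.exists
  refine ⟨f p0, hl.mono fun p hp => tendsto_nhds_unique hp (hp0.congr fun n => ?_)⟩
  exact (hconst n p0).trans (hconst n p).symm

/-- A solution of the first order equations is a multiple of `exp (-H)`. -/
lemma ae_eq_of_integral_fderiv_sub {u : Phase → ℂ} (hu : LocallyIntegrable u) {H : Phase → ℝ}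
    (hH : ContDiff ℝ 1 H) (h : ∀ Φ : Phase → ℂ, IsTest Φ → ∀ a ∈ axes,
      ∫ p, u p * (fderiv ℝ Φ p a - (fderiv ℝ H p a : ℂ) * Φ p) = 0) :
    ∃ c : ℂ, u =ᵐ[volume] fun p => c * (Real.exp (-H p) : ℂ) := by
  have hf : LocallyIntegrable fun p => u p * (Real.exp (H p) : ℂ) := by
    rw [← locallyIntegrableOn_univ] at hu ⊢
    exact hu.mul_continuousOn (by have := hH.continuous; fun_prop) isOpen_univ.isLocallyClosed
  obtain ⟨c, hc⟩ := ae_eq_const_of_integral_fderiv_eq_zero hf fun ψ hψ hs a ha => by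
    have hd : Continuous fun p => (fderiv ℝ H p a : ℂ) :=
      Complex.continuous_ofReal.comp ((hH.continuous_fderiv (by simp)).clm_apply continuous_const)
    have hC : ContDiff ℝ 1 fun p => ((Real.exp (H p) * ψ p : ℝ) : ℂ) :=
      Complex.ofRealCLM.contDiff.comp (hH.exp.mul hψ)
    have hS : HasCompactSupport fun p => ((Real.exp (H p) * ψ p : ℝ) : ℂ) :=
      (HasCompactSupport.mul_left hs).comp_left (g := fun r : ℝ => (r : ℂ)) Complex.ofReal_zero
    rw [← integral_fderiv_sub_eq_zero hu hd (fun Φ hΦ => h Φ hΦ a ha) hC hS]; congr 1; ext p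
    have h1 := (hH.differentiable (by simp) p).hasFDerivAt.exp.mul
      (hψ.differentiable (by simp) p).hasFDerivAt
    have h2 : fderiv ℝ (fun p => ((Real.exp (H p) * ψ p : ℝ) : ℂ)) p = _ :=
      (Complex.ofRealCLM.hasFDerivAt.comp p h1).fderiv
    rw [h2]; simp; ring
  refine ⟨c, hc.mono fun p hp => ?_⟩
  dsimp only at hp ⊢
  rw [← hp, mul_assoc, ← Complex.ofReal_mul, ← Real.exp_add, add_neg_cancel]; simp

lemma lintegral_wt_eq_top {s : ℝ} (hs : s ≤ 1) : ∫⁻ x : E3, wt (-s) x = ⊤ := by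
  by_contra hI
  set v : ℝ≥0∞ := volume (ball (0 : E3) 1) with hv
  have hv0 : v / 2 ≠ 0 :=
    ENNReal.div_ne_zero.2 ⟨(Metric.measure_ball_pos volume (0 : E3) one_pos).ne', by simp⟩
  have hvt : v / 2 ≠ ⊤ := (ENNReal.div_lt_top measure_ball_lt_top.ne two_ne_zero).ne
  obtain ⟨n, hn⟩ := ENNReal.exists_nat_gt (ENNReal.div_lt_top hI hv0).ne
  rw [ENNReal.div_lt_iff (Or.inl hv0) (Or.inl hvt)] at hn
  refine hn.not_ge ?_
  rcases n.eq_zero_or_pos with rfl | hn0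
  · simp
  have hn1 : (1 : ℝ) ≤ n := by exact_mod_cast hn0
  have hw : ∀ x ∈ ball (0 : E3) n, ofReal (1 / (1 + (n : ℝ) ^ 2)) ≤ wt (-s) x := by
    intro x hx
    refine ofReal_le_ofReal (le_trans ?_
      (Real.rpow_le_rpow_of_exponent_le (one_le_bracket x) (by linarith : -2 ≤ 2 * -s)))
    rw [bracket_rpow, show (-2 / 2 : ℝ) = -1 by norm_num, Real.rpow_neg_one, one_div]
    have : ‖x‖ ≤ n := (mem_ball_zero_iff.1 hx).le
    gcongr
  calc (n : ℝ≥0∞) * (v / 2) = ofReal (n / 2) * v := by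
        rw [ENNReal.ofReal_div_of_pos two_pos, ENNReal.ofReal_natCast, ENNReal.ofReal_ofNat,
          div_eq_mul_inv, div_eq_mul_inv]
        ring
    _ ≤ ofReal (1 / (1 + (n : ℝ) ^ 2)) * volume (ball (0 : E3) n) := by
        rw [Measure.addHaar_ball _ _ (by positivity), ← mul_assoc, ← ofReal_mul (by positivity)]
        gcongr
        rw [finrank_euclideanSpace_fin, div_mul_eq_mul_div, div_le_div_iff₀ (by norm_num) (by positivity)]
        nlinarith [mul_nonneg (n.cast_nonneg (α := ℝ)) (sub_nonneg.2 hn1)]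
    _ ≤ ∫⁻ x in ball (0 : E3) n, wt (-s) x := by
        rw [← setLIntegral_const]
        exact setLIntegral_mono (measurable_wt _) hw
    _ ≤ _ := setLIntegral_le_lintegral _ _

/-- A potential whose force decays faster than `|x|⁻²` is bounded above. -/
lemma exists_potential_le {V : E3 → ℝ} (hV : ContDiff ℝ 1 V) {ρ C : ℝ} (hρ : 1 < ρ)
    (hVC : ∀ x, ‖gradient V x‖ ≤ C * bracket x ^ (-ρ - 1)) : ∃ B, ∀ x, V x ≤ B := by
  refine ⟨V 0 + |C| * (π / 2), fun x => ?_⟩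
  have hd : ∀ r : ℝ, HasDerivAt (fun r : ℝ => |C| * Real.arctan (r * ‖x‖) - V (r • x))
      (|C| * (1 / (1 + (r * ‖x‖) ^ 2) * ‖x‖) - inner ℝ (gradient V (r • x)) x) r := fun r => by
    refine ((((hasDerivAt_id r).mul_const ‖x‖).arctan.const_mul |C|).congr_deriv (by simp)).sub ?_
    have h1 := (hV.differentiable (by simp) (r • x)).hasGradientAt.hasFDerivAt.comp_hasDerivAt r
      ((hasDerivAt_id r).smul_const x)
    exact HasDerivAt.congr_deriv (f := fun r : ℝ => V (r • x)) h1 (by simp)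
  have hm := monotone_of_deriv_nonneg (fun r => (hd r).differentiableAt) fun r => by
    rw [(hd r).deriv, sub_nonneg]
    have h1 : bracket (r • x) ^ (-ρ - 1) ≤ 1 / (1 + (r * ‖x‖) ^ 2) := by
      refine (Real.rpow_le_rpow_of_exponent_le (one_le_bracket _)
        (by linarith : -ρ - 1 ≤ -2)).trans (le_of_eq ?_)
      rw [bracket_rpow, show (-2 / 2 : ℝ) = -1 by norm_num, Real.rpow_neg_one, one_div, norm_smul,
        mul_pow, mul_pow, Real.norm_eq_abs, sq_abs]
    calc _ ≤ ‖gradient V (r • x)‖ * ‖x‖ := real_inner_le_norm _ _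
      _ ≤ |C| * bracket (r • x) ^ (-ρ - 1) * ‖x‖ := by
          have := bracket_pos (r • x)
          gcongr; exact (hVC _).trans (by gcongr; exact le_abs_self C)
      _ ≤ _ := by rw [← mul_assoc]; gcongr
  have h1 := hm zero_le_one
  simp only [zero_mul, zero_smul, Real.arctan_zero, mul_zero, one_mul, one_smul, zero_sub] at h1
  have h2 := mul_le_mul_of_nonneg_left (Real.arctan_lt_pi_div_two ‖x‖).le (abs_nonneg C)
  linarith

/-! ### Absence of zero energy solutions -/

section

variable {V : E3 → ℝ} {ρ C : ℝ}

lemma abs_dV_le_const (hρ : 1 < ρ) (hVC : ∀ x : E3, ‖gradient V x‖ ≤ C * bracket x ^ (-ρ - 1))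
    (j : Fin 3) (x : E3) : |dV V j x| ≤ |C| :=
  (abs_dV_le hVC j x).trans (mul_le_of_le_one_right (abs_nonneg C)
    (Real.rpow_le_one_of_one_le_of_nonpos (one_le_bracket x) (by linarith)))

lemma locallyIntegrable_of_memLp {u : Phase → ℂ} {s : ℝ} (hs0 : 0 ≤ s) (hs : s ≤ 1)
    (hu : MemLp u 2 (weightedVolume (-s))) : LocallyIntegrable u volume := by
  have h1 := memLp_mul (continuous_chi 1) (wt_zero_mul_chi_sq_le hs0 hs one_pos le_rfl) hu
  rw [weightedVolume_zero] at h1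
  have h2 := h1.locallyIntegrable (by norm_num)
  have h0 : ∀ x, chi 1 x ≠ 0 := fun x => (Real.rpow_pos_of_pos (bracket_pos _) _).ne'
  have hc : Continuous fun p : Phase => (((chi 1 p.1)⁻¹ : ℝ) : ℂ) := Complex.continuous_ofReal.comp
    (((continuous_chi 1).comp continuous_fst).inv₀ fun p => h0 p.1)
  rw [← locallyIntegrableOn_univ] at h2 ⊢
  refine (h2.mul_continuousOn hc.continuousOn isOpen_univ.isLocallyClosed).congr
    (ae_of_all _ fun p => ?_)
  have := Complex.ofReal_ne_zero.2 (h0 p.1)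
  push_cast; field_simp

/-- Half of the total energy `|v|²/2 + V(x)`. -/
def energy (V : E3 → ℝ) (p : Phase) : ℝ := V p.1 / 2 + ‖p.2‖ ^ 2 / 4

lemma contDiff_energy (hV : ContDiff ℝ 1 V) : ContDiff ℝ 1 (energy V) :=
  ((hV.comp contDiff_fst).div_const 2).add ((contDiff_snd.norm_sq ℝ).div_const 4)

lemma fderiv_energy (hV : ContDiff ℝ 1 V) (j : Fin 3) (p : Phase) :
    fderiv ℝ (energy V) p (eb j, 0) = dV V j p.1 / 2 ∧
      fderiv ℝ (energy V) p (0, eb j) = p.2 j / 2 := by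
  have h1 := (hV.differentiable (by simp) p.1).hasGradientAt.hasFDerivAt.comp p
    (hasFDerivAt_fst (𝕜 := ℝ) (E := E3) (F := E3))
  have h2 := (hasFDerivAt_snd (𝕜 := ℝ) (E := E3) (F := E3) (p := p)).norm_sq
  have h3 : fderiv ℝ (energy V) p = _ :=
    ((h1.mul_const (2 : ℝ)⁻¹).add (h2.mul_const (4 : ℝ)⁻¹)).fderiv
  have h5 : ∀ y : E3, inner ℝ y (eb j) = y j := fun y => by
    simp [eb, EuclideanSpace.inner_single_right]
  have h4 : fderiv ℝ V p.1 (eb j) = dV V j p.1 := by rw [← toDual_gradient]; exact h5 _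
  rw [h3]; constructor
  · simp [h4]; ring
  · simp [h5]; ring

/-- A multiple of the Maxwellian `exp (-energy)` in `L^{2,-s}`, `s ≤ 1`, vanishes. -/
lemma eq_zero_of_memLp_exp {B : ℝ} (hB : ∀ x, V x ≤ B) {s : ℝ} (hs : s ≤ 1) {c : ℂ}
    (h : MemLp (fun p => c * (Real.exp (-energy V p) : ℂ)) 2 (weightedVolume (-s))) : c = 0 := by
  by_contra hc
  set k : ℝ≥0∞ := ofReal (‖c‖ * Real.exp (-(B / 2 + 1 / 4))) ^ 2 with hk
  have hk0 : k ≠ 0 := by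
    have : 0 < ‖c‖ := norm_pos_iff.2 hc
    refine pow_ne_zero 2 ?_
    rw [ne_eq, ENNReal.ofReal_eq_zero, not_le]; positivity
  set I : E3 → ℝ≥0∞ := (ball (0 : E3) 1).indicator fun _ => k with hI
  have hIm : Measurable I := measurable_const.indicator Metric.isOpen_ball.measurableSet
  have h1 : ∫⁻ p : Phase, wt (-s) p.1 * I p.2 ≤
      eLpNorm (fun p => c * (Real.exp (-energy V p) : ℂ)) 2 (weightedVolume (-s)) ^ 2 := by
    rw [eLpNorm_sq, lintegral_weightedVolume]
    refine lintegral_mono fun p => mul_le_mul_right ?_ _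
    by_cases hv : p.2 ∈ ball (0 : E3) 1
    · rw [hI, Set.indicator_of_mem hv, hk, ← ofReal_norm, norm_mul, norm_real,
        Real.norm_of_nonneg (Real.exp_pos _).le, energy]
      have h2 : ‖p.2‖ < 1 := mem_ball_zero_iff.1 hv
      have h3 := hB p.1
      gcongr; nlinarith [norm_nonneg p.2]
    · rw [hI, Set.indicator_of_notMem hv]; exact bot_le
  rw [volume_eq_prod, lintegral_prod_mul (measurable_wt _).aemeasurable hIm.aemeasurable,
    lintegral_wt_eq_top hs, ENNReal.top_mul] at h1
  · exact (ENNReal.pow_lt_top h.2).ne (top_le_iff.1 h1)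
  · rw [hI, lintegral_indicator Metric.isOpen_ball.measurableSet, setLIntegral_const]
    exact mul_ne_zero hk0 (Metric.measure_ball_pos volume (0 : E3) one_pos).ne'

/-- There are no zero energy solutions in `L^{2,-s}` for `s < 1`. -/
lemma ae_eq_zero_of_weakEq (hV : ContDiff ℝ 1 V) (hρ : 1 < ρ)
    (hVC : ∀ x : E3, ‖gradient V x‖ ≤ C * bracket x ^ (-ρ - 1)) {u : Phase → ℂ} {s : ℝ}
    (hs0 : 0 ≤ s) (hs : s < 1) (hu : MemLp u 2 (weightedVolume (-s))) (hP : WeakEq V u 0) :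
    u =ᵐ[volume] 0 := by
  let F : Fin 3 → E3 →ᵇ ℝ := fun j => BoundedContinuousFunction.ofNormedAddCommGroup (dV V j)
    (continuous_dV hV j) |C| (abs_dV_le_const hρ hVC j)
  have hF : ∀ j x, F j x = dV V j x := fun _ _ => rfl
  have hP' : ∀ Φ : S6, HasCompactSupport Φ →
      ∫ p, u p * (qPt Φ p + ∑ j, (F j p.1 : ℂ) * qD j Φ p) = 0 := fun Φ hΦ => by
    have h := hP Φ (isTest_of_schwartz hΦ)
    simp only [transposeP_eq, Pi.zero_apply, zero_mul, integral_zero] at h; exact h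
  obtain ⟨B, hB⟩ := exists_potential_le hV hρ hVC
  obtain ⟨c, hc⟩ := ae_eq_of_integral_fderiv_sub (locallyIntegrable_of_memLp hs0 hs.le hu)
    (contDiff_energy hV) (fun Φ hΦ a ha => by
      obtain ⟨j, rfl | rfl⟩ := ha
      · rw [← integral_mul_qX_eq hs0 hs hu hP' j hΦ.toS hΦ.2]
        simp only [(fderiv_energy hV j _).1, qX_apply, hF]; push_cast; rfl
      · rw [← integral_mul_qD_eq hs0 hs hu hP' j hΦ.toS]
        simp only [(fderiv_energy hV j _).2, qD_apply]; push_cast; rfl)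
  have hc0 := eq_zero_of_memLp_exp hB hs.le
    ((memLp_congr_ae ((aeEq_weightedVolume_iff (-s)).2 hc)).1 hu)
  filter_upwards [hc] with p hp
  rw [hp, hc0, zero_mul, Pi.zero_apply]

/-- The weak equation for a solution of `u + K u = 0`. -/
lemma weakEq_of_add_eq_zero (hVc : ∀ j, Continuous (dV V j)) {s σ t c : ℝ} (hs : 0 ≤ s)
    (hσ : 0 ≤ σ) (hVb : ∀ j x, |dV V j x| ≤ c) {M : Fin 3 → L2w (-t) →L[ℂ] L2w σ}
    (hM : ∀ j u, ⇑(M j u) =ᵐ[volume] fun p => (dV V j p.1 : ℂ) * u p)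
    {K : L2w (-t) →L[ℂ] L2w (-s)} (hK : Tendsto (Kz hs hσ M) (𝓝[halfLineᶜ] 0) (𝓝 K))
    {u : L2w (-t)} (hu : ⇑u =ᵐ[volume] -(K u : Phase → ℂ)) :
    WeakEq V (K u) 0 := by
  intro φ hφ
  have h1 := integral_limit_Kz hs hσ hM hK u hφ.toS
  have hi := fun Φ => integrable_mul_schwartz_weighted t (Lp.memLp u) Φ
  have h2 : ∀ j, Integrable fun p => (dV V j p.1 : ℂ) * u p * qD j hφ.toS p := by
    intro j
    have hc1 : Continuous fun p : Phase => (dV V j p.1 : ℂ) :=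
      Complex.continuous_ofReal.comp ((hVc j).comp continuous_fst)
    simpa only [mul_assoc] using (hi (qD j hφ.toS)).bdd_mul (c := c) hc1.aestronglyMeasurable
      (ae_of_all _ fun p => by simpa using hVb j p.1)
  rw [← integral_finsetSum _ fun j _ => h2 j, ← sub_eq_zero,
    ← integral_sub (integrable_mul_schwartz_weighted s (Lp.memLp (K u)) _)
      (integrable_finsetSum _ fun j _ => h2 j)] at h1
  simp only [Pi.zero_apply, zero_mul, integral_zero]; rw [← h1]
  refine integral_congr_ae ?_
  filter_upwards [hu] with p hp
  have e : transposeP V φ p = _ := transposeP_eq V hφ.toS p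
  rw [e, hp, mul_add, mul_sum, sub_eq_add_neg, ← Finset.sum_neg_distrib]; congr 1
  refine sum_congr rfl fun j _ => ?_
  simp only [dV, Pi.neg_apply]; ring

/-- The limits are taken in a space with weight exponent `-t`, `t < 1`, so that solutions of
`u + K u = 0` fall into the class where zero energy solutions vanish. -/
lemma exists_limit_operators (hV : ContDiff ℝ 1 V) (hρ : 1 < ρ)
    (hVC : ∀ x : E3, ‖gradient V x‖ ≤ C * bracket x ^ (-ρ - 1)) {s : ℝ} (hs1 : 1 < s)
    (hs2 : s < (1 + ρ) / 2) :
    ∃ (G : L2w (1 + ρ - s) →L[ℂ] L2w (-s)) (K : L2w (-s) →L[ℂ] L2w (-s)),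
      IsG0 (1 + ρ - s) (-s) G ∧ IsG0W V (1 + ρ - s) (-s) G K ∧
      IsCompactOperator K ∧ ∀ u : L2w (-s), u + K u = 0 → u = 0 := by
  -- a weight below the threshold of uniqueness for which the limits exist
  obtain ⟨t, ht1, ht2, ht3⟩ : ∃ t, 1 / 2 < t ∧ t < 1 ∧ 2 < t + (1 + ρ - s) := by
    refine ⟨max (3 / 4) (1 - (ρ - s) / 2), ?_, max_lt (by norm_num) (by linarith), ?_⟩
    · exact lt_of_lt_of_le (by norm_num) (le_max_left _ _)
    · linarith [le_max_right (3 / 4) (1 - (ρ - s) / 2)]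
  have ht0' : 0 < t := by linarith
  have ht0 := ht0'.le
  have hσ0 : 0 ≤ 1 + ρ - s := by linarith
  have hts : t ≤ s := by linarith
  have hVc := continuous_dV hV
  have hVb := abs_dV_le_const hρ hVC
  have hb : ∀ j x, wt (1 + ρ - s) x * ‖dV V j x‖ₑ ^ 2 ≤ ofReal |C| ^ 2 * wt (-s) x := fun j x => by
      have h := wt_mul_dV_sq_le hVC (1 + ρ - s) j x
      rwa [show 1 + ρ - s - (1 + ρ) = -s by ring] at h
  let M : Fin 3 → L2w (-s) →L[ℂ] L2w (1 + ρ - s) := fun j => mulW (hVc j) (abs_nonneg C) (hb j)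
  have hM : ∀ j u, ⇑(M j u) =ᵐ[volume]
      fun p => (dV V j p.1 : ℂ) * u p := fun j u => coeFn_mulW _ _ (hb j) u
  obtain ⟨G, hG⟩ := isChannel_RR.exists_limit ht1 (by linarith) ht3 ht0 hσ0
  obtain ⟨K, hK⟩ := exists_limit_Kz ht1 (by linarith) ht3 ht0 hσ0 M
  refine ⟨_, _, isG0_of_tendsto ht0 hσ0 hts hG, isG0W_of_tendsto ht0 hσ0 hts hVc hVb hM hK hG,
    ?_, fun u hu => ?_⟩
  · have hKc : IsCompactOperator K := isCompactOperator_of_tendsto hK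
      (eventually_near.mono fun z hz => isCompactOperator_Kz ht0' hσ0 M hz.1 hz.2)
    exact hKc.clm_comp (incl (weightedVolume_mono (neg_le_neg hts)))
  · have hu1 : ⇑u =ᵐ[volume] -(K u : Phase → ℂ) := by
      have h1 := eq_neg_of_add_eq_zero_left hu
      have hle := weightedVolume_mono (neg_le_neg hts)
      filter_upwards [(aeEq_weightedVolume_iff (-s)).1 (coeFn_incl hle (K u)),
        (aeEq_weightedVolume_iff (-s)).1 (Lp.coeFn_neg (incl hle (K u)))] with p h2 h3
      have h4 : u p = (-(incl hle (K u)) : L2w (-s)) p := congrArg (fun w : L2w (-s) =>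
        w p) h1
      rw [h4, h3, Pi.neg_apply, h2, Pi.neg_apply]
    have h0 := ae_eq_zero_of_weakEq hV hρ hVC ht0 ht2 (Lp.memLp (K u))
      (weakEq_of_add_eq_zero hVc ht0 hσ0 hVb hM hK hu1)
    refine Lp.eq_zero_iff_ae_eq_zero.2 ((aeEq_weightedVolume_iff (-s)).2 ?_)
    filter_upwards [hu1, h0] with p h1 h2
    rw [h1, Pi.neg_apply, h2, Pi.zero_apply, neg_zero]

end

end

end KFP

theorem mainTheorem3 (V : KFP.E3 → ℝ) (hV : ContDiff ℝ 1 V) (ρ C : ℝ) (hρ : 1 < ρ)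
    (hVC : ∀ x : KFP.E3, ‖gradient V x‖ ≤ C * KFP.bracket x ^ (-ρ - 1)) :
    (∀ s : ℝ, 1 < s → s < (1 + ρ) / 2 →
      ∃ (G : KFP.L2w (1 + ρ - s) →L[ℂ] KFP.L2w (-s)) (K : KFP.L2w (-s) →L[ℂ] KFP.L2w (-s)),
        KFP.IsG0 (1 + ρ - s) (-s) G ∧ KFP.IsG0W V (1 + ρ - s) (-s) G K ∧
        IsCompactOperator K ∧ ∀ u : KFP.L2w (-s), u + K u = 0 → u = 0) ∧
    ¬ KFP.ZeroIsEigenvalue V ∧ ¬ KFP.ZeroIsResonance V := by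
  refine ⟨fun s hs1 hs2 => KFP.exists_limit_operators hV hρ hVC hs1 hs2, ?_, ?_⟩
  · rintro ⟨u, hu, hu0, hP⟩
    rw [← KFP.weightedVolume_zero, ← neg_zero] at hu
    exact hu0 (KFP.ae_eq_zero_of_weakEq hV hρ hVC le_rfl one_pos hu hP)
  · rintro ⟨u, hu, hu0, hP⟩
    have h := KFP.ae_eq_zero_of_weakEq hV hρ hVC (s := 3 / 4) (by norm_num) (by norm_num)
      (hu _ (by norm_num)) hP
    exact hu0 ((memLp_congr_ae h).2 MemLp.zero)
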